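/- **Conventions.** Manifolds are smooth, finite-dimensional, Hausdorff, second countable and without boundary. A *quaternionic Kähler manifold* $(M,g,Q)$ is a Riemannian manifold $(M,g)$ with a parallel (for the Levi-Civita connection $\nabla$) skew-symmetric quaternionic structure $Q\subset \mathrm{End}(TM)$, i.e. a subbundle locally spanned by smooth skew-symmetric $J_1,J_2,J_3$ with $J_1^2=J_2^2=-1$, $J_3=J_1J_2=-J_2J_1$; if $\dim M=4$ one requires in addition $Q\cdot R=0$ for the curvature tensor $R$, where $Q$ acts by derivations. The *moment map* of a Killing field $\xi$ is the section $P=(\nabla\xi)^Q$ of $Q$ given by the pointwise orthogonal projection (for the trace form) of $\nabla\xi$ onto $Q$. A complex structure is *integrable* if its bundle $T^{1,0}$ is closed under the Lie bracket. A *Kähler structure* is a Riemannian metric together with an integrable complex structure for which it is Hermitian and whose fundamental two-form is closed. **Theorem.** Let $(M,g,Q)$ be a quaternionic Kähler manifold whose scalar curvature is nowhere zero, $\xi_1,\xi_2$ Killing vector fields on $M$ with moment maps $P_1,P_2\in\Gamma(Q)$, and $N\subset M$ an (immersed) submanifold such that: 1. $\xi_1|_N,\xi_2|_N$ are tangent to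 $N$, $[\xi_1,\xi_2]|_N=0$, and $|\xi_1|=|\xi_2|\neq 0$ on $N$; 2. $P_1P_2|_N$ is a section of $Q|_N$ which preserves $TN$ and satisfies $P_1P_2\,\xi_1=f\,\xi_2$ on $N$ for some nowhere vanishing function $f\in C^\infty(N)$. Let $\mathcal D\subset TN$ be the distribution spanned by $\xi_1|_N,\xi_2|_N$ and $\mathcal N\subset TN$ its orthogonal complement in $TN$. Then $\mathcal D$ has rank two and is integrable; $I:=\frac1f P_1P_2|_N$ satisfies $I^2=-1$, preserves $TN$, $\mathcal D$ and $\mathcal N$, and defines an integrable complex structure on $N$; and $h:=g|_{\mathcal N\times\mathcal N}$, $J:=I|_{\mathcal N}$ is a transversal Kähler structure for the foliation tangent to $\mathcal D$. The latter means: for every submanifold $S\subset N$ with $T_sN=T_sS\oplus\mathcal D_s$ for all $s\in S$, the pair $(h,J)$ induces, through the isomorphisms $T_sS\cong T_sN/\mathcal D_s\cong\mathcal N_s$, a Kähler structure on $S$; and for any two such submanifolds $S,S'$ the holonomy transformations of the foliation from open subsets of $S$ to $S'$ (the maps obtained by moving the points smoothly along the leaves) preserve the induced Kähler structures. -/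

import Mathlib

open Bundle VectorField
open scoped Manifold ContDiff

noncomputable section

/-! Throughout, a manifold is a Hausdorff, second countable, smooth manifold without boundary,
modelled on a finite-dimensional real vector space. -/

section SmoothManifolds

variable {E : Type*} [NormedAddCommGroup E] [NormedSpace ℝ E]
  {M : Type*} [TopologicalSpace M] [ChartedSpace E M]

/-- The value at `x` of the function obtained by applying the tangent vector `v` to `f`. -/
def tangentDeriv (f : M → ℝ) (x : M) (v : TangentSpace 𝓘(ℝ, E) x) : ℝ :=
  mvfderiv 𝓘(ℝ, E) f x v

variable [IsManifold 𝓘(ℝ, E) ∞ M]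

/-- The vector field `X` is smooth at the point `x`. -/
def SmoothFieldAt (X : Π x : M, TangentSpace 𝓘(ℝ, E) x) (x : M) : Prop :=
  ContMDiffAt 𝓘(ℝ, E) (𝓘(ℝ, E).prod 𝓘(ℝ, E)) ∞
    (fun y => (⟨y, X y⟩ : TotalSpace E (TangentSpace 𝓘(ℝ, E) : M → Type _))) x

/-- The field of endomorphisms `A` of the tangent spaces is smooth on the set `U`. -/
def SmoothEndOn
    (A : Π x : M, TangentSpace 𝓘(ℝ, E) x →L[ℝ] TangentSpace 𝓘(ℝ, E) x) (U : Set M) : Prop :=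
  ContMDiffOn 𝓘(ℝ, E) (𝓘(ℝ, E).prod 𝓘(ℝ, E →L[ℝ] E)) ∞
    (fun y => TotalSpace.mk' (E →L[ℝ] E)
      (E := fun y : M => TangentSpace 𝓘(ℝ, E) y →L[ℝ] TangentSpace 𝓘(ℝ, E) y) y (A y)) U

/-- The field of bilinear forms `h` on the tangent spaces is smooth. -/
def SmoothForm
    (h : Π x : M, TangentSpace 𝓘(ℝ, E) x →L[ℝ] TangentSpace 𝓘(ℝ, E) x →L[ℝ] ℝ) : Prop :=
  ContMDiff 𝓘(ℝ, E) (𝓘(ℝ, E).prod 𝓘(ℝ, E →L[ℝ] E →L[ℝ] ℝ)) ∞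
    (fun y => TotalSpace.mk' (E →L[ℝ] E →L[ℝ] ℝ)
      (E := fun y : M => TangentSpace 𝓘(ℝ, E) y →L[ℝ] TangentSpace 𝓘(ℝ, E) y →L[ℝ] ℝ) y (h y))

/-- `J` is an integrable complex structure on `M`: a smooth field of endomorphisms of `TM` with
`J² = -1` such that the bundle `T^{1,0}` of the vectors `X - i J X` is closed under the Lie
bracket. Since
`[X - i JX, Y - i JY] = ([X, Y] - [JX, JY]) - i ([X, JY] + [JX, Y])`,
this closedness is the vanishing of the Nijenhuis tensor, in the form stated here. -/
structure IsIntegrableComplexStructure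
    (J : Π x : M, TangentSpace 𝓘(ℝ, E) x →L[ℝ] TangentSpace 𝓘(ℝ, E) x) : Prop where
  smooth : SmoothEndOn J Set.univ
  sq : ∀ x v, J x (J x v) = -v
  integrable : ∀ (x : M) (X Y : Π x : M, TangentSpace 𝓘(ℝ, E) x),
    SmoothFieldAt X x → SmoothFieldAt Y x →
      mlieBracket 𝓘(ℝ, E) X (fun y => J y (Y y)) x + mlieBracket 𝓘(ℝ, E) (fun y => J y (X y)) Y x
        = J x (mlieBracket 𝓘(ℝ, E) X Y x
            - mlieBracket 𝓘(ℝ, E) (fun y => J y (X y)) (fun y => J y (Y y)) x)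

/-- The two-form `α` is closed: `dα = 0`, where `dα` is given on vector fields by the invariant
formula for the exterior derivative. -/
def IsClosedTwoForm
    (α : Π x : M, TangentSpace 𝓘(ℝ, E) x → TangentSpace 𝓘(ℝ, E) x → ℝ) : Prop :=
  ∀ (x : M) (X Y Z : Π x : M, TangentSpace 𝓘(ℝ, E) x),
    SmoothFieldAt X x → SmoothFieldAt Y x → SmoothFieldAt Z x →
      tangentDeriv (fun y => α y (Y y) (Z y)) x (X x)
        - tangentDeriv (fun y => α y (X y) (Z y)) x (Y x)
        + tangentDeriv (fun y => α y (X y) (Y y)) x (Z x)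
        - α x (mlieBracket 𝓘(ℝ, E) X Y x) (Z x)
        + α x (mlieBracket 𝓘(ℝ, E) X Z x) (Y x)
        - α x (mlieBracket 𝓘(ℝ, E) Y Z x) (X x) = 0

/-- `(g, J)` is a Kähler structure: `J` is an integrable complex structure, the Riemannian metric
`g` is Hermitian, and the fundamental form `g(·, J·)` is closed. -/
structure IsKahler
    (g : ContMDiffRiemannianMetric 𝓘(ℝ, E) ∞ E (TangentSpace 𝓘(ℝ, E) : M → Type _))
    (J : Π x : M, TangentSpace 𝓘(ℝ, E) x →L[ℝ] TangentSpace 𝓘(ℝ, E) x) : Prop where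
  complex : IsIntegrableComplexStructure J
  hermitian : ∀ x u v, g.inner x (J x u) (J x v) = g.inner x u v
  closed : IsClosedTwoForm (fun x u v => g.inner x u (J x v))

end SmoothManifolds

/-- The smooth map `ι : N → M` is the inclusion of an (immersed) submanifold: it is an injective
immersion. -/
structure IsSubmanifold {E : Type*} [NormedAddCommGroup E] [NormedSpace ℝ E]
    {M : Type*} [TopologicalSpace M] [ChartedSpace E M]
    {F : Type*} [NormedAddCommGroup F] [NormedSpace ℝ F]
    {N : Type*} [TopologicalSpace N] [ChartedSpace F N] (ι : N → M) : Prop where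
  smooth : ContMDiff 𝓘(ℝ, F) 𝓘(ℝ, E) ∞ ι
  injective : Function.Injective ι
  immersion : ∀ y, Function.Injective (mfderiv 𝓘(ℝ, F) 𝓘(ℝ, E) ι y)

/-! ### Riemannian and quaternionic Kähler geometry -/

section Riemannian

variable {E : Type*} [NormedAddCommGroup E] [NormedSpace ℝ E] [FiniteDimensional ℝ E]
  {M : Type*} [TopologicalSpace M] [ChartedSpace E M] [IsManifold 𝓘(ℝ, E) ∞ M]

/-- The curvature tensor `R(u, v) w = ∇_u ∇_v w - ∇_v ∇_u w - ∇_[u, v] w` at `x` of a connection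
on the tangent bundle. It is evaluated on vector fields, smooth near `x`, that extend the
tangent vectors `u`, `v`, `w`. -/
def curvature (cov : CovariantDerivative 𝓘(ℝ, E) E (TangentSpace 𝓘(ℝ, E) : M → Type _)) (x : M)
    (u v w : TangentSpace 𝓘(ℝ, E) x) : TangentSpace 𝓘(ℝ, E) x :=
  let U : Π y : M, TangentSpace 𝓘(ℝ, E) y := FiberBundle.extend E u
  let V : Π y : M, TangentSpace 𝓘(ℝ, E) y := FiberBundle.extend E v
  let W : Π y : M, TangentSpace 𝓘(ℝ, E) y := FiberBundle.extend E w
  cov (fun y => cov W y (V y)) x u - cov (fun y => cov W y (U y)) x v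
    - cov W x (mlieBracket 𝓘(ℝ, E) U V x)

/-- `B` is the covariant derivative `∇_v A` at `x` of the field of endomorphisms `A`:
`(∇_v A) Y = ∇_v (A Y) - A (∇_v Y)` for all vector fields `Y`. -/
def IsCovDerivEnd (cov : CovariantDerivative 𝓘(ℝ, E) E (TangentSpace 𝓘(ℝ, E) : M → Type _))
    (A : Π x : M, TangentSpace 𝓘(ℝ, E) x →L[ℝ] TangentSpace 𝓘(ℝ, E) x) (x : M)
    (v : TangentSpace 𝓘(ℝ, E) x) (B : TangentSpace 𝓘(ℝ, E) x →L[ℝ] TangentSpace 𝓘(ℝ, E) x) :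
    Prop :=
  ∀ Y : Π x : M, TangentSpace 𝓘(ℝ, E) x, SmoothFieldAt Y x →
    cov (fun y => A y (Y y)) x v - A x (cov Y x v) = B (Y x)

variable [RiemannianBundle (fun x : M => TangentSpace 𝓘(ℝ, E) x)]

/-- The tangent spaces are finite-dimensional. -/
instance tangentSpaceFiniteDimensional (x : M) : FiniteDimensional ℝ (TangentSpace 𝓘(ℝ, E) x) :=
  inferInstanceAs (FiniteDimensional ℝ E)

/-- The scalar curvature `∑ i j, g(R(eᵢ, eⱼ) eⱼ, eᵢ)`, for an orthonormal basis `e` of the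
tangent space. -/
def scalarCurvature
    (cov : CovariantDerivative 𝓘(ℝ, E) E (TangentSpace 𝓘(ℝ, E) : M → Type _)) (x : M) : ℝ :=
  let e := stdOrthonormalBasis ℝ (TangentSpace 𝓘(ℝ, E) x)
  ∑ i, ∑ j, inner ℝ (curvature cov x (e i) (e j) (e j)) (e i)

/-- `ξ` is a Killing vector field: it is smooth, and `∇ξ` is skew-symmetric (`L_ξ g = 0`). -/
structure IsKilling (cov : CovariantDerivative 𝓘(ℝ, E) E (TangentSpace 𝓘(ℝ, E) : M → Type _))
    (ξ : Π x : M, TangentSpace 𝓘(ℝ, E) x) : Prop where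
  smooth : ∀ x, SmoothFieldAt ξ x
  skew : ∀ (x : M) (v w : TangentSpace 𝓘(ℝ, E) x),
    inner ℝ (cov ξ x v) w + inner ℝ v (cov ξ x w) = 0

/-- `Q` is a skew-symmetric quaternionic structure: a family of subspaces of the spaces
`End(T_xM)` which locally is spanned by three smooth fields of skew-symmetric endomorphisms
`J₁`, `J₂`, `J₃` with `J₁² = J₂² = -1` and `J₃ = J₁ J₂ = -J₂ J₁`. -/
def IsQuaternionicStructure
    (Q : Π x : M, Submodule ℝ (TangentSpace 𝓘(ℝ, E) x →L[ℝ] TangentSpace 𝓘(ℝ, E) x)) : Prop :=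
  ∀ x₀ : M, ∃ U : Set M, IsOpen U ∧ x₀ ∈ U ∧
    ∃ J₁ J₂ J₃ : Π x : M, TangentSpace 𝓘(ℝ, E) x →L[ℝ] TangentSpace 𝓘(ℝ, E) x,
      SmoothEndOn J₁ U ∧ SmoothEndOn J₂ U ∧ SmoothEndOn J₃ U ∧
      ∀ x ∈ U,
        (∀ v, J₁ x (J₁ x v) = -v) ∧ (∀ v, J₂ x (J₂ x v) = -v) ∧
        (∀ v, J₁ x (J₂ x v) = J₃ x v) ∧ (∀ v, J₂ x (J₁ x v) = -J₃ x v) ∧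
        (∀ A ∈ ({J₁ x, J₂ x, J₃ x} : Set _), ∀ v w, inner ℝ (A v) w = -inner ℝ v (A w)) ∧
        Q x = Submodule.span ℝ {J₁ x, J₂ x, J₃ x}

/-- `Q` is a quaternionic Kähler structure on the Riemannian manifold `M`, with Levi-Civita
connection `cov`: a skew-symmetric quaternionic structure which is parallel (the covariant
derivatives of its local smooth sections are again in `Q`), and which annihilates the curvature
tensor (`Q · R = 0`, where `Q` acts by derivations) if `dim M = 4`. -/
structure IsQuaternionicKahler
    (cov : CovariantDerivative 𝓘(ℝ, E) E (TangentSpace 𝓘(ℝ, E) : M → Type _))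
    (Q : Π x : M, Submodule ℝ (TangentSpace 𝓘(ℝ, E) x →L[ℝ] TangentSpace 𝓘(ℝ, E) x)) :
    Prop where
  quaternionic : IsQuaternionicStructure Q
  parallel : ∀ (U : Set M) (A : Π x : M, TangentSpace 𝓘(ℝ, E) x →L[ℝ] TangentSpace 𝓘(ℝ, E) x),
    IsOpen U → SmoothEndOn A U → (∀ x ∈ U, A x ∈ Q x) →
      ∀ x ∈ U, ∀ v : TangentSpace 𝓘(ℝ, E) x, ∃ B ∈ Q x, IsCovDerivEnd cov A x v B
  dim_four : Module.finrank ℝ E = 4 → ∀ (x : M), ∀ A ∈ Q x, ∀ u v w : TangentSpace 𝓘(ℝ, E) x,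
    A (curvature cov x u v w) - curvature cov x (A u) v w - curvature cov x u (A v) w
      - curvature cov x u v (A w) = 0

/-- `P` is the moment map of the Killing field `ξ`: the section `P = (∇ξ)^Q` of `Q` which at each
point is the orthogonal projection of `∇ξ` onto `Q`, with respect to the trace form. -/
structure IsMomentMap (cov : CovariantDerivative 𝓘(ℝ, E) E (TangentSpace 𝓘(ℝ, E) : M → Type _))
    (Q : Π x : M, Submodule ℝ (TangentSpace 𝓘(ℝ, E) x →L[ℝ] TangentSpace 𝓘(ℝ, E) x))
    (ξ : Π x : M, TangentSpace 𝓘(ℝ, E) x)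
    (P : Π x : M, TangentSpace 𝓘(ℝ, E) x →L[ℝ] TangentSpace 𝓘(ℝ, E) x) : Prop where
  mem : ∀ x, P x ∈ Q x
  orthogonal : ∀ x, ∀ A ∈ Q x,
    LinearMap.trace ℝ (TangentSpace 𝓘(ℝ, E) x)
      ((cov ξ x - P x) ∘L A : TangentSpace 𝓘(ℝ, E) x →L[ℝ] TangentSpace 𝓘(ℝ, E) x).toLinearMap = 0

/-- `cov` is the Levi-Civita connection: the smooth, metric, torsion-free connection on the
tangent bundle. -/
structure IsLeviCivita
    (cov : CovariantDerivative 𝓘(ℝ, E) E (TangentSpace 𝓘(ℝ, E) : M → Type _)) : Prop where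
  smooth : CovariantDerivative.ContMDiffCovariantDerivative cov ∞
  metric : ∀ (x : M) (X Y : Π x : M, TangentSpace 𝓘(ℝ, E) x),
    SmoothFieldAt X x → SmoothFieldAt Y x → ∀ v : TangentSpace 𝓘(ℝ, E) x,
      tangentDeriv (fun y => inner ℝ (X y) (Y y)) x v =
        inner ℝ (cov X x v) (Y x) + inner ℝ (X x) (cov Y x v)
  torsion : CovariantDerivative.torsion cov = 0

end Riemannian

/-! ### Foliations and transversal Kähler structures -/

section Transversal

universe u

variable {F : Type*} [NormedAddCommGroup F] [NormedSpace ℝ F]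
  {N : Type u} [TopologicalSpace N] [ChartedSpace F N]

variable [IsManifold 𝓘(ℝ, F) ∞ N]

/-- The distribution `D` on `N` is involutive (hence tangent to a foliation). -/
def IsInvolutive (D : Π y : N, Submodule ℝ (TangentSpace 𝓘(ℝ, F) y)) : Prop :=
  ∀ (X Y : Π y : N, TangentSpace 𝓘(ℝ, F) y) (U : Set N), IsOpen U →
    (∀ y ∈ U, SmoothFieldAt X y ∧ X y ∈ D y) → (∀ y ∈ U, SmoothFieldAt Y y ∧ Y y ∈ D y) →
      ∀ y ∈ U, mlieBracket 𝓘(ℝ, F) X Y y ∈ D y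

/-- `j : S → N` is a submanifold transversal to the distribution `D`, of dimension complementary
to that of `D`: `T_{j s}N = dj(T_sS) ⊕ D` at all points. -/
structure IsTransversal (D : Π y : N, Submodule ℝ (TangentSpace 𝓘(ℝ, F) y))
    {k : ℕ} {S : Type*} [TopologicalSpace S] [ChartedSpace (EuclideanSpace ℝ (Fin k)) S]
    (j : S → N) : Prop where
  submanifold : IsSubmanifold (E := F) (F := EuclideanSpace ℝ (Fin k)) j
  complementary : ∀ s,
    IsCompl (mfderiv 𝓘(ℝ, EuclideanSpace ℝ (Fin k)) 𝓘(ℝ, F) j s).range (D (j s))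

/-- The metric `g` and the endomorphism field `JS` of the transversal submanifold `j : S → N` are
those that `h` and `J` induce through the isomorphisms `T_sS ≅ T_{j s}N / D`. -/
structure IsInducedOn (D : Π y : N, Submodule ℝ (TangentSpace 𝓘(ℝ, F) y))
    (h : Π y : N, TangentSpace 𝓘(ℝ, F) y →L[ℝ] TangentSpace 𝓘(ℝ, F) y →L[ℝ] ℝ)
    (J : Π y : N, TangentSpace 𝓘(ℝ, F) y →L[ℝ] TangentSpace 𝓘(ℝ, F) y)
    {k : ℕ} {S : Type*} [TopologicalSpace S] [ChartedSpace (EuclideanSpace ℝ (Fin k)) S]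
    [IsManifold 𝓘(ℝ, EuclideanSpace ℝ (Fin k)) ∞ S] (j : S → N)
    (g : ContMDiffRiemannianMetric 𝓘(ℝ, EuclideanSpace ℝ (Fin k)) ∞ (EuclideanSpace ℝ (Fin k))
      (TangentSpace 𝓘(ℝ, EuclideanSpace ℝ (Fin k)) : S → Type _))
    (JS : Π s : S, TangentSpace 𝓘(ℝ, EuclideanSpace ℝ (Fin k)) s →L[ℝ]
      TangentSpace 𝓘(ℝ, EuclideanSpace ℝ (Fin k)) s) : Prop where
  metric : ∀ s u v, g.inner s u v =
    h (j s) (mfderiv 𝓘(ℝ, EuclideanSpace ℝ (Fin k)) 𝓘(ℝ, F) j s u)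
      (mfderiv 𝓘(ℝ, EuclideanSpace ℝ (Fin k)) 𝓘(ℝ, F) j s v)
  complex : ∀ s u, mfderiv 𝓘(ℝ, EuclideanSpace ℝ (Fin k)) 𝓘(ℝ, F) j s (JS s u)
    - J (j s) (mfderiv 𝓘(ℝ, EuclideanSpace ℝ (Fin k)) 𝓘(ℝ, F) j s u) ∈ D (j s)

/-- `φ : S → S'`, defined on the open set `U ⊆ S`, is a holonomy transformation of the foliation
tangent to `D`, between the transversal submanifolds `j : S → N` and `j' : S' → N`: the points of
`U` are moved smoothly along the leaves from `S` to `S'`, during the time interval `[0, 1]`. -/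
def IsHolonomy (D : Π y : N, Submodule ℝ (TangentSpace 𝓘(ℝ, F) y)) {k : ℕ}
    {S : Type*} [TopologicalSpace S] [ChartedSpace (EuclideanSpace ℝ (Fin k)) S]
    {S' : Type*} [TopologicalSpace S'] [ChartedSpace (EuclideanSpace ℝ (Fin k)) S']
    (j : S → N) (j' : S' → N) (U : Set S) (φ : S → S') : Prop :=
  IsOpen U ∧
  ContMDiffOn 𝓘(ℝ, EuclideanSpace ℝ (Fin k)) 𝓘(ℝ, EuclideanSpace ℝ (Fin k)) ∞ φ U ∧
  ∃ H : ℝ → S → N,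
    ContMDiffOn (𝓘(ℝ, ℝ).prod 𝓘(ℝ, EuclideanSpace ℝ (Fin k))) 𝓘(ℝ, F) ∞
      (fun p : ℝ × S => H p.1 p.2) (Set.univ ×ˢ U) ∧
    (∀ s ∈ U, H 0 s = j s ∧ H 1 s = j' (φ s)) ∧
    ∀ t ∈ Set.Icc (0 : ℝ) 1, ∀ s ∈ U,
      mfderiv 𝓘(ℝ, ℝ) 𝓘(ℝ, F) (fun τ => H τ s) t (1 : ℝ) ∈ D (H t s)

/-- `(h, J)` is a transversal Kähler structure for the foliation tangent to the distribution `D`.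
Here a transversal metric (on `TN / D`) is given by a smooth symmetric bilinear form `h` on `TN`
which vanishes on `D`, and a transversal complex structure by a smooth field `J` of endomorphisms
of `TN` which preserve `D`. The pair `(h, J)` induces a Kähler structure on each submanifold
transversal to `D`, and the holonomy transformations between such submanifolds preserve the
induced Kähler structures. -/
structure IsTransversalKahler (D : Π y : N, Submodule ℝ (TangentSpace 𝓘(ℝ, F) y))
    (h : Π y : N, TangentSpace 𝓘(ℝ, F) y →L[ℝ] TangentSpace 𝓘(ℝ, F) y →L[ℝ] ℝ)
    (J : Π y : N, TangentSpace 𝓘(ℝ, F) y →L[ℝ] TangentSpace 𝓘(ℝ, F) y) : Prop where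
  smooth_metric : SmoothForm h
  smooth_complex : SmoothEndOn J Set.univ
  symm : ∀ y u v, h y u v = h y v u
  vanish : ∀ y, ∀ u ∈ D y, ∀ v, h y u v = 0
  preserve : ∀ y, ∀ u ∈ D y, J y u ∈ D y
  kahler : ∀ (k : ℕ) (S : Type u) [TopologicalSpace S] [T2Space S] [SecondCountableTopology S]
    [ChartedSpace (EuclideanSpace ℝ (Fin k)) S]
    [IsManifold 𝓘(ℝ, EuclideanSpace ℝ (Fin k)) ∞ S] (j : S → N), IsTransversal (k := k) D j →
      ∃ (g : ContMDiffRiemannianMetric 𝓘(ℝ, EuclideanSpace ℝ (Fin k)) ∞ (EuclideanSpace ℝ (Fin k))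
          (TangentSpace 𝓘(ℝ, EuclideanSpace ℝ (Fin k)) : S → Type _))
        (JS : Π s : S, TangentSpace 𝓘(ℝ, EuclideanSpace ℝ (Fin k)) s →L[ℝ]
          TangentSpace 𝓘(ℝ, EuclideanSpace ℝ (Fin k)) s),
        IsInducedOn (k := k) D h J j g JS ∧ IsKahler g JS
  holonomy : ∀ (k : ℕ) (S S' : Type u)
    [TopologicalSpace S] [T2Space S] [SecondCountableTopology S]
    [ChartedSpace (EuclideanSpace ℝ (Fin k)) S]
    [IsManifold 𝓘(ℝ, EuclideanSpace ℝ (Fin k)) ∞ S]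
    [TopologicalSpace S'] [T2Space S'] [SecondCountableTopology S']
    [ChartedSpace (EuclideanSpace ℝ (Fin k)) S']
    [IsManifold 𝓘(ℝ, EuclideanSpace ℝ (Fin k)) ∞ S'] (j : S → N) (j' : S' → N),
    IsTransversal (k := k) D j → IsTransversal (k := k) D j' →
      ∀ (g : ContMDiffRiemannianMetric 𝓘(ℝ, EuclideanSpace ℝ (Fin k)) ∞ (EuclideanSpace ℝ (Fin k))
          (TangentSpace 𝓘(ℝ, EuclideanSpace ℝ (Fin k)) : S → Type _))
        (JS : Π s : S, TangentSpace 𝓘(ℝ, EuclideanSpace ℝ (Fin k)) s →L[ℝ]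
          TangentSpace 𝓘(ℝ, EuclideanSpace ℝ (Fin k)) s)
        (g' : ContMDiffRiemannianMetric 𝓘(ℝ, EuclideanSpace ℝ (Fin k)) ∞ (EuclideanSpace ℝ (Fin k))
          (TangentSpace 𝓘(ℝ, EuclideanSpace ℝ (Fin k)) : S' → Type _))
        (JS' : Π s : S', TangentSpace 𝓘(ℝ, EuclideanSpace ℝ (Fin k)) s →L[ℝ]
          TangentSpace 𝓘(ℝ, EuclideanSpace ℝ (Fin k)) s),
        IsInducedOn (k := k) D h J j g JS → IsInducedOn (k := k) D h J j' g' JS' →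
        ∀ (U : Set S) (φ : S → S'), IsHolonomy (k := k) D j j' U φ → ∀ s ∈ U,
          (∀ u v, g'.inner (φ s)
              (mfderiv 𝓘(ℝ, EuclideanSpace ℝ (Fin k)) 𝓘(ℝ, EuclideanSpace ℝ (Fin k)) φ s u)
              (mfderiv 𝓘(ℝ, EuclideanSpace ℝ (Fin k)) 𝓘(ℝ, EuclideanSpace ℝ (Fin k)) φ s v)
            = g.inner s u v) ∧
          ∀ u, mfderiv 𝓘(ℝ, EuclideanSpace ℝ (Fin k)) 𝓘(ℝ, EuclideanSpace ℝ (Fin k)) φ s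
              (JS s u)
            = JS' (φ s) (mfderiv 𝓘(ℝ, EuclideanSpace ℝ (Fin k))
                𝓘(ℝ, EuclideanSpace ℝ (Fin k)) φ s u)

end Transversal

/-! ### The distribution spanned by two vector fields along a submanifold -/

section Span

variable {E : Type*} [NormedAddCommGroup E] [NormedSpace ℝ E] [FiniteDimensional ℝ E]
  {M : Type*} [TopologicalSpace M] [ChartedSpace E M]
  {F : Type*} [NormedAddCommGroup F] [NormedSpace ℝ F]
  {N : Type*} [TopologicalSpace N] [ChartedSpace F N]

/-- The distribution on the submanifold `ι : N → M` spanned by the vector fields `ξ₁`, `ξ₂` of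
`M` (which are supposed to be tangent to `N`). -/
def spanDistribution (ι : N → M) (ξ₁ ξ₂ : Π x : M, TangentSpace 𝓘(ℝ, E) x) (y : N) :
    Submodule ℝ (TangentSpace 𝓘(ℝ, F) y) :=
  (Submodule.span ℝ {ξ₁ (ι y), ξ₂ (ι y)}).comap (mfderiv 𝓘(ℝ, F) 𝓘(ℝ, E) ι y).toLinearMap

variable [RiemannianBundle (fun x : M => TangentSpace 𝓘(ℝ, E) x)]

/-- The transversal metric which `g` induces on the submanifold `ι : N → M`, for the distribution
`D` spanned by `ξ₁`, `ξ₂`: the restriction of `g` to the orthogonal complement of `D` in `TN`,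
extended by zero to `D`. It is `(u, v) ↦ g(u^⊥, v^⊥)`, with `^⊥` the component orthogonal to
`ξ₁`, `ξ₂`. -/
def transversalMetric (ι : N → M) (ξ₁ ξ₂ : Π x : M, TangentSpace 𝓘(ℝ, E) x) (y : N) :
    TangentSpace 𝓘(ℝ, F) y →L[ℝ] TangentSpace 𝓘(ℝ, F) y →L[ℝ] ℝ :=
  let A : TangentSpace 𝓘(ℝ, F) y →L[ℝ] TangentSpace 𝓘(ℝ, E) (ι y) :=
    (Submodule.span ℝ {ξ₁ (ι y), ξ₂ (ι y)})ᗮ.starProjection ∘L mfderiv 𝓘(ℝ, F) 𝓘(ℝ, E) ι y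
  ContinuousLinearMap.precomp ℝ A ∘L (innerSL ℝ ∘L A)

/-- The transversal metric, evaluated on two vectors. -/
theorem transversalMetric_apply (ι : N → M) (ξ₁ ξ₂ : Π x : M, TangentSpace 𝓘(ℝ, E) x) (y : N)
    (u v : TangentSpace 𝓘(ℝ, F) y) :
    transversalMetric ι ξ₁ ξ₂ y u v =
      inner ℝ
        ((Submodule.span ℝ {ξ₁ (ι y), ξ₂ (ι y)})ᗮ.starProjection
          (mfderiv 𝓘(ℝ, F) 𝓘(ℝ, E) ι y u))
        ((Submodule.span ℝ {ξ₁ (ι y), ξ₂ (ι y)})ᗮ.starProjection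
          (mfderiv 𝓘(ℝ, F) 𝓘(ℝ, E) ι y v)) :=
  rfl

end Span

end

/-! The proof is tensor calculus with the Levi-Civita connection `∇` of `M`, carried out in charts;
the work lies in four facts, each resting on the one before.

Curvature. As `Q` is parallel, `R(u, v)` normalizes `Q`; let `r_α(u, v)` be its component along
`J_α`. The Bianchi identity ties the `r_α` to the Ricci form (`QuatCurvature.quatCoeff_ricciForm`).
In dimension other than four this and pair symmetry force `r_α(u, v) = c g(J_α u, v)`; in dimension
four the condition `Q · R = 0` does. Nonzero scalar curvature means `c ≠ 0`
(`QuatCurvature.exists_quatCoeff_eq`).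

Moment maps. Kostant's formula `∇_u ∇ξ = R(u, ξ)` and projection to `Q` give `∇_u P = c ∑ g(J_α u,
ξ) J_α` (`FlatMoment.covEnd_eq`, `FlatMoment.anticommutator`). Put `S = ∇ξ - P`. Then `∇S` commutes
with `Q`, so by the Ricci identity `[R(u, v), S]` does too, and contracting `R` with `J_α` yields
`[S, J_α] = 0` because `c ≠ 0` (`FlatMoment.sub_commute`).

The complex structure. Along `N` the product `P₁ P₂` is imaginary, so `P₁` and `P₂` anticommute, and
`K = P₁ P₂ / f` satisfies `K² = -1` since it takes `ξ₁` to `ξ₂`, of equal length. Differentiating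
the relations among `K`, `P₁`, `P₂` and the identity `g(P₁ ξ₁, ξ₂) = 0` gives `∇_v K = (2 / |ξ₁|²)
(g(v, ξ₁) P₁ K - g(v, ξ₂) K P₂)` (`FlatSub.covEnd_unit`). Comparison with `[∇ξ_a, K]` shows that
both fields preserve `I`, so the Nijenhuis tensor vanishes on the distribution `D` spanned by the
fields. As `∇K` sees its direction only through the products with `ξ₁`, `ξ₂`, this already makes the
tensor vanish altogether (`FlatSub.nij_eq_zero`).

The transversal metric. The form `h` is invariant under both fields and annihilates them, hence so
does `ω = h(·, I ·)`, and `dω` annihilates `D`. In directions orthogonal to `D` one has `∇K = 0`,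
and `dω` reduces to a cyclic sum that vanishes because second derivatives of the inclusion are
symmetric (`FlatSub.closed_aux`).

These facts are collected in `TransFlat`, which no longer mentions `M`. Its consequences for
transversals are that the induced complex structure is integrable (`TransFlat.nij_induced`), that
closedness pulls back (`fderiv_pullBilin_cyclic`), and that basic forms are constant under motion
along the leaves (`BasicForm.hasDerivAt`). Holonomy invariance of `h` and `ω` follows, and with it
that of `J`. The passage from manifolds to charts is made by `IsQuaternionicKahler.exists_flatQK`,
`exists_flatSub` and `LocallyTrans`. -/

open Bundle VectorField
open scoped Manifold ContDiff Topology
noncomputable section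
set_option linter.unusedSectionVars false
set_option synthInstance.maxHeartbeats 200000

/-! ### Functions, tensor fields and Lie brackets in charts. -/

section Charts

variable {E : Type*} [NormedAddCommGroup E] [NormedSpace ℝ E]
  {M : Type*} [TopologicalSpace M] [ChartedSpace E M] [IsManifold 𝓘(ℝ, E) ∞ M]

/-- The inverse of the chart at `x₀`. -/
def chartInv (x₀ : M) : E → M := (extChartAt 𝓘(ℝ, E) x₀).symm

/-- The domain of the inverse of the chart at `x₀`. -/
def chartDom (x₀ : M) : Set E := (extChartAt 𝓘(ℝ, E) x₀).target

/-- The tangent map of the inverse of the chart at `x₀`. -/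
def fromChart (x₀ x : M) : E →L[ℝ] TangentSpace 𝓘(ℝ, E) x :=
  (trivializationAt E (TangentSpace 𝓘(ℝ, E)) x₀).symmL ℝ x

/-- The tangent map of the chart at `x₀`. -/
def toChart (x₀ x : M) : TangentSpace 𝓘(ℝ, E) x →L[ℝ] E :=
  (trivializationAt E (TangentSpace 𝓘(ℝ, E)) x₀).continuousLinearMapAt ℝ x

variable {x₀ x : M} {z : E}

theorem isOpen_chartDom (x₀ : M) : IsOpen (chartDom (E := E) x₀) := isOpen_extChartAt_target x₀

theorem chartInv_mem_source (hz : z ∈ chartDom x₀) :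
    chartInv x₀ z ∈ (chartAt E x₀).source := by
  rw [← extChartAt_source 𝓘(ℝ, E)]
  exact (extChartAt 𝓘(ℝ, E) x₀).map_target hz

theorem chart_chartInv (hz : z ∈ chartDom x₀) :
    extChartAt 𝓘(ℝ, E) x₀ (chartInv x₀ z) = z :=
  (extChartAt 𝓘(ℝ, E) x₀).right_inv hz

theorem chartInv_chart (hx : x ∈ (chartAt E x₀).source) :
    chartInv x₀ (extChartAt 𝓘(ℝ, E) x₀ x) = x :=
  (extChartAt 𝓘(ℝ, E) x₀).left_inv (by rwa [extChartAt_source])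

theorem chart_mem_chartDom (hx : x ∈ (chartAt E x₀).source) :
    extChartAt 𝓘(ℝ, E) x₀ x ∈ chartDom x₀ :=
  (extChartAt 𝓘(ℝ, E) x₀).map_source (by rwa [extChartAt_source])

theorem toChart_fromChart (hx : x ∈ (chartAt E x₀).source) (v : E) :
    toChart x₀ x (fromChart x₀ x v) = v :=
  Trivialization.continuousLinearMapAt_symmL _ (by simpa using hx) v

theorem fromChart_toChart (hx : x ∈ (chartAt E x₀).source) (v : TangentSpace 𝓘(ℝ, E) x) :
    fromChart x₀ x (toChart x₀ x v) = v :=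
  Trivialization.symmL_continuousLinearMapAt _ (by simpa using hx) v

theorem mfderiv_chart (hx : x ∈ (chartAt E x₀).source) :
    mfderiv 𝓘(ℝ, E) 𝓘(ℝ, E) (extChartAt 𝓘(ℝ, E) x₀) x = toChart (E := E) x₀ x :=
  (TangentBundle.continuousLinearMapAt_trivializationAt hx).symm

theorem mfderiv_chartInv (hz : z ∈ chartDom x₀) :
    mfderiv 𝓘(ℝ, E) 𝓘(ℝ, E) (chartInv x₀) z =
      fromChart (E := E) x₀ (chartInv x₀ z) := by
  have h := TangentBundle.symmL_trivializationAt (I := 𝓘(ℝ, E)) (chartInv_mem_source hz)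
  rw [chart_chartInv hz] at h
  simp only [modelWithCornersSelf_coe, Set.range_id, mfderivWithin_univ] at h
  exact h.symm

theorem contMDiffOn_chartInv (x₀ : M) :
    ContMDiffOn 𝓘(ℝ, E) 𝓘(ℝ, E) ∞ (chartInv x₀) (chartDom (E := E) x₀) :=
  contMDiffOn_extChartAt_symm x₀

theorem contMDiffAt_chartInv (hz : z ∈ chartDom x₀) :
    ContMDiffAt 𝓘(ℝ, E) 𝓘(ℝ, E) ∞ (chartInv x₀) z :=
  (contMDiffOn_chartInv x₀).contMDiffAt ((isOpen_chartDom x₀).mem_nhds hz)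

theorem contMDiffAt_chart (hx : x ∈ (chartAt E x₀).source) :
    ContMDiffAt 𝓘(ℝ, E) 𝓘(ℝ, E) ∞ (extChartAt 𝓘(ℝ, E) x₀) x :=
  contMDiffAt_extChartAt' hx

/-- Smoothness of a map into a vector space, in a chart. -/
theorem contMDiffAt_iff_chart {F : Type*} [NormedAddCommGroup F] [NormedSpace ℝ F] {f : M → F}
    {n : ℕ∞} (hz : z ∈ chartDom x₀) :
    ContMDiffAt 𝓘(ℝ, E) 𝓘(ℝ, F) n f (chartInv x₀ z) ↔
      ContDiffAt ℝ n (fun w => f (chartInv x₀ w)) z := by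
  have hn : (n : WithTop ℕ∞) ≤ ∞ := by exact_mod_cast le_top
  constructor
  · intro h
    exact (h.comp z ((contMDiffAt_chartInv hz).of_le hn)).contDiffAt
  · intro h
    have hx := chartInv_mem_source hz
    have h1 : ContMDiffAt 𝓘(ℝ, E) 𝓘(ℝ, F) n
        ((fun w => f (chartInv x₀ w)) ∘ extChartAt 𝓘(ℝ, E) x₀) (chartInv x₀ z) := by
      refine ContMDiffAt.comp _ ?_ ((contMDiffAt_chart hx).of_le hn)
      rw [chart_chartInv hz]
      exact h.contMDiffAt
    refine h1.congr_of_eventuallyEq ?_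
    filter_upwards [(chartAt E x₀).open_source.mem_nhds hx] with y hy
    exact congrArg f (chartInv_chart hy).symm

theorem mdifferentiableAt_iff_chart {F : Type*} [NormedAddCommGroup F] [NormedSpace ℝ F]
    {f : M → F} (hz : z ∈ chartDom x₀) :
    MDifferentiableAt 𝓘(ℝ, E) 𝓘(ℝ, F) f (chartInv x₀ z) ↔
      DifferentiableAt ℝ (fun w => f (chartInv x₀ w)) z := by
  constructor
  · intro h
    exact (h.comp z ((contMDiffAt_chartInv hz).mdifferentiableAt (by simp))).differentiableAt
  · intro h
    have hx := chartInv_mem_source hz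
    have h1 : MDifferentiableAt 𝓘(ℝ, E) 𝓘(ℝ, F)
        ((fun w => f (chartInv x₀ w)) ∘ extChartAt 𝓘(ℝ, E) x₀) (chartInv x₀ z) := by
      refine MDifferentiableAt.comp _ ?_ ((contMDiffAt_chart hx).mdifferentiableAt (by simp))
      rw [chart_chartInv hz]
      exact h.mdifferentiableAt
    refine h1.congr_of_eventuallyEq ?_
    filter_upwards [(chartAt E x₀).open_source.mem_nhds hx] with y hy
    exact congrArg f (chartInv_chart hy).symm

theorem two_le_infty : (2 : WithTop ℕ∞) ≤ ∞ :=
  WithTop.coe_le_coe.2 (le_top : (2 : ℕ∞) ≤ ⊤)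

theorem contDiffAt_congr {F G : Type*} [NormedAddCommGroup F] [NormedSpace ℝ F]
    [NormedAddCommGroup G] [NormedSpace ℝ G] {f g : F → G} {p : F} {n : WithTop ℕ∞}
    (h : f =ᶠ[𝓝 p] g) : ContDiffAt ℝ n f p ↔ ContDiffAt ℝ n g p :=
  ⟨fun hf => hf.congr_of_eventuallyEq h.symm, fun hg => hg.congr_of_eventuallyEq h⟩

theorem trivialization_snd (hx : x ∈ (chartAt E x₀).source) (v : TangentSpace 𝓘(ℝ, E) x) :
    (trivializationAt E (TangentSpace 𝓘(ℝ, E)) x₀ ⟨x, v⟩).2 = toChart x₀ x v := by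
  have h : x ∈ (trivializationAt E (TangentSpace 𝓘(ℝ, E) : M → Type _) x₀).baseSet := by
    simpa using hx
  rw [toChart, Trivialization.continuousLinearMapAt_apply, Trivialization.linearMapAt_apply,
    if_pos h]

/-- A vector field, in the chart at `x₀`. -/
def chartField (x₀ : M) (X : Π x : M, TangentSpace 𝓘(ℝ, E) x) (z : E) : E :=
  toChart x₀ (chartInv x₀ z) (X (chartInv x₀ z))

/-- A field of endomorphisms, in the chart at `x₀`. -/
def chartEnd (x₀ : M) (A : Π x : M, TangentSpace 𝓘(ℝ, E) x →L[ℝ] TangentSpace 𝓘(ℝ, E) x)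
    (z : E) : E →L[ℝ] E :=
  toChart x₀ (chartInv x₀ z) ∘L A (chartInv x₀ z) ∘L fromChart x₀ (chartInv x₀ z)

/-- A field of bilinear forms, in the chart at `x₀`. -/
def chartForm (x₀ : M)
    (h : Π x : M, TangentSpace 𝓘(ℝ, E) x →L[ℝ] TangentSpace 𝓘(ℝ, E) x →L[ℝ] ℝ) (z : E) :
    E →L[ℝ] E →L[ℝ] ℝ :=
  ContinuousLinearMap.precomp ℝ (fromChart x₀ (chartInv x₀ z)) ∘L
    h (chartInv x₀ z) ∘L fromChart x₀ (chartInv x₀ z)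

theorem chartForm_apply (x₀ : M)
    (h : Π x : M, TangentSpace 𝓘(ℝ, E) x →L[ℝ] TangentSpace 𝓘(ℝ, E) x →L[ℝ] ℝ) (z u v : E) :
    chartForm x₀ h z u v = h (chartInv x₀ z) (fromChart x₀ (chartInv x₀ z) u)
      (fromChart x₀ (chartInv x₀ z) v) := rfl

theorem contMDiffAt_section_iff_chart {n : ℕ∞} {X : Π x : M, TangentSpace 𝓘(ℝ, E) x}
    (hz : z ∈ chartDom x₀) :
    ContMDiffAt 𝓘(ℝ, E) (𝓘(ℝ, E).prod 𝓘(ℝ, E)) n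
      (fun y => (⟨y, X y⟩ : TotalSpace E (TangentSpace 𝓘(ℝ, E) : M → Type _))) (chartInv x₀ z) ↔
    ContDiffAt ℝ n (chartField x₀ X) z := by
  rw [Trivialization.contMDiffAt_section_iff (trivializationAt E (TangentSpace 𝓘(ℝ, E)) x₀)
    (by simpa using chartInv_mem_source hz), contMDiffAt_iff_chart hz]
  refine contDiffAt_congr ?_
  filter_upwards [(isOpen_chartDom x₀).mem_nhds hz] with w hw
  exact trivialization_snd (chartInv_mem_source hw) _

theorem mdifferentiableAt_section_iff_chart {X : Π x : M, TangentSpace 𝓘(ℝ, E) x}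
    (hz : z ∈ chartDom x₀) :
    MDifferentiableAt 𝓘(ℝ, E) (𝓘(ℝ, E).prod 𝓘(ℝ, E))
      (fun y => (⟨y, X y⟩ : TotalSpace E (TangentSpace 𝓘(ℝ, E) : M → Type _))) (chartInv x₀ z) ↔
    DifferentiableAt ℝ (chartField x₀ X) z := by
  rw [Trivialization.mdifferentiableAt_section_iff 𝓘(ℝ, E)
    (trivializationAt E (TangentSpace 𝓘(ℝ, E)) x₀) X
    (by simpa using chartInv_mem_source hz), mdifferentiableAt_iff_chart hz]
  refine Filter.EventuallyEq.differentiableAt_iff ?_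
  filter_upwards [(isOpen_chartDom x₀).mem_nhds hz] with w hw
  exact trivialization_snd (chartInv_mem_source hw) _

theorem smoothFieldAt_iff_chart {X : Π x : M, TangentSpace 𝓘(ℝ, E) x}
    (hz : z ∈ chartDom x₀) :
    SmoothFieldAt X (chartInv x₀ z) ↔ ContDiffAt ℝ ∞ (chartField x₀ X) z :=
  contMDiffAt_section_iff_chart (n := ⊤) hz

theorem contMDiffAt_end_iff_chart
    {A : Π x : M, TangentSpace 𝓘(ℝ, E) x →L[ℝ] TangentSpace 𝓘(ℝ, E) x} (hz : z ∈ chartDom x₀) :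
    ContMDiffAt 𝓘(ℝ, E) (𝓘(ℝ, E).prod 𝓘(ℝ, E →L[ℝ] E)) ∞
      (fun y => TotalSpace.mk' (E →L[ℝ] E)
      (E := fun y : M => TangentSpace 𝓘(ℝ, E) y →L[ℝ] TangentSpace 𝓘(ℝ, E) y) y (A y))
      (chartInv x₀ z) ↔
    ContDiffAt ℝ ∞ (chartEnd x₀ A) z := by
  rw [Trivialization.contMDiffAt_section_iff (trivializationAt (E →L[ℝ] E)
    (fun y : M => TangentSpace 𝓘(ℝ, E) y →L[ℝ] TangentSpace 𝓘(ℝ, E) y) x₀)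
    (by simpa using chartInv_mem_source hz), contMDiffAt_iff_chart (n := ⊤) hz]
  rfl

theorem smoothEndOn_iff_chart
    {A : Π x : M, TangentSpace 𝓘(ℝ, E) x →L[ℝ] TangentSpace 𝓘(ℝ, E) x} {U : Set M}
    (hU : IsOpen U) (hz : z ∈ chartDom x₀) (hzU : chartInv x₀ z ∈ U) (h : SmoothEndOn A U) :
    ContDiffAt ℝ ∞ (chartEnd x₀ A) z :=
  (contMDiffAt_end_iff_chart hz).1 (h.contMDiffAt (hU.mem_nhds hzU))

-- Forms are sections of a twice nested bundle of homomorphisms, whose trivialization is matched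
-- with `chartForm` by evaluating on two vectors; for endomorphisms the match is definitional.
set_option synthInstance.maxHeartbeats 200000 in
theorem contMDiffAt_form_iff_chart
    {h : Π x : M, TangentSpace 𝓘(ℝ, E) x →L[ℝ] TangentSpace 𝓘(ℝ, E) x →L[ℝ] ℝ}
    (hz : z ∈ chartDom x₀) :
    ContMDiffAt 𝓘(ℝ, E) (𝓘(ℝ, E).prod 𝓘(ℝ, E →L[ℝ] E →L[ℝ] ℝ)) ∞
    (fun y => TotalSpace.mk' (E →L[ℝ] E →L[ℝ] ℝ)
      (E := fun y : M => TangentSpace 𝓘(ℝ, E) y →L[ℝ] TangentSpace 𝓘(ℝ, E) y →L[ℝ] ℝ) y (h y))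
      (chartInv x₀ z) ↔
    ContDiffAt ℝ ∞ (chartForm x₀ h) z := by
  rw [Trivialization.contMDiffAt_section_iff (trivializationAt (E →L[ℝ] E →L[ℝ] ℝ)
    (fun y : M => TangentSpace 𝓘(ℝ, E) y →L[ℝ] TangentSpace 𝓘(ℝ, E) y →L[ℝ] ℝ) x₀)
    (by simpa using chartInv_mem_source hz), contMDiffAt_iff_chart (n := ⊤) hz]
  refine contDiffAt_congr ?_
  filter_upwards [(isOpen_chartDom x₀).mem_nhds hz] with w hw
  have := chartInv_mem_source hw
  have this' : chartInv x₀ w ∈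
      (trivializationAt E (TangentSpace 𝓘(ℝ, E) : M → Type _) x₀).baseSet := by simpa using this
  ext u v
  rw [chartForm_apply, hom_trivializationAt_apply]
  simp only
  rw [inCoordinates_apply_eq₂ (by simpa using this) (by simpa using this) (by simp)]
  simp only [Trivial.fiberBundle_trivializationAt', Trivial.linearMapAt_trivialization,
    LinearMap.id_coe, id_eq, fromChart, Trivialization.symmL_apply _ this']

theorem tangentDeriv_chart {f : M → ℝ} (hz : z ∈ chartDom x₀)
    (hf : DifferentiableAt ℝ (fun w => f (chartInv x₀ w)) z) (v : E) :
    tangentDeriv f (chartInv x₀ z) (fromChart x₀ (chartInv x₀ z) v) =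
      fderiv ℝ (fun w => f (chartInv x₀ w)) z v := by
  have h := mvfderiv_comp_apply (I := 𝓘(ℝ, E)) (I' := 𝓘(ℝ, E)) (f := chartInv x₀) z
    ((mdifferentiableAt_iff_chart hz).2 hf) ((contMDiffAt_chartInv hz).mdifferentiableAt (by simp)) v
  rw [mfderiv_chartInv hz] at h
  refine h.symm.trans ?_
  rw [mvfderiv, mfderiv_eq_fderiv]
  rfl

/-- The differential of `chartInv` is `fromChart`, with inverse `toChart`; pulling back along
`chartInv` therefore means passing to coordinates. -/
theorem mpullback_chartInv (X : Π x : M, TangentSpace 𝓘(ℝ, E) x) (hz : z ∈ chartDom x₀) :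
    mpullback 𝓘(ℝ, E) 𝓘(ℝ, E) (chartInv x₀) X z = chartField x₀ X z := by
  have hx := chartInv_mem_source hz
  have e := mfderiv_chartInv hz
  have h : (mfderiv 𝓘(ℝ, E) 𝓘(ℝ, E) (chartInv x₀) z).inverse =
      toChart (E := E) x₀ (chartInv x₀ z) := by
    refine ContinuousLinearMap.inverse_eq ?_ ?_
    · exact ContinuousLinearMap.ext fun v => (congrArg (fun L : E →L[ℝ] _ =>
        L (toChart x₀ _ v)) e).trans (fromChart_toChart hx v)
    · exact ContinuousLinearMap.ext fun v => (congrArg (fun L : E →L[ℝ] _ =>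
        toChart x₀ _ (L v)) e).trans (toChart_fromChart hx v)
  exact congrArg (fun L : _ →L[ℝ] E => L (X (chartInv x₀ z))) h

theorem mlieBracket_vectorSpace (V W : Π x : E, TangentSpace 𝓘(ℝ, E) x) (z : E) :
    mlieBracket 𝓘(ℝ, E) V W z = lieBracket ℝ V W z := by
  rw [← mlieBracketWithin_univ, mlieBracketWithin_eq_lieBracketWithin]
  exact congrFun lieBracketWithin_univ z

/-- Lie brackets are natural under pullback by the inverse chart, and on a vector space they are
given by derivatives. -/
theorem mlieBracket_chart {X Y : Π x : M, TangentSpace 𝓘(ℝ, E) x} [CompleteSpace E]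
    (hz : z ∈ chartDom x₀)
    (hX : DifferentiableAt ℝ (chartField x₀ X) z) (hY : DifferentiableAt ℝ (chartField x₀ Y) z) :
    mlieBracket 𝓘(ℝ, E) X Y (chartInv x₀ z) = fromChart x₀ (chartInv x₀ z)
      (fderiv ℝ (chartField x₀ Y) z (chartField x₀ X z) -
        fderiv ℝ (chartField x₀ X) z (chartField x₀ Y z)) := by
  have : IsManifold 𝓘(ℝ, E) (minSmoothness ℝ 2) M :=
    IsManifold.of_le (n := ∞) (by simpa using two_le_infty)
  have h := mpullback_mlieBracket (I := 𝓘(ℝ, E)) (I' := 𝓘(ℝ, E)) (f := chartInv x₀) (x₀ := z)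
    (n := 2)
    ((mdifferentiableAt_section_iff_chart hz).2 hX) ((mdifferentiableAt_section_iff_chart hz).2 hY)
    ((contMDiffAt_chartInv hz).of_le two_le_infty) (by simp)
  have h1 : mlieBracket 𝓘(ℝ, E) (mpullback 𝓘(ℝ, E) 𝓘(ℝ, E) (chartInv x₀) X)
      (mpullback 𝓘(ℝ, E) 𝓘(ℝ, E) (chartInv x₀) Y) z =
      lieBracket ℝ (chartField x₀ X) (chartField x₀ Y) z := by
    refine (Filter.EventuallyEq.mlieBracket_vectorField_eq
      (I := 𝓘(ℝ, E)) (M := E) 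
      (V := chartField (E := E) x₀ X) (W := chartField (E := E) x₀ Y) ?_ ?_).trans ?_
    · filter_upwards [(isOpen_chartDom x₀).mem_nhds hz] with w hw using mpullback_chartInv _ hw
    · filter_upwards [(isOpen_chartDom x₀).mem_nhds hz] with w hw using mpullback_chartInv _ hw
    · exact mlieBracket_vectorSpace _ _ z
  have h2 : chartField x₀ (mlieBracket 𝓘(ℝ, E) X Y) z =
      lieBracket ℝ (chartField x₀ X) (chartField x₀ Y) z :=
    (mpullback_chartInv _ hz).symm.trans (h.trans h1)
  refine (fromChart_toChart (chartInv_mem_source hz) _).symm.trans ?_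
  exact congrArg _ h2

end Charts

/-! ### Covariant derivatives and Christoffel symbols in charts. -/

section Connections

variable {E : Type*} [NormedAddCommGroup E] [NormedSpace ℝ E]
  {M : Type*} [TopologicalSpace M] [ChartedSpace E M] [IsManifold 𝓘(ℝ, E) ∞ M]

/-- The vector field which in the chart at `x₀` is `Y`. -/
def ofChart (x₀ : M) (Y : E → E) (x : M) : TangentSpace 𝓘(ℝ, E) x :=
  fromChart x₀ x (Y (extChartAt 𝓘(ℝ, E) x₀ x))

variable {x₀ x : M} {z : E}

theorem chartField_ofChart (Y : E → E) (hz : z ∈ chartDom x₀) :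
    chartField x₀ (ofChart x₀ Y) z = Y z := by
  rw [chartField, ofChart, toChart_fromChart (chartInv_mem_source hz), chart_chartInv hz]

theorem chartField_ofChart_eventuallyEq (Y : E → E) (hz : z ∈ chartDom x₀) :
    chartField x₀ (ofChart x₀ Y) =ᶠ[𝓝 z] Y := by
  filter_upwards [(isOpen_chartDom x₀).mem_nhds hz] with w hw using chartField_ofChart Y hw

theorem fromChart_chartField (X : Π x : M, TangentSpace 𝓘(ℝ, E) x) (hz : z ∈ chartDom x₀) :
    fromChart x₀ (chartInv x₀ z) (chartField x₀ X z) = X (chartInv x₀ z) :=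
  fromChart_toChart (chartInv_mem_source hz) _

theorem smoothFieldAt_ofChart {Y : E → E} (hz : z ∈ chartDom x₀) (hY : ContDiffAt ℝ ∞ Y z) :
    SmoothFieldAt (ofChart x₀ Y) (chartInv x₀ z) :=
  (smoothFieldAt_iff_chart hz).2
    ((contDiffAt_congr (chartField_ofChart_eventuallyEq Y hz)).2 hY)

theorem chartEnd_apply_chartField
    (A : Π x : M, TangentSpace 𝓘(ℝ, E) x →L[ℝ] TangentSpace 𝓘(ℝ, E) x)
    (X : Π x : M, TangentSpace 𝓘(ℝ, E) x) (hz : z ∈ chartDom x₀) :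
    chartField x₀ (fun y => A y (X y)) z = chartEnd x₀ A z (chartField x₀ X z) := by
  simp only [chartEnd, ContinuousLinearMap.comp_apply, fromChart_chartField X hz]
  rfl

variable [FiniteDimensional ℝ E]
  (cov : CovariantDerivative 𝓘(ℝ, E) E (TangentSpace 𝓘(ℝ, E) : M → Type _))

/-- The Christoffel symbols `(u, v) ↦ Γ(u, v)` of a connection in the chart at `x₀`. -/
def christoffel (x₀ : M) (z : E) : E →L[ℝ] E →L[ℝ] E :=
  ∑ i, (ContinuousLinearMap.smulRightL ℝ E E
    (LinearMap.toContinuousLinearMap ((Module.finBasis ℝ E).coord i))) ∘L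
      chartEnd x₀ (cov (ofChart x₀ (fun _ => Module.finBasis ℝ E i))) z

theorem christoffel_apply (z u v : E) :
    christoffel cov x₀ z u v = ∑ i, (Module.finBasis ℝ E).repr v i •
      chartEnd x₀ (cov (ofChart x₀ (fun _ => Module.finBasis ℝ E i))) z u := by
  simp [christoffel]

/-- Differentiability is carried through the induction because a connection is additive on
differentiable sections. -/
theorem cov_sum {ι : Type*} (s : Finset ι) (X : ι → Π x : M, TangentSpace 𝓘(ℝ, E) x)
    (hz : z ∈ chartDom x₀) (hX : ∀ i ∈ s, DifferentiableAt ℝ (chartField x₀ (X i)) z) :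
    DifferentiableAt ℝ (chartField x₀ (∑ i ∈ s, X i)) z ∧
    cov (∑ i ∈ s, X i) (chartInv x₀ z) = ∑ i ∈ s, cov (X i) (chartInv x₀ z) := by
  classical
  induction s using Finset.induction_on with
  | empty =>
    constructor
    · have : chartField x₀ (∑ i ∈ (∅ : Finset ι), X i) = fun _ => (0 : E) := by
        ext w; simp [chartField]
      rw [this]; fun_prop
    · simp
  | insert a s ha ih =>
    obtain ⟨h1, h2⟩ := ih fun i hi => hX i (Finset.mem_insert_of_mem hi)
    have h3 := hX a (Finset.mem_insert_self _ _)
    constructor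
    · have : chartField x₀ (∑ i ∈ insert a s, X i) =
          chartField x₀ (X a) + chartField x₀ (∑ i ∈ s, X i) := by
        ext w; simp [chartField, Finset.sum_insert ha]
      rw [this]; exact h3.add h1
    · rw [Finset.sum_insert ha, Finset.sum_insert ha, ← h2]
      exact cov.isCovariantDerivativeOnUniv.add ((mdifferentiableAt_section_iff_chart hz).2 h3)
        ((mdifferentiableAt_section_iff_chart hz).2 h1)

theorem cov_congr {X Y : Π x : M, TangentSpace 𝓘(ℝ, E) x} (hz : z ∈ chartDom x₀)
    (hX : DifferentiableAt ℝ (chartField x₀ X) z)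
    (h : chartField x₀ X =ᶠ[𝓝 z] chartField x₀ Y) :
    cov X (chartInv x₀ z) = cov Y (chartInv x₀ z) := by
  refine cov.isCovariantDerivativeOnUniv.congr_of_eventuallyEq
    ((mdifferentiableAt_section_iff_chart hz).2 hX)
    ((mdifferentiableAt_section_iff_chart hz).2 (h.differentiableAt_iff.1 hX)) Filter.univ_mem ?_
  have hx := chartInv_mem_source hz
  have hc : Filter.Tendsto (extChartAt 𝓘(ℝ, E) x₀) (𝓝 (chartInv x₀ z)) (𝓝 z) := by
    have := (contMDiffAt_chart hx).continuousAt
    rwa [ContinuousAt, chart_chartInv hz] at this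
  filter_upwards [hc.eventually h, (chartAt E x₀).open_source.mem_nhds hx] with y hy hys
  rw [chartField, chartField, chartInv_chart hys] at hy
  rw [← fromChart_toChart hys (X y), hy, fromChart_toChart hys]

/-- A covariant derivative in the chart. -/
theorem cov_chart {Y : Π x : M, TangentSpace 𝓘(ℝ, E) x} (hz : z ∈ chartDom x₀)
    (hY : DifferentiableAt ℝ (chartField x₀ Y) z) (u : E) :
    toChart x₀ (chartInv x₀ z) (cov Y (chartInv x₀ z) (fromChart x₀ (chartInv x₀ z) u)) =
      fderiv ℝ (chartField x₀ Y) z u + christoffel cov x₀ z u (chartField x₀ Y z) := by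
  have hx := chartInv_mem_source hz
  -- Near the point `Y = ∑ gᵢ cᵢ`, where the `cᵢ` have constant coordinates and the `gᵢ` are the
  -- components of `Y`. The Leibniz rule then yields the derivative term and the Christoffel term.
  let b := Module.finBasis ℝ E
  let c : Fin (Module.finrank ℝ E) → Π x : M, TangentSpace 𝓘(ℝ, E) x :=
    fun i => ofChart x₀ (fun _ => b i)
  let k : Fin (Module.finrank ℝ E) → E →L[ℝ] ℝ := fun i =>
    LinearMap.toContinuousLinearMap (b.coord i)
  let g : Fin (Module.finrank ℝ E) → M → ℝ := fun i x => k i (toChart x₀ x (Y x))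
  have hg : ∀ i, (fun w => g i (chartInv x₀ w)) = fun w => k i (chartField x₀ Y w) :=
    fun i => rfl
  have hgd : ∀ i, DifferentiableAt ℝ (fun w => g i (chartInv x₀ w)) z := fun i => by
    rw [hg]; fun_prop
  have hcd : ∀ i, DifferentiableAt ℝ (chartField x₀ (c i)) z := fun i =>
    (chartField_ofChart_eventuallyEq _ hz).differentiableAt_iff.2 (by fun_prop)
  have hgc : ∀ i, chartField x₀ (g i • c i) =ᶠ[𝓝 z] fun w => k i (chartField x₀ Y w) • b i := by
    intro i
    filter_upwards [chartField_ofChart_eventuallyEq (x₀ := x₀) (fun _ => b i) hz] with w hw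
    rw [← hw]
    simp only [chartField, Pi.smul_apply', map_smul]
    rfl
  have hgcd : ∀ i ∈ Finset.univ, DifferentiableAt ℝ (chartField x₀ (g i • c i)) z := fun i _ =>
    (hgc i).differentiableAt_iff.2 (by fun_prop)
  have hsum : chartField x₀ Y =ᶠ[𝓝 z] chartField x₀ (∑ i, g i • c i) := by
    filter_upwards [Filter.eventually_all.2 hgc] with w hw
    have : chartField x₀ (∑ i, g i • c i) w = ∑ i, chartField x₀ (g i • c i) w := by
      simp [chartField]
    rw [this, Finset.sum_congr rfl fun i _ => hw i]
    exact (b.sum_repr _).symm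
  rw [cov_congr cov hz hY hsum, (cov_sum cov Finset.univ _ hz hgcd).2]
  have hleib : ∀ i, cov (g i • c i) (chartInv x₀ z) = g i (chartInv x₀ z) • cov (c i) (chartInv x₀ z)
      + (mvfderiv 𝓘(ℝ, E) (g i) (chartInv x₀ z)).smulRight (c i (chartInv x₀ z)) := fun i =>
    cov.isCovariantDerivativeOnUniv.leibniz ((mdifferentiableAt_section_iff_chart hz).2 (hcd i))
      ((mdifferentiableAt_iff_chart hz).2 (hgd i))
  have hd : ∀ i, mvfderiv 𝓘(ℝ, E) (g i) (chartInv x₀ z) (fromChart x₀ (chartInv x₀ z) u) =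
      k i (fderiv ℝ (chartField x₀ Y) z u) := fun i => by
    refine (tangentDeriv_chart hz (hgd i) u).trans ?_
    rw [hg, fderiv_fun_comp z (k i).differentiableAt hY, ContinuousLinearMap.fderiv]
    rfl
  have hci : ∀ i, toChart x₀ (chartInv x₀ z) (c i (chartInv x₀ z)) = b i := fun i =>
    chartField_ofChart _ hz
  simp only [sum_apply, map_sum, hleib, add_apply,
    ContinuousLinearMap.smulRight_apply, smul_apply, map_add, map_smul, hd, hci,
    Finset.sum_add_distrib]
  rw [add_comm, christoffel_apply]
  congr 1
  exact b.sum_repr _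

end Connections

/-! ### Smoothness of the Christoffel symbols, and curvature in charts. -/

section Christoffel

variable {E : Type*} [NormedAddCommGroup E] [NormedSpace ℝ E] [FiniteDimensional ℝ E]
  {M : Type*} [TopologicalSpace M] [T2Space M] [ChartedSpace E M] [IsManifold 𝓘(ℝ, E) ∞ M]
  (cov : CovariantDerivative 𝓘(ℝ, E) E (TangentSpace 𝓘(ℝ, E) : M → Type _))
  {x₀ x : M} {z : E}

/-- A bump function cuts off the extension by the chart. Global fields are needed because smoothness
of a connection is applied to globally smooth sections. -/
theorem exists_global_extension (Y : E → E) (hY : ContDiff ℝ ∞ Y) (hz : z ∈ chartDom x₀) :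
    ∃ X : Π x : M, TangentSpace 𝓘(ℝ, E) x, (∀ x, SmoothFieldAt X x) ∧
      chartField x₀ X =ᶠ[𝓝 z] Y := by
  have hx := chartInv_mem_source hz
  obtain ⟨χ, -, hχ⟩ := (SmoothBumpFunction.nhds_basis_tsupport (I := 𝓘(ℝ, E))
    (chartInv x₀ z)).mem_iff.1 ((chartAt E x₀).open_source.mem_nhds hx)
  refine ⟨(χ : M → ℝ) • ofChart x₀ Y, ?_, ?_⟩
  · have h1 : ContMDiffOn 𝓘(ℝ, E) (𝓘(ℝ, E).prod 𝓘(ℝ, E)) ∞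
        (fun y => (⟨y, ofChart x₀ Y y⟩ : TotalSpace E (TangentSpace 𝓘(ℝ, E) : M → Type _)))
        (chartAt E x₀).source := by
      intro y hy
      have := smoothFieldAt_ofChart (x₀ := x₀) (chart_mem_chartDom hy) hY.contDiffAt
      rw [chartInv_chart hy] at this
      exact ContMDiffAt.contMDiffWithinAt this
    exact ContMDiffOn.smul_section_of_tsupport χ.contMDiff.contMDiffOn
      (chartAt E x₀).open_source hχ h1
  · have hc : Filter.Tendsto (chartInv x₀) (𝓝 z) (𝓝 (chartInv x₀ z)) :=
      (contMDiffAt_chartInv hz).continuousAt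
    filter_upwards [hc.eventually χ.eventuallyEq_one, chartField_ofChart_eventuallyEq Y hz]
      with w h1 h2
    rw [← h2]
    simp [chartField, h1]

/-- The local field is replaced by a global one with the same germ, and a connection depends only on
germs. -/
theorem contDiffAt_chartEnd_cov
    (hcov : CovariantDerivative.ContMDiffCovariantDerivative cov ∞) {Y : E → E}
    (hY : ContDiff ℝ ∞ Y) (hz : z ∈ chartDom x₀) :
    ContDiffAt ℝ ∞ (chartEnd x₀ (cov (ofChart x₀ Y))) z := by
  obtain ⟨X, hX, hXY⟩ := exists_global_extension Y hY hz
  have h1 := hcov.contMDiff.contMDiff (σ := X)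
    (fun x _ => ContMDiffAt.contMDiffWithinAt (hX x))
  have h2 := (contMDiffAt_end_iff_chart hz).1 (h1.contMDiffAt Filter.univ_mem)
  refine h2.congr_of_eventuallyEq ?_
  filter_upwards [hXY.eventually_nhds, (isOpen_chartDom x₀).mem_nhds hz] with w hw hwd
  have h3 : cov (ofChart x₀ Y) (chartInv x₀ w) = cov X (chartInv x₀ w) := by
    refine cov_congr cov hwd ?_ ?_
    · exact (chartField_ofChart_eventuallyEq Y hwd).differentiableAt_iff.2
        (hY.differentiable (by simp) w)
    · exact (chartField_ofChart_eventuallyEq Y hwd).trans (Filter.EventuallyEq.symm hw)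
  rw [chartEnd, chartEnd, h3]

theorem contDiffAt_christoffel
    (hcov : CovariantDerivative.ContMDiffCovariantDerivative cov ∞) (hz : z ∈ chartDom x₀) :
    ContDiffAt ℝ ∞ (christoffel cov x₀) z := by
  have : christoffel cov x₀ = fun z => ∑ i, (ContinuousLinearMap.smulRightL ℝ E E
    (LinearMap.toContinuousLinearMap ((Module.finBasis ℝ E).coord i))) ∘L
      chartEnd x₀ (cov (ofChart x₀ (fun _ => Module.finBasis ℝ E i))) z := rfl
  rw [this]
  exact ContDiffAt.sum fun i _ =>
    contDiffAt_const.clm_comp (contDiffAt_chartEnd_cov cov hcov contDiff_const hz)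

/-- The curvature operator of the connection with Christoffel symbols `Γ`. -/
def flatCurvature (Γ : E → E →L[ℝ] E →L[ℝ] E) (z u v : E) : E →L[ℝ] E :=
  fderiv ℝ Γ z u v - fderiv ℝ Γ z v u + Γ z u ∘L Γ z v - Γ z v ∘L Γ z u

theorem chartField_extend (hx : x ∈ (chartAt E x₀).source) (u : TangentSpace 𝓘(ℝ, E) x) :
    ∀ᶠ w in 𝓝 (extChartAt 𝓘(ℝ, E) x₀ x),
      ContDiffAt ℝ ∞ (chartField x₀ (FiberBundle.extend E u)) w := by
  obtain ⟨s, hs, h⟩ := FiberBundle.exists_contMDiffOn_extend 𝓘(ℝ, E) E (k := ∞) u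
  have hz := chart_mem_chartDom hx
  have hc : Filter.Tendsto (chartInv x₀) (𝓝 (extChartAt 𝓘(ℝ, E) x₀ x)) (𝓝 x) := by
    have : ContinuousAt _ _ := (contMDiffAt_chartInv hz).continuousAt
    rwa [ContinuousAt, chartInv_chart hx] at this
  filter_upwards [hc.eventually (eventually_mem_nhds_iff.2 hs), (isOpen_chartDom x₀).mem_nhds hz]
    with w hw hwd
  exact (smoothFieldAt_iff_chart hwd).1 (h.contMDiffAt hw)

/-- The derivatives of the chosen extensions cancel: the second ones by symmetry, the first ones
among themselves and against the bracket term. Only `Γ` and its derivative survive. -/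
theorem curvature_chart (hcov : CovariantDerivative.ContMDiffCovariantDerivative cov ∞)
    (hz : z ∈ chartDom x₀) (u v w : E) :
    toChart x₀ (chartInv x₀ z) (curvature cov (chartInv x₀ z)
      (fromChart x₀ _ u) (fromChart x₀ _ v) (fromChart x₀ _ w)) =
    flatCurvature (christoffel cov x₀) z u v w := by
  have hx := chartInv_mem_source hz
  have hΓ : DifferentiableAt ℝ (christoffel cov x₀) z :=
    (contDiffAt_christoffel cov hcov hz).differentiableAt (by simp)
  set Γ := christoffel cov x₀ with hΓdef
  let ext : E → Π y : M, TangentSpace 𝓘(ℝ, E) y := fun a =>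
    FiberBundle.extend E (fromChart x₀ (chartInv x₀ z) a)
  have hext : ∀ a, ∀ᶠ p in 𝓝 z, ContDiffAt ℝ ∞ (chartField x₀ (ext a)) p := fun a => by
    have := chartField_extend hx (fromChart x₀ (chartInv x₀ z) a)
    rwa [chart_chartInv hz] at this
  have hval : ∀ a, chartField x₀ (ext a) z = a := fun a => by
    simp only [chartField, ext, FiberBundle.extend_apply_self]
    exact toChart_fromChart hx a
  have hd : ∀ a, DifferentiableAt ℝ (chartField x₀ (ext a)) z := fun a =>
    (hext a).self_of_nhds.differentiableAt (by simp)
  have hd2 : ∀ a, DifferentiableAt ℝ (fderiv ℝ (chartField x₀ (ext a))) z := fun a =>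
    ((hext a).self_of_nhds.fderiv_right (m := 1) two_le_infty).differentiableAt (by simp)
  have hcc : ∀ a b, chartField x₀ (fun y => cov (ext a) y (ext b y)) =ᶠ[𝓝 z] fun p =>
      fderiv ℝ (chartField x₀ (ext a)) p (chartField x₀ (ext b) p) +
        Γ p (chartField x₀ (ext b) p) (chartField x₀ (ext a) p) := fun a b => by
    filter_upwards [hext a, (isOpen_chartDom x₀).mem_nhds hz] with p hp hpd
    rw [hΓdef, ← cov_chart cov hpd (hp.differentiableAt (by simp)), fromChart_chartField _ hpd]
    rfl
  have hccd : ∀ a b, HasFDerivAt (fun p => fderiv ℝ (chartField x₀ (ext a)) p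
      (chartField x₀ (ext b) p) + Γ p (chartField x₀ (ext b) p) (chartField x₀ (ext a) p))
      _ z := fun a b =>
    ((hd2 a).hasFDerivAt.clm_apply (hd b).hasFDerivAt).add
      ((hΓ.hasFDerivAt.clm_apply (hd b).hasFDerivAt).clm_apply (hd a).hasFDerivAt)
  have hcov2 : ∀ a b c, toChart x₀ (chartInv x₀ z) (cov (fun y => cov (ext a) y (ext b y))
      (chartInv x₀ z) (fromChart x₀ (chartInv x₀ z) c)) =
      fderiv ℝ (fderiv ℝ (chartField x₀ (ext a))) z c b
        + fderiv ℝ (chartField x₀ (ext a)) z (fderiv ℝ (chartField x₀ (ext b)) z c)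
        + fderiv ℝ Γ z c b a + Γ z (fderiv ℝ (chartField x₀ (ext b)) z c) a
        + Γ z b (fderiv ℝ (chartField x₀ (ext a)) z c)
        + Γ z c (fderiv ℝ (chartField x₀ (ext a)) z b + Γ z b a) := fun a b c => by
    rw [cov_chart cov hz ((hcc a b).differentiableAt_iff.2 (hccd a b).differentiableAt),
      (hcc a b).fderiv_eq, (hccd a b).fderiv, (hcc a b).self_of_nhds]
    simp only [hval, add_apply, ContinuousLinearMap.comp_apply,
      ContinuousLinearMap.flip_apply, ← hΓdef]
    abel
  have hbr : mlieBracket 𝓘(ℝ, E) (ext u) (ext v) (chartInv x₀ z) =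
      fromChart x₀ (chartInv x₀ z) (fderiv ℝ (chartField x₀ (ext v)) z u -
        fderiv ℝ (chartField x₀ (ext u)) z v) := by
    have := mlieBracket_chart hz (hd u) (hd v)
    rwa [hval, hval] at this
  have hsymm : fderiv ℝ (fderiv ℝ (chartField x₀ (ext w))) z u v =
      fderiv ℝ (fderiv ℝ (chartField x₀ (ext w))) z v u := by
    have := (hext w).self_of_nhds.isSymmSndFDerivAt (by simpa using two_le_infty)
    exact this u v
  change toChart x₀ (chartInv x₀ z) (cov (fun y => cov (ext w) y (ext v y)) (chartInv x₀ z)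
      (fromChart x₀ _ u) - cov (fun y => cov (ext w) y (ext u y)) (chartInv x₀ z)
      (fromChart x₀ _ v) - cov (ext w) (chartInv x₀ z)
      (mlieBracket 𝓘(ℝ, E) (ext u) (ext v) (chartInv x₀ z))) = _
  rw [hbr, map_sub, map_sub, hcov2, hcov2, cov_chart cov hz (hd w), hval, hsymm]
  simp only [flatCurvature, map_add, map_sub, sub_apply, add_apply,
    ContinuousLinearMap.comp_apply, ← hΓdef]
  abel

end Christoffel

/-! ### Maps between manifolds in charts. -/

section Maps

variable {E : Type*} [NormedAddCommGroup E] [NormedSpace ℝ E]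
  {M : Type*} [TopologicalSpace M] [ChartedSpace E M] [IsManifold 𝓘(ℝ, E) ∞ M]
  {F : Type*} [NormedAddCommGroup F] [NormedSpace ℝ F]
  {N : Type*} [TopologicalSpace N] [ChartedSpace F N] [IsManifold 𝓘(ℝ, F) ∞ N]

/-- A map between manifolds, in the charts at `y₀` and `x₀`. -/
def chartMap (y₀ : N) (x₀ : M) (g : N → M) (w : F) : E :=
  extChartAt 𝓘(ℝ, E) x₀ (g (chartInv y₀ w))

variable {y₀ : N} {x₀ : M} {g : N → M} {w : F}

theorem chartInv_chartMap (hg : g (chartInv y₀ w) ∈ (chartAt E x₀).source) :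
    chartInv x₀ (chartMap (E := E) y₀ x₀ g w) = g (chartInv y₀ w) :=
  chartInv_chart hg

theorem chartMap_mem_chartDom (hg : g (chartInv y₀ w) ∈ (chartAt E x₀).source) :
    chartMap (E := E) y₀ x₀ g w ∈ chartDom x₀ :=
  chart_mem_chartDom hg

theorem contDiffAt_chartMap (hw : w ∈ chartDom y₀)
    (hg : g (chartInv y₀ w) ∈ (chartAt E x₀).source)
    (hgs : ContMDiffAt 𝓘(ℝ, F) 𝓘(ℝ, E) ∞ g (chartInv y₀ w)) :
    ContDiffAt ℝ ∞ (chartMap (E := E) y₀ x₀ g) w :=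
  (contMDiffAt_iff_chart (n := ⊤) hw).1
    (ContMDiffAt.comp (chartInv y₀ w) (contMDiffAt_chart hg) hgs)

theorem mfderiv_chartMap (hw : w ∈ chartDom y₀)
    (hg : g (chartInv y₀ w) ∈ (chartAt E x₀).source)
    (hgs : MDifferentiableAt 𝓘(ℝ, F) 𝓘(ℝ, E) g (chartInv y₀ w)) (v : F) :
    mfderiv 𝓘(ℝ, F) 𝓘(ℝ, E) g (chartInv y₀ w) (fromChart y₀ (chartInv y₀ w) v) =
      fromChart x₀ (g (chartInv y₀ w)) (fderiv ℝ (chartMap (E := E) y₀ x₀ g) w v) := by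
  have h1 : MDifferentiableAt 𝓘(ℝ, F) 𝓘(ℝ, F) (chartInv y₀) w :=
    (contMDiffAt_chartInv hw).mdifferentiableAt (by simp)
  have h2 : MDifferentiableAt 𝓘(ℝ, E) 𝓘(ℝ, E) (extChartAt 𝓘(ℝ, E) x₀) (g (chartInv y₀ w)) :=
    (contMDiffAt_chart hg).mdifferentiableAt (by simp)
  have h3 : mfderiv 𝓘(ℝ, F) 𝓘(ℝ, E) (chartMap (E := E) y₀ x₀ g) w =
      (mfderiv 𝓘(ℝ, E) 𝓘(ℝ, E) (extChartAt 𝓘(ℝ, E) x₀) (g (chartInv y₀ w))).comp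
        ((mfderiv 𝓘(ℝ, F) 𝓘(ℝ, E) g (chartInv y₀ w)).comp
          (mfderiv 𝓘(ℝ, F) 𝓘(ℝ, F) (chartInv y₀) w)) := by
    exact (mfderiv_comp (I' := 𝓘(ℝ, E)) w h2 (hgs.comp w h1)).trans
      (congrArg _ (mfderiv_comp (I' := 𝓘(ℝ, F)) w hgs h1))
  rw [mfderiv_chart hg, mfderiv_chartInv hw, mfderiv_eq_fderiv] at h3
  have h4 : fderiv ℝ (chartMap (E := E) y₀ x₀ g) w v = toChart x₀ (g (chartInv y₀ w))
      (mfderiv 𝓘(ℝ, F) 𝓘(ℝ, E) g (chartInv y₀ w) (fromChart y₀ (chartInv y₀ w) v)) :=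
    congrArg (fun L : F →L[ℝ] E => L v) h3
  rw [h4, fromChart_toChart hg]

end Maps

/-! ### Imaginary quaternion units, traces and orthonormal bases. -/

section QuaternionicAlgebra

variable {V : Type*} [NormedAddCommGroup V] [NormedSpace ℝ V]

/-- The trace of a continuous endomorphism. -/
def endTrace : (V →L[ℝ] V) →ₗ[ℝ] ℝ := LinearMap.trace ℝ V ∘ₗ ContinuousLinearMap.coeLM ℝ

theorem endTrace_apply (A : V →L[ℝ] V) : endTrace A = LinearMap.trace ℝ V A.toLinearMap := rfl

theorem endTrace_mul_comm (A C : V →L[ℝ] V) : endTrace (A * C) = endTrace (C * A) :=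
  LinearMap.trace_mul_comm ℝ A.toLinearMap C.toLinearMap

theorem endTrace_one [FiniteDimensional ℝ V] : endTrace (1 : V →L[ℝ] V) = Module.finrank ℝ V :=
  LinearMap.trace_one ℝ V

/-- `J₁, J₂, J₃` satisfy the relations of the imaginary quaternion units. -/
structure QuatTriple (J₁ J₂ J₃ : V →L[ℝ] V) : Prop where
  sq₁ : J₁ * J₁ = -1
  sq₂ : J₂ * J₂ = -1
  mul₁₂ : J₁ * J₂ = J₃
  mul₂₁ : J₂ * J₁ = -J₃

namespace QuatTriple

variable {J₁ J₂ J₃ : V →L[ℝ] V} (hJ : QuatTriple J₁ J₂ J₃)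
include hJ

theorem mul₂₃ : J₂ * J₃ = J₁ := by
  rw [← neg_eq_iff_eq_neg.2 hJ.mul₂₁, mul_neg, ← mul_assoc, hJ.sq₂]; simp

theorem mul₁₃ : J₁ * J₃ = -J₂ := by
  rw [← hJ.mul₁₂, ← mul_assoc, hJ.sq₁]; simp

theorem mul₃₂ : J₃ * J₂ = -J₁ := by
  rw [← hJ.mul₁₂, mul_assoc, hJ.sq₂]; simp

theorem mul₃₁ : J₃ * J₁ = J₂ := by
  rw [← neg_eq_iff_eq_neg.2 hJ.mul₂₁, neg_mul, mul_assoc, hJ.sq₁]; simp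

theorem sq₃ : J₃ * J₃ = -1 := by
  nth_rewrite 1 [← hJ.mul₁₂]
  rw [mul_assoc, hJ.mul₂₃, hJ.sq₁]

theorem rotate : QuatTriple J₂ J₃ J₁ where
  sq₁ := hJ.sq₂
  sq₂ := hJ.sq₃
  mul₁₂ := hJ.mul₂₃
  mul₂₁ := hJ.mul₃₂

theorem apply₁₁ (v : V) : J₁ (J₁ v) = -v := congrArg (fun L : V →L[ℝ] V => L v) hJ.sq₁
theorem apply₂₂ (v : V) : J₂ (J₂ v) = -v := congrArg (fun L : V →L[ℝ] V => L v) hJ.sq₂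
theorem apply₃₃ (v : V) : J₃ (J₃ v) = -v := congrArg (fun L : V →L[ℝ] V => L v) hJ.sq₃
theorem apply₁₂ (v : V) : J₁ (J₂ v) = J₃ v := congrArg (fun L : V →L[ℝ] V => L v) hJ.mul₁₂
theorem apply₂₃ (v : V) : J₂ (J₃ v) = J₁ v := congrArg (fun L : V →L[ℝ] V => L v) hJ.mul₂₃
theorem apply₃₁ (v : V) : J₃ (J₁ v) = J₂ v := congrArg (fun L : V →L[ℝ] V => L v) hJ.mul₃₁
theorem apply₂₁ (v : V) : J₂ (J₁ v) = -J₃ v := congrArg (fun L : V →L[ℝ] V => L v) hJ.mul₂₁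
theorem apply₃₂ (v : V) : J₃ (J₂ v) = -J₁ v := congrArg (fun L : V →L[ℝ] V => L v) hJ.mul₃₂
theorem apply₁₃ (v : V) : J₁ (J₃ v) = -J₂ v := congrArg (fun L : V →L[ℝ] V => L v) hJ.mul₁₃

/-- `J₁ = J₂ J₃ = -J₃ J₂`, and the trace does not see the order of the factors. -/
theorem endTrace_eq_zero : endTrace J₁ = 0 := by
  have h := endTrace_mul_comm J₂ J₃
  rw [hJ.mul₂₃, hJ.mul₃₂, map_neg] at h
  linarith

variable [FiniteDimensional ℝ V] [Nontrivial V]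

/-- Products of distinct units are again units up to sign, hence traceless: the units are orthogonal
for the trace form, each with square `-dim`. -/
theorem coeff₁ (a b c : ℝ) :
    endTrace ((a • J₁ + b • J₂ + c • J₃) * J₁) = -(Module.finrank ℝ V * a) := by
  have h2 := hJ.rotate.endTrace_eq_zero
  have h3 := hJ.rotate.rotate.endTrace_eq_zero
  simp only [add_mul, smul_mul_assoc, hJ.sq₁, hJ.mul₂₁, hJ.mul₃₁, map_add, map_smul, map_neg,
    endTrace_one, h2, h3, smul_eq_mul]
  ring

/-- The coefficients of an element of the span, by traces. -/
theorem eq_of_mem_span {X : V →L[ℝ] V} (hX : X ∈ Submodule.span ℝ {J₁, J₂, J₃}) :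
    X = -(Module.finrank ℝ V : ℝ)⁻¹ • (endTrace (X * J₁) • J₁ + endTrace (X * J₂) • J₂ +
      endTrace (X * J₃) • J₃) := by
  obtain ⟨a, b, c, rfl⟩ := Submodule.mem_span_triple.1 hX
  have hd : (Module.finrank ℝ V : ℝ) ≠ 0 := by
    exact_mod_cast Module.finrank_pos.ne'
  have e2 : a • J₁ + b • J₂ + c • J₃ = b • J₂ + c • J₃ + a • J₁ := by abel
  have e3 : a • J₁ + b • J₂ + c • J₃ = c • J₃ + a • J₁ + b • J₂ := by abel
  have h1 := hJ.coeff₁ a b c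
  have h2 := hJ.rotate.coeff₁ b c a
  have h3 := hJ.rotate.rotate.coeff₁ c a b
  rw [← e2] at h2
  rw [← e3] at h3
  rw [h1, h2, h3]
  simp only [smul_add, smul_smul]
  congr 2 <;> field_simp

/-- The commutator of an operator which normalizes the span with `J₁`. -/
theorem commutator {R : V →L[ℝ] V} (hR : R * J₁ - J₁ * R ∈ Submodule.span ℝ {J₁, J₂, J₃}) :
    R * J₁ - J₁ * R = (2 * -((Module.finrank ℝ V : ℝ)⁻¹ * endTrace (R * J₃))) • J₂ -
      (2 * -((Module.finrank ℝ V : ℝ)⁻¹ * endTrace (R * J₂))) • J₃ := by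
  have h1 : endTrace ((R * J₁ - J₁ * R) * J₁) = 0 := by
    rw [sub_mul, map_sub, mul_assoc J₁, endTrace_mul_comm J₁, sub_self]
  have h2 : endTrace ((R * J₁ - J₁ * R) * J₂) = 2 * endTrace (R * J₃) := by
    rw [sub_mul, map_sub, mul_assoc J₁, endTrace_mul_comm J₁, mul_assoc, mul_assoc, hJ.mul₁₂,
      hJ.mul₂₁, mul_neg, map_neg]
    ring
  have h3 : endTrace ((R * J₁ - J₁ * R) * J₃) = -2 * endTrace (R * J₂) := by
    rw [sub_mul, map_sub, mul_assoc J₁, endTrace_mul_comm J₁, mul_assoc, mul_assoc, hJ.mul₁₃,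
      hJ.mul₃₁, mul_neg, map_neg]
    ring
  rw [hJ.eq_of_mem_span hR, h1, h2, h3]
  module

end QuatTriple

section OrthonormalBasis

variable {κ : Type*} [Fintype κ] [DecidableEq κ] {B : V →L[ℝ] V →L[ℝ] ℝ} {e : Module.Basis κ ℝ V}
  (he : ∀ i j, B (e i) (e j) = if i = j then 1 else 0)
include he

theorem repr_eq_of_orthonormal (v : V) (i : κ) : e.repr v i = B v (e i) := by
  conv_rhs => rw [← e.sum_repr v]
  simp only [map_sum, map_smul, sum_apply, smul_apply, he, smul_eq_mul, mul_ite, mul_one, mul_zero,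
    Finset.sum_ite_eq', Finset.mem_univ, if_true]

theorem sum_of_orthonormal (v : V) : ∑ i, B v (e i) • e i = v := by
  simp only [← repr_eq_of_orthonormal he]
  exact e.sum_repr v

theorem symm_of_orthonormal (v w : V) : B v w = B w v := by
  rw [← sum_of_orthonormal he v, ← sum_of_orthonormal he w]
  simp [he, mul_comm]

theorem endTrace_of_orthonormal (A : V →L[ℝ] V) : endTrace A = ∑ i, B (A (e i)) (e i) := by
  rw [endTrace_apply, LinearMap.trace_eq_matrix_trace ℝ e, Matrix.trace]
  refine Finset.sum_congr rfl fun i _ => ?_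
  rw [Matrix.diag, LinearMap.toMatrix_apply, repr_eq_of_orthonormal he]
  rfl

theorem sum_linear_of_orthonormal (T : V →ₗ[ℝ] ℝ) (v : V) : ∑ i, B v (e i) * T (e i) = T v := by
  conv_rhs => rw [← sum_of_orthonormal he v]
  simp

/-- The trace of a bilinear form twisted by a skew endomorphism. -/
theorem sum_skew_of_orthonormal {J : V →L[ℝ] V} (hJ : ∀ v w, B (J v) w = -B v (J w))
    (T : V →ₗ[ℝ] V →ₗ[ℝ] ℝ) : ∑ i, T (J (e i)) (e i) = -∑ i, T (e i) (J (e i)) := by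
  have h1 : ∀ i, T (J (e i)) (e i) = ∑ j, B (J (e i)) (e j) * T (e j) (e i) := fun i =>
    (sum_linear_of_orthonormal he (T.flip (e i)) (J (e i))).symm
  have h2 : ∀ i, T (e i) (J (e i)) = ∑ j, B (J (e i)) (e j) * T (e i) (e j) := fun i =>
    (sum_linear_of_orthonormal he (T (e i)) (J (e i))).symm
  simp only [h1, h2, ← Finset.sum_neg_distrib]
  rw [Finset.sum_comm]
  refine Finset.sum_congr rfl fun i _ => Finset.sum_congr rfl fun j _ => ?_
  rw [hJ, symm_of_orthonormal he (e j)]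
  ring

theorem ext_of_orthonormal {v w : V} (h : ∀ z, B v z = B w z) : v = w := by
  rw [← sum_of_orthonormal he v, ← sum_of_orthonormal he w]
  simp only [h]

end OrthonormalBasis

end QuaternionicAlgebra

/-! ### Algebra of quaternionic Kähler curvature tensors. -/

section QuaternionicCurvature

variable {V : Type*} [NormedAddCommGroup V] [NormedSpace ℝ V]

/-- `R` has the symmetries of the curvature tensor of a quaternionic Kähler manifold. -/
structure QuatCurvature (B : V →L[ℝ] V →L[ℝ] ℝ) (R : V → V → V →L[ℝ] V)
    (J₁ J₂ J₃ : V →L[ℝ] V) : Prop where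
  quat : QuatTriple J₁ J₂ J₃
  skew₁ : ∀ v w, B (J₁ v) w = -B v (J₁ w)
  skew₂ : ∀ v w, B (J₂ v) w = -B v (J₂ w)
  skew₃ : ∀ v w, B (J₃ v) w = -B v (J₃ w)
  add_right : ∀ u v w, R u (v + w) = R u v + R u w
  smul_right : ∀ u (c : ℝ) v, R u (c • v) = c • R u v
  antisymm : ∀ u v, R u v = -R v u
  skew : ∀ u v w z, B (R u v w) z = -B w (R u v z)
  bianchi : ∀ u v w, R u v w + R v w u + R w u v = 0
  normalizes : ∀ u v, ∀ J ∈ ({J₁, J₂, J₃} : Set (V →L[ℝ] V)),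
    R u v * J - J * R u v ∈ Submodule.span ℝ {J₁, J₂, J₃}

/-- The component of `R u v` along `J`. -/
def quatCoeff (R : V → V → V →L[ℝ] V) (J : V →L[ℝ] V) (u v : V) : ℝ :=
  -((Module.finrank ℝ V : ℝ)⁻¹ * endTrace (R u v * J))

/-- The Ricci form of `R`. -/
def ricciForm {κ : Type*} [Fintype κ] (B : V →L[ℝ] V →L[ℝ] ℝ) (e : κ → V)
    (R : V → V → V →L[ℝ] V) (u v : V) : ℝ :=
  ∑ i, B (R (e i) u v) (e i)

namespace QuatCurvature

variable {B : V →L[ℝ] V →L[ℝ] ℝ} {R : V → V → V →L[ℝ] V} {J₁ J₂ J₃ : V →L[ℝ] V}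
  (h : QuatCurvature B R J₁ J₂ J₃)
include h

theorem rotate : QuatCurvature B R J₂ J₃ J₁ where
  quat := h.quat.rotate
  skew₁ := h.skew₂
  skew₂ := h.skew₃
  skew₃ := h.skew₁
  add_right := h.add_right
  smul_right := h.smul_right
  antisymm := h.antisymm
  skew := h.skew
  bianchi := h.bianchi
  normalizes := by
    have e : ({J₂, J₃, J₁} : Set (V →L[ℝ] V)) = {J₁, J₂, J₃} := by
      ext; simp; tauto
    rw [e]
    exact h.normalizes

theorem neg_right (u v : V) : R u (-v) = -R u v := by
  rw [← neg_one_smul ℝ v, h.smul_right, neg_one_smul]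

theorem add_left (u v w : V) : R (u + v) w = R u w + R v w := by
  rw [h.antisymm, h.add_right, h.antisymm u, h.antisymm v, neg_add]

theorem smul_left (c : ℝ) (u v : V) : R (c • u) v = c • R u v := by
  rw [h.antisymm, h.smul_right, h.antisymm u, smul_neg]

theorem neg_left (u v : V) : R (-u) v = -R u v := by
  rw [h.antisymm, h.neg_right, h.antisymm u]

theorem quatCoeff_neg_right (J : V →L[ℝ] V) (u v : V) :
    quatCoeff R J u (-v) = -quatCoeff R J u v := by
  simp [quatCoeff, h.neg_right]

theorem quatCoeff_neg_left (J : V →L[ℝ] V) (u v : V) :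
    quatCoeff R J (-u) v = -quatCoeff R J u v := by
  simp [quatCoeff, h.neg_left]

/-- The component along `J`, as a bilinear map. -/
def quatCoeffLM (J : V →L[ℝ] V) : V →ₗ[ℝ] V →ₗ[ℝ] ℝ := LinearMap.mk₂ ℝ (quatCoeff R J)
  (fun u v w => by simp [quatCoeff, h.add_left, add_mul]; ring)
  (fun c u v => by simp [quatCoeff, h.smul_left]; ring)
  (fun u v w => by simp [quatCoeff, h.add_right, add_mul]; ring)
  (fun c u v => by simp [quatCoeff, h.smul_right]; ring)

theorem quatCoeff_antisymm (J : V →L[ℝ] V) (u v : V) :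
    quatCoeff R J u v = -quatCoeff R J v u := by
  simp [quatCoeff, h.antisymm u v]

/-- The Bianchi identity at the four cyclic rotations of `(u, v, w, z)`, combined with the two
skew-symmetries, allows the pairs to be exchanged. -/
theorem pair_symm (hB : ∀ v w, B v w = B w v) (u v w z : V) :
    B (R u v w) z = B (R w z u) v := by
  have b : ∀ u v w z, B (R u v w) z + B (R v w u) z + B (R w u v) z = 0 := fun u v w z => by
    rw [← add_apply, ← map_add, ← add_apply, ← map_add, h.bianchi]; simp
  have a : ∀ u v w z, B (R u v w) z = -B (R v u w) z := fun u v w z => by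
    rw [h.antisymm u v]; simp
  have s : ∀ u v w z, B (R u v w) z = -B (R u v z) w := fun u v w z => by
    rw [h.skew, hB w]
  have h1 := b u v w z
  have h2 := b v w z u
  have h3 := b w z u v
  have h4 := b z u v w
  linarith [a u v w z, a v w u z, a w u v z, s u v w z, s v w u z, s w u v z, a w z u v, a z u w v,
    a u w z v, s w z u v, s z u w v, s u w z v, a v w z u, a w z v u, a z v w u, s v w z u,
    s w z v u, s z v w u, a z u v w, a u v z w, a v z u w, s z u v w, s u v z w, s v z u w]

variable [FiniteDimensional ℝ V] [Nontrivial V]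

theorem commutator₁ (u v : V) :
    R u v * J₁ - J₁ * R u v = (2 * quatCoeff R J₃ u v) • J₂ - (2 * quatCoeff R J₂ u v) • J₃ :=
  h.quat.commutator (h.normalizes u v J₁ (by simp))

theorem apply_comm₁ (u v w : V) :
    R u v (J₁ w) = J₁ (R u v w) + (2 * quatCoeff R J₃ u v) • J₂ w
      - (2 * quatCoeff R J₂ u v) • J₃ w := by
  have := congrArg (fun L : V →L[ℝ] V => L w) (h.commutator₁ u v)
  simp only [sub_apply, mul_apply_eq_comp, smul_apply] at this
  rw [sub_eq_iff_eq_add.1 this]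
  abel

variable {κ : Type*} [Fintype κ] [DecidableEq κ] {e : Module.Basis κ ℝ V}
  (he : ∀ i j, B (e i) (e j) = if i = j then 1 else 0)
include he

/-- The sum `∑ R(Jeᵢ, u, v, eᵢ)`. -/
theorem sum_twisted (u v : V) : ∑ i, B (R (J₂ (e i)) u v) (e i) =
    ricciForm B e R u (J₂ v) + 2 * quatCoeff R J₁ u (J₃ v) - 2 * quatCoeff R J₃ u (J₁ v) := by
  have hB := symm_of_orthonormal he
  have hr : ∀ J x y, quatCoeff R J x y = -quatCoeff R J y x := h.quatCoeff_antisymm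
  let T : V →ₗ[ℝ] V →ₗ[ℝ] ℝ := LinearMap.mk₂ ℝ (fun x y => B (R x u v) y)
    (by simp [h.add_left]) (by simp [h.smul_left]) (by simp) (by simp)
  have h1 := sum_skew_of_orthonormal he h.skew₂ T
  simp only [T, LinearMap.mk₂_apply] at h1
  -- Moving `J₂` across `R (e i) u` onto `v` costs the commutator terms along `J₁` and `J₃`.
  have h2 : ∀ i, B (R (e i) u v) (J₂ (e i)) = -B (R (e i) u (J₂ v)) (e i) +
      2 * (quatCoeff R J₁ (e i) u * B (J₃ v) (e i)) -
      2 * (quatCoeff R J₃ (e i) u * B (J₁ v) (e i)) := fun i => by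
    have := h.skew₂ (R (e i) u v) (e i)
    rw [h.rotate.apply_comm₁]
    simp only [map_sub, map_add, map_smul, sub_apply, add_apply, smul_apply, smul_eq_mul]
    linarith
  have h3 : ∀ J x, ∑ i, quatCoeff R J (e i) u * B x (e i) = quatCoeff R J x u := by
    intro J x
    refine Eq.trans ?_ (sum_linear_of_orthonormal he ((h.quatCoeffLM J).flip u) x)
    exact Finset.sum_congr rfl fun i _ => mul_comm _ _
  rw [h1, Finset.sum_congr rfl fun i _ => h2 i, Finset.sum_sub_distrib, Finset.sum_add_distrib,
    ← Finset.mul_sum, ← Finset.mul_sum, h3, h3, Finset.sum_neg_distrib, ricciForm,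
    hr J₁ (J₃ v), hr J₃ (J₁ v)]
  ring

theorem finrank_mul_quatCoeff (J : V →L[ℝ] V) (u v : V) :
    Module.finrank ℝ V * quatCoeff R J u v = -∑ i, B (R u v (J (e i))) (e i) := by
  have hd : (Module.finrank ℝ V : ℝ) ≠ 0 := by exact_mod_cast Module.finrank_pos.ne'
  rw [quatCoeff, endTrace_of_orthonormal he]
  field_simp
  rfl

/-- By Bianchi the trace of `R u v J₂` splits into two twisted Ricci sums. They are opposite by pair
symmetry and skewness of `J₂`, whence the factor `2`, and `sum_twisted` evaluates them. -/
theorem finrank_mul_quatCoeff₂ (u v : V) : Module.finrank ℝ V * quatCoeff R J₂ u v =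
    2 * (ricciForm B e R u (J₂ v) + 2 * quatCoeff R J₁ u (J₃ v) - 2 * quatCoeff R J₃ u (J₁ v)) := by
  have hB := symm_of_orthonormal he
  have h1 : ∀ x y, ∑ i, B (R (J₂ (e i)) x y) (e i) = -∑ i, B (R (J₂ (e i)) y x) (e i) := by
    intro x y
    let T : V →ₗ[ℝ] V →ₗ[ℝ] ℝ := LinearMap.mk₂ ℝ (fun a b => B (R a x y) b)
      (by simp [h.add_left]) (by simp [h.smul_left]) (by simp) (by simp)
    have h2 := sum_skew_of_orthonormal he h.skew₂ T
    simp only [T, LinearMap.mk₂_apply] at h2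
    rw [h2]
    congr 1
    refine Finset.sum_congr rfl fun i _ => ?_
    rw [h.pair_symm hB, h.antisymm y, neg_apply, map_neg, neg_apply, h.skew, neg_neg, hB]
  have h3 : ∀ i, B (R u v (J₂ (e i))) (e i) =
      B (R (J₂ (e i)) v u) (e i) - B (R (J₂ (e i)) u v) (e i) := by
    intro i
    have := congrArg (fun x => B x (e i)) (h.bianchi u v (J₂ (e i)))
    simp only [map_add, add_apply, map_zero, zero_apply, h.antisymm v (J₂ (e i)), neg_apply,
      map_neg] at this
    linarith
  rw [h.finrank_mul_quatCoeff he, Finset.sum_congr rfl fun i _ => h3 i, Finset.sum_sub_distrib,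
    h1 v u, ← h.sum_twisted he]
  ring

theorem ricciForm_symm (u v : V) : ricciForm B e R u v = ricciForm B e R v u := by
  have hB := symm_of_orthonormal he
  refine Finset.sum_congr rfl fun i _ => ?_
  rw [h.pair_symm hB, h.antisymm v, neg_apply, map_neg, neg_apply, h.skew, neg_neg, hB]

/-- The relation between the components of the curvature and the Ricci form. -/
theorem quatCoeff_ricciForm (u v : V) : Module.finrank ℝ V * quatCoeff R J₂ u (J₂ v) +
    4 * quatCoeff R J₁ u (J₁ v) + 4 * quatCoeff R J₃ u (J₃ v) = -2 * ricciForm B e R u v := by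
  have hn : ricciForm B e R u (-v) = -ricciForm B e R u v := by simp [ricciForm]
  rw [h.finrank_mul_quatCoeff₂ he, h.quat.apply₂₂, h.quat.apply₃₂, h.quat.apply₁₂, hn,
    h.quatCoeff_neg_right]
  ring

/-- Pair symmetry turns the contraction of `R` with `J₁` into the trace of `R u v J₁`. This is how
`J₁` itself will be recovered from the curvature operators. -/
theorem sum_apply_complex (u : V) :
    ∑ i, R (e i) (J₁ (e i)) u = (Module.finrank ℝ V : ℝ) • ∑ i, quatCoeff R J₁ u (e i) • e i := by
  have hB := symm_of_orthonormal he
  refine ext_of_orthonormal he fun v => ?_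
  have h1 : ∑ i, quatCoeff R J₁ u (e i) * B (e i) v = quatCoeff R J₁ u v := by
    refine Eq.trans ?_ (sum_linear_of_orthonormal he (h.quatCoeffLM J₁ u) v)
    exact Finset.sum_congr rfl fun i _ => by rw [mul_comm, hB]; rfl
  simp only [map_sum, sum_apply, map_smul, smul_apply, smul_eq_mul, h1]
  rw [h.finrank_mul_quatCoeff he, ← Finset.sum_neg_distrib]
  refine Finset.sum_congr rfl fun i _ => ?_
  rw [h.pair_symm hB, h.skew, hB]

end QuatCurvature

end QuaternionicCurvature

/-! ### The quaternionic components in dimension other than four. -/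

namespace QuatCurvature

variable {V : Type*} [NormedAddCommGroup V] [NormedSpace ℝ V]
  {B : V →L[ℝ] V →L[ℝ] ℝ} {R : V → V → V →L[ℝ] V} {J₁ J₂ J₃ : V →L[ℝ] V}
  (h : QuatCurvature B R J₁ J₂ J₃) [FiniteDimensional ℝ V] [Nontrivial V]
  {κ : Type*} [Fintype κ] [DecidableEq κ] {e : Module.Basis κ ℝ V}
  (he : ∀ i j, B (e i) (e j) = if i = j then 1 else 0)
include h he

/-- `J₁` is an isometry, so after commuting it past `R u v` only the commutator terms remain. -/
theorem apply_complex_complex (u v w z : V) : B (R u v (J₁ w)) (J₁ z) = B (R u v w) z -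
    2 * quatCoeff R J₃ u v * B (J₃ w) z - 2 * quatCoeff R J₂ u v * B (J₂ w) z := by
  have hs : ∀ x, B (J₁ x) (J₁ z) = B x z := fun x => by
    rw [h.skew₁, h.quat.apply₁₁, map_neg, neg_neg]
  have h2 : B (J₂ w) (J₁ z) = -B (J₃ w) z := by
    rw [← neg_eq_iff_eq_neg.2 (h.skew₁ (J₂ w) z), h.quat.apply₁₂]
  have h3 : B (J₃ w) (J₁ z) = B (J₂ w) z := by
    rw [← neg_eq_iff_eq_neg.2 (h.skew₁ (J₃ w) z), h.quat.apply₁₃, map_neg, neg_apply, neg_neg]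
  rw [h.apply_comm₁]
  simp only [map_sub, map_add, map_smul, sub_apply, add_apply, smul_apply, smul_eq_mul, hs, h2, h3]
  ring

/-- Compute `R` with all four arguments twisted by `J₁`, once as it stands and once after exchanging
`(u, v)` with `(w, z)`. By pair symmetry both computations give the same number, and what is left is
the comparison of the correction terms. -/
theorem pairing (h2 : ∀ u v, quatCoeff R J₂ (J₁ u) (J₁ v) = -quatCoeff R J₂ u v)
    (h3 : ∀ u v, quatCoeff R J₃ (J₁ u) (J₁ v) = -quatCoeff R J₃ u v) (u v w z : V) :
    quatCoeff R J₂ u v * B (J₂ w) z + quatCoeff R J₃ u v * B (J₃ w) z =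
    quatCoeff R J₂ w z * B (J₂ u) v + quatCoeff R J₃ w z * B (J₃ u) v := by
  have hp := h.pair_symm (symm_of_orthonormal he)
  have hq : ∀ u v w z, B (R (J₁ u) (J₁ v) (J₁ w)) (J₁ z) = B (R w z u) v
      - 2 * quatCoeff R J₃ w z * B (J₃ u) v - 2 * quatCoeff R J₂ w z * B (J₂ u) v
      + 2 * quatCoeff R J₃ u v * B (J₃ w) z + 2 * quatCoeff R J₂ u v * B (J₂ w) z := by
    intro u v w z
    rw [h.apply_complex_complex he, h2, h3, hp, h.apply_complex_complex he]
    ring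
  have e1 := hq u v w z
  have e2 := hq w z u v
  rw [hp] at e1
  rw [hp u v] at e2
  have e3 := hp w z (J₁ u) (J₁ v)
  have := hp (J₁ u) (J₁ v) (J₁ w) (J₁ z)
  linarith

/-- Subtracting cyclic instances of `quatCoeff_ricciForm` leaves `dim - 4` times the differences of
the forms `r_α(u, J_α v)`, so the three forms agree. Then `dim + 8` times their common value is `-2`
times the Ricci form, which is symmetric, and `pairing` forces proportionality to the metric. -/
theorem quatCoeff_eq_of_ne_four (hd : Module.finrank ℝ V ≠ 4) : ∃ c : ℝ, ∀ u v,
    quatCoeff R J₁ u v = c * B (J₁ u) v ∧ quatCoeff R J₂ u v = c * B (J₂ u) v ∧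
      quatCoeff R J₃ u v = c * B (J₃ u) v := by
  have hd' : (Module.finrank ℝ V : ℝ) - 4 ≠ 0 := by
    rw [sub_ne_zero]; exact_mod_cast hd
  have hd8 : (Module.finrank ℝ V : ℝ) + 8 ≠ 0 := by positivity
  have ha := h.quatCoeff_antisymm
  have f1 := h.rotate.rotate.quatCoeff_ricciForm he
  have f2 := h.quatCoeff_ricciForm he
  have f3 := h.rotate.quatCoeff_ricciForm he
  have h12 : ∀ u v, quatCoeff R J₂ u (J₂ v) = quatCoeff R J₁ u (J₁ v) := fun u v =>
    mul_left_cancel₀ hd' (by linarith [f1 u v, f2 u v])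
  have h13 : ∀ u v, quatCoeff R J₃ u (J₃ v) = quatCoeff R J₁ u (J₁ v) := fun u v =>
    mul_left_cancel₀ hd' (by linarith [f1 u v, f3 u v])
  have hs : ∀ u v, quatCoeff R J₁ u (J₁ v) = quatCoeff R J₁ v (J₁ u) := fun u v => by
    refine mul_left_cancel₀ hd8 ?_
    have := f1 u v
    have := f1 v u
    rw [h12, h13] at *
    linarith [h.ricciForm_symm he u v]
  have hl : ∀ u v, quatCoeff R J₁ (J₁ u) v = -quatCoeff R J₁ u (J₁ v) := fun u v => by
    rw [ha, ← hs]
  have hl2 : ∀ u v, quatCoeff R J₂ (J₂ u) v = -quatCoeff R J₂ u (J₂ v) := fun u v => by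
    rw [ha, h12, h12, ← hs]
  have hl3 : ∀ u v, quatCoeff R J₃ (J₃ u) v = -quatCoeff R J₃ u (J₃ v) := fun u v => by
    rw [ha, h13, h13, ← hs]
  -- Quantified over frames, because the identity is needed for all three cyclic rotations of the
  -- given one.
  have key : ∀ {J₁ J₂ J₃ : V →L[ℝ] V} (h : QuatCurvature B R J₁ J₂ J₃)
      (h12 : ∀ u v, quatCoeff R J₂ u (J₂ v) = quatCoeff R J₁ u (J₁ v))
      (h13 : ∀ u v, quatCoeff R J₃ u (J₃ v) = quatCoeff R J₁ u (J₁ v))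
      (hl : ∀ u v, quatCoeff R J₁ (J₁ u) v = -quatCoeff R J₁ u (J₁ v))
      (hl2 : ∀ u v, quatCoeff R J₂ (J₂ u) v = -quatCoeff R J₂ u (J₂ v))
      (hl3 : ∀ u v, quatCoeff R J₃ (J₃ u) v = -quatCoeff R J₃ u (J₃ v)) (u v w z : V),
      quatCoeff R J₂ u v * B (J₂ w) z + quatCoeff R J₃ u v * B (J₃ w) z =
        quatCoeff R J₂ w z * B (J₂ u) v + quatCoeff R J₃ w z * B (J₃ u) v := by
    intro J₁ J₂ J₃ h h12 h13 hl hl2 hl3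
    have nr := h.quatCoeff_neg_right
    have nl := h.quatCoeff_neg_left
    have l1 : ∀ u v, quatCoeff R J₁ u v = -quatCoeff R J₁ u (J₁ (J₁ v)) := fun u v => by
      rw [h.quat.apply₁₁, nr, neg_neg]
    have l2 : ∀ u v, quatCoeff R J₂ u v = -quatCoeff R J₁ u (J₁ (J₂ v)) := fun u v => by
      rw [← h12, h.quat.apply₂₂, nr, neg_neg]
    have l3 : ∀ u v, quatCoeff R J₃ u v = -quatCoeff R J₁ u (J₁ (J₃ v)) := fun u v => by
      rw [← h13, h.quat.apply₃₃, nr, neg_neg]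
    refine h.pairing he (fun u v => ?_) fun u v => ?_
    · rw [l2, l2, hl, h.quat.apply₂₁, h.quat.apply₁₂]
      simp only [map_neg, h.quat.apply₁₃, neg_neg]
      rw [h.quat.apply₁₂]
    · rw [l3, l3, hl, h.quat.apply₃₁, h.quat.apply₁₃]
      simp only [h.quat.apply₁₃, h.quat.apply₁₂, nr, neg_neg]
  have k1 := key h h12 h13 hl hl2 hl3
  have k2 := key h.rotate (fun u v => by rw [h13, h12]) (fun u v => (h12 u v).symm) hl2 hl3 hl
  have k3 := key h.rotate.rotate (fun u v => (h13 u v).symm) (fun u v => by rw [h12, h13])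
    hl3 hl hl2
  obtain ⟨w⟩ : Nonempty κ := e.index_nonempty
  have hw : ∀ {J : V →L[ℝ] V}, (∀ v w, B (J v) w = -B v (J w)) → (∀ v, J (J v) = -v) →
      B (J (e w)) (J (e w)) = 1 := fun {J} h1 h2 => by
    rw [h1, h2, map_neg, neg_neg, he, if_pos rfl]
  -- The combination `k2 + k3 - k1` isolates the `J₁`-terms, and `J₁ (e w)` as last argument makes
  -- the coefficient on the left equal to `1`. The other two units are treated in the same way.
  refine ⟨quatCoeff R J₁ (e w) (J₁ (e w)), fun u v => ⟨?_, ?_, ?_⟩⟩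
  · have e1 := k1 u v (e w) (J₁ (e w))
    have e2 := k2 u v (e w) (J₁ (e w))
    have e3 := k3 u v (e w) (J₁ (e w))
    have := hw h.skew₁ h.quat.apply₁₁
    simp only [this, mul_one] at e1 e2 e3
    linarith
  · have e1 := k1 u v (e w) (J₂ (e w))
    have e2 := k2 u v (e w) (J₂ (e w))
    have e3 := k3 u v (e w) (J₂ (e w))
    have := hw h.skew₂ h.quat.apply₂₂
    simp only [this, mul_one] at e1 e2 e3
    rw [← h12]
    linarith
  · have e1 := k1 u v (e w) (J₃ (e w))
    have e2 := k2 u v (e w) (J₃ (e w))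
    have e3 := k3 u v (e w) (J₃ (e w))
    have := hw h.skew₃ h.quat.apply₃₃
    simp only [this, mul_one] at e1 e2 e3
    rw [← h13]
    linarith

end QuatCurvature

/-! ### Dimension four, and operators commuting with the quaternionic units. -/

namespace QuatCurvature

variable {V : Type*} [NormedAddCommGroup V] [NormedSpace ℝ V]
  {B : V →L[ℝ] V →L[ℝ] ℝ} {R : V → V → V →L[ℝ] V} {J₁ J₂ J₃ : V →L[ℝ] V}
  (h : QuatCurvature B R J₁ J₂ J₃) [FiniteDimensional ℝ V] [Nontrivial V]
include h

/-- The condition says `R (J₁ u) v + R u (J₁ v) = -[R u v, J₁]`; the three relations are its traces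
against the units. -/
theorem quatCoeff_derivation
    (hd : ∀ u v w, J₁ (R u v w) - R (J₁ u) v w - R u (J₁ v) w - R u v (J₁ w) = 0) (u v : V) :
    quatCoeff R J₁ (J₁ u) v + quatCoeff R J₁ u (J₁ v) = 0 ∧
    quatCoeff R J₂ (J₁ u) v + quatCoeff R J₂ u (J₁ v) = -2 * quatCoeff R J₃ u v ∧
    quatCoeff R J₃ (J₁ u) v + quatCoeff R J₃ u (J₁ v) = 2 * quatCoeff R J₂ u v := by
  have hdim : (Module.finrank ℝ V : ℝ) ≠ 0 := by exact_mod_cast Module.finrank_pos.ne'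
  have e : R (J₁ u) v + R u (J₁ v) = (0 : ℝ) • J₁ + (-(2 * quatCoeff R J₃ u v)) • J₂ +
      (2 * quatCoeff R J₂ u v) • J₃ := by
    have h1 : R (J₁ u) v + R u (J₁ v) = -(R u v * J₁ - J₁ * R u v) := by
      ext w
      simp only [add_apply, neg_apply, sub_apply, mul_apply_eq_comp]
      have := hd u v w
      rw [← sub_eq_zero, ← neg_eq_zero, ← this]
      abel
    rw [h1, h.commutator₁]
    module
  have hr : ∀ J, quatCoeff R J (J₁ u) v + quatCoeff R J u (J₁ v) = -((Module.finrank ℝ V : ℝ)⁻¹ *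
      endTrace (((0 : ℝ) • J₁ + (-(2 * quatCoeff R J₃ u v)) • J₂ +
      (2 * quatCoeff R J₂ u v) • J₃) * J)) := fun J => by
    rw [← e, add_mul, map_add, quatCoeff, quatCoeff]
    ring
  refine ⟨?_, ?_, ?_⟩
  · rw [hr, h.quat.coeff₁]; ring
  · rw [hr, add_assoc, add_comm, h.quat.rotate.coeff₁]; field_simp
  · rw [hr, add_comm, ← add_assoc, h.quat.rotate.rotate.coeff₁]; field_simp

variable {κ : Type*} [Fintype κ] [DecidableEq κ] {e : Module.Basis κ ℝ V}
  (he : ∀ i j, B (e i) (e j) = if i = j then 1 else 0)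
include he

theorem orthogonal_complex {J : V →L[ℝ] V} (hJ : ∀ v w, B (J v) w = -B v (J w)) (v : V) :
    B v (J v) = 0 := by
  have h1 := hJ v v
  rw [symm_of_orthonormal he (J v)] at h1
  linarith

/-- In dimension four, invariant symmetric forms are multiples of the metric. -/
theorem eq_smul_of_invariant (hd : Module.finrank ℝ V = 4) (T : V →ₗ[ℝ] V →ₗ[ℝ] ℝ)
    (hT : ∀ u v, T u v = T v u) (h1 : ∀ u v, T (J₁ u) (J₁ v) = T u v)
    (h2 : ∀ u v, T (J₂ u) (J₂ v) = T u v) (h3 : ∀ u v, T (J₃ u) (J₃ v) = T u v) :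
    ∃ c, ∀ u v, T u v = c * B u v := by
  obtain ⟨a⟩ : Nonempty κ := e.index_nonempty
  have hB := symm_of_orthonormal he
  have z1 := h.orthogonal_complex he h.skew₁ (e a)
  have z2 := h.orthogonal_complex he h.skew₂ (e a)
  have z3 := h.orthogonal_complex he h.skew₃ (e a)
  have z0 : B (e a) (e a) = 1 := by simp [he]
  -- In dimension four a unit vector and its images under the units form a basis. On it one checks
  -- that `T` minus `T (e a) (e a)` times the metric is zero.
  let f : Fin 4 → V := ![e a, J₁ (e a), J₂ (e a), J₃ (e a)]
  have hli : LinearIndependent ℝ f := by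
    rw [Fintype.linearIndependent_iff]
    intro g hg
    rw [Fin.sum_univ_four] at hg
    change g 0 • e a + g 1 • J₁ (e a) + g 2 • J₂ (e a) + g 3 • J₃ (e a) = 0 at hg
    have c0 := congrArg (fun x => B (e a) x) hg
    have c1 := congrArg (fun x => B (e a) (J₁ x)) hg
    have c2 := congrArg (fun x => B (e a) (J₂ x)) hg
    have c3 := congrArg (fun x => B (e a) (J₃ x)) hg
    simp only [map_add, map_smul, map_zero, map_neg, smul_eq_mul, z0, z1, z2, z3, mul_zero, add_zero,
      mul_one, zero_add, h.quat.apply₁₁, h.quat.apply₁₂, h.quat.apply₁₃, h.quat.apply₂₁,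
      h.quat.apply₂₂, h.quat.apply₂₃, h.quat.apply₃₁, h.quat.apply₃₂, h.quat.apply₃₃, neg_zero,
      mul_neg, neg_eq_zero] at c0 c1 c2 c3
    intro i
    fin_cases i <;> assumption
  let b := basisOfLinearIndependentOfCardEqFinrank hli (by simp [hd])
  let W : V →ₗ[ℝ] V →ₗ[ℝ] ℝ := LinearMap.mk₂ ℝ (fun u v => T u v - T (e a) (e a) * B u v)
    (fun u v w => by simp; ring) (fun c u v => by simp; ring) (fun u v w => by simp; ring)
    (fun c u v => by simp; ring)
  have hW : ∀ u v, W u v = T u v - T (e a) (e a) * B u v := fun u v => rfl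
  have hinv : ∀ {J : V →L[ℝ] V}, (∀ v w, B (J v) w = -B v (J w)) → (∀ v, J (J v) = -v) →
      (∀ u v, T (J u) (J v) = T u v) → ∀ u v, W (J u) (J v) = W u v := by
    intro J s q t u v
    rw [hW, hW, t, s, q, map_neg, neg_neg]
  have hz : ∀ {J : V →L[ℝ] V}, (∀ v w, B (J v) w = -B v (J w)) → (∀ v, J (J v) = -v) →
      (∀ u v, T (J u) (J v) = T u v) → W (e a) (J (e a)) = 0 := by
    intro J s q t
    -- Invariance gives `T(e, Je) = T(Je, J²e) = -T(Je, e)`, which with symmetry means zero.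
    have e1 := t (e a) (J (e a))
    rw [q, map_neg, hT] at e1
    have : T (e a) (J (e a)) = 0 := by linarith
    rw [hW, this, h.orthogonal_complex he s]
    ring
  have hbf : ∀ i, b i = f i := fun i => by simp [b]
  have hW0 : W (e a) = 0 := by
    refine b.ext fun i => ?_
    rw [hbf]
    fin_cases i
    · change W (e a) (e a) = 0
      rw [hW, z0]; ring
    · exact hz h.skew₁ h.quat.apply₁₁ h1
    · exact hz h.skew₂ h.quat.apply₂₂ h2
    · exact hz h.skew₃ h.quat.apply₃₃ h3
  have hWJ : ∀ {J : V →L[ℝ] V}, (∀ v w, B (J v) w = -B v (J w)) → (∀ v, J (J v) = -v) →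
      (∀ u v, T (J u) (J v) = T u v) → W (J (e a)) = 0 := by
    intro J s q t
    ext v
    rw [← hinv s q t, q, map_neg, hW0]
    simp
  have hW1 : W = 0 := by
    refine b.ext fun i => ?_
    rw [hbf]
    fin_cases i
    · exact hW0
    · exact hWJ h.skew₁ h.quat.apply₁₁ h1
    · exact hWJ h.skew₂ h.quat.apply₂₂ h2
    · exact hWJ h.skew₃ h.quat.apply₃₃ h3
  refine ⟨T (e a) (e a), fun u v => ?_⟩
  have := hW u v
  rw [hW1] at this
  simp only [LinearMap.zero_apply] at this
  linarith

omit he in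
/-- The relations between the components of the curvature in dimension four. -/
theorem quatCoeff_swap
    (hd : ∀ u v w, J₁ (R u v w) - R (J₁ u) v w - R u (J₁ v) w - R u v (J₁ w) = 0) :
    (∀ u v, quatCoeff R J₁ (J₁ u) v = -quatCoeff R J₁ u (J₁ v)) ∧
    (∀ u v, quatCoeff R J₂ (J₁ u) v = -quatCoeff R J₃ u v) ∧
    (∀ u v, quatCoeff R J₂ u (J₁ v) = -quatCoeff R J₃ u v) ∧
    (∀ u v, quatCoeff R J₃ (J₁ u) v = quatCoeff R J₂ u v) ∧
    (∀ u v, quatCoeff R J₃ u (J₁ v) = quatCoeff R J₂ u v) := by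
  have hk := h.quatCoeff_derivation hd
  have nr := h.quatCoeff_neg_right
  have nl := h.quatCoeff_neg_left
  have q := h.quat.apply₁₁
  -- The third relation at `(J₁ u, v)` and at `(u, J₁ v)` has the same left-hand side, because `J₁²
  -- = -1`. Hence the two summands of the second relation are equal.
  have h2 : ∀ u v, quatCoeff R J₂ (J₁ u) v = -quatCoeff R J₃ u v := fun u v => by
    have a1 := (hk u v).2.1
    have a2 := (hk (J₁ u) v).2.2
    have a3 := (hk u (J₁ v)).2.2
    rw [q, nl] at a2
    rw [q, nr] at a3
    linarith
  have h3 : ∀ u v, quatCoeff R J₃ (J₁ u) v = quatCoeff R J₂ u v := fun u v => by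
    have := h2 (J₁ u) v
    rw [q, nl] at this
    linarith
  exact ⟨fun u v => by linarith [(hk u v).1], h2, fun u v => by linarith [(hk u v).2.1, h2 u v], h3,
    fun u v => by linarith [(hk u v).2.2, h3 u v]⟩

/-- By `quatCoeff_swap` the form `r₁(u, J₁ v)` is symmetric and invariant under all three units, so
`eq_smul_of_invariant` applies to it. -/
theorem exists_quatCoeff_eq_of_four (hdim : Module.finrank ℝ V = 4)
    (hd : ∀ J ∈ ({J₁, J₂, J₃} : Set (V →L[ℝ] V)),
      ∀ u v w, J (R u v w) - R (J u) v w - R u (J v) w - R u v (J w) = 0) : ∃ c : ℝ, ∀ u v,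
    quatCoeff R J₁ u v = c * B (J₁ u) v := by
  have nr := h.quatCoeff_neg_right
  have ha := h.quatCoeff_antisymm
  obtain ⟨s1, -, -, -, -⟩ := h.quatCoeff_swap (hd J₁ (by simp))
  obtain ⟨-, -, -, s2, -⟩ := h.rotate.quatCoeff_swap (hd J₂ (by simp))
  obtain ⟨-, s3, -, -, -⟩ := h.rotate.rotate.quatCoeff_swap (hd J₃ (by simp))
  obtain ⟨-, -, -, -, t2'⟩ := h.rotate.rotate.quatCoeff_swap (hd J₃ (by simp))
  obtain ⟨-, -, t3', -, -⟩ := h.rotate.quatCoeff_swap (hd J₂ (by simp))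
  let T : V →ₗ[ℝ] V →ₗ[ℝ] ℝ := (h.quatCoeffLM J₁).compl₂ J₁.toLinearMap
  have hT : ∀ u v, T u v = quatCoeff R J₁ u (J₁ v) := fun u v => rfl
  obtain ⟨c, hc⟩ := h.eq_smul_of_invariant he hdim T
    (fun u v => by rw [hT, hT, ha, s1, neg_neg])
    (fun u v => by rw [hT, hT, s1, h.quat.apply₁₁, nr, neg_neg])
    (fun u v => by rw [hT, hT, h.quat.apply₁₂, ← neg_eq_iff_eq_neg.2 (h.quat.apply₂₁ v), nr, s2, t3',
      neg_neg])
    (fun u v => by rw [hT, hT, h.quat.apply₁₃, ← h.quat.apply₃₁, nr, s3, neg_neg, t2'])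
  refine ⟨c, fun u v => ?_⟩
  have := hc u (J₁ v)
  rw [hT, h.quat.apply₁₁, nr] at this
  rw [h.skew₁]
  linarith

theorem quatCoeff_eq_of_four (hdim : Module.finrank ℝ V = 4)
    (hd : ∀ J ∈ ({J₁, J₂, J₃} : Set (V →L[ℝ] V)),
      ∀ u v w, J (R u v w) - R (J u) v w - R u (J v) w - R u v (J w) = 0) : ∃ c : ℝ, ∀ u v,
    quatCoeff R J₁ u v = c * B (J₁ u) v ∧ quatCoeff R J₂ u v = c * B (J₂ u) v ∧
      quatCoeff R J₃ u v = c * B (J₃ u) v := by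
  obtain ⟨c, hc⟩ := h.exists_quatCoeff_eq_of_four he hdim hd
  obtain ⟨-, -, -, s2, -⟩ := h.rotate.quatCoeff_swap (hd J₂ (by simp))
  obtain ⟨-, s3, -, -, -⟩ := h.rotate.rotate.quatCoeff_swap (hd J₃ (by simp))
  refine ⟨c, fun u v => ⟨hc u v, ?_, ?_⟩⟩
  · rw [← neg_eq_iff_eq_neg.2 (s3 u v), hc, h.quat.apply₁₃, map_neg, neg_apply]
    ring
  · rw [← s2, hc, h.quat.apply₁₂]

/-- If the constant were zero, `quatCoeff_ricciForm` would annihilate the Ricci form on each basis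
vector, and with it the scalar curvature. -/
theorem exists_quatCoeff_eq (hs : ∑ i, ∑ j, B (R (e i) (e j) (e j)) (e i) ≠ 0)
    (hd : Module.finrank ℝ V = 4 → ∀ J ∈ ({J₁, J₂, J₃} : Set (V →L[ℝ] V)),
      ∀ u v w, J (R u v w) - R (J u) v w - R u (J v) w - R u v (J w) = 0) : ∃ c : ℝ, c ≠ 0 ∧
    ∀ u v, quatCoeff R J₁ u v = c * B (J₁ u) v ∧ quatCoeff R J₂ u v = c * B (J₂ u) v ∧
      quatCoeff R J₃ u v = c * B (J₃ u) v := by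
  obtain ⟨c, hc⟩ : ∃ c : ℝ, ∀ u v,
      quatCoeff R J₁ u v = c * B (J₁ u) v ∧ quatCoeff R J₂ u v = c * B (J₂ u) v ∧
        quatCoeff R J₃ u v = c * B (J₃ u) v := by
    by_cases h4 : Module.finrank ℝ V = 4
    · exact h.quatCoeff_eq_of_four he h4 (hd h4)
    · exact h.quatCoeff_eq_of_ne_four he h4
  refine ⟨c, ?_, hc⟩
  rintro rfl
  refine hs ?_
  rw [Finset.sum_comm]
  refine Finset.sum_eq_zero fun j _ => ?_
  have := h.quatCoeff_ricciForm he (e j) (e j)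
  simp only [(hc _ _).1, (hc _ _).2.1, (hc _ _).2.2, zero_mul, mul_zero, add_zero] at this
  change ricciForm B e R (e j) (e j) = 0
  linarith

/-- Contracting the curvature with `J₁` gives `dim * c` times `J₁`, so `[J₁, S]` commutes with `J₁`.
It also anticommutes with `J₁`, since `J₁² = -1`; hence it is zero. -/
theorem commute_of_commutator_curvature {c : ℝ} (hc0 : c ≠ 0)
    (hc : ∀ u v, quatCoeff R J₁ u v = c * B (J₁ u) v) {S : V →L[ℝ] V}
    (hS : ∀ u v, (R u v * S - S * R u v) * J₁ = J₁ * (R u v * S - S * R u v)) :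
    S * J₁ = J₁ * S := by
  have hdim : (Module.finrank ℝ V : ℝ) ≠ 0 := by exact_mod_cast Module.finrank_pos.ne'
  have hX : ∑ i, R (e i) (J₁ (e i)) = (Module.finrank ℝ V * c) • J₁ := by
    ext u
    rw [sum_apply, h.sum_apply_complex he]
    simp only [hc, mul_smul, ← Finset.smul_sum, sum_of_orthonormal he, smul_apply]
  have h1 : (∑ i, R (e i) (J₁ (e i))) * S - S * (∑ i, R (e i) (J₁ (e i))) =
      ∑ i, (R (e i) (J₁ (e i)) * S - S * R (e i) (J₁ (e i))) := by
    rw [Finset.sum_mul, Finset.mul_sum, Finset.sum_sub_distrib]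
  have h2 : (∑ i, (R (e i) (J₁ (e i)) * S - S * R (e i) (J₁ (e i)))) * J₁ =
      J₁ * ∑ i, (R (e i) (J₁ (e i)) * S - S * R (e i) (J₁ (e i))) := by
    rw [Finset.sum_mul, Finset.mul_sum]
    exact Finset.sum_congr rfl fun i _ => hS _ _
  rw [← h1, hX, smul_mul_assoc, mul_smul_comm, ← smul_sub, smul_mul_assoc, mul_smul_comm] at h2
  have h3 := smul_right_injective _ (mul_ne_zero hdim hc0) h2
  have h4 : (J₁ * S - S * J₁) * J₁ = -(J₁ * (J₁ * S - S * J₁)) := by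
    rw [sub_mul, mul_sub, mul_assoc S, h.quat.sq₁, ← mul_assoc J₁ J₁, h.quat.sq₁, ← mul_assoc]
    simp [mul_assoc]
  have h5 : (2 : ℝ) • ((J₁ * S - S * J₁) * J₁) = 0 := by
    rw [two_smul]
    nth_rewrite 2 [h4]
    exact add_neg_eq_zero.2 h3
  have h6 : (J₁ * S - S * J₁) * J₁ = 0 := (smul_eq_zero.1 h5).resolve_left two_ne_zero
  have h7 : (J₁ * S - S * J₁) * J₁ * J₁ = 0 := by rw [h6, zero_mul]
  rw [mul_assoc, h.quat.sq₁, mul_neg, mul_one, neg_eq_zero, sub_eq_zero] at h7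
  exact h7.symm

end QuatCurvature

/-! ### Covariant derivatives along maps, the Ricci identity, symmetries of curvature. -/

section CovariantCalculus

variable {E : Type*} [NormedAddCommGroup E] [NormedSpace ℝ E]
  {F : Type*} [NormedAddCommGroup F] [NormedSpace ℝ F]
  {F' : Type*} [NormedAddCommGroup F'] [NormedSpace ℝ F']

/-- The covariant derivative of a vector field, for the connection form `G`. -/
def covVec (G : F → F →L[ℝ] E →L[ℝ] E) (X : F → E) (y v : F) : E :=
  fderiv ℝ X y v + G y v (X y)

/-- The covariant derivative of a field of endomorphisms, for the connection form `G`. -/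
def covEnd (G : F → F →L[ℝ] E →L[ℝ] E) (A : F → E →L[ℝ] E) (y v : F) : E →L[ℝ] E :=
  fderiv ℝ A y v + G y v * A y - A y * G y v

/-- The pullback of a connection form. -/
def pullForm (i : F' → F) (G : F → F →L[ℝ] E →L[ℝ] E) (y : F') : F' →L[ℝ] E →L[ℝ] E :=
  G (i y) ∘L fderiv ℝ i y

variable {G : F → F →L[ℝ] E →L[ℝ] E} {A C : F → E →L[ℝ] E} {X Y : F → E} {y : F}

theorem fderiv_mul_apply (hA : DifferentiableAt ℝ A y) (hC : DifferentiableAt ℝ C y) (v : F) :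
    fderiv ℝ (fun z => A z * C z) y v = fderiv ℝ A y v * C y + A y * fderiv ℝ C y v := by
  have := (hA.hasFDerivAt.mul' hC.hasFDerivAt).fderiv
  rw [show (fun z => A z * C z) = A * C from rfl, this]
  simp [add_comm]

theorem covEnd_mul (hA : DifferentiableAt ℝ A y) (hC : DifferentiableAt ℝ C y) (v : F) :
    covEnd G (fun z => A z * C z) y v = covEnd G A y v * C y + A y * covEnd G C y v := by
  rw [covEnd, covEnd, covEnd, fderiv_mul_apply hA hC]
  noncomm_ring

theorem covEnd_add (hA : DifferentiableAt ℝ A y) (hC : DifferentiableAt ℝ C y) (v : F) :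
    covEnd G (fun z => A z + C z) y v = covEnd G A y v + covEnd G C y v := by
  rw [covEnd, covEnd, covEnd, fderiv_fun_add hA hC, add_apply]
  noncomm_ring

theorem covEnd_sub (hA : DifferentiableAt ℝ A y) (hC : DifferentiableAt ℝ C y) (v : F) :
    covEnd G (fun z => A z - C z) y v = covEnd G A y v - covEnd G C y v := by
  rw [covEnd, covEnd, covEnd, fderiv_fun_sub hA hC, sub_apply]
  noncomm_ring

theorem covEnd_smul {a : F → ℝ} (ha : DifferentiableAt ℝ a y) (hA : DifferentiableAt ℝ A y)
    (v : F) : covEnd G (fun z => a z • A z) y v = fderiv ℝ a y v • A y + a y • covEnd G A y v := by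
  rw [covEnd, covEnd, fderiv_fun_smul ha hA]
  simp only [add_apply, smul_apply, ContinuousLinearMap.smulRight_apply, smul_mul_assoc,
    mul_smul_comm, smul_sub, smul_add]
  abel

theorem covEnd_congr (h : A =ᶠ[𝓝 y] C) (v : F) : covEnd G A y v = covEnd G C y v := by
  rw [covEnd, covEnd, h.fderiv_eq, h.self_of_nhds]

theorem covVec_congr (h : X =ᶠ[𝓝 y] Y) (v : F) : covVec G X y v = covVec G Y y v := by
  rw [covVec, covVec, h.fderiv_eq, h.self_of_nhds]

theorem covVec_apply (hA : DifferentiableAt ℝ A y) (hX : DifferentiableAt ℝ X y) (v : F) :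
    covVec G (fun z => A z (X z)) y v = covEnd G A y v (X y) + A y (covVec G X y v) := by
  rw [covVec, covVec, covEnd, fderiv_clm_apply hA hX]
  simp only [add_apply, sub_apply, ContinuousLinearMap.comp_apply, ContinuousLinearMap.flip_apply,
    mul_apply_eq_comp, map_add]
  abel

/-- A connection is compatible with the metric `B`. -/
def MetricAt (B : F → E →L[ℝ] E →L[ℝ] ℝ) (G : F → F →L[ℝ] E →L[ℝ] E) (y : F) : Prop :=
  ∀ u v w, fderiv ℝ B y u v w = B y (G y u v) w + B y v (G y u w)

theorem fderiv_metric {B : F → E →L[ℝ] E →L[ℝ] ℝ} (hB : DifferentiableAt ℝ B y)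
    (h : MetricAt B G y) (hX : DifferentiableAt ℝ X y) (hY : DifferentiableAt ℝ Y y) (v : F) :
    fderiv ℝ (fun z => B z (X z) (Y z)) y v =
      B y (covVec G X y v) (Y y) + B y (X y) (covVec G Y y v) := by
  rw [fderiv_clm_apply (hB.clm_apply hX) hY, fderiv_clm_apply hB hX]
  simp only [add_apply, ContinuousLinearMap.comp_apply, ContinuousLinearMap.flip_apply, covVec,
    map_add, h v]
  abel

section Pull

variable {i : F' → F} {p : F'}

theorem covEnd_pull (hi : DifferentiableAt ℝ i p) (hA : DifferentiableAt ℝ A (i p)) (v : F') :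
    covEnd (pullForm i G) (fun q => A (i q)) p v = covEnd G A (i p) (fderiv ℝ i p v) := by
  rw [covEnd, covEnd, fderiv_fun_comp p hA hi]
  rfl

theorem covVec_pull (hi : DifferentiableAt ℝ i p) (hX : DifferentiableAt ℝ X (i p)) (v : F') :
    covVec (pullForm i G) (fun q => X (i q)) p v = covVec G X (i p) (fderiv ℝ i p v) := by
  rw [covVec, covVec, fderiv_fun_comp p hX hi]
  rfl

theorem MetricAt.pull {B : F → E →L[ℝ] E →L[ℝ] ℝ} (h : MetricAt B G (i p))
    (hi : DifferentiableAt ℝ i p) (hB : DifferentiableAt ℝ B (i p)) :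
    MetricAt (fun q => B (i q)) (pullForm i G) p := by
  intro u v w
  have e : fderiv ℝ (fun q => B (i q)) p = (fderiv ℝ B (i p)).comp (fderiv ℝ i p) :=
    fderiv_comp (g := B) p hB hi
  rw [e]
  exact h _ _ _

end Pull

section Second

variable {Γ : E → E →L[ℝ] E →L[ℝ] E} {A : E → E →L[ℝ] E} {z : E}

theorem hasFDerivAt_covEnd (hΓ : DifferentiableAt ℝ Γ z) (hA : ContDiffAt ℝ 2 A z) (u v : E) :
    DifferentiableAt ℝ (fun y => covEnd Γ A y v) z ∧
    fderiv ℝ (fun y => covEnd Γ A y v) z u = fderiv ℝ (fderiv ℝ A) z u v +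
      (fderiv ℝ Γ z u v * A z + Γ z v * fderiv ℝ A z u) -
      (fderiv ℝ A z u * Γ z v + A z * fderiv ℝ Γ z u v) := by
  have h1 : DifferentiableAt ℝ A z := hA.differentiableAt (by simp)
  have h2 : DifferentiableAt ℝ (fderiv ℝ A) z :=
    (hA.fderiv_right (m := 1) (by norm_num)).differentiableAt (by simp)
  have d1 : DifferentiableAt ℝ (fun y => fderiv ℝ A y v) z := by fun_prop
  have d2 : DifferentiableAt ℝ (fun y => Γ y v) z := by fun_prop
  have d3 : DifferentiableAt ℝ (fun y => Γ y v * A y) z := d2.mul h1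
  have d4 : DifferentiableAt ℝ (fun y => A y * Γ y v) z := h1.mul d2
  have d5 := d1.fun_add d3
  refine ⟨d5.fun_sub d4, ?_⟩
  have e : (fun y => covEnd Γ A y v) =
      fun y => fderiv ℝ A y v + Γ y v * A y - A y * Γ y v := rfl
  rw [e, fderiv_fun_sub d5 d4, fderiv_fun_add d1 d3, sub_apply, add_apply,
    fderiv_mul_apply d2 h1, fderiv_mul_apply h1 d2, fderiv_clm_apply h2 (by fun_prop),
    fderiv_clm_apply hΓ (by fun_prop)]
  simp

/-- The Ricci identity. -/
theorem covEnd_comm (hΓ : DifferentiableAt ℝ Γ z) (hA : ContDiffAt ℝ 2 A z) (u v : E) :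
    covEnd Γ (fun y => covEnd Γ A y v) z u - covEnd Γ (fun y => covEnd Γ A y u) z v =
      flatCurvature Γ z u v * A z - A z * flatCurvature Γ z u v := by
  have hs : fderiv ℝ (fderiv ℝ A) z u v = fderiv ℝ (fderiv ℝ A) z v u :=
    hA.isSymmSndFDerivAt (by simp) u v
  have e : ∀ C v, covEnd Γ C z v = fderiv ℝ C z v + Γ z v * C z - C z * Γ z v := fun _ _ => rfl
  rw [e, e (fun y => covEnd Γ A y u), (hasFDerivAt_covEnd hΓ hA u v).2,
    (hasFDerivAt_covEnd hΓ hA v u).2, hs, e, e, flatCurvature]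
  simp only [← ContinuousLinearMap.mul_def]
  noncomm_ring

/-- Vanishing torsion near `z` makes `dΓ` symmetric in its last two arguments, and then the cyclic
sum cancels term by term. -/
theorem flatCurvature_bianchi (hΓ : DifferentiableAt ℝ Γ z)
    (hs : ∀ᶠ y in 𝓝 z, ∀ u v, Γ y u v = Γ y v u) (u v w : E) :
    flatCurvature Γ z u v w + flatCurvature Γ z v w u + flatCurvature Γ z w u v = 0 := by
  have h1 : ∀ a b c, fderiv ℝ Γ z a b c = fderiv ℝ Γ z a c b := by
    intro a b c
    have e1 : fderiv ℝ (fun y => Γ y b c) z a = fderiv ℝ Γ z a b c := by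
      rw [fderiv_clm_apply (by fun_prop) (by fun_prop), fderiv_clm_apply hΓ (by fun_prop)]
      simp
    have e2 : fderiv ℝ (fun y => Γ y c b) z a = fderiv ℝ Γ z a c b := by
      rw [fderiv_clm_apply (by fun_prop) (by fun_prop), fderiv_clm_apply hΓ (by fun_prop)]
      simp
    rw [← e1, ← e2]
    refine congrArg (fun L : E →L[ℝ] E => L a) (Filter.EventuallyEq.fderiv_eq ?_)
    filter_upwards [hs] with y hy using hy b c
  have h2 := hs.self_of_nhds
  simp only [flatCurvature, add_apply, sub_apply, ContinuousLinearMap.comp_apply]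
  rw [h1 u w v, h1 v u w, h1 w v u, h2 v w, h2 w u, h2 u v]
  abel

theorem fderiv_fderiv_symm {W : Type*} [NormedAddCommGroup W] [NormedSpace ℝ W] {φ : E → W}
    (h : ContDiffAt ℝ 2 φ z) (a b : E) :
    fderiv ℝ (fun y => fderiv ℝ φ y b) z a = fderiv ℝ (fun y => fderiv ℝ φ y a) z b := by
  have h2 : DifferentiableAt ℝ (fderiv ℝ φ) z :=
    (h.fderiv_right (m := 1) (by norm_num)).differentiableAt (by simp)
  have hs : fderiv ℝ (fderiv ℝ φ) z a b = fderiv ℝ (fderiv ℝ φ) z b a :=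
    h.isSymmSndFDerivAt (by simp) a b
  rw [fderiv_clm_apply h2 (by fun_prop), fderiv_clm_apply h2 (by fun_prop)]
  simpa using hs

/-- The second derivatives of the function `B(w, x)`, for constant `w` and `x`, are symmetric.
Rewriting them by metric compatibility, the terms that remain after antisymmetrization are those of
the curvature. -/
theorem flatCurvature_skew {B : E → E →L[ℝ] E →L[ℝ] ℝ} (hΓ : DifferentiableAt ℝ Γ z)
    (hB : ContDiffAt ℝ 2 B z) (hm : ∀ᶠ y in 𝓝 z, MetricAt B Γ y) (u v w x : E) :
    B z (flatCurvature Γ z u v w) x = -B z w (flatCurvature Γ z u v x) := by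
  have hB1 : DifferentiableAt ℝ B z := hB.differentiableAt (by simp)
  have hφ : ContDiffAt ℝ 2 (fun y => B y w x) z :=
    (hB.clm_apply contDiffAt_const).clm_apply contDiffAt_const
  have hBd : ∀ᶠ y in 𝓝 z, DifferentiableAt ℝ B y := by
    filter_upwards [hB.eventually (by simp)] with y hy using hy.differentiableAt (by simp)
  have m := hm.self_of_nhds
  have key : ∀ a b, fderiv ℝ (fun y => fderiv ℝ (fun y => B y w x) y b) z a =
      B z (Γ z a (Γ z b w)) x + B z (Γ z b w) (Γ z a x) + B z (fderiv ℝ Γ z a b w) x +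
      (B z (Γ z a w) (Γ z b x) + B z w (Γ z a (Γ z b x)) + B z w (fderiv ℝ Γ z a b x)) := by
    intro a b
    have e2 : (fun y => fderiv ℝ (fun y => B y w x) y b) =ᶠ[𝓝 z]
        fun y => B y (Γ y b w) x + B y w (Γ y b x) := by
      filter_upwards [hm, hBd] with y hy hyd
      have hc : ∀ v : E, covVec Γ (fun _ => v) y b = Γ y b v := fun v => by simp [covVec]
      rw [fderiv_metric hyd hy (differentiableAt_const w) (differentiableAt_const x), hc, hc]
    have d0 : DifferentiableAt ℝ (fun y => Γ y b) z := hΓ.clm_apply (differentiableAt_const b)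
    have d : ∀ c, DifferentiableAt ℝ (fun y => Γ y b c) z := fun c =>
      d0.clm_apply (differentiableAt_const c)
    have hd : ∀ c, fderiv ℝ (fun y => Γ y b c) z a = fderiv ℝ Γ z a b c := fun c => by
      rw [fderiv_clm_apply d0 (differentiableAt_const c),
        fderiv_clm_apply hΓ (differentiableAt_const b)]
      simp
    have hc : ∀ c, covVec Γ (fun y => Γ y b c) z a = fderiv ℝ Γ z a b c + Γ z a (Γ z b c) :=
      fun c => by rw [covVec, hd]
    have hc' : ∀ c : E, covVec Γ (fun _ => c) z a = Γ z a c := fun c => by simp [covVec]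
    have dl : DifferentiableAt ℝ (fun y => B y (Γ y b w) x) z :=
      (hB1.clm_apply (d w)).clm_apply (differentiableAt_const x)
    have dr : DifferentiableAt ℝ (fun y => B y w (Γ y b x)) z :=
      (hB1.clm_apply (differentiableAt_const w)).clm_apply (d x)
    rw [e2.fderiv_eq, fderiv_fun_add dl dr, add_apply,
      fderiv_metric hB1 m (d w) (differentiableAt_const x),
      fderiv_metric hB1 m (differentiableAt_const w) (d x), hc, hc, hc', hc']
    simp only [add_apply, map_add]
    ring
  have k1 := key u v
  have k2 := key v u
  rw [fderiv_fderiv_symm hφ u v] at k1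
  simp only [flatCurvature, add_apply, sub_apply, ContinuousLinearMap.comp_apply, map_add,
    map_sub]
  linarith

end Second

end CovariantCalculus

/-! ### Quaternionic Kähler structures on open subsets of a vector space. -/

section FlatQuaternionic

variable {E : Type*} [NormedAddCommGroup E] [NormedSpace ℝ E] [FiniteDimensional ℝ E]
  {Γ : E → E →L[ℝ] E →L[ℝ] E} {z : E}

/-- The trace as a continuous linear map. -/
def endTraceL : (E →L[ℝ] E) →L[ℝ] ℝ := LinearMap.toContinuousLinearMap endTrace

theorem fderiv_endTrace {A : E → E →L[ℝ] E} (hA : DifferentiableAt ℝ A z) (v : E) :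
    fderiv ℝ (fun y => endTrace (A y)) z v = endTrace (covEnd Γ A z v) := by
  have h1 : fderiv ℝ (fun y => endTrace (A y)) z = endTraceL ∘L fderiv ℝ A z :=
    ((endTraceL (E := E)).hasFDerivAt.comp z hA.hasFDerivAt).fderiv
  rw [h1, covEnd, map_sub, map_add, endTrace_mul_comm (Γ z v), add_sub_cancel_right]
  rfl

theorem differentiableAt_endTrace {A : E → E →L[ℝ] E} (hA : DifferentiableAt ℝ A z) :
    DifferentiableAt ℝ (fun y => endTrace (A y)) z :=
  (endTraceL (E := E)).differentiableAt.comp z hA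

theorem contDiffAt_endTrace {A : E → E →L[ℝ] E} {n : WithTop ℕ∞} (hA : ContDiffAt ℝ n A z) :
    ContDiffAt ℝ n (fun y => endTrace (A y)) z :=
  (endTraceL (E := E)).contDiff.contDiffAt.comp z hA

/-- The covariant derivatives of sections of a parallel bundle of quaternionic type. -/
theorem covEnd_mem_span {J₁ J₂ J₃ q : E → E →L[ℝ] E} [Nontrivial E]
    (hJ : ∀ᶠ y in 𝓝 z, QuatTriple (J₁ y) (J₂ y) (J₃ y))
    (d₁ : DifferentiableAt ℝ J₁ z) (d₂ : DifferentiableAt ℝ J₂ z) (d₃ : DifferentiableAt ℝ J₃ z)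
    (hq : DifferentiableAt ℝ q z) (hm : ∀ᶠ y in 𝓝 z, q y ∈ Submodule.span ℝ {J₁ y, J₂ y, J₃ y})
    {v : E} (p₁ : covEnd Γ J₁ z v ∈ Submodule.span ℝ {J₁ z, J₂ z, J₃ z})
    (p₂ : covEnd Γ J₂ z v ∈ Submodule.span ℝ {J₁ z, J₂ z, J₃ z})
    (p₃ : covEnd Γ J₃ z v ∈ Submodule.span ℝ {J₁ z, J₂ z, J₃ z}) :
    covEnd Γ q z v ∈ Submodule.span ℝ {J₁ z, J₂ z, J₃ z} := by
  -- The trace formula writes `q` in the frame with differentiable coefficients, so that the product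
  -- rule applies.
  have e : q =ᶠ[𝓝 z] fun y => -(Module.finrank ℝ E : ℝ)⁻¹ • (endTrace (q y * J₁ y) • J₁ y +
      endTrace (q y * J₂ y) • J₂ y + endTrace (q y * J₃ y) • J₃ y) := by
    filter_upwards [hJ, hm] with y h1 h2 using h1.eq_of_mem_span h2
  have t₁ := differentiableAt_endTrace (hq.fun_mul d₁)
  have t₂ := differentiableAt_endTrace (hq.fun_mul d₂)
  have t₃ := differentiableAt_endTrace (hq.fun_mul d₃)
  have m₁ : J₁ z ∈ Submodule.span ℝ {J₁ z, J₂ z, J₃ z} := Submodule.subset_span (by simp)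
  have m₂ : J₂ z ∈ Submodule.span ℝ {J₁ z, J₂ z, J₃ z} := Submodule.subset_span (by simp)
  have m₃ : J₃ z ∈ Submodule.span ℝ {J₁ z, J₂ z, J₃ z} := Submodule.subset_span (by simp)
  rw [covEnd_congr e, covEnd_smul (differentiableAt_const _)
    (((t₁.fun_smul d₁).fun_add (t₂.fun_smul d₂)).fun_add (t₃.fun_smul d₃)),
    covEnd_add ((t₁.fun_smul d₁).fun_add (t₂.fun_smul d₂)) (t₃.fun_smul d₃),
    covEnd_add (t₁.fun_smul d₁) (t₂.fun_smul d₂), covEnd_smul t₁ d₁, covEnd_smul t₂ d₂,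
    covEnd_smul t₃ d₃, fderiv_fun_const, Pi.zero_apply, zero_apply, zero_smul, zero_add]
  exact Submodule.smul_mem _ _ (Submodule.add_mem _ (Submodule.add_mem _
    (Submodule.add_mem _ (Submodule.smul_mem _ _ m₁) (Submodule.smul_mem _ _ p₁))
    (Submodule.add_mem _ (Submodule.smul_mem _ _ m₂) (Submodule.smul_mem _ _ p₂)))
    (Submodule.add_mem _ (Submodule.smul_mem _ _ m₃) (Submodule.smul_mem _ _ p₃)))

/-- A quaternionic Kähler structure of nonvanishing scalar curvature on an open subset `Ω` of a
vector space: the metric `B`, the Christoffel symbols `Γ` and a local quaternionic frame. -/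
structure FlatQK (Ω : Set E) (B : E → E →L[ℝ] E →L[ℝ] ℝ) (Γ : E → E →L[ℝ] E →L[ℝ] E)
    (J₁ J₂ J₃ : E → E →L[ℝ] E) : Prop where
  isOpen : IsOpen Ω
  smooth_metric : ∀ z ∈ Ω, ContDiffAt ℝ ∞ B z
  smooth_form : ∀ z ∈ Ω, ContDiffAt ℝ ∞ Γ z
  smooth₁ : ∀ z ∈ Ω, ContDiffAt ℝ ∞ J₁ z
  smooth₂ : ∀ z ∈ Ω, ContDiffAt ℝ ∞ J₂ z
  smooth₃ : ∀ z ∈ Ω, ContDiffAt ℝ ∞ J₃ z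
  torsion : ∀ z ∈ Ω, ∀ u v, Γ z u v = Γ z v u
  metric : ∀ z ∈ Ω, MetricAt B Γ z
  quat : ∀ z ∈ Ω, QuatTriple (J₁ z) (J₂ z) (J₃ z)
  skew : ∀ z ∈ Ω, ∀ J ∈ ({J₁ z, J₂ z, J₃ z} : Set (E →L[ℝ] E)), ∀ v w,
    B z (J v) w = -B z v (J w)
  parallel : ∀ z ∈ Ω, ∀ J ∈ ({J₁, J₂, J₃} : Set (E → E →L[ℝ] E)), ∀ v,
    covEnd Γ J z v ∈ Submodule.span ℝ {J₁ z, J₂ z, J₃ z}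
  scalar : ∀ z ∈ Ω, ∃ e : Module.Basis (Fin (Module.finrank ℝ E)) ℝ E,
    (∀ i j, B z (e i) (e j) = if i = j then 1 else 0) ∧
    ∑ i, ∑ j, B z (flatCurvature Γ z (e i) (e j) (e j)) (e i) ≠ 0
  dim_four : Module.finrank ℝ E = 4 → ∀ z ∈ Ω, ∀ J ∈ ({J₁ z, J₂ z, J₃ z} : Set (E →L[ℝ] E)),
    ∀ u v w, J (flatCurvature Γ z u v w) - flatCurvature Γ z (J u) v w
      - flatCurvature Γ z u (J v) w - flatCurvature Γ z u v (J w) = 0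

/-- The covariant derivative of a vector field, as an endomorphism. -/
def covOp (Γ : E → E →L[ℝ] E →L[ℝ] E) (ξ : E → E) (z : E) : E →L[ℝ] E :=
  fderiv ℝ ξ z + (Γ z).flip (ξ z)

theorem covOp_apply (ξ : E → E) (z v : E) : covOp Γ ξ z v = covVec Γ ξ z v := rfl

theorem contDiffAt_covOp {ξ : E → E} (hΓ : ContDiffAt ℝ ∞ Γ z) (hξ : ContDiffAt ℝ ∞ ξ z) :
    ContDiffAt ℝ ∞ (covOp Γ ξ) z := by
  have h1 : ContDiffAt ℝ ∞ (fun y => (Γ y).flip) z :=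
    (ContinuousLinearMap.flipₗᵢ ℝ E E E).contDiff.contDiffAt.comp z hΓ
  exact (hξ.fderiv_right (m := ∞) (by simp)).add (h1.clm_apply hξ)

/-- The Ricci identity for a vector field. -/
theorem covEnd_covOp_comm {ξ : E → E} (hΓ : ContDiffAt ℝ ∞ Γ z) (hξ : ContDiffAt ℝ ∞ ξ z)
    (hs : ∀ u v, Γ z u v = Γ z v u) (u v : E) :
    covEnd Γ (covOp Γ ξ) z u v - covEnd Γ (covOp Γ ξ) z v u = flatCurvature Γ z u v (ξ z) := by
  have hΓ1 : DifferentiableAt ℝ Γ z := hΓ.differentiableAt (by simp)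
  have hξ1 : DifferentiableAt ℝ ξ z := hξ.differentiableAt (by simp)
  have hA : DifferentiableAt ℝ (covOp Γ ξ) z :=
    (contDiffAt_covOp hΓ hξ).differentiableAt (by simp)
  have hd : ∀ a b, fderiv ℝ (covOp Γ ξ) z a b =
      fderiv ℝ (fun y => fderiv ℝ ξ y b) z a + fderiv ℝ Γ z a b (ξ z) + Γ z b (fderiv ℝ ξ z a) := by
    intro a b
    have e1 : fderiv ℝ (fun y => covOp Γ ξ y b) z a = fderiv ℝ (covOp Γ ξ) z a b := by
      rw [fderiv_clm_apply hA (differentiableAt_const b)]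
      simp
    have h2 : DifferentiableAt ℝ (fun y => fderiv ℝ ξ y b) z :=
      ((hξ.fderiv_right (m := 1) two_le_infty).differentiableAt (by simp)).clm_apply
        (differentiableAt_const b)
    have h3 : DifferentiableAt ℝ (fun y => Γ y b) z := hΓ1.clm_apply (differentiableAt_const b)
    have e2 : (fun y => covOp Γ ξ y b) = fun y => fderiv ℝ ξ y b + Γ y b (ξ y) := rfl
    rw [← e1, e2, fderiv_fun_add h2 (h3.clm_apply hξ1), add_apply, fderiv_clm_apply h3 hξ1,
      fderiv_clm_apply hΓ1 (differentiableAt_const b)]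
    simp only [fderiv_fun_const, Pi.zero_apply, ContinuousLinearMap.comp_zero, zero_add, add_apply,
      ContinuousLinearMap.comp_apply, ContinuousLinearMap.flip_apply]
    abel
  have hsym := fderiv_fderiv_symm (hξ.of_le two_le_infty) u v
  have hc : ∀ w, covOp Γ ξ z w = fderiv ℝ ξ z w + Γ z w (ξ z) := fun w => rfl
  simp only [covEnd, add_apply, sub_apply, mul_apply_eq_comp, hd, hsym, hs v u, flatCurvature,
    ContinuousLinearMap.comp_apply]
  rw [hc v, hc u]
  simp only [map_add]
  abel

theorem flatCurvature_antisymm (Γ : E → E →L[ℝ] E →L[ℝ] E) (z u v : E) :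
    flatCurvature Γ z u v = -flatCurvature Γ z v u := by
  rw [flatCurvature, flatCurvature]
  abel

theorem flatCurvature_add_right (Γ : E → E →L[ℝ] E →L[ℝ] E) (z u v w : E) :
    flatCurvature Γ z u (v + w) = flatCurvature Γ z u v + flatCurvature Γ z u w := by
  ext x
  simp only [flatCurvature, map_add, add_apply, sub_apply, ContinuousLinearMap.comp_apply]
  abel

theorem flatCurvature_smul_right (Γ : E → E →L[ℝ] E →L[ℝ] E) (z u : E) (c : ℝ) (v : E) :
    flatCurvature Γ z u (c • v) = c • flatCurvature Γ z u v := by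
  ext x
  simp only [flatCurvature, map_smul, add_apply, sub_apply, ContinuousLinearMap.comp_apply,
    smul_apply, smul_add, smul_sub]

namespace FlatQK

variable {Ω : Set E} {B : E → E →L[ℝ] E →L[ℝ] ℝ} {J₁ J₂ J₃ : E → E →L[ℝ] E}
  (h : FlatQK Ω B Γ J₁ J₂ J₃) (hz : z ∈ Ω)
include h hz

/-- On the zero space the double sum defining the scalar curvature would vanish. -/
theorem nontrivial : Nontrivial E := by
  obtain ⟨e, -, h2⟩ := h.scalar z hz
  by_contra hE
  rw [not_nontrivial_iff_subsingleton] at hE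
  refine h2 (Finset.sum_eq_zero fun i _ => Finset.sum_eq_zero fun j _ => ?_)
  rw [Subsingleton.elim (e i) 0, map_zero]

theorem eventually_mem : ∀ᶠ y in 𝓝 z, y ∈ Ω := h.isOpen.mem_nhds hz

theorem differentiable {J : E → E →L[ℝ] E} (hJ : J ∈ ({J₁, J₂, J₃} : Set (E → E →L[ℝ] E))) :
    ContDiffAt ℝ ∞ J z := by
  obtain rfl | rfl | rfl : J = J₁ ∨ J = J₂ ∨ J = J₃ := by simpa using hJ
  exacts [h.smooth₁ z hz, h.smooth₂ z hz, h.smooth₃ z hz]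

theorem covEnd_mem [Nontrivial E] {q : E → E →L[ℝ] E} (hq : DifferentiableAt ℝ q z)
    (hm : ∀ y ∈ Ω, q y ∈ Submodule.span ℝ {J₁ y, J₂ y, J₃ y}) (v : E) :
    covEnd Γ q z v ∈ Submodule.span ℝ {J₁ z, J₂ z, J₃ z} := by
  have hev := h.eventually_mem hz
  refine covEnd_mem_span (hev.mono fun y hy => h.quat y hy)
    ((h.smooth₁ z hz).differentiableAt (by simp)) ((h.smooth₂ z hz).differentiableAt (by simp))
    ((h.smooth₃ z hz).differentiableAt (by simp)) hq (hev.mono hm) ?_ ?_ ?_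
  all_goals exact h.parallel z hz _ (by simp) v

/-- The clause `normalizes` comes from the Ricci identity: second covariant derivatives of the frame
stay in the span because the span is parallel. -/
theorem quatCurvature [Nontrivial E] :
    QuatCurvature (B z) (flatCurvature Γ z) (J₁ z) (J₂ z) (J₃ z) where
  quat := h.quat z hz
  skew₁ := h.skew z hz _ (by simp)
  skew₂ := h.skew z hz _ (by simp)
  skew₃ := h.skew z hz _ (by simp)
  add_right := flatCurvature_add_right Γ z
  smul_right := flatCurvature_smul_right Γ z
  antisymm := flatCurvature_antisymm Γ z
  skew := flatCurvature_skew ((h.smooth_form z hz).differentiableAt (by simp))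
    ((h.smooth_metric z hz).of_le two_le_infty)
    ((h.eventually_mem hz).mono fun y hy => h.metric y hy)
  bianchi := flatCurvature_bianchi ((h.smooth_form z hz).differentiableAt (by simp))
    ((h.eventually_mem hz).mono fun y hy => h.torsion y hy)
  normalizes u v J hJ := by
    obtain ⟨q, hq, rfl⟩ : ∃ q ∈ ({J₁, J₂, J₃} : Set (E → E →L[ℝ] E)), q z = J := by
      obtain rfl | rfl | rfl : J = J₁ z ∨ J = J₂ z ∨ J = J₃ z := by simpa using hJ
      exacts [⟨J₁, by simp, rfl⟩, ⟨J₂, by simp, rfl⟩, ⟨J₃, by simp, rfl⟩]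
    have hΓ : DifferentiableAt ℝ Γ z := (h.smooth_form z hz).differentiableAt (by simp)
    have hq2 : ContDiffAt ℝ 2 q z := (h.differentiable hz hq).of_le two_le_infty
    rw [← covEnd_comm hΓ hq2]
    exact Submodule.sub_mem _
      (h.covEnd_mem hz (hasFDerivAt_covEnd hΓ hq2 u v).1 (fun y hy => h.parallel y hy q hq v) u)
      (h.covEnd_mem hz (hasFDerivAt_covEnd hΓ hq2 v u).1 (fun y hy => h.parallel y hy q hq u) v)

/-- The components of the curvature along the quaternionic bundle. -/
theorem exists_const [Nontrivial E] : ∃ c : ℝ, c ≠ 0 ∧ ∀ u v,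
    quatCoeff (flatCurvature Γ z) (J₁ z) u v = c * B z (J₁ z u) v ∧
    quatCoeff (flatCurvature Γ z) (J₂ z) u v = c * B z (J₂ z u) v ∧
    quatCoeff (flatCurvature Γ z) (J₃ z) u v = c * B z (J₃ z u) v := by
  obtain ⟨e, he, hs⟩ := h.scalar z hz
  exact (h.quatCurvature hz).exists_quatCoeff_eq he hs fun hd => h.dim_four hd z hz

theorem commute_of_commutator [Nontrivial E] {S : E →L[ℝ] E}
    (hS : ∀ u v, ∀ J ∈ ({J₁ z, J₂ z, J₃ z} : Set (E →L[ℝ] E)),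
      (flatCurvature Γ z u v * S - S * flatCurvature Γ z u v) * J =
        J * (flatCurvature Γ z u v * S - S * flatCurvature Γ z u v)) :
    ∀ J ∈ ({J₁ z, J₂ z, J₃ z} : Set (E →L[ℝ] E)), S * J = J * S := by
  obtain ⟨e, he, hs⟩ := h.scalar z hz
  obtain ⟨c, hc0, hc⟩ := h.exists_const hz
  have q := h.quatCurvature hz
  intro J hJ
  obtain rfl | rfl | rfl : J = J₁ z ∨ J = J₂ z ∨ J = J₃ z := by simpa using hJ
  · exact q.commute_of_commutator_curvature he hc0 (fun u v => (hc u v).1)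
      fun u v => hS u v _ (by simp)
  · exact q.rotate.commute_of_commutator_curvature he hc0 (fun u v => (hc u v).2.1)
      fun u v => hS u v _ (by simp)
  · exact q.rotate.rotate.commute_of_commutator_curvature he hc0 (fun u v => (hc u v).2.2)
      fun u v => hS u v _ (by simp)

omit hz in
/-- The covariant derivatives of endomorphisms commuting with the quaternionic bundle. -/
theorem covEnd_commute (hz : z ∈ Ω) {S : E → E →L[ℝ] E} (hS : DifferentiableAt ℝ S z)
    (hc : ∀ y ∈ Ω, ∀ J ∈ ({J₁ y, J₂ y, J₃ y} : Set (E →L[ℝ] E)), S y * J = J * S y) (v : E) :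
    ∀ J ∈ ({J₁ z, J₂ z, J₃ z} : Set (E →L[ℝ] E)),
      covEnd Γ S z v * J = J * covEnd Γ S z v := by
  intro J hJ
  obtain ⟨q, hq, rfl⟩ : ∃ q ∈ ({J₁, J₂, J₃} : Set (E → E →L[ℝ] E)), q z = J := by
    obtain rfl | rfl | rfl : J = J₁ z ∨ J = J₂ z ∨ J = J₃ z := by simpa using hJ
    exacts [⟨J₁, by simp, rfl⟩, ⟨J₂, by simp, rfl⟩, ⟨J₃, by simp, rfl⟩]
  have hqd : DifferentiableAt ℝ q z := (h.differentiable hz hq).differentiableAt (by simp)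
  have e : (fun y => S y * q y) =ᶠ[𝓝 z] fun y => q y * S y := by
    filter_upwards [h.eventually_mem hz] with y hy
    refine hc y hy _ ?_
    obtain rfl | rfl | rfl : q = J₁ ∨ q = J₂ ∨ q = J₃ := by simpa using hq
    all_goals simp
  have h1 := covEnd_congr (G := Γ) e v
  rw [covEnd_mul hS hqd, covEnd_mul hqd hS] at h1
  -- In the derivative of `S q = q S` the terms containing `∇q` cancel, as `∇q` lies in the span and
  -- so commutes with `S`.
  have h2 : ∀ p ∈ Submodule.span ℝ {J₁ z, J₂ z, J₃ z}, S z * p = p * S z := by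
    intro p hp
    obtain ⟨a, b, c, rfl⟩ := Submodule.mem_span_triple.1 hp
    simp only [mul_add, add_mul, mul_smul_comm, smul_mul_assoc, hc z hz _ (show J₁ z ∈ _ by simp),
      hc z hz _ (show J₂ z ∈ _ by simp), hc z hz _ (show J₃ z ∈ _ by simp)]
  rw [h2 _ (h.parallel z hz q hq v), add_comm] at h1
  exact add_left_cancel h1

end FlatQK

end FlatQuaternionic

/-! ### Killing fields and their moment maps. -/

section FlatMomentMaps

variable {E : Type*} [NormedAddCommGroup E] [NormedSpace ℝ E] [FiniteDimensional ℝ E]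
  {Γ : E → E →L[ℝ] E →L[ℝ] E} {z : E}

/-- A Killing field `ξ` with moment map `P`, on an open subset of a vector space. -/
structure FlatMoment (Ω : Set E) (B : E → E →L[ℝ] E →L[ℝ] ℝ) (Γ : E → E →L[ℝ] E →L[ℝ] E)
    (J₁ J₂ J₃ : E → E →L[ℝ] E) (ξ : E → E) (P : E → E →L[ℝ] E) : Prop where
  smooth : ∀ z ∈ Ω, ContDiffAt ℝ ∞ ξ z
  skew : ∀ z ∈ Ω, ∀ v w, B z (covOp Γ ξ z v) w = -B z v (covOp Γ ξ z w)
  mem : ∀ z ∈ Ω, P z ∈ Submodule.span ℝ {J₁ z, J₂ z, J₃ z}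
  orthogonal : ∀ z ∈ Ω, ∀ J ∈ ({J₁ z, J₂ z, J₃ z} : Set (E →L[ℝ] E)),
    endTrace ((covOp Γ ξ z - P z) * J) = 0

variable {Ω : Set E} {B : E → E →L[ℝ] E →L[ℝ] ℝ} {J₁ J₂ J₃ : E → E →L[ℝ] E}
  {ξ : E → E} {P : E → E →L[ℝ] E}

/-- Differentiate the skewness of `A` on constant vectors, for a metric connection. -/
theorem covEnd_skew {A : E → E →L[ℝ] E} (hA : DifferentiableAt ℝ A z)
    (hB : DifferentiableAt ℝ B z) (hm : MetricAt B Γ z)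
    (hs : ∀ᶠ y in 𝓝 z, ∀ v w, B y (A y v) w = -B y v (A y w)) (u v w : E) :
    B z (covEnd Γ A z u v) w = -B z v (covEnd Γ A z u w) := by
  have dA : ∀ v, DifferentiableAt ℝ (fun y => A y v) z := fun v =>
    hA.clm_apply (differentiableAt_const v)
  have e : (fun y => B y (A y v) w) =ᶠ[𝓝 z] fun y => -B y v (A y w) := by
    filter_upwards [hs] with y hy using hy v w
  have h1 := congrArg (fun L : E →L[ℝ] ℝ => L u) e.fderiv_eq
  simp only [fderiv_fun_neg, neg_apply] at h1
  rw [fderiv_metric hB hm (dA v) (differentiableAt_const w),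
    fderiv_metric hB hm (differentiableAt_const v) (dA w),
    covVec_apply hA (differentiableAt_const v), covVec_apply hA (differentiableAt_const w)] at h1
  have hs' := hs.self_of_nhds
  simp only [map_add, add_apply] at h1
  rw [hs' (covVec Γ _ z u) w, hs' v] at h1
  linarith

namespace FlatMoment

variable (hQ : FlatQK Ω B Γ J₁ J₂ J₃) (h : FlatMoment Ω B Γ J₁ J₂ J₃ ξ P) (hz : z ∈ Ω)
include hQ h hz

theorem contDiffAt_covOp : ContDiffAt ℝ ∞ (covOp Γ ξ) z :=
  _root_.contDiffAt_covOp (hQ.smooth_form z hz) (h.smooth z hz)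

theorem covEnd_covOp_skew (u v w : E) : B z (covEnd Γ (covOp Γ ξ) z u v) w =
    -B z v (covEnd Γ (covOp Γ ξ) z u w) :=
  covEnd_skew ((h.contDiffAt_covOp hQ hz).differentiableAt (by simp))
    ((hQ.smooth_metric z hz).differentiableAt (by simp)) (hQ.metric z hz)
    ((hQ.eventually_mem hz).mono fun y hy => h.skew y hy) u v w

/-- Kostant's formula for the second covariant derivative of a Killing field. -/
theorem covEnd_covOp (u : E) :
    covEnd Γ (covOp Γ ξ) z u = flatCurvature Γ z u (ξ z) := by
  have := hQ.nontrivial hz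
  obtain ⟨e, he, -⟩ := hQ.scalar z hz
  have hB := symm_of_orthonormal he
  have q := hQ.quatCurvature hz
  have hp := q.pair_symm hB
  ext v
  refine ext_of_orthonormal he fun w => ?_
  -- The tensor `∇∇ξ` is skew in its last two arguments, and its antisymmetrization in the first two
  -- is the curvature. As in the Koszul formula, cyclic permutation then determines it; Bianchi and
  -- pair symmetry simplify the outcome.
  have hR : ∀ a b x, B z (covEnd Γ (covOp Γ ξ) z a b) x - B z (covEnd Γ (covOp Γ ξ) z b a) x =
      B z (flatCurvature Γ z a b (ξ z)) x := fun a b x => by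
    rw [← covEnd_covOp_comm (hQ.smooth_form z hz) (h.smooth z hz) (hQ.torsion z hz) a b, map_sub,
      sub_apply]
  have hS : ∀ a b x, B z (covEnd Γ (covOp Γ ξ) z a b) x =
      -B z (covEnd Γ (covOp Γ ξ) z a x) b := fun a b x => by
    rw [h.covEnd_covOp_skew hQ hz, hB]
  have b1 : B z (flatCurvature Γ z (ξ z) v w) u + B z (flatCurvature Γ z v w (ξ z)) u +
      B z (flatCurvature Γ z w (ξ z) v) u = 0 := by
    rw [← add_apply, ← map_add, ← add_apply, ← map_add, q.bianchi]; simp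
  have a : ∀ a b x y, B z (flatCurvature Γ z a b x) y = -B z (flatCurvature Γ z b a x) y := by
    intro a b x y
    rw [q.antisymm a b, neg_apply, map_neg, neg_apply]
  have s : ∀ a b x y, B z (flatCurvature Γ z a b x) y = -B z (flatCurvature Γ z a b y) x := by
    intro a b x y
    rw [q.skew, hB x]
  have r1 := hR u v w
  have r2 := hR v w u
  have r3 := hR w u v
  have s1 := hS u v w
  have s2 := hS v w u
  have s3 := hS w u v
  have p1 := hp w u (ξ z) v
  have p2 := hp v w (ξ z) u
  have p3 := hp u v (ξ z) w
  have p4 := hp u (ξ z) v w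
  have t1 := a u (ξ z) v w
  have t2 := s (ξ z) w u v
  have t3 := s (ξ z) v w u
  have t4 := s (ξ z) v u w
  have t5 := a w (ξ z) v u
  have t6 := s (ξ z) u v w
  have t7 := s (ξ z) w v u
  linarith

/-- An element of the span is determined by its traces against the frame, and these are the same for
`P` and `∇ξ`. -/
theorem eq_trace [Nontrivial E] : P z = -(Module.finrank ℝ E : ℝ)⁻¹ •
    (endTrace (covOp Γ ξ z * J₁ z) • J₁ z + endTrace (covOp Γ ξ z * J₂ z) • J₂ z +
      endTrace (covOp Γ ξ z * J₃ z) • J₃ z) := by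
  have ht : ∀ J ∈ ({J₁ z, J₂ z, J₃ z} : Set (E →L[ℝ] E)),
      endTrace (P z * J) = endTrace (covOp Γ ξ z * J) := by
    intro J hJ
    have := h.orthogonal z hz J hJ
    rw [sub_mul, map_sub, sub_eq_zero] at this
    exact this.symm
  rw [(hQ.quat z hz).eq_of_mem_span (h.mem z hz), ht _ (by simp), ht _ (by simp), ht _ (by simp)]

/-- Smoothness is not part of the definition of a moment map; it is read off from the trace formula.
-/
theorem contDiffAt [Nontrivial E] : ContDiffAt ℝ ∞ P z := by
  have e : P =ᶠ[𝓝 z] fun y => -(Module.finrank ℝ E : ℝ)⁻¹ •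
      (endTrace (covOp Γ ξ y * J₁ y) • J₁ y + endTrace (covOp Γ ξ y * J₂ y) • J₂ y +
        endTrace (covOp Γ ξ y * J₃ y) • J₃ y) := by
    filter_upwards [hQ.eventually_mem hz] with y hy using h.eq_trace hQ hy
  rw [contDiffAt_congr e]
  have hA := h.contDiffAt_covOp hQ hz
  have d₁ := hQ.smooth₁ z hz
  have d₂ := hQ.smooth₂ z hz
  have d₃ := hQ.smooth₃ z hz
  exact (contDiffAt_const (c := -(Module.finrank ℝ E : ℝ)⁻¹)).smul ((((contDiffAt_endTrace (hA.mul d₁)).smul d₁).add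
    ((contDiffAt_endTrace (hA.mul d₂)).smul d₂)).add ((contDiffAt_endTrace (hA.mul d₃)).smul d₃))

/-- Differentiate `tr((∇ξ - P) J) = 0`. The term with `∇J` drops out because `∇J` lies in the span,
and Kostant's formula replaces `∇∇ξ`. -/
theorem endTrace_covEnd [Nontrivial E] (u : E) (J : E → E →L[ℝ] E)
    (hJ : J ∈ ({J₁, J₂, J₃} : Set (E → E →L[ℝ] E))) :
    endTrace (covEnd Γ P z u * J z) = endTrace (flatCurvature Γ z u (ξ z) * J z) := by
  have hA : DifferentiableAt ℝ (covOp Γ ξ) z :=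
    (h.contDiffAt_covOp hQ hz).differentiableAt (by simp)
  have hP : DifferentiableAt ℝ P z := (h.contDiffAt hQ hz).differentiableAt (by simp)
  have hJd : DifferentiableAt ℝ J z := (hQ.differentiable hz hJ).differentiableAt (by simp)
  have hS : DifferentiableAt ℝ (fun y => covOp Γ ξ y - P y) z := hA.sub hP
  have e : (fun y => endTrace ((covOp Γ ξ y - P y) * J y)) =ᶠ[𝓝 z] fun _ => 0 := by
    filter_upwards [hQ.eventually_mem hz] with y hy
    refine h.orthogonal y hy _ ?_
    obtain rfl | rfl | rfl : J = J₁ ∨ J = J₂ ∨ J = J₃ := by simpa using hJ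
    all_goals simp
  have h1 := congrArg (fun L : E →L[ℝ] ℝ => L u) e.fderiv_eq
  simp only [fderiv_fun_const, Pi.zero_apply, zero_apply] at h1
  rw [fderiv_endTrace (Γ := Γ) (hS.fun_mul hJd), covEnd_mul hS hJd, map_add, covEnd_sub hA hP,
    h.covEnd_covOp hQ hz] at h1
  have h2 : ∀ p ∈ Submodule.span ℝ {J₁ z, J₂ z, J₃ z},
      endTrace ((covOp Γ ξ z - P z) * p) = 0 := by
    intro p hp
    obtain ⟨a, b, c, rfl⟩ := Submodule.mem_span_triple.1 hp
    simp [mul_add, h.orthogonal z hz _ (show J₁ z ∈ _ by simp),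
      h.orthogonal z hz _ (show J₂ z ∈ _ by simp), h.orthogonal z hz _ (show J₃ z ∈ _ by simp)]
  rw [h2 _ (hQ.parallel z hz J hJ u), add_zero, sub_mul, map_sub, sub_eq_zero] at h1
  exact h1.symm

/-- The covariant derivative of the moment map. -/
theorem covEnd_eq [Nontrivial E] (u : E) : covEnd Γ P z u =
    quatCoeff (flatCurvature Γ z) (J₁ z) u (ξ z) • J₁ z +
    quatCoeff (flatCurvature Γ z) (J₂ z) u (ξ z) • J₂ z +
    quatCoeff (flatCurvature Γ z) (J₃ z) u (ξ z) • J₃ z := by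
  have hP : DifferentiableAt ℝ P z := (h.contDiffAt hQ hz).differentiableAt (by simp)
  rw [(hQ.quat z hz).eq_of_mem_span (hQ.covEnd_mem hz hP h.mem u),
    h.endTrace_covEnd hQ hz u J₁ (by simp), h.endTrace_covEnd hQ hz u J₂ (by simp),
    h.endTrace_covEnd hQ hz u J₃ (by simp), quatCoeff, quatCoeff, quatCoeff]
  module

/-- The derivative is `R(u, ξ)` minus its component in the span, and that component alone accounts
for the commutators of `R(u, ξ)` with the units. -/
theorem covEnd_sub_commute [Nontrivial E] (u : E) :
    ∀ J ∈ ({J₁ z, J₂ z, J₃ z} : Set (E →L[ℝ] E)),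
    covEnd Γ (fun y => covOp Γ ξ y - P y) z u * J =
      J * covEnd Γ (fun y => covOp Γ ξ y - P y) z u := by
  have hA : DifferentiableAt ℝ (covOp Γ ξ) z :=
    (h.contDiffAt_covOp hQ hz).differentiableAt (by simp)
  have hP : DifferentiableAt ℝ P z := (h.contDiffAt hQ hz).differentiableAt (by simp)
  have qc := hQ.quatCurvature hz
  have q := hQ.quat z hz
  have c1 := qc.commutator₁ u (ξ z)
  have c2 := qc.rotate.commutator₁ u (ξ z)
  have c3 := qc.rotate.rotate.commutator₁ u (ξ z)
  rw [covEnd_sub hA hP, h.covEnd_covOp hQ hz, h.covEnd_eq hQ hz]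
  intro J hJ
  rw [← sub_eq_zero]
  obtain rfl | rfl | rfl : J = J₁ z ∨ J = J₂ z ∨ J = J₃ z := by simpa using hJ
  · rw [sub_eq_iff_eq_add] at c1
    simp only [sub_mul, mul_sub, c1, add_mul, mul_add, smul_mul_assoc, mul_smul_comm, q.sq₁,
      q.mul₂₁, q.mul₃₁, q.mul₁₂, q.mul₁₃]
    module
  · rw [sub_eq_iff_eq_add] at c2
    simp only [sub_mul, mul_sub, c2, add_mul, mul_add, smul_mul_assoc, mul_smul_comm, q.sq₂,
      q.mul₂₁, q.mul₃₂, q.mul₁₂, q.mul₂₃]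
    module
  · rw [sub_eq_iff_eq_add] at c3
    simp only [sub_mul, mul_sub, c3, add_mul, mul_add, smul_mul_assoc, mul_smul_comm, q.sq₃,
      q.mul₂₃, q.mul₃₁, q.mul₃₂, q.mul₁₃]
    module

/-- For `S = ∇ξ - P`, the operators `∇S` commute with the units, hence so do the second derivatives
of `S`, and by the Ricci identity the operators `[R(u, v), S]`. Nonvanishing scalar curvature then
passes this on to `S`. Geometrically, Killing fields preserve `Q`. -/
theorem sub_commute [Nontrivial E] : ∀ J ∈ ({J₁ z, J₂ z, J₃ z} : Set (E →L[ℝ] E)),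
    (covOp Γ ξ z - P z) * J = J * (covOp Γ ξ z - P z) := by
  have hS : ∀ y ∈ Ω, ContDiffAt ℝ 2 (fun y => covOp Γ ξ y - P y) y := fun y hy =>
    ((h.contDiffAt_covOp hQ hy).sub (h.contDiffAt hQ hy)).of_le two_le_infty
  have hΓ : DifferentiableAt ℝ Γ z := (hQ.smooth_form z hz).differentiableAt (by simp)
  refine hQ.commute_of_commutator hz fun u v J hJ => ?_
  rw [← covEnd_comm hΓ (hS z hz) u v, sub_mul, mul_sub,
    hQ.covEnd_commute hz (hasFDerivAt_covEnd hΓ (hS z hz) u v).1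
      (fun y hy => h.covEnd_sub_commute hQ hy v) u J hJ,
    hQ.covEnd_commute hz (hasFDerivAt_covEnd hΓ (hS z hz) v u).1
      (fun y hy => h.covEnd_sub_commute hQ hy u) v J hJ]

theorem sub_commute_span [Nontrivial E] {q : E →L[ℝ] E}
    (hq : q ∈ Submodule.span ℝ {J₁ z, J₂ z, J₃ z}) :
    (covOp Γ ξ z - P z) * q = q * (covOp Γ ξ z - P z) := by
  have hs := h.sub_commute hQ hz
  obtain ⟨a, b, c, rfl⟩ := Submodule.mem_span_triple.1 hq
  simp only [mul_add (covOp Γ ξ z - P z), add_mul _ _ (covOp Γ ξ z - P z), mul_smul_comm,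
    smul_mul_assoc, hs _ (show J₁ z ∈ _ by simp), hs _ (show J₂ z ∈ _ by simp),
    hs _ (show J₃ z ∈ _ by simp)]

omit h in
theorem skew_of_mem_span {q : E →L[ℝ] E} (hq : q ∈ Submodule.span ℝ {J₁ z, J₂ z, J₃ z})
    (v w : E) : B z (q v) w = -B z v (q w) := by
  have hs := hQ.skew z hz
  obtain ⟨a, b, c, rfl⟩ := Submodule.mem_span_triple.1 hq
  simp only [add_apply, smul_apply, map_add, map_smul, smul_eq_mul,
    hs _ (show J₁ z ∈ _ by simp), hs _ (show J₂ z ∈ _ by simp), hs _ (show J₃ z ∈ _ by simp)]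
  ring

omit hQ h hz in
/-- The frame-free form of the formula for the covariant derivative of the moment map. -/
theorem anticommutator [Nontrivial E] (hQ : FlatQK Ω B Γ J₁ J₂ J₃) (hz : z ∈ Ω) :
    ∃ c : ℝ, c ≠ 0 ∧ ∀ ξ P, FlatMoment Ω B Γ J₁ J₂ J₃ ξ P →
      ∀ u, ∀ q ∈ Submodule.span ℝ {J₁ z, J₂ z, J₃ z},
      covEnd Γ P z u * q + q * covEnd Γ P z u = (-(2 * c * B z (q u) (ξ z))) • 1 := by
  obtain ⟨c, hc0, hc⟩ := hQ.exists_const hz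
  have qt := hQ.quat z hz
  -- The constant depends on the point only, so that one value serves both Killing fields.
  refine ⟨c, hc0, fun ξ P h u q hq => ?_⟩
  rw [h.covEnd_eq hQ hz, (hc u (ξ z)).1, (hc u (ξ z)).2.1, (hc u (ξ z)).2.2]
  obtain ⟨a, b, d, rfl⟩ := Submodule.mem_span_triple.1 hq
  simp only [add_mul, mul_add, smul_mul_assoc, mul_smul_comm, qt.sq₁, qt.sq₂, qt.sq₃, qt.mul₁₂,
    qt.mul₂₁, qt.mul₂₃, qt.mul₃₂, qt.mul₃₁, qt.mul₁₃, map_add, map_smul, add_apply, smul_apply,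
    smul_eq_mul]
  module

end FlatMoment

/-- Elements of the span square to scalars, and their anticommutators are scalars. -/
theorem QuatTriple.anticommutator_mem {J₁ J₂ J₃ p q : E →L[ℝ] E} (hJ : QuatTriple J₁ J₂ J₃)
    (hp : p ∈ Submodule.span ℝ {J₁, J₂, J₃}) (hq : q ∈ Submodule.span ℝ {J₁, J₂, J₃}) :
    ∃ a : ℝ, p * q + q * p = a • 1 := by
  obtain ⟨a, b, c, rfl⟩ := Submodule.mem_span_triple.1 hp
  obtain ⟨a', b', c', rfl⟩ := Submodule.mem_span_triple.1 hq
  refine ⟨-(2 * (a * a' + b * b' + c * c')), ?_⟩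
  simp only [add_mul, mul_add, smul_mul_assoc, mul_smul_comm, hJ.sq₁, hJ.sq₂, hJ.sq₃, hJ.mul₁₂,
    hJ.mul₂₁, hJ.mul₂₃, hJ.mul₃₂, hJ.mul₃₁, hJ.mul₁₃]
  module

end FlatMomentMaps

/-! ### The complex structure along the submanifold and its covariant derivative. -/

section FlatSubmanifolds

variable {E : Type*} [NormedAddCommGroup E] [NormedSpace ℝ E]
  {F : Type*} [NormedAddCommGroup F] [NormedSpace ℝ F]

/-- The field `(1 / f) P₁ P₂`. -/
def unitEnd (f : F → ℝ) (P₁ P₂ : F → E →L[ℝ] E) (y : F) : E →L[ℝ] E :=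
  (f y)⁻¹ • (P₁ y * P₂ y)

/-- The geometric data along a submanifold tangent to two commuting Killing fields `ξ₁`, `ξ₂` with
moment maps `P₁`, `P₂`, in charts: `i` is the inclusion, `b` and `G` are the metric and the
connection form along the submanifold, `A₁`, `A₂` are the covariant derivatives of `ξ₁`, `ξ₂`. -/
structure FlatSub (Ω : Set F) (i : F → E) (b : F → E →L[ℝ] E →L[ℝ] ℝ)
    (G : F → F →L[ℝ] E →L[ℝ] E) (ξ₁ ξ₂ : F → E) (A₁ A₂ P₁ P₂ : F → E →L[ℝ] E) (f : F → ℝ)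
    (X₁ X₂ : F → F) (I : F → F →L[ℝ] F) : Prop where
  isOpen : IsOpen Ω
  smooth_map : ∀ y ∈ Ω, ContDiffAt ℝ ∞ i y
  immersion : ∀ y ∈ Ω, Function.Injective (fderiv ℝ i y)
  smooth_metric : ∀ y ∈ Ω, ContDiffAt ℝ ∞ b y
  smooth_field₁ : ∀ y ∈ Ω, ContDiffAt ℝ ∞ ξ₁ y
  smooth_field₂ : ∀ y ∈ Ω, ContDiffAt ℝ ∞ ξ₂ y
  smooth_moment₁ : ∀ y ∈ Ω, ContDiffAt ℝ ∞ P₁ y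
  smooth_moment₂ : ∀ y ∈ Ω, ContDiffAt ℝ ∞ P₂ y
  smooth_fun : ∀ y ∈ Ω, ContDiffAt ℝ ∞ f y
  smooth_tangent₁ : ∀ y ∈ Ω, ContDiffAt ℝ ∞ X₁ y
  smooth_tangent₂ : ∀ y ∈ Ω, ContDiffAt ℝ ∞ X₂ y
  smooth_complex : ∀ y ∈ Ω, ContDiffAt ℝ ∞ I y
  symm : ∀ y ∈ Ω, ∀ u v, b y u v = b y v u
  nonneg : ∀ y ∈ Ω, ∀ u, 0 ≤ b y u u
  definite : ∀ y ∈ Ω, ∀ u, b y u u = 0 → u = 0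
  metric : ∀ y ∈ Ω, MetricAt b G y
  torsion : ∀ y ∈ Ω, ∀ u v, G y u (fderiv ℝ i y v) = G y v (fderiv ℝ i y u)
  cov₁ : ∀ y ∈ Ω, ∀ v, covVec G ξ₁ y v = A₁ y (fderiv ℝ i y v)
  cov₂ : ∀ y ∈ Ω, ∀ v, covVec G ξ₂ y v = A₂ y (fderiv ℝ i y v)
  skew₁ : ∀ y ∈ Ω, ∀ u v, b y (A₁ y u) v = -b y u (A₁ y v)
  skew₂ : ∀ y ∈ Ω, ∀ u v, b y (A₂ y u) v = -b y u (A₂ y v)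
  comm : ∀ y ∈ Ω, A₁ y (ξ₂ y) = A₂ y (ξ₁ y)
  skew_moment₁ : ∀ y ∈ Ω, ∀ u v, b y (P₁ y u) v = -b y u (P₁ y v)
  skew_moment₂ : ∀ y ∈ Ω, ∀ u v, b y (P₂ y u) v = -b y u (P₂ y v)
  sq₁ : ∀ y ∈ Ω, ∃ a : ℝ, P₁ y * P₁ y = a • 1
  sq₂ : ∀ y ∈ Ω, ∃ a : ℝ, P₂ y * P₂ y = a • 1
  anti : ∀ y ∈ Ω, P₂ y * P₁ y = -(P₁ y * P₂ y)
  commute₁₁ : ∀ y ∈ Ω, (A₁ y - P₁ y) * P₁ y = P₁ y * (A₁ y - P₁ y)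
  commute₁₂ : ∀ y ∈ Ω, (A₁ y - P₁ y) * P₂ y = P₂ y * (A₁ y - P₁ y)
  commute₂₁ : ∀ y ∈ Ω, (A₂ y - P₂ y) * P₁ y = P₁ y * (A₂ y - P₂ y)
  commute₂₂ : ∀ y ∈ Ω, (A₂ y - P₂ y) * P₂ y = P₂ y * (A₂ y - P₂ y)
  skew_cov₁ : ∀ y ∈ Ω, ∀ v u w, b y (covEnd G P₁ y v u) w = -b y u (covEnd G P₁ y v w)
  anticommutator : ∀ y ∈ Ω, ∃ c : ℝ, ∀ v,
    covEnd G P₁ y v * (P₁ y * P₂ y) + (P₁ y * P₂ y) * covEnd G P₁ y v =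
      (-(2 * c * b y (P₁ y (P₂ y (fderiv ℝ i y v))) (ξ₁ y))) • 1 ∧
    covEnd G P₂ y v * (P₁ y * P₂ y) + (P₁ y * P₂ y) * covEnd G P₂ y v =
      (-(2 * c * b y (P₁ y (P₂ y (fderiv ℝ i y v))) (ξ₂ y))) • 1
  ne_zero : ∀ y ∈ Ω, f y ≠ 0
  norm_eq : ∀ y ∈ Ω, b y (ξ₁ y) (ξ₁ y) = b y (ξ₂ y) (ξ₂ y)
  norm_ne : ∀ y ∈ Ω, b y (ξ₁ y) (ξ₁ y) ≠ 0
  apply_field : ∀ y ∈ Ω, P₁ y (P₂ y (ξ₁ y)) = f y • ξ₂ y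
  tangent₁ : ∀ y ∈ Ω, fderiv ℝ i y (X₁ y) = ξ₁ y
  tangent₂ : ∀ y ∈ Ω, fderiv ℝ i y (X₂ y) = ξ₂ y
  complex : ∀ y ∈ Ω, ∀ v, fderiv ℝ i y (I y v) = unitEnd f P₁ P₂ y (fderiv ℝ i y v)

/-- An operator which anticommutes with `P₁`, `P₂` and `P₁ P₂ / f` vanishes. -/
theorem eq_zero_of_anticommute {P₁ P₂ K W : E →L[ℝ] E} {f : ℝ} (hf : f ≠ 0)
    (hK : K * K = -1) (hP : P₁ * P₂ = f • K) (h1 : W * P₁ = -(P₁ * W)) (h2 : W * P₂ = -(P₂ * W))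
    (h3 : W * K = -(K * W)) : W = 0 := by
  have h4 : W * (P₁ * P₂) = P₁ * P₂ * W := by
    rw [← mul_assoc, h1, neg_mul, mul_assoc, h2, mul_neg, neg_neg, mul_assoc]
  rw [hP, mul_smul_comm, smul_mul_assoc] at h4
  have h5 := smul_right_injective _ hf h4
  have h6 : (2 : ℝ) • (W * K) = 0 := by
    rw [two_smul]
    nth_rewrite 1 [h3]
    exact neg_add_eq_zero.2 h5.symm
  have h7 : W * K * K = 0 := by
    rw [(smul_eq_zero.1 h6).resolve_left two_ne_zero, zero_mul]
  rwa [mul_assoc, hK, mul_neg, mul_one, neg_eq_zero] at h7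

namespace FlatSub

variable {Ω : Set F} {i : F → E} {b : F → E →L[ℝ] E →L[ℝ] ℝ}
    {G : F → F →L[ℝ] E →L[ℝ] E} {ξ₁ ξ₂ : F → E} {A₁ A₂ P₁ P₂ : F → E →L[ℝ] E} {f : F → ℝ}
    {X₁ X₂ : F → F} {I : F → F →L[ℝ] F} {y : F}
    (h : FlatSub Ω i b G ξ₁ ξ₂ A₁ A₂ P₁ P₂ f X₁ X₂ I) (hy : y ∈ Ω)
include h hy

local notation "K" => unitEnd f P₁ P₂

theorem mul_eq : P₁ y * P₂ y = f y • K y := by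
  rw [unitEnd, smul_smul, mul_inv_cancel₀ (h.ne_zero y hy), one_smul]

theorem unit_mul₁ : K y * P₁ y = -(P₁ y * K y) := by
  rw [unitEnd, smul_mul_assoc, mul_smul_comm, mul_assoc, h.anti y hy, mul_neg, smul_neg]

theorem unit_mul₂ : K y * P₂ y = -(P₂ y * K y) := by
  rw [unitEnd, smul_mul_assoc, mul_smul_comm, ← mul_assoc (P₂ y), h.anti y hy, neg_mul, smul_neg,
    neg_neg]

theorem unit_skew (u v : E) : b y (K y u) v = -b y u (K y v) := by
  have h1 : P₂ y (P₁ y v) = -P₁ y (P₂ y v) := congrArg (fun L : E →L[ℝ] E => L v) (h.anti y hy)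
  simp only [unitEnd, smul_apply, mul_apply_eq_comp, map_smul, smul_eq_mul]
  rw [h.skew_moment₁ y hy, h.skew_moment₂ y hy, h1, map_neg]
  ring

theorem unit_field₁ : K y (ξ₁ y) = ξ₂ y := by
  rw [unitEnd, smul_apply, mul_apply_eq_comp, h.apply_field y hy, smul_smul,
    inv_mul_cancel₀ (h.ne_zero y hy), one_smul]

/-- Since `P₁` and `P₂` anticommute and square to scalars, `K²` is a scalar. As `K` is skew and maps
`ξ₁` to a vector of the same length, that scalar is `-1`. -/
theorem unit_sq : K y * K y = -1 := by
  obtain ⟨a, ha⟩ := h.sq₁ y hy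
  obtain ⟨a', ha'⟩ := h.sq₂ y hy
  have h1 : K y * K y = (-(f y)⁻¹ ^ 2 * (a * a')) • 1 := by
    rw [unitEnd, smul_mul_assoc, mul_smul_comm, mul_assoc, ← mul_assoc (P₂ y), h.anti y hy, neg_mul,
      mul_neg, mul_assoc, ha', mul_smul_comm, mul_one, mul_smul_comm, ha]
    module
  have h2 : b y (K y (ξ₁ y)) (K y (ξ₁ y)) = b y (ξ₁ y) (ξ₁ y) := by
    rw [h.unit_field₁ hy, h.norm_eq y hy]
  have h3 : K y (K y (ξ₁ y)) = (-(f y)⁻¹ ^ 2 * (a * a')) • ξ₁ y :=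
    congrArg (fun L : E →L[ℝ] E => L (ξ₁ y)) h1
  rw [h.unit_skew hy, h3, map_smul, smul_eq_mul] at h2
  have h4 : -(f y)⁻¹ ^ 2 * (a * a') = -1 := by
    refine mul_right_cancel₀ (h.norm_ne y hy) ?_
    linarith
  rw [h1, h4, neg_one_smul]

theorem unit_unit (v : E) : K y (K y v) = -v :=
  congrArg (fun L : E →L[ℝ] E => L v) (h.unit_sq hy)

theorem unit_field₂ : K y (ξ₂ y) = -ξ₁ y := by
  rw [← h.unit_field₁ hy, h.unit_unit hy]

/-- `ξ₂ = K ξ₁` with `K` skew. -/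
theorem orthogonal : b y (ξ₁ y) (ξ₂ y) = 0 := by
  have h1 := h.unit_skew hy (ξ₁ y) (ξ₁ y)
  rw [h.unit_field₁ hy, h.symm y hy] at h1
  linarith

theorem contDiffAt_unit : ContDiffAt ℝ ∞ K y :=
  ((h.smooth_fun y hy).inv (h.ne_zero y hy)).smul
    ((h.smooth_moment₁ y hy).mul (h.smooth_moment₂ y hy))

theorem eventually_mem : ∀ᶠ z in 𝓝 y, z ∈ Ω := h.isOpen.mem_nhds hy

theorem covEnd_unit_sq (v : F) : covEnd G K y v * K y = -(K y * covEnd G K y v) := by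
  have hd : DifferentiableAt ℝ K y := (h.contDiffAt_unit hy).differentiableAt (by simp)
  have e : (fun z => K z * K z) =ᶠ[𝓝 y] fun _ => -1 := by
    filter_upwards [h.eventually_mem hy] with z hz using h.unit_sq hz
  have h1 := covEnd_congr (G := G) e v
  rw [covEnd_mul hd hd] at h1
  have h2 : covEnd G (fun _ => (-1 : E →L[ℝ] E)) y v = 0 := by simp [covEnd]
  rw [h2] at h1
  exact eq_neg_of_add_eq_zero_left h1

/-- Differentiating `K P + P K = 0` separates the unknown `∇K` from `∇P`, which the moment map
equation controls. -/
theorem covEnd_unit_mul {P : F → E →L[ℝ] E} (hP : DifferentiableAt ℝ P y)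
    (hKP : ∀ z ∈ Ω, K z * P z = -(P z * K z)) (v : F) :
    covEnd G K y v * P y + P y * covEnd G K y v =
      -(covEnd G P y v * K y + K y * covEnd G P y v) := by
  have hd : DifferentiableAt ℝ K y := (h.contDiffAt_unit hy).differentiableAt (by simp)
  have e : (fun z => K z * P z + P z * K z) =ᶠ[𝓝 y] fun _ => 0 := by
    filter_upwards [h.eventually_mem hy] with z hz
    rw [hKP z hz, neg_add_cancel]
  have h1 := covEnd_congr (G := G) e v
  rw [covEnd_add (hd.fun_mul hP) (hP.fun_mul hd), covEnd_mul hd hP, covEnd_mul hP hd] at h1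
  have h2 : covEnd G (fun _ => (0 : E →L[ℝ] E)) y v = 0 := by simp [covEnd]
  rw [h2] at h1
  rw [eq_neg_iff_add_eq_zero, ← h1]
  abel

/-- The anticommutators of the derivatives of the moment maps with the complex structure. -/
theorem anticommutator_unit : ∃ c : ℝ, ∀ v,
    covEnd G P₁ y v * K y + K y * covEnd G P₁ y v = (2 * c * b y (fderiv ℝ i y v) (ξ₂ y)) • 1 ∧
    covEnd G P₂ y v * K y + K y * covEnd G P₂ y v =
      (-(2 * c * b y (fderiv ℝ i y v) (ξ₁ y))) • 1 := by
  obtain ⟨c, hc⟩ := h.anticommutator y hy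
  have hf := h.ne_zero y hy
  have e : ∀ x, P₁ y (P₂ y x) = f y • K y x := fun x =>
    congrArg (fun L : E →L[ℝ] E => L x) (h.mul_eq hy)
  refine ⟨c, fun v => ?_⟩
  obtain ⟨h1, h2⟩ := hc v
  rw [h.mul_eq hy, mul_smul_comm, smul_mul_assoc, ← smul_add, e, map_smul, smul_apply] at h1 h2
  have k : ∀ {W : E →L[ℝ] E} {r s : ℝ}, f y • W = r • 1 → r = f y * s → W = s • 1 := by
    intro W r s hW hr
    rw [hr, mul_smul] at hW
    exact smul_right_injective _ hf hW
  refine ⟨k h1 ?_, k h2 ?_⟩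
  · rw [h.unit_skew hy, h.unit_field₁ hy, smul_eq_mul]; ring
  · rw [h.unit_skew hy, h.unit_field₂ hy, smul_eq_mul, map_neg]; ring

/-- Up to a scalar `P₁ K` is `P₂`, so the value is a multiple of `g(ξ₁, P₂ ξ₁)`, which vanishes by
skewness. The derivative of this identity fixes the constant in `covEnd_unit`. -/
theorem eq_zero_on_fields : b y (P₁ y (ξ₁ y)) (ξ₂ y) = 0 := by
  have h1 : P₁ y (ξ₂ y) = -K y (P₁ y (ξ₁ y)) := by
    have := congrArg (fun L : E →L[ℝ] E => L (ξ₁ y)) (h.unit_mul₁ hy)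
    simp only [mul_apply_eq_comp, neg_apply, h.unit_field₁ hy] at this
    rw [this, neg_neg]
  have h2 : ∀ x, b y (K y (P₁ y x)) x = b y x (P₁ y (K y x)) := fun x => by
    rw [h.unit_skew hy, h.skew_moment₁ y hy, neg_neg]
  obtain ⟨a, ha⟩ := h.sq₁ y hy
  have h3 : P₁ y (K y (ξ₁ y)) = ((f y)⁻¹ * a) • P₂ y (ξ₁ y) := by
    have h4 : P₁ y * K y = ((f y)⁻¹ * a) • P₂ y := by
      rw [unitEnd, mul_smul_comm, ← mul_assoc, ha, smul_mul_assoc, one_mul, smul_smul]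
    exact congrArg (fun L : E →L[ℝ] E => L (ξ₁ y)) h4
  have h5 : b y (ξ₁ y) (P₂ y (ξ₁ y)) = 0 := by
    have := h.skew_moment₂ y hy (ξ₁ y) (ξ₁ y)
    rw [h.symm y hy] at this
    linarith
  rw [h.skew_moment₁ y hy, ← h.unit_field₁ hy, h3, map_smul, h5, smul_zero, neg_zero]

/-- The covariant derivative of the complex structure. -/
theorem covEnd_unit (v : F) : covEnd G K y v = (2 / b y (ξ₁ y) (ξ₁ y)) •
    (b y (fderiv ℝ i y v) (ξ₁ y) • (P₁ y * K y) - b y (fderiv ℝ i y v) (ξ₂ y) • (K y * P₂ y)) := by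
  obtain ⟨c, hc⟩ := h.anticommutator_unit hy
  have hf := h.ne_zero y hy
  have hK := h.unit_sq hy
  have k1 := h.unit_mul₁ hy
  have k2 := h.unit_mul₂ hy
  have hP := h.mul_eq hy
  have hP' : P₂ y * P₁ y = -(f y • K y) := by rw [h.anti y hy, hP]
  have d1 : DifferentiableAt ℝ P₁ y := (h.smooth_moment₁ y hy).differentiableAt (by simp)
  have d2 : DifferentiableAt ℝ P₂ y := (h.smooth_moment₂ y hy).differentiableAt (by simp)
  -- The anticommutators of `∇K` with `K`, `P₁` and `P₂` are known, and the difference between `∇K`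
  -- and the claimed value anticommutes with all three. Anticommuting with `P₁` and `P₂` entails
  -- commuting with `P₁ P₂ = f K`, so the difference is zero.
  have step : ∀ v, covEnd G K y v = (c / f y) •
    (b y (fderiv ℝ i y v) (ξ₁ y) • (P₁ y * K y) - b y (fderiv ℝ i y v) (ξ₂ y) • (K y * P₂ y)) := by
    intro v
    have e1 := h.covEnd_unit_mul hy d1 (fun z hz => h.unit_mul₁ hz) v
    have e2 := h.covEnd_unit_mul hy d2 (fun z hz => h.unit_mul₂ hz) v
    have e3 := h.covEnd_unit_sq hy v
    rw [(hc v).1] at e1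
    rw [(hc v).2] at e2
    rw [← sub_eq_zero]
    set D := covEnd G K y v
    set β₁ := b y (fderiv ℝ i y v) (ξ₁ y)
    set β₂ := b y (fderiv ℝ i y v) (ξ₂ y)
    have m1 : P₁ y * K y * P₁ y = -(P₁ y * (P₁ y * K y)) := by rw [mul_assoc, k1, mul_neg]
    have m2 : K y * P₂ y * P₁ y = f y • 1 := by
      rw [mul_assoc, hP', mul_neg, mul_smul_comm, hK, smul_neg, neg_neg]
    have m3 : P₁ y * (K y * P₂ y) = f y • 1 := by
      rw [k2, mul_neg, ← mul_assoc, hP, smul_mul_assoc, hK, smul_neg, neg_neg]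
    have m4 : P₁ y * K y * P₂ y = f y • 1 := by rw [mul_assoc, m3]
    have m5 : P₂ y * (P₁ y * K y) = f y • 1 := by
      rw [← mul_assoc, hP', neg_mul, smul_mul_assoc, hK, smul_neg, neg_neg]
    have m6 : K y * P₂ y * P₂ y = -(P₂ y * (K y * P₂ y)) := by
      rw [k2, neg_mul, mul_assoc, k2]
    have m7 : P₁ y * K y * K y = -(K y * (P₁ y * K y)) := by
      rw [← mul_assoc (K y), k1, neg_mul, neg_neg]
    have m8 : K y * P₂ y * K y = -(K y * (K y * P₂ y)) := by
      rw [mul_assoc, k2, mul_neg, neg_neg]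
    refine eq_zero_of_anticommute hf hK hP ?_ ?_ ?_
    · rw [← add_eq_zero_iff_eq_neg]
      have : D * P₁ y + P₁ y * D - (-((2 * c * β₂) • 1)) = 0 := sub_eq_zero.2 e1
      rw [← this, sub_mul, mul_sub, smul_mul_assoc, mul_smul_comm, sub_mul, mul_sub]
      simp only [smul_mul_assoc, mul_smul_comm, m1, m2, m3]
      match_scalars <;> field_simp <;> ring
    · rw [← add_eq_zero_iff_eq_neg]
      have : D * P₂ y + P₂ y * D - (-((-(2 * c * β₁)) • 1)) = 0 := sub_eq_zero.2 e2
      rw [← this, sub_mul, mul_sub, smul_mul_assoc, mul_smul_comm, sub_mul, mul_sub]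
      simp only [smul_mul_assoc, mul_smul_comm, m4, m5, m6]
      match_scalars <;> field_simp <;> ring
    · rw [← add_eq_zero_iff_eq_neg]
      have : D * K y + K y * D = 0 := add_eq_zero_iff_eq_neg.2 e3
      rw [← this, sub_mul, mul_sub, smul_mul_assoc, mul_smul_comm, sub_mul, mul_sub]
      simp only [smul_mul_assoc, mul_smul_comm, m7, m8]
      match_scalars <;> ring
  -- Differentiating `g(P₁ ξ₁, ξ₂) = 0` along `ξ₂` evaluates the curvature constant. The inputs are
  -- `[ξ₁, ξ₂] = 0` and the fact that `A₁ - P₁` and `A₂ - P₂` commute with `P₁`.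
  have hcm : c * b y (ξ₁ y) (ξ₁ y) = 2 * f y := by
    have dx1 : DifferentiableAt ℝ ξ₁ y := (h.smooth_field₁ y hy).differentiableAt (by simp)
    have dx2 : DifferentiableAt ℝ ξ₂ y := (h.smooth_field₂ y hy).differentiableAt (by simp)
    have db : DifferentiableAt ℝ b y := (h.smooth_metric y hy).differentiableAt (by simp)
    have e : (fun z => b z (P₁ z (ξ₁ z)) (ξ₂ z)) =ᶠ[𝓝 y] fun _ => 0 := by
      filter_upwards [h.eventually_mem hy] with z hz using h.eq_zero_on_fields hz
    have h1 := congrArg (fun L : F →L[ℝ] ℝ => L (X₂ y)) e.fderiv_eq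
    simp only [fderiv_fun_const, Pi.zero_apply, zero_apply] at h1
    rw [fderiv_metric db (h.metric y hy) (d1.clm_apply dx1) dx2, covVec_apply d1 dx1, h.cov₁ y hy,
      h.cov₂ y hy, h.tangent₂ y hy, map_add, add_apply] at h1
    have hs := h.symm y hy
    -- the derivative of the moment map
    have t1 : b y (covEnd G P₁ y (X₂ y) (ξ₁ y)) (ξ₂ y) =
        -(c * b y (ξ₁ y) (ξ₁ y) * b y (ξ₂ y) (ξ₂ y)) := by
      have := congrArg (fun L : E →L[ℝ] E => b y (L (ξ₁ y)) (ξ₁ y)) (hc (X₂ y)).1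
      simp only [add_apply, mul_apply_eq_comp, map_add, smul_apply, one_apply_eq_self, map_smul,
        smul_eq_mul, h.unit_field₁ hy, h.tangent₂ y hy] at this
      rw [h.skew_cov₁ y hy, h.unit_skew hy, h.unit_field₁ hy, hs (ξ₂ y)] at this
      linarith
    have t2 : b y (P₁ y (A₁ y (ξ₂ y))) (ξ₂ y) = b y (ξ₂ y) (A₁ y (P₁ y (ξ₂ y))) := by
      rw [h.skew_moment₁ y hy, h.skew₁ y hy, neg_neg]
    have t3 : b y (P₁ y (ξ₁ y)) (A₂ y (ξ₂ y)) = -b y (ξ₂ y) (A₂ y (P₁ y (ξ₁ y))) := by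
      rw [← neg_eq_iff_eq_neg.2 (h.skew₂ y hy (P₁ y (ξ₁ y)) (ξ₂ y)), hs]
    have s1 : A₁ y (P₁ y (ξ₂ y)) = P₁ y (A₁ y (ξ₂ y)) := by
      have := congrArg (fun L : E →L[ℝ] E => L (ξ₂ y)) (h.commute₁₁ y hy)
      simp only [mul_apply_eq_comp, sub_apply, map_sub] at this
      exact sub_left_injective this
    have s2 : A₂ y (P₁ y (ξ₁ y)) = P₁ y (A₂ y (ξ₁ y)) - (2 * f y) • ξ₂ y := by
      have := congrArg (fun L : E →L[ℝ] E => L (ξ₁ y)) (h.commute₂₁ y hy)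
      have h4 : P₂ y (P₁ y (ξ₁ y)) = -(f y • ξ₂ y) := by
        rw [← h.apply_field y hy]
        exact congrArg (fun L : E →L[ℝ] E => L (ξ₁ y)) (h.anti y hy)
      simp only [mul_apply_eq_comp, sub_apply, map_sub, h4, h.apply_field y hy] at this
      rw [sub_eq_iff_eq_add] at this
      rw [this]
      module
    rw [t1, t2, t3, s1, s2, h.comm y hy, map_sub, map_smul, smul_eq_mul] at h1
    have hm := h.norm_ne y hy
    rw [h.norm_eq y hy] at hm
    refine mul_right_cancel₀ hm ?_
    linarith
  have : c / f y = 2 / b y (ξ₁ y) (ξ₁ y) := by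
    rw [div_eq_div_iff hf (h.norm_ne y hy), hcm]
  rw [step, this]

/-- `A₁ - P₁` commutes with `P₁` and `P₂`, hence with `K`, whereas `P₁` anticommutes with `K`. The
result is the value of `∇K` along `ξ₁`. -/
theorem commutator₁ : A₁ y * K y - K y * A₁ y = (2 : ℝ) • (P₁ y * K y) := by
  have h1 : (A₁ y - P₁ y) * K y = K y * (A₁ y - P₁ y) := by
    rw [unitEnd, mul_smul_comm, smul_mul_assoc, ← mul_assoc, h.commute₁₁ y hy, mul_assoc,
      h.commute₁₂ y hy, mul_assoc]
  have h2 := h.unit_mul₁ hy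
  rw [sub_mul, mul_sub, h2] at h1
  rw [sub_eq_iff_eq_add] at h1
  rw [two_smul, h1]
  abel

theorem commutator₂ : A₂ y * K y - K y * A₂ y = -(2 : ℝ) • (K y * P₂ y) := by
  have h1 : (A₂ y - P₂ y) * K y = K y * (A₂ y - P₂ y) := by
    rw [unitEnd, mul_smul_comm, smul_mul_assoc, ← mul_assoc, h.commute₂₁ y hy, mul_assoc,
      h.commute₂₂ y hy, mul_assoc]
  have h2 : P₂ y * K y = -(K y * P₂ y) := by rw [h.unit_mul₂ hy, neg_neg]
  rw [sub_mul, mul_sub, h2, sub_neg_eq_add] at h1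
  rw [neg_smul, two_smul, sub_eq_iff_eq_add]
  rw [← eq_sub_iff_add_eq] at h1
  rw [h1]
  abel

end FlatSub

end FlatSubmanifolds

/-! ### Invariance and integrability of the complex structure. -/

section TransversalStructures

variable {E : Type*} [NormedAddCommGroup E] [NormedSpace ℝ E]
  {F : Type*} [NormedAddCommGroup F] [NormedSpace ℝ F]

/-- A transversal Kähler structure `(h, I)` for the foliation spanned by the commuting fields
`X₁` and `X₂ = I X₁`, on an open subset `Ω` of a vector space. The forms `θ₁`, `θ₂` are dual to
`X₁`, `X₂`. -/
structure TransFlat (Ω : Set F) (X₁ X₂ : F → F) (θ₁ θ₂ : F → F →L[ℝ] ℝ) (I : F → F →L[ℝ] F)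
    (h : F → F →L[ℝ] F →L[ℝ] ℝ) : Prop where
  isOpen : IsOpen Ω
  smooth₁ : ∀ y ∈ Ω, ContDiffAt ℝ ∞ X₁ y
  smooth₂ : ∀ y ∈ Ω, ContDiffAt ℝ ∞ X₂ y
  smooth_dual₁ : ∀ y ∈ Ω, ContDiffAt ℝ ∞ θ₁ y
  smooth_dual₂ : ∀ y ∈ Ω, ContDiffAt ℝ ∞ θ₂ y
  smooth_complex : ∀ y ∈ Ω, ContDiffAt ℝ ∞ I y
  smooth_metric : ∀ y ∈ Ω, ContDiffAt ℝ ∞ h y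
  dual₁₁ : ∀ y ∈ Ω, θ₁ y (X₁ y) = 1
  dual₁₂ : ∀ y ∈ Ω, θ₁ y (X₂ y) = 0
  dual₂₁ : ∀ y ∈ Ω, θ₂ y (X₁ y) = 0
  dual₂₂ : ∀ y ∈ Ω, θ₂ y (X₂ y) = 1
  symm : ∀ y ∈ Ω, ∀ u v, h y u v = h y v u
  vanish₁ : ∀ y ∈ Ω, ∀ v, h y (X₁ y) v = 0
  vanish₂ : ∀ y ∈ Ω, ∀ v, h y (X₂ y) v = 0
  hermitian : ∀ y ∈ Ω, ∀ u v, h y (I y u) (I y v) = h y u v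
  nonneg : ∀ y ∈ Ω, ∀ u, 0 ≤ h y u u
  definite : ∀ y ∈ Ω, ∀ u, h y u u = 0 → u = θ₁ y u • X₁ y + θ₂ y u • X₂ y
  sq : ∀ y ∈ Ω, ∀ v, I y (I y v) = -v
  apply₁ : ∀ y ∈ Ω, I y (X₁ y) = X₂ y
  bracket : ∀ y ∈ Ω, fderiv ℝ X₂ y (X₁ y) = fderiv ℝ X₁ y (X₂ y)
  lie_complex₁ : ∀ y ∈ Ω, ∀ v,
    fderiv ℝ I y (X₁ y) v = fderiv ℝ X₁ y (I y v) - I y (fderiv ℝ X₁ y v)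
  lie_complex₂ : ∀ y ∈ Ω, ∀ v,
    fderiv ℝ I y (X₂ y) v = fderiv ℝ X₂ y (I y v) - I y (fderiv ℝ X₂ y v)
  lie_metric₁ : ∀ y ∈ Ω, ∀ u v, fderiv ℝ h y (X₁ y) u v =
    -(h y (fderiv ℝ X₁ y u) v + h y u (fderiv ℝ X₁ y v))
  lie_metric₂ : ∀ y ∈ Ω, ∀ u v, fderiv ℝ h y (X₂ y) u v =
    -(h y (fderiv ℝ X₂ y u) v + h y u (fderiv ℝ X₂ y v))
  nijenhuis : ∀ y ∈ Ω, ∀ u v, fderiv ℝ I y (I y u) v - fderiv ℝ I y (I y v) u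
    - I y (fderiv ℝ I y u v) + I y (fderiv ℝ I y v u) = 0
  closed : ∀ y ∈ Ω, ∀ u v w,
    (fderiv ℝ h y u v (I y w) + h y v (fderiv ℝ I y u w)) +
    (fderiv ℝ h y v w (I y u) + h y w (fderiv ℝ I y v u)) +
    (fderiv ℝ h y w u (I y v) + h y u (fderiv ℝ I y w v)) = 0

/-- The Nijenhuis tensor of `I`. -/
def nij (I : F → F →L[ℝ] F) (y u v : F) : F :=
  fderiv ℝ I y (I y u) v - fderiv ℝ I y (I y v) u - I y (fderiv ℝ I y u v) + I y (fderiv ℝ I y v u)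

namespace FlatSub

variable {Ω : Set F} {i : F → E} {b : F → E →L[ℝ] E →L[ℝ] ℝ}
    {G : F → F →L[ℝ] E →L[ℝ] E} {ξ₁ ξ₂ : F → E} {A₁ A₂ P₁ P₂ : F → E →L[ℝ] E} {f : F → ℝ}
    {X₁ X₂ : F → F} {I : F → F →L[ℝ] F} {y : F}

/-- The second fundamental form `(w, u) ↦ ∇_w (di u)`. -/
def sff (i : F → E) (G : F → F →L[ℝ] E →L[ℝ] E) (y w u : F) : E :=
  covVec G (fun z => fderiv ℝ i z u) y w

variable (h : FlatSub Ω i b G ξ₁ ξ₂ A₁ A₂ P₁ P₂ f X₁ X₂ I) (hy : y ∈ Ω)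
include h hy

local notation "K" => unitEnd f P₁ P₂
local notation "dᵢ" => fderiv ℝ i y
local notation "σ" => sff i G y

theorem differentiableAt_fderiv : DifferentiableAt ℝ (fderiv ℝ i) y :=
  ((h.smooth_map y hy).fderiv_right (m := 1) two_le_infty).differentiableAt (by simp)

theorem differentiableAt_fderiv_apply (u : F) : DifferentiableAt ℝ (fun z => fderiv ℝ i z u) y :=
  (h.differentiableAt_fderiv hy).clm_apply (differentiableAt_const u)

/-- Symmetry of the second derivatives of the inclusion, together with vanishing torsion. -/
theorem sff_symm (u v : F) : σ u v = σ v u := by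
  rw [sff, sff, covVec, covVec, fderiv_fderiv_symm ((h.smooth_map y hy).of_le two_le_infty),
    h.torsion y hy]

/-- The derivative of a field `X` tangent to the submanifold. -/
theorem fderiv_tangent {X : F → F} {ξ : F → E} {A : F → E →L[ℝ] E} (hX : DifferentiableAt ℝ X y)
    (ht : ∀ z ∈ Ω, fderiv ℝ i z (X z) = ξ z) (hc : ∀ v, covVec G ξ y v = A y (dᵢ v)) (v : F) :
    dᵢ (fderiv ℝ X y v) = A y (dᵢ v) - σ v (X y) := by
  have e : (fun z => fderiv ℝ i z (X z)) =ᶠ[𝓝 y] ξ := by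
    filter_upwards [h.eventually_mem hy] with z hz using ht z hz
  have hd := h.differentiableAt_fderiv hy
  rw [← hc, ← covVec_congr e, sff, covVec, covVec, fderiv_clm_apply hd hX,
    fderiv_clm_apply hd (differentiableAt_const _)]
  simp

/-- Differentiate `di ∘ I = K ∘ di`; the `σ`-terms arise from differentiating `di`. -/
theorem fderiv_complex (u v : F) :
    dᵢ (fderiv ℝ I y u v) = covEnd G K y u (dᵢ v) + K y (σ u v) - σ u (I y v) := by
  have e : (fun z => fderiv ℝ i z (I z v)) =ᶠ[𝓝 y] fun z => K z (fderiv ℝ i z v) := by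
    filter_upwards [h.eventually_mem hy] with z hz using h.complex z hz v
  have hd := h.differentiableAt_fderiv hy
  have hI : DifferentiableAt ℝ I y := (h.smooth_complex y hy).differentiableAt (by simp)
  have hK : DifferentiableAt ℝ K y := (h.contDiffAt_unit hy).differentiableAt (by simp)
  have h1 := covVec_congr (G := G) e u
  rw [covVec_apply hK (h.differentiableAt_fderiv_apply hy v)] at h1
  rw [sff, ← h1, sff, covVec, covVec, fderiv_clm_apply hd (hI.clm_apply (differentiableAt_const v)),
    fderiv_clm_apply hI (differentiableAt_const v), fderiv_clm_apply hd (differentiableAt_const _)]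
  simp

theorem unit_left₁ (x : E) : b y (K y x) (ξ₁ y) = -b y x (ξ₂ y) := by
  rw [h.unit_skew hy, h.unit_field₁ hy]

theorem unit_left₂ (x : E) : b y (K y x) (ξ₂ y) = b y x (ξ₁ y) := by
  rw [h.unit_skew hy, h.unit_field₂ hy, map_neg, neg_neg]

/-- `∇K` along `ξ₁` equals `[∇ξ₁, K]`, which means that `X₁` preserves `I`. The `σ`-terms cancel by
symmetry. -/
theorem lie_complex_aux₁ (v : F) :
    fderiv ℝ I y (X₁ y) v = fderiv ℝ X₁ y (I y v) - I y (fderiv ℝ X₁ y v) := by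
  apply h.immersion y hy
  have hX : DifferentiableAt ℝ X₁ y := (h.smooth_tangent₁ y hy).differentiableAt (by simp)
  have hF := h.fderiv_tangent hy hX h.tangent₁ (h.cov₁ y hy)
  have hc := congrArg (fun L : E →L[ℝ] E => L (dᵢ v)) (h.commutator₁ hy)
  have hm := h.norm_ne y hy
  simp only [sub_apply, mul_apply_eq_comp, smul_apply] at hc
  rw [map_sub, h.complex y hy, hF, hF, h.complex y hy, h.fderiv_complex hy, h.covEnd_unit hy,
    h.tangent₁ y hy, h.orthogonal hy, map_sub, h.sff_symm hy (X₁ y) v,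
    h.sff_symm hy (X₁ y) (I y v), zero_smul, sub_zero, smul_smul, div_mul_cancel₀ _ hm, smul_apply,
    mul_apply_eq_comp, ← hc]
  abel

theorem lie_complex_aux₂ (v : F) :
    fderiv ℝ I y (X₂ y) v = fderiv ℝ X₂ y (I y v) - I y (fderiv ℝ X₂ y v) := by
  apply h.immersion y hy
  have hX : DifferentiableAt ℝ X₂ y := (h.smooth_tangent₂ y hy).differentiableAt (by simp)
  have hF := h.fderiv_tangent hy hX h.tangent₂ (h.cov₂ y hy)
  have hc := congrArg (fun L : E →L[ℝ] E => L (dᵢ v)) (h.commutator₂ hy)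
  have hm := h.norm_ne y hy
  simp only [sub_apply, mul_apply_eq_comp, smul_apply] at hc
  rw [map_sub, h.complex y hy, hF, hF, h.complex y hy, h.fderiv_complex hy, h.covEnd_unit hy,
    h.tangent₂ y hy, h.symm y hy (ξ₂ y) (ξ₁ y), h.orthogonal hy, ← h.norm_eq y hy, map_sub,
    h.sff_symm hy (X₂ y) v, h.sff_symm hy (X₂ y) (I y v), zero_smul, zero_sub, smul_neg, smul_smul,
    div_mul_cancel₀ _ hm, ← neg_smul, smul_apply, mul_apply_eq_comp, ← hc]
  abel

/-- The brackets are compared after applying the injective `di`, where `∇_{ξ₁} ξ₂ = ∇_{ξ₂} ξ₁`. -/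
theorem bracket_eq : fderiv ℝ X₂ y (X₁ y) = fderiv ℝ X₁ y (X₂ y) := by
  apply h.immersion y hy
  rw [h.fderiv_tangent hy ((h.smooth_tangent₁ y hy).differentiableAt (by simp)) h.tangent₁
    (h.cov₁ y hy), h.fderiv_tangent hy ((h.smooth_tangent₂ y hy).differentiableAt (by simp))
    h.tangent₂ (h.cov₂ y hy), h.tangent₁ y hy, h.tangent₂ y hy, h.comm y hy, h.sff_symm hy]

theorem complex_field₁ : I y (X₁ y) = X₂ y := by
  apply h.immersion y hy
  rw [h.complex y hy, h.tangent₁ y hy, h.tangent₂ y hy, h.unit_field₁ hy]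

theorem complex_field₂ : I y (X₂ y) = -X₁ y := by
  apply h.immersion y hy
  rw [h.complex y hy, map_neg, h.tangent₁ y hy, h.tangent₂ y hy, h.unit_field₂ hy]

theorem complex_sq (v : F) : I y (I y v) = -v := by
  apply h.immersion y hy
  rw [h.complex y hy, h.complex y hy, h.unit_unit hy, map_neg]

theorem fderiv_complex_field₁ (w : F) :
    fderiv ℝ I y w (X₁ y) = fderiv ℝ X₂ y w - I y (fderiv ℝ X₁ y w) := by
  have e : (fun z => I z (X₁ z)) =ᶠ[𝓝 y] X₂ := by
    filter_upwards [h.eventually_mem hy] with z hz using h.complex_field₁ hz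
  rw [← e.fderiv_eq, fderiv_clm_apply ((h.smooth_complex y hy).differentiableAt (by simp))
    ((h.smooth_tangent₁ y hy).differentiableAt (by simp))]
  simp

theorem fderiv_complex_field₂ (w : F) :
    fderiv ℝ I y w (X₂ y) = -fderiv ℝ X₁ y w - I y (fderiv ℝ X₂ y w) := by
  have e : (fun z => I z (X₂ z)) =ᶠ[𝓝 y] fun z => -X₁ z := by
    filter_upwards [h.eventually_mem hy] with z hz using h.complex_field₂ hz
  have h1 := congrArg (fun L : F →L[ℝ] F => L w) e.fderiv_eq
  simp only [fderiv_fun_neg, neg_apply] at h1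
  rw [← h1, fderiv_clm_apply ((h.smooth_complex y hy).differentiableAt (by simp))
    ((h.smooth_tangent₂ y hy).differentiableAt (by simp))]
  simp

/-- As `I X₁ = X₂` and both fields preserve `I`, each derivative of `I` that occurs can be written
with derivatives of the two fields, and these cancel. -/
theorem nij_field₁ (v : F) : nij I y (X₁ y) v = 0 := by
  have l1 := h.lie_complex_aux₁ hy
  have l2 := h.lie_complex_aux₂ hy
  have s := h.complex_sq hy
  rw [nij, h.complex_field₁ hy, h.fderiv_complex_field₁ hy, h.fderiv_complex_field₁ hy, l1, l2]
  simp only [map_sub, s]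
  abel

theorem nij_field₂ (v : F) : nij I y (X₂ y) v = 0 := by
  have l1 := h.lie_complex_aux₁ hy
  have l2 := h.lie_complex_aux₂ hy
  have s := h.complex_sq hy
  rw [nij, h.complex_field₂ hy, h.fderiv_complex_field₂ hy, h.fderiv_complex_field₂ hy, map_neg,
    neg_apply, l1, l2]
  simp only [map_sub, map_neg, s]
  abel

/-- The symmetric `σ` drops out of the Nijenhuis tensor, leaving `∇K`, which depends on its
direction only through the products with `ξ₁` and `ξ₂`. -/
theorem nij_formula (u v : F) : dᵢ (nij I y u v) = (2 / b y (ξ₁ y) (ξ₁ y)) •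
    (-(b y (dᵢ u) (ξ₂ y) • (P₁ y (K y (dᵢ v)) + P₂ y (dᵢ v))) -
      b y (dᵢ u) (ξ₁ y) • (K y (P₂ y (dᵢ v)) + P₁ y (dᵢ v)) +
      b y (dᵢ v) (ξ₂ y) • (P₁ y (K y (dᵢ u)) + P₂ y (dᵢ u)) +
      b y (dᵢ v) (ξ₁ y) • (K y (P₂ y (dᵢ u)) + P₁ y (dᵢ u))) := by
  have s := h.unit_unit hy
  have k1 : ∀ x, K y (P₁ y x) = -P₁ y (K y x) := fun x =>
    congrArg (fun L : E →L[ℝ] E => L x) (h.unit_mul₁ hy)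
  rw [nij, map_add, map_sub, map_sub, h.complex y hy, h.complex y hy, h.fderiv_complex hy,
    h.fderiv_complex hy, h.fderiv_complex hy, h.fderiv_complex hy, h.sff_symm hy (I y u) (I y v),
    h.sff_symm hy (I y u) v, h.sff_symm hy (I y v) u, h.sff_symm hy u v]
  simp only [h.covEnd_unit hy, h.complex y hy, h.unit_left₁ hy, h.unit_left₂ hy, smul_apply,
    sub_apply, mul_apply_eq_comp, map_add, map_sub, map_smul, s, k1, map_neg]
  module

/-- In `nij_formula` the tensor is assembled from the products with `ξ₁`, `ξ₂` and the operators `K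
P₂ + P₁` and `P₁ K + P₂`. Its vanishing on `X₁` and `X₂` expresses these operators by the same
products; substituted back, they make the formula both symmetric and antisymmetric in `u`, `v`. -/
theorem nij_eq_zero (u v : F) : nij I y u v = 0 := by
  apply h.immersion y hy
  have hm := h.norm_ne y hy
  have hm2 : (2 / b y (ξ₁ y) (ξ₁ y)) ≠ 0 := div_ne_zero two_ne_zero hm
  have ho := h.orthogonal hy
  have ho' : b y (ξ₂ y) (ξ₁ y) = 0 := by rw [h.symm y hy, ho]
  have n1 : ∀ w, b y (ξ₁ y) (ξ₁ y) • (K y (P₂ y (dᵢ w)) + P₁ y (dᵢ w)) =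
      b y (dᵢ w) (ξ₂ y) • (P₁ y (K y (ξ₁ y)) + P₂ y (ξ₁ y)) +
      b y (dᵢ w) (ξ₁ y) • (K y (P₂ y (ξ₁ y)) + P₁ y (ξ₁ y)) := fun w => by
    have := h.nij_formula hy (X₁ y) w
    rw [h.nij_field₁ hy, map_zero] at this
    have := (smul_eq_zero.1 this.symm).resolve_left hm2
    rw [h.tangent₁ y hy, ho, zero_smul, neg_zero, zero_sub, add_assoc] at this
    exact (neg_add_eq_zero.1 this)
  have n2 : ∀ w, b y (ξ₁ y) (ξ₁ y) • (P₁ y (K y (dᵢ w)) + P₂ y (dᵢ w)) =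
      b y (dᵢ w) (ξ₂ y) • (P₁ y (K y (ξ₂ y)) + P₂ y (ξ₂ y)) +
      b y (dᵢ w) (ξ₁ y) • (K y (P₂ y (ξ₂ y)) + P₁ y (ξ₂ y)) := fun w => by
    have := h.nij_formula hy (X₂ y) w
    rw [h.nij_field₂ hy, map_zero] at this
    have := (smul_eq_zero.1 this.symm).resolve_left hm2
    rw [h.tangent₂ y hy, ho', zero_smul, sub_zero, add_assoc, ← h.norm_eq y hy] at this
    exact (neg_add_eq_zero.1 this)
  -- This coincidence makes the mixed terms, those with one product with `ξ₁` and one with `ξ₂`,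
  -- symmetric.
  have k2 : K y (P₂ y (ξ₂ y)) + P₁ y (ξ₂ y) = P₁ y (K y (ξ₁ y)) + P₂ y (ξ₁ y) := by
    have : K y (P₂ y (K y (ξ₁ y))) = P₂ y (ξ₁ y) := by
      have := congrArg (fun L : E →L[ℝ] E => L (K y (ξ₁ y))) (h.unit_mul₂ hy)
      simp only [mul_apply_eq_comp, neg_apply] at this
      rw [this, h.unit_unit hy, map_neg, neg_neg]
    rw [← h.unit_field₁ hy, this, add_comm]
  rw [h.nij_formula hy, map_zero]
  refine (smul_eq_zero.2 (Or.inr ?_))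
  apply smul_right_injective E hm
  simp only [smul_zero, smul_add, smul_sub, smul_neg, smul_comm (b y (ξ₁ y) (ξ₁ y))]
  simp only [← smul_add, n1, n2, k2]
  module

end FlatSub

end TransversalStructures

/-- On a finite-dimensional domain a linear map amounts to its finitely many values on a basis. -/
theorem contDiffAt_clm_of_apply {𝕜 D V W : Type*} [NontriviallyNormedField 𝕜] [CompleteSpace 𝕜]
    [NormedAddCommGroup D] [NormedSpace 𝕜 D] [NormedAddCommGroup V] [NormedSpace 𝕜 V]
    [FiniteDimensional 𝕜 V] [NormedAddCommGroup W] [NormedSpace 𝕜 W] {n : WithTop ℕ∞}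
    {f : D → V →L[𝕜] W} {x : D} (h : ∀ v, ContDiffAt 𝕜 n (fun z => f z v) x) :
    ContDiffAt 𝕜 n f x := by
  have hd : Module.finrank 𝕜 V = Module.finrank 𝕜 (Fin (Module.finrank 𝕜 V) → 𝕜) :=
    (Module.finrank_fin_fun 𝕜).symm
  let e₁ := ContinuousLinearEquiv.ofFinrankEq hd
  let e₂ := (e₁.arrowCongr (1 : W ≃L[𝕜] W)).trans
    (ContinuousLinearEquiv.piRing (Fin (Module.finrank 𝕜 V)))
  rw [← Function.id_comp f, ← e₂.symm_comp_self]
  exact e₂.symm.contDiff.contDiffAt.comp x (contDiffAt_pi.2 fun i => h _)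

/-! ### The transversal metric and its invariance. -/

namespace FlatSub

variable {E : Type*} [NormedAddCommGroup E] [NormedSpace ℝ E]
  {F : Type*} [NormedAddCommGroup F] [NormedSpace ℝ F]
variable {Ω : Set F} {i : F → E} {b : F → E →L[ℝ] E →L[ℝ] ℝ}
    {G : F → F →L[ℝ] E →L[ℝ] E} {ξ₁ ξ₂ : F → E} {A₁ A₂ P₁ P₂ : F → E →L[ℝ] E} {f : F → ℝ}
    {X₁ X₂ : F → F} {I : F → F →L[ℝ] F} {y : F} {hm : F → F →L[ℝ] F →L[ℝ] ℝ}

/-- `hm` is the transversal metric of the submanifold. -/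
def IsTransMetric (Ω : Set F) (i : F → E) (b : F → E →L[ℝ] E →L[ℝ] ℝ) (ξ₁ ξ₂ : F → E)
    (hm : F → F →L[ℝ] F →L[ℝ] ℝ) : Prop :=
  ∀ y ∈ Ω, ∀ u v, hm y u v = b y (fderiv ℝ i y u) (fderiv ℝ i y v) -
    (b y (ξ₁ y) (fderiv ℝ i y u) * b y (ξ₁ y) (fderiv ℝ i y v) +
      b y (ξ₂ y) (fderiv ℝ i y u) * b y (ξ₂ y) (fderiv ℝ i y v)) / b y (ξ₁ y) (ξ₁ y)

variable (h : FlatSub Ω i b G ξ₁ ξ₂ A₁ A₂ P₁ P₂ f X₁ X₂ I) 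
  (hh : IsTransMetric Ω i b ξ₁ ξ₂ hm) (hy : y ∈ Ω)

local notation "K" => unitEnd f P₁ P₂
local notation "dᵢ" => fderiv ℝ i y
local notation "σ" => sff i G y

section
include h hy

theorem differentiableAt_metric : DifferentiableAt ℝ b y :=
  (h.smooth_metric y hy).differentiableAt (by simp)

theorem fderiv_induced (w u v : F) :
    fderiv ℝ (fun z => b z (fderiv ℝ i z u) (fderiv ℝ i z v)) y w =
      b y (σ w u) (dᵢ v) + b y (dᵢ u) (σ w v) :=
  fderiv_metric (h.differentiableAt_metric hy) (h.metric y hy)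
    (h.differentiableAt_fderiv_apply hy u) (h.differentiableAt_fderiv_apply hy v) w

theorem fderiv_dual {ξ : F → E} {A : F → E →L[ℝ] E} (hξ : DifferentiableAt ℝ ξ y)
    (hc : ∀ v, covVec G ξ y v = A y (dᵢ v)) (w u : F) :
    fderiv ℝ (fun z => b z (ξ z) (fderiv ℝ i z u)) y w =
      b y (A y (dᵢ w)) (dᵢ u) + b y (ξ y) (σ w u) := by
  rw [fderiv_metric (h.differentiableAt_metric hy) (h.metric y hy) hξ
    (h.differentiableAt_fderiv_apply hy u) w, hc]
  rfl

theorem differentiableAt_field₁ : DifferentiableAt ℝ ξ₁ y :=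
  (h.smooth_field₁ y hy).differentiableAt (by simp)

theorem differentiableAt_field₂ : DifferentiableAt ℝ ξ₂ y :=
  (h.smooth_field₂ y hy).differentiableAt (by simp)

theorem contDiffAt_dual {ξ : F → E} (hξ : ContDiffAt ℝ ∞ ξ y) (u : F) :
    ContDiffAt ℝ ∞ (fun z => b z (ξ z) (fderiv ℝ i z u)) y :=
  ((h.smooth_metric y hy).clm_apply hξ).clm_apply
    (((h.smooth_map y hy).fderiv_right (m := ∞) (by simp)).clm_apply contDiffAt_const)

theorem contDiffAt_norm : ContDiffAt ℝ ∞ (fun z => b z (ξ₁ z) (ξ₁ z)) y :=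
  ((h.smooth_metric y hy).clm_apply (h.smooth_field₁ y hy)).clm_apply (h.smooth_field₁ y hy)

theorem fderiv_norm (w : F) :
    fderiv ℝ (fun z => b z (ξ₁ z) (ξ₁ z)) y w = 2 * b y (A₁ y (dᵢ w)) (ξ₁ y) := by
  have hd := h.differentiableAt_field₁ hy
  rw [fderiv_metric (h.differentiableAt_metric hy) (h.metric y hy) hd hd, h.cov₁ y hy,
    h.symm y hy (ξ₁ y)]
  ring

theorem fderiv_norm_field₁ : fderiv ℝ (fun z => b z (ξ₁ z) (ξ₁ z)) y (X₁ y) = 0 := by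
  have h1 := h.skew₁ y hy (ξ₁ y) (ξ₁ y)
  rw [h.symm y hy (ξ₁ y)] at h1
  rw [h.fderiv_norm hy, h.tangent₁ y hy]
  linarith

/-- As the fields commute, `ξ₂ |ξ₁|² = 2 g(∇_{ξ₂} ξ₁, ξ₁) = 2 g(∇_{ξ₁} ξ₂, ξ₁)`, which is zero
because `∇ξ₂` is skew. -/
theorem fderiv_norm_field₂ : fderiv ℝ (fun z => b z (ξ₁ z) (ξ₁ z)) y (X₂ y) = 0 := by
  have h1 := h.skew₂ y hy (ξ₁ y) (ξ₁ y)
  rw [h.symm y hy (ξ₁ y)] at h1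
  rw [h.fderiv_norm hy, h.tangent₂ y hy, h.comm y hy]
  linarith

end

include h hh hy

/-- With the denominator cleared, the transversal metric can be differentiated by the product rule
alone. -/
theorem mul_transMetric (u v : F) : b y (ξ₁ y) (ξ₁ y) * hm y u v =
    b y (ξ₁ y) (ξ₁ y) * b y (dᵢ u) (dᵢ v) -
    (b y (ξ₁ y) (dᵢ u) * b y (ξ₁ y) (dᵢ v) + b y (ξ₂ y) (dᵢ u) * b y (ξ₂ y) (dᵢ v)) := by
  have := h.norm_ne y hy
  rw [hh y hy]
  field_simp

theorem contDiffAt_transMetric [FiniteDimensional ℝ F] : ContDiffAt ℝ ∞ hm y := by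
  refine contDiffAt_clm_of_apply fun u => contDiffAt_clm_of_apply fun v => ?_
  have e : (fun z => hm z u v) =ᶠ[𝓝 y] fun z => b z (fderiv ℝ i z u) (fderiv ℝ i z v) -
      (b z (ξ₁ z) (fderiv ℝ i z u) * b z (ξ₁ z) (fderiv ℝ i z v) +
      b z (ξ₂ z) (fderiv ℝ i z u) * b z (ξ₂ z) (fderiv ℝ i z v)) / b z (ξ₁ z) (ξ₁ z) := by
    filter_upwards [h.eventually_mem hy] with z hz using hh z hz u v
  rw [contDiffAt_congr e]
  have hd := h.smooth_field₁ y hy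
  have hd' := h.smooth_field₂ y hy
  have hi : ∀ u, ContDiffAt ℝ ∞ (fun z => fderiv ℝ i z u) y := fun u =>
    ((h.smooth_map y hy).fderiv_right (m := ∞) (by simp)).clm_apply contDiffAt_const
  exact (h.contDiffAt_dual hy (hi u) v).sub (ContDiffAt.div
    (((h.contDiffAt_dual hy hd u).mul (h.contDiffAt_dual hy hd v)).add
    ((h.contDiffAt_dual hy hd' u).mul (h.contDiffAt_dual hy hd' v))) (h.contDiffAt_norm hy)
    (h.norm_ne y hy))

/-- The derivative of the transversal metric. -/
theorem fderiv_transMetric [FiniteDimensional ℝ F] (w u v : F) :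
    fderiv ℝ (fun z => b z (ξ₁ z) (ξ₁ z)) y w * hm y u v +
      b y (ξ₁ y) (ξ₁ y) * fderiv ℝ hm y w u v =
    fderiv ℝ (fun z => b z (ξ₁ z) (ξ₁ z)) y w * b y (dᵢ u) (dᵢ v) +
      b y (ξ₁ y) (ξ₁ y) * (b y (σ w u) (dᵢ v) + b y (dᵢ u) (σ w v)) -
    ((b y (A₁ y (dᵢ w)) (dᵢ u) + b y (ξ₁ y) (σ w u)) * b y (ξ₁ y) (dᵢ v) +
      b y (ξ₁ y) (dᵢ u) * (b y (A₁ y (dᵢ w)) (dᵢ v) + b y (ξ₁ y) (σ w v)) +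
      ((b y (A₂ y (dᵢ w)) (dᵢ u) + b y (ξ₂ y) (σ w u)) * b y (ξ₂ y) (dᵢ v) +
      b y (ξ₂ y) (dᵢ u) * (b y (A₂ y (dᵢ w)) (dᵢ v) + b y (ξ₂ y) (σ w v)))) := by
  have hd : DifferentiableAt ℝ hm y := (h.contDiffAt_transMetric hh hy).differentiableAt (by simp)
  have e1 : fderiv ℝ (fun z => hm z u v) y w = fderiv ℝ hm y w u v := by
    rw [fderiv_clm_apply (hd.clm_apply (differentiableAt_const u)) (differentiableAt_const v),
      fderiv_clm_apply hd (differentiableAt_const u)]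
    simp
  have e : (fun z => b z (ξ₁ z) (ξ₁ z) * hm z u v) =ᶠ[𝓝 y] fun z =>
      b z (ξ₁ z) (ξ₁ z) * b z (fderiv ℝ i z u) (fderiv ℝ i z v) -
      (b z (ξ₁ z) (fderiv ℝ i z u) * b z (ξ₁ z) (fderiv ℝ i z v) +
        b z (ξ₂ z) (fderiv ℝ i z u) * b z (ξ₂ z) (fderiv ℝ i z v)) := by
    filter_upwards [h.eventually_mem hy] with z hz using h.mul_transMetric hh hz u v
  have hdu : DifferentiableAt ℝ (fun z => hm z u v) y :=
    (hd.clm_apply (differentiableAt_const u)).clm_apply (differentiableAt_const v)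
  have dn : DifferentiableAt ℝ (fun z => b z (ξ₁ z) (ξ₁ z)) y :=
    (h.contDiffAt_norm hy).differentiableAt (by simp)
  have dg : DifferentiableAt ℝ (fun z => b z (fderiv ℝ i z u) (fderiv ℝ i z v)) y :=
    ((h.differentiableAt_metric hy).clm_apply (h.differentiableAt_fderiv_apply hy u)).clm_apply
      (h.differentiableAt_fderiv_apply hy v)
  have d1 : ∀ u, DifferentiableAt ℝ (fun z => b z (ξ₁ z) (fderiv ℝ i z u)) y := fun u =>
    (h.contDiffAt_dual hy (h.smooth_field₁ y hy) u).differentiableAt (by simp)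
  have d2 : ∀ u, DifferentiableAt ℝ (fun z => b z (ξ₂ z) (fderiv ℝ i z u)) y := fun u =>
    (h.contDiffAt_dual hy (h.smooth_field₂ y hy) u).differentiableAt (by simp)
  have h1 := congrArg (fun L : F →L[ℝ] ℝ => L w) e.fderiv_eq
  have f1 := h.fderiv_dual hy (h.differentiableAt_field₁ hy) (h.cov₁ y hy) w
  have f2 := h.fderiv_dual hy (h.differentiableAt_field₂ hy) (h.cov₂ y hy) w
  rw [fderiv_fun_mul dn hdu, fderiv_fun_sub (dn.fun_mul dg)
    (((d1 u).fun_mul (d1 v)).fun_add ((d2 u).fun_mul (d2 v))),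
    fderiv_fun_add ((d1 u).fun_mul (d1 v)) ((d2 u).fun_mul (d2 v)), fderiv_fun_mul dn dg,
    fderiv_fun_mul (d1 u) (d1 v), fderiv_fun_mul (d2 u) (d2 v)] at h1
  simp only [add_apply, sub_apply, smul_apply, smul_eq_mul, f1, f2, e1, h.fderiv_induced hy] at h1
  linarith

/-- A Killing field that commutes with `ξ₁`, `ξ₂` and preserves `|ξ₁|` preserves every ingredient of
the transversal metric. The commutation enters as `h₁` and `h₂`; a general `ξ` covers both fields at
once. -/
theorem lie_metric_aux [FiniteDimensional ℝ F] {X : F → F} {ξ : F → E} {A : F → E →L[ℝ] E}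
    (hX : DifferentiableAt ℝ X y) (ht : ∀ z ∈ Ω, fderiv ℝ i z (X z) = ξ z)
    (hc : ∀ v, covVec G ξ y v = A y (dᵢ v)) (hs : ∀ u v, b y (A y u) v = -b y u (A y v))
    (hn : fderiv ℝ (fun z => b z (ξ₁ z) (ξ₁ z)) y (X y) = 0)
    (h₁ : A₁ y (ξ y) = A y (ξ₁ y)) (h₂ : A₂ y (ξ y) = A y (ξ₂ y)) (u v : F) :
    fderiv ℝ hm y (X y) u v = -(hm y (fderiv ℝ X y u) v + hm y u (fderiv ℝ X y v)) := by
  have hF := h.fderiv_tangent hy hX ht hc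
  refine mul_left_cancel₀ (h.norm_ne y hy) ?_
  have e := h.fderiv_transMetric hh hy (X y) u v
  have e1 := h.mul_transMetric hh hy (fderiv ℝ X y u) v
  have e2 := h.mul_transMetric hh hy u (fderiv ℝ X y v)
  rw [hn, ht y hy, h₁, h₂, hs, hs, hs, hs, zero_mul, zero_mul, h.sff_symm hy (X y) u,
    h.sff_symm hy (X y) v] at e
  rw [hF, map_sub, map_sub, map_sub, sub_apply, hs] at e1
  rw [hF, map_sub, map_sub, map_sub] at e2
  linear_combination e + e1 + e2

theorem lie_metric_aux₁ [FiniteDimensional ℝ F] (u v : F) :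
    fderiv ℝ hm y (X₁ y) u v = -(hm y (fderiv ℝ X₁ y u) v + hm y u (fderiv ℝ X₁ y v)) :=
  h.lie_metric_aux hh hy ((h.smooth_tangent₁ y hy).differentiableAt (by simp)) h.tangent₁
    (h.cov₁ y hy) (h.skew₁ y hy) (h.fderiv_norm_field₁ hy) rfl (h.comm y hy).symm u v

theorem lie_metric_aux₂ [FiniteDimensional ℝ F] (u v : F) :
    fderiv ℝ hm y (X₂ y) u v = -(hm y (fderiv ℝ X₂ y u) v + hm y u (fderiv ℝ X₂ y v)) :=
  h.lie_metric_aux hh hy ((h.smooth_tangent₂ y hy).differentiableAt (by simp)) h.tangent₂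
    (h.cov₂ y hy) (h.skew₂ y hy) (h.fderiv_norm_field₂ hy) (h.comm y hy) rfl u v

theorem transMetric_symm (u v : F) : hm y u v = hm y v u := by
  rw [hh y hy, hh y hy, h.symm y hy (dᵢ u)]
  ring

theorem transMetric_field₁ (v : F) : hm y (X₁ y) v = 0 := by
  have := h.norm_ne y hy
  have ho := h.orthogonal hy
  rw [h.symm y hy] at ho
  rw [hh y hy, h.tangent₁ y hy, ho]
  field_simp
  ring

theorem transMetric_field₂ (v : F) : hm y (X₂ y) v = 0 := by
  have := h.norm_ne y hy
  rw [hh y hy, h.tangent₂ y hy, h.orthogonal hy, ← h.norm_eq y hy]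
  field_simp
  ring

/-- `K` is an isometry and rotates the pair of products with `ξ₁`, `ξ₂`, so the subtracted term is
invariant as well. -/
theorem transMetric_hermitian (u v : F) : hm y (I y u) (I y v) = hm y u v := by
  have e : ∀ u v, b y (K y u) (K y v) = b y u v := fun u v => by
    rw [h.unit_skew hy, h.unit_unit hy, map_neg, neg_neg]
  have s := h.symm y hy
  rw [hh y hy, hh y hy, h.complex y hy, h.complex y hy, e, s (ξ₁ y) (K y (dᵢ u)),
    s (ξ₁ y) (K y (dᵢ v)), s (ξ₂ y) (K y (dᵢ u)), s (ξ₂ y) (K y (dᵢ v)), h.unit_left₁ hy,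
    h.unit_left₁ hy, h.unit_left₂ hy, h.unit_left₂ hy, s (ξ₁ y) (dᵢ u), s (ξ₁ y) (dᵢ v),
    s (ξ₂ y) (dᵢ u), s (ξ₂ y) (dᵢ v)]
  ring

/-- The transversal length is the length of the component orthogonal to both fields; positivity, and
the kernel of the form, are read off from this. -/
theorem transMetric_self (u : F) : hm y u u =
    b y (dᵢ (u - (b y (ξ₁ y) (dᵢ u) / b y (ξ₁ y) (ξ₁ y)) • X₁ y -
      (b y (ξ₂ y) (dᵢ u) / b y (ξ₁ y) (ξ₁ y)) • X₂ y))
    (dᵢ (u - (b y (ξ₁ y) (dᵢ u) / b y (ξ₁ y) (ξ₁ y)) • X₁ y -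
      (b y (ξ₂ y) (dᵢ u) / b y (ξ₁ y) (ξ₁ y)) • X₂ y)) := by
  have hm := h.norm_ne y hy
  have s := h.symm y hy
  have ho := h.orthogonal hy
  rw [hh y hy]
  simp only [map_sub, map_smul, h.tangent₁ y hy, h.tangent₂ y hy, sub_apply, smul_apply,
    smul_eq_mul, s (dᵢ u) (ξ₁ y), s (dᵢ u) (ξ₂ y), ho, s (ξ₂ y) (ξ₁ y), ← h.norm_eq y hy]
  field_simp
  ring

end FlatSub

/-! ### Closedness of the fundamental form. -/

namespace FlatSub

variable {E : Type*} [NormedAddCommGroup E] [NormedSpace ℝ E]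
  {F : Type*} [NormedAddCommGroup F] [NormedSpace ℝ F] [FiniteDimensional ℝ F]
variable {Ω : Set F} {i : F → E} {b : F → E →L[ℝ] E →L[ℝ] ℝ}
    {G : F → F →L[ℝ] E →L[ℝ] E} {ξ₁ ξ₂ : F → E} {A₁ A₂ P₁ P₂ : F → E →L[ℝ] E} {f : F → ℝ}
    {X₁ X₂ : F → F} {I : F → F →L[ℝ] F} {y : F} {hm : F → F →L[ℝ] F →L[ℝ] ℝ}

/-- The covariant derivative of the fundamental form `h(·, I ·)`. -/
def derivForm (hm : F → F →L[ℝ] F →L[ℝ] ℝ) (I : F → F →L[ℝ] F) (y u v w : F) : ℝ :=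
  fderiv ℝ hm y u v (I y w) + hm y v (fderiv ℝ I y u w)

variable (h : FlatSub Ω i b G ξ₁ ξ₂ A₁ A₂ P₁ P₂ f X₁ X₂ I)
  (hh : IsTransMetric Ω i b ξ₁ ξ₂ hm) (hy : y ∈ Ω)
include h hh hy

local notation "K" => unitEnd f P₁ P₂
local notation "dᵢ" => fderiv ℝ i y
local notation "σ" => sff i G y

theorem transMetric_skew (u v : F) : hm y (I y u) v = -hm y u (I y v) := by
  have h1 := h.transMetric_hermitian hh hy u (I y v)
  rwa [h.complex_sq hy, map_neg, neg_eq_iff_eq_neg] at h1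

theorem fderiv_transMetric_field {X : F → F} (hX : DifferentiableAt ℝ X y)
    (ht : ∀ z ∈ Ω, ∀ v, hm z (X z) v = 0) (u v : F) :
    fderiv ℝ hm y u v (X y) = -hm y v (fderiv ℝ X y u) := by
  have hd : DifferentiableAt ℝ hm y := (h.contDiffAt_transMetric hh hy).differentiableAt (by simp)
  have e : (fun z => hm z v (X z)) =ᶠ[𝓝 y] fun _ => 0 := by
    filter_upwards [h.eventually_mem hy] with z hz
    rw [h.transMetric_symm hh hz, ht z hz]
  have h1 := congrArg (fun L : F →L[ℝ] ℝ => L u) e.fderiv_eq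
  rw [fderiv_clm_apply (hd.clm_apply (differentiableAt_const v)) hX,
    fderiv_clm_apply hd (differentiableAt_const v)] at h1
  simp at h1
  linarith

/-- For `ω = h(·, I ·)` both the contraction with `X` and the Lie derivative along `X` vanish, so by
Cartan's formula `dω` is annihilated by `X`. The pair `X`, `Y = I X` is general in order to cover
`X₁, X₂` and `X₂, -X₁`. -/
theorem closed_field {X Y : F → F} (hX : DifferentiableAt ℝ X y) (hY : DifferentiableAt ℝ Y y)
    (htX : ∀ z ∈ Ω, ∀ v, hm z (X z) v = 0) (htY : ∀ z ∈ Ω, ∀ v, hm z (Y z) v = 0)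
    (hI : I y (X y) = Y y) (hIX : ∀ w, fderiv ℝ I y w (X y) = fderiv ℝ Y y w - I y (fderiv ℝ X y w))
    (hlm : ∀ u v, fderiv ℝ hm y (X y) u v =
      -(hm y (fderiv ℝ X y u) v + hm y u (fderiv ℝ X y v)))
    (hlc : ∀ v, fderiv ℝ I y (X y) v = fderiv ℝ X y (I y v) - I y (fderiv ℝ X y v)) (v w : F) :
    derivForm hm I y (X y) v w + derivForm hm I y v w (X y) + derivForm hm I y w (X y) v = 0 := by
  have s := h.transMetric_symm hh hy
  have hd : DifferentiableAt ℝ hm y := (h.contDiffAt_transMetric hh hy).differentiableAt (by simp)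
  have h1 : ∀ u v, fderiv ℝ hm y w u v = fderiv ℝ hm y w v u := fun u v => by
    have e : (fun z => hm z u v) =ᶠ[𝓝 y] fun z => hm z v u := by
      filter_upwards [h.eventually_mem hy] with z hz using h.transMetric_symm hh hz u v
    have h1 := congrArg (fun L : F →L[ℝ] ℝ => L w) e.fderiv_eq
    rw [fderiv_clm_apply (hd.clm_apply (differentiableAt_const u)) (differentiableAt_const v),
      fderiv_clm_apply hd (differentiableAt_const u),
      fderiv_clm_apply (hd.clm_apply (differentiableAt_const v)) (differentiableAt_const u),
      fderiv_clm_apply hd (differentiableAt_const v)] at h1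
    simpa using h1
  rw [derivForm, derivForm, derivForm, htX y hy, h1 (X y), hI,
    h.fderiv_transMetric_field hh hy hX htX, h.fderiv_transMetric_field hh hy hY htY, hlm, hlc, hIX,
    map_sub, map_sub, s (I y v), ← neg_eq_iff_eq_neg.2 (h.transMetric_skew hh hy _ v),
    ← neg_eq_iff_eq_neg.2 (h.transMetric_skew hh hy w _), s w, s v]
  rw [s v, s (I y w)]
  ring

omit hh [FiniteDimensional ℝ F] in
theorem orthogonal' : b y (ξ₂ y) (ξ₁ y) = 0 := by rw [h.symm y hy, h.orthogonal hy]

theorem closed_field₁ (v w : F) :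
    derivForm hm I y (X₁ y) v w + derivForm hm I y v w (X₁ y) + derivForm hm I y w (X₁ y) v = 0 :=
  h.closed_field hh hy ((h.smooth_tangent₁ y hy).differentiableAt (by simp))
    ((h.smooth_tangent₂ y hy).differentiableAt (by simp)) (fun _ hz => h.transMetric_field₁ hh hz)
    (fun _ hz => h.transMetric_field₂ hh hz) (h.complex_field₁ hy) (h.fderiv_complex_field₁ hy)
    (h.lie_metric_aux₁ hh hy) (h.lie_complex_aux₁ hy) v w

theorem closed_field₂ (v w : F) :
    derivForm hm I y (X₂ y) v w + derivForm hm I y v w (X₂ y) + derivForm hm I y w (X₂ y) v = 0 :=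
  h.closed_field (Y := fun z => -X₁ z) hh hy ((h.smooth_tangent₂ y hy).differentiableAt (by simp))
    ((h.smooth_tangent₁ y hy).differentiableAt (by simp)).neg
    (fun _ hz => h.transMetric_field₂ hh hz)
    (fun _ hz v => by simp [h.transMetric_field₁ hh hz]) (h.complex_field₂ hy)
    (fun w => by rw [h.fderiv_complex_field₂ hy, fderiv_fun_neg, neg_apply])
    (h.lie_metric_aux₂ hh hy) (h.lie_complex_aux₂ hy) v w

/-- When all arguments are orthogonal to both fields, `∇K` vanishes, and the part subtracted in the
transversal metric has zero derivative, being a sum of products of vanishing factors. Only `σ`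
remains. -/
theorem derivForm_orthogonal {u v w : F} (hu₁ : b y (ξ₁ y) (dᵢ u) = 0) (hu₂ : b y (ξ₂ y) (dᵢ u) = 0)
    (hv₁ : b y (ξ₁ y) (dᵢ v) = 0) (hv₂ : b y (ξ₂ y) (dᵢ v) = 0)
    (hw₁ : b y (ξ₁ y) (dᵢ w) = 0) (hw₂ : b y (ξ₂ y) (dᵢ w) = 0) :
    derivForm hm I y w u v = b y (σ w u) (K y (dᵢ v)) - b y (σ w v) (K y (dᵢ u)) := by
  have s := h.symm y hy
  have hI₁ : b y (ξ₁ y) (dᵢ (I y v)) = 0 := by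
    rw [h.complex y hy, s, h.unit_left₁ hy, s, hv₂, neg_zero]
  have hI₂ : b y (ξ₂ y) (dᵢ (I y v)) = 0 := by
    rw [h.complex y hy, s, h.unit_left₂ hy, s, hv₁]
  have hm0 := h.norm_ne y hy
  have e1 := h.fderiv_transMetric hh hy w u (I y v)
  have e2 := h.mul_transMetric hh hy u (I y v)
  have e3 := h.mul_transMetric hh hy u (fderiv ℝ I y w v)
  simp only [hu₁, hu₂, hI₁, hI₂, zero_mul, mul_zero, add_zero, sub_zero] at e1 e2 e3
  have e4 : hm y u (I y v) = b y (dᵢ u) (dᵢ (I y v)) := mul_left_cancel₀ hm0 e2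
  rw [e4, add_right_inj] at e1
  have e5 := mul_left_cancel₀ hm0 e1
  have e6 := mul_left_cancel₀ hm0 e3
  have hK : covEnd G K y w = 0 := by
    rw [h.covEnd_unit hy, s (dᵢ w), hw₁, s (dᵢ w), hw₂]
    simp
  rw [derivForm, e5, e6, h.fderiv_complex hy, hK, h.complex y hy, zero_apply, zero_add, map_sub,
    ← neg_eq_iff_eq_neg.2 (h.unit_skew hy _ (σ w v)), s (σ w v)]
  ring

/-- The cyclic sum is trilinear and vanishes if an argument is `X₁` or `X₂`, so all arguments may be
projected to the orthogonal complement. There it is zero by symmetry of `σ`. -/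
theorem closed_aux (u v w : F) :
    derivForm hm I y u v w + derivForm hm I y v w u + derivForm hm I y w u v = 0 := by
  have hm0 := h.norm_ne y hy
  set p : F → F := fun u => u - (b y (ξ₁ y) (dᵢ u) / b y (ξ₁ y) (ξ₁ y)) • X₁ y -
      (b y (ξ₂ y) (dᵢ u) / b y (ξ₁ y) (ξ₁ y)) • X₂ y with hp
  have hp₁ : ∀ u, b y (ξ₁ y) (dᵢ (p u)) = 0 := fun u => by
    simp only [hp, map_sub, map_smul, h.tangent₁ y hy, h.tangent₂ y hy, h.orthogonal hy,
      smul_eq_mul]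
    field_simp
    ring
  have hp₂ : ∀ u, b y (ξ₂ y) (dᵢ (p u)) = 0 := fun u => by
    simp only [hp, map_sub, map_smul, h.tangent₁ y hy, h.tangent₂ y hy, h.orthogonal' hy,
      smul_eq_mul, ← h.norm_eq y hy]
    field_simp
    ring
  set T : F → F → F → ℝ := fun u v w =>
    derivForm hm I y u v w + derivForm hm I y v w u + derivForm hm I y w u v with hT
  have step : ∀ u v w, T (p u) v w = T u v w := fun u v w => by
    have h1 := h.closed_field₁ hh hy v w
    have h2 := h.closed_field₂ hh hy v w
    simp only [derivForm] at h1 h2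
    simp only [hT, hp, derivForm, map_sub, map_smul, sub_apply, smul_apply, smul_eq_mul]
    linear_combination (-(b y (ξ₁ y) (dᵢ u) / b y (ξ₁ y) (ξ₁ y))) * h1 -
      (b y (ξ₂ y) (dᵢ u) / b y (ξ₁ y) (ξ₁ y)) * h2
  have cyc : ∀ u v w, T u v w = T v w u := fun u v w => by
    simp only [hT]
    ring
  have main : T (p w) (p u) (p v) = 0 := by
    simp only [hT]
    rw [h.derivForm_orthogonal hh hy, h.derivForm_orthogonal hh hy, h.derivForm_orthogonal hh hy,
      h.sff_symm hy (p u) (p w), h.sff_symm hy (p v) (p w), h.sff_symm hy (p v) (p u)] <;>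
    first
    | exact hp₁ _
    | exact hp₂ _
    | ring
  change T u v w = 0
  rw [← step, cyc, ← step, cyc, ← step, main]

-- Turns the geometry along the submanifold into conditions on the submanifold alone. The dual forms
-- are the products with the fields, divided by `|ξ₁|²`.
omit hy in
theorem transFlat : TransFlat Ω X₁ X₂
    (fun y => (b y (ξ₁ y) (ξ₁ y))⁻¹ • (b y (ξ₁ y) ∘L fderiv ℝ i y))
    (fun y => (b y (ξ₁ y) (ξ₁ y))⁻¹ • (b y (ξ₂ y) ∘L fderiv ℝ i y)) I hm where
  isOpen := h.isOpen
  smooth₁ := h.smooth_tangent₁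
  smooth₂ := h.smooth_tangent₂
  smooth_dual₁ y hy := ((h.contDiffAt_norm hy).inv (h.norm_ne y hy)).smul
    (((h.smooth_metric y hy).clm_apply (h.smooth_field₁ y hy)).clm_comp
      ((h.smooth_map y hy).fderiv_right (by simp)))
  smooth_dual₂ y hy := ((h.contDiffAt_norm hy).inv (h.norm_ne y hy)).smul
    (((h.smooth_metric y hy).clm_apply (h.smooth_field₂ y hy)).clm_comp
      ((h.smooth_map y hy).fderiv_right (by simp)))
  smooth_complex := h.smooth_complex
  smooth_metric y hy := h.contDiffAt_transMetric hh hy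
  dual₁₁ y hy := by simp [h.tangent₁ y hy, h.norm_ne y hy]
  dual₁₂ y hy := by simp [h.tangent₂ y hy, h.orthogonal hy]
  dual₂₁ y hy := by simp [h.tangent₁ y hy, h.orthogonal' hy]
  dual₂₂ y hy := by simp [h.tangent₂ y hy, ← h.norm_eq y hy, h.norm_ne y hy]
  symm y hy := h.transMetric_symm hh hy
  vanish₁ y hy := h.transMetric_field₁ hh hy
  vanish₂ y hy := h.transMetric_field₂ hh hy
  hermitian y hy := h.transMetric_hermitian hh hy
  nonneg y hy u := by
    rw [h.transMetric_self hh hy]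
    exact h.nonneg y hy _
  definite y hy u hu := by
    rw [h.transMetric_self hh hy] at hu
    have h1 := h.definite y hy _ hu
    have h2 := h.immersion y hy (h1.trans (map_zero _).symm)
    rw [sub_sub, sub_eq_zero] at h2
    simpa [div_eq_inv_mul] using h2
  sq y hy := h.complex_sq hy
  apply₁ y hy := h.complex_field₁ hy
  bracket y hy := h.bracket_eq hy
  lie_complex₁ y hy := h.lie_complex_aux₁ hy
  lie_complex₂ y hy := h.lie_complex_aux₂ hy
  lie_metric₁ y hy := h.lie_metric_aux₁ hh hy
  lie_metric₂ y hy := h.lie_metric_aux₂ hh hy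
  nijenhuis y hy := h.nij_eq_zero hy
  closed y hy := h.closed_aux hh hy

end FlatSub

/-! ### Smoothness tested through injective maps. -/

/-- A field is smooth if its image under a smooth family of injective linear maps is. -/
theorem contDiffAt_of_injective {D V W : Type*} [NormedAddCommGroup D] [NormedSpace ℝ D]
    [NormedAddCommGroup V] [NormedSpace ℝ V] [FiniteDimensional ℝ V]
    [NormedAddCommGroup W] [NormedSpace ℝ W] [FiniteDimensional ℝ W] {Φ : D → V →L[ℝ] W} {x : D}
    (hΦ : ContDiffAt ℝ ∞ Φ x) (hi : Function.Injective (Φ x)) {c : D → V} {d : D → W}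
    (hd : ContDiffAt ℝ ∞ d x) (hc : ∀ᶠ z in 𝓝 x, Φ z (c z) = d z) : ContDiffAt ℝ ∞ c x := by
  -- For a left inverse `L` of `Φ x`, the operators `L ∘ Φ z` stay invertible near `x`, and there `c
  -- = (L ∘ Φ)⁻¹ (L d)`.
  obtain ⟨L, hL⟩ := LinearMap.exists_leftInverse_of_injective (Φ x).toLinearMap
    (LinearMap.ker_eq_bot.2 hi)
  let L' : W →L[ℝ] V := LinearMap.toContinuousLinearMap L
  have h1 : L' ∘L Φ x = 1 := by
    ext v
    exact congrArg (fun l : V →ₗ[ℝ] V => l v) hL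
  have hA : ContDiffAt ℝ ∞ (fun z => L' ∘L Φ z) x := contDiffAt_const.clm_comp hΦ
  have hu : IsUnit (L' ∘L Φ x) := by rw [h1]; exact isUnit_one
  have hr : ContDiffAt ℝ ∞ (fun z => Ring.inverse (L' ∘L Φ z)) x := by
    obtain ⟨u, hu'⟩ := hu
    have := contDiffAt_ringInverse (n := ∞) ℝ u
    rw [hu'] at this
    exact this.comp x hA
  have he : ∀ᶠ z in 𝓝 x, IsUnit (L' ∘L Φ z) :=
    hA.continuousAt.eventually (Units.isOpen.mem_nhds hu)
  refine (hr.clm_apply (contDiffAt_const (c := L').clm_apply hd)).congr_of_eventuallyEq ?_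
  filter_upwards [he, hc] with z hz hzc
  rw [← hzc]
  have := congrArg (fun l : V →L[ℝ] V => l (c z)) (Ring.inverse_mul_cancel _ hz)
  exact this.symm

theorem contDiffAt_clm_of_injective {D U V W : Type*} [NormedAddCommGroup D] [NormedSpace ℝ D]
    [NormedAddCommGroup U] [NormedSpace ℝ U] [FiniteDimensional ℝ U]
    [NormedAddCommGroup V] [NormedSpace ℝ V] [FiniteDimensional ℝ V]
    [NormedAddCommGroup W] [NormedSpace ℝ W] [FiniteDimensional ℝ W] {Φ : D → V →L[ℝ] W} {x : D}
    (hΦ : ContDiffAt ℝ ∞ Φ x) (hi : Function.Injective (Φ x)) {c : D → U →L[ℝ] V} {d : D → U →L[ℝ] W}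
    (hd : ContDiffAt ℝ ∞ d x) (hc : ∀ᶠ z in 𝓝 x, ∀ u, Φ z (c z u) = d z u) :
    ContDiffAt ℝ ∞ c x :=
  contDiffAt_clm_of_apply fun u => contDiffAt_of_injective hΦ hi
    (hd.clm_apply contDiffAt_const) (hc.mono fun _ h => h u)

/-! ### Integrability and closedness tested in charts. -/

section ChartCriteria

variable {E : Type*} [NormedAddCommGroup E] [NormedSpace ℝ E]
  {M : Type*} [TopologicalSpace M] [ChartedSpace E M] [IsManifold 𝓘(ℝ, E) ∞ M]

/-- The origin of the chart at `x`. -/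
abbrev chartPt (x : M) : E := extChartAt 𝓘(ℝ, E) x x

theorem chartPt_mem (x : M) : chartPt (E := E) x ∈ chartDom x :=
  chart_mem_chartDom (mem_chart_source E x)

theorem chartInv_chartPt (x : M) : chartInv x (chartPt (E := E) x) = x :=
  chartInv_chart (mem_chart_source E x)

/-- Each point is replaced by `chartInv x₀ (chartPt x₀)`, so that chart lemmas apply literally and
no tangent vector has to be transported between equal base points. -/
theorem forall_of_chart {p : M → Prop} (h : ∀ x₀ : M, p (chartInv x₀ (chartPt (E := E) x₀)))
    (x : M) : p x := by
  have := h x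
  rwa [chartInv_chartPt] at this

theorem smoothEndOn_of_chart {J : Π x : M, TangentSpace 𝓘(ℝ, E) x →L[ℝ] TangentSpace 𝓘(ℝ, E) x}
    (hs : ∀ x, ContDiffAt ℝ ∞ (chartEnd x J) (chartPt x)) : SmoothEndOn J Set.univ :=
  contMDiffOn_univ.2 (forall_of_chart fun x₀ => (contMDiffAt_end_iff_chart (chartPt_mem x₀)).2 (hs x₀))

theorem smoothForm_of_chart
    {h : Π x : M, TangentSpace 𝓘(ℝ, E) x →L[ℝ] TangentSpace 𝓘(ℝ, E) x →L[ℝ] ℝ}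
    (hs : ∀ x, ContDiffAt ℝ ∞ (chartForm x h) (chartPt x)) : SmoothForm h :=
  forall_of_chart fun x₀ => (contMDiffAt_form_iff_chart (chartPt_mem x₀)).2 (hs x₀)

/-- After the product rule the derivatives of `X` and `Y` cancel by `J² = -1`, and the difference of
the two sides is `J` applied to the Nijenhuis tensor. -/
theorem flat_bracket_identity {J : E → E →L[ℝ] E} {X Y : E → E} {z : E}
    (hJ : DifferentiableAt ℝ J z)
    (hX : DifferentiableAt ℝ X z) (hY : DifferentiableAt ℝ Y z) (hJJ : ∀ v, J z (J z v) = -v)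
    (hn : ∀ u v, nij J z u v = 0) :
    (fderiv ℝ (fun w => J w (Y w)) z (X z) - fderiv ℝ X z (J z (Y z))) +
      (fderiv ℝ Y z (J z (X z)) - fderiv ℝ (fun w => J w (X w)) z (Y z)) =
    J z ((fderiv ℝ Y z (X z) - fderiv ℝ X z (Y z)) -
      (fderiv ℝ (fun w => J w (Y w)) z (J z (X z)) -
        fderiv ℝ (fun w => J w (X w)) z (J z (Y z)))) := by
  have h1 := congrArg (J z) (hn (X z) (Y z))
  rw [nij] at h1
  rw [fderiv_clm_apply hJ hX, fderiv_clm_apply hJ hY]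
  simp only [add_apply, ContinuousLinearMap.comp_apply, ContinuousLinearMap.flip_apply, map_add,
    map_sub, hJJ, map_zero] at h1 ⊢
  rw [← sub_eq_zero, ← h1]
  abel

theorem isIntegrableComplexStructure_of_chart [CompleteSpace E]
    {J : Π x : M, TangentSpace 𝓘(ℝ, E) x →L[ℝ] TangentSpace 𝓘(ℝ, E) x}
    (hs : ∀ x, ContDiffAt ℝ ∞ (chartEnd x J) (chartPt x)) (hJ : ∀ x v, J x (J x v) = -v)
    (hn : ∀ x u v, nij (chartEnd x J) (chartPt (E := E) x) u v = 0) :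
    IsIntegrableComplexStructure J where
  smooth := smoothEndOn_of_chart hs
  sq := hJ
  integrable := by
    refine forall_of_chart (E := E) fun x₀ X Y hX hY => ?_
    have hz := chartPt_mem (E := E) x₀
    have dX := ((smoothFieldAt_iff_chart hz).1 hX).differentiableAt (by simp)
    have dY := ((smoothFieldAt_iff_chart hz).1 hY).differentiableAt (by simp)
    have dJ := (hs x₀).differentiableAt (by simp)
    have e : ∀ X : Π x : M, TangentSpace 𝓘(ℝ, E) x, chartField x₀ (fun y => J y (X y)) =ᶠ[𝓝 (chartPt (E := E) x₀)]
        fun w => chartEnd x₀ J w (chartField x₀ X w) := fun X => by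
      filter_upwards [(isOpen_chartDom x₀).mem_nhds hz] with w hw
        using chartEnd_apply_chartField J X hw
    have dJX := (e X).differentiableAt_iff.2 (dJ.clm_apply dX)
    have dJY := (e Y).differentiableAt_iff.2 (dJ.clm_apply dY)
    have sqz : ∀ v, chartEnd x₀ J (chartPt x₀) (chartEnd x₀ J (chartPt x₀) v) = -v := fun v => by
      simp only [chartEnd, ContinuousLinearMap.comp_apply,
        fromChart_toChart (chartInv_mem_source hz), hJ, map_neg,
        toChart_fromChart (chartInv_mem_source hz)]
    have key := flat_bracket_identity dJ dX dY sqz (hn x₀)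
    rw [mlieBracket_chart hz dX dJY, mlieBracket_chart hz dJX dY, mlieBracket_chart hz dX dY,
      mlieBracket_chart hz dJX dJY, (e X).fderiv_eq, (e Y).fderiv_eq,
      chartEnd_apply_chartField J X hz, chartEnd_apply_chartField J Y hz, ← map_add, key, ← map_sub]
    simp only [chartEnd, ContinuousLinearMap.comp_apply, fromChart_toChart (chartInv_mem_source hz)]

/-- In the invariant formula the derivatives of the fields cancel against the brackets, which leaves
the cyclic sum of derivatives of the coordinate form. -/
theorem isClosedTwoForm_of_chart [CompleteSpace E]
    {α : Π x : M, TangentSpace 𝓘(ℝ, E) x →L[ℝ] TangentSpace 𝓘(ℝ, E) x →L[ℝ] ℝ}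
    (hs : ∀ x, ContDiffAt ℝ ∞ (chartForm x α) (chartPt x))
    (hα : ∀ x u v, α x u v = -α x v u)
    (hc : ∀ x (u v w : E), fderiv ℝ (chartForm x α) (chartPt x) u v w +
      fderiv ℝ (chartForm x α) (chartPt x) v w u + fderiv ℝ (chartForm x α) (chartPt x) w u v = 0) :
    IsClosedTwoForm fun x u v => α x u v := by
  refine forall_of_chart (E := E) fun x₀ X Y Z hX hY hZ => ?_
  have hz := chartPt_mem (E := E) x₀
  have dX := ((smoothFieldAt_iff_chart hz).1 hX).differentiableAt (by simp)
  have dY := ((smoothFieldAt_iff_chart hz).1 hY).differentiableAt (by simp)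
  have dZ := ((smoothFieldAt_iff_chart hz).1 hZ).differentiableAt (by simp)
  have dα := (hs x₀).differentiableAt (by simp)
  set a := chartForm x₀ α
  have e : ∀ X Y : Π x : M, TangentSpace 𝓘(ℝ, E) x,
      (fun w => α (chartInv x₀ w) (X (chartInv x₀ w)) (Y (chartInv x₀ w))) =ᶠ[𝓝 (chartPt (E := E) x₀)]
      fun w => a w (chartField x₀ X w) (chartField x₀ Y w) := fun X Y => by
    filter_upwards [(isOpen_chartDom x₀).mem_nhds hz] with w hw
    rw [chartForm_apply, fromChart_chartField X hw, fromChart_chartField Y hw]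
  have key : ∀ X Y Z : Π x : M, TangentSpace 𝓘(ℝ, E) x,
      DifferentiableAt ℝ (chartField (E := E) x₀ X) (chartPt x₀) →
      DifferentiableAt ℝ (chartField (E := E) x₀ Y) (chartPt x₀) →
      tangentDeriv (fun y => α y (X y) (Y y)) (chartInv x₀ (chartPt (E := E) x₀))
        (Z (chartInv x₀ (chartPt (E := E) x₀))) =
      fderiv ℝ a (chartPt x₀) (chartField x₀ Z (chartPt x₀)) (chartField x₀ X (chartPt x₀))
          (chartField x₀ Y (chartPt x₀)) +
        a (chartPt x₀) (fderiv ℝ (chartField x₀ X) (chartPt x₀) (chartField x₀ Z (chartPt x₀)))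
          (chartField x₀ Y (chartPt x₀)) +
        a (chartPt x₀) (chartField x₀ X (chartPt x₀))
          (fderiv ℝ (chartField x₀ Y) (chartPt x₀) (chartField x₀ Z (chartPt x₀))) := by
    intro X Y Z dX dY
    have h1 := tangentDeriv_chart (f := fun y => α y (X y) (Y y)) hz
      ((e X Y).differentiableAt_iff.2 ((dα.clm_apply dX).clm_apply dY))
      (chartField x₀ Z (chartPt x₀))
    rw [fromChart_chartField Z hz, (e X Y).fderiv_eq, fderiv_clm_apply (dα.clm_apply dX) dY,
      fderiv_clm_apply dα dX] at h1
    rw [h1]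
    simp only [add_apply, ContinuousLinearMap.comp_apply, ContinuousLinearMap.flip_apply]
    ring
  have key2 : ∀ X Y Z : Π x : M, TangentSpace 𝓘(ℝ, E) x,
      DifferentiableAt ℝ (chartField (E := E) x₀ X) (chartPt x₀) →
      DifferentiableAt ℝ (chartField (E := E) x₀ Y) (chartPt x₀) →
      α (chartInv x₀ (chartPt (E := E) x₀)) (mlieBracket 𝓘(ℝ, E) X Y (chartInv x₀ (chartPt (E := E) x₀)))
        (Z (chartInv x₀ (chartPt (E := E) x₀))) =
      a (chartPt x₀) (fderiv ℝ (chartField x₀ Y) (chartPt x₀) (chartField x₀ X (chartPt x₀)))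
          (chartField x₀ Z (chartPt x₀)) -
        a (chartPt x₀) (fderiv ℝ (chartField x₀ X) (chartPt x₀) (chartField x₀ Y (chartPt x₀)))
          (chartField x₀ Z (chartPt x₀)) := by
    intro X Y Z dX dY
    rw [mlieBracket_chart hz dX dY, ← fromChart_chartField Z hz, ← chartForm_apply, map_sub,
      sub_apply]
  have skew : ∀ u v, a (chartPt x₀) u v = -a (chartPt x₀) v u := fun u v => by
    rw [chartForm_apply, chartForm_apply, hα]
  have skew' : ∀ t u v, fderiv ℝ a (chartPt x₀) t u v = -fderiv ℝ a (chartPt x₀) t v u := by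
    intro t u v
    have e : (fun z => a z u v) = fun z => -a z v u := by
      ext z
      rw [chartForm_apply, chartForm_apply, hα]
    have h1 := congrArg (fun f => fderiv ℝ f (chartPt x₀) t) e
    simp only [fderiv_fun_neg] at h1
    rw [fderiv_clm_apply (dα.clm_apply (differentiableAt_const _)) (differentiableAt_const _),
      fderiv_clm_apply dα (differentiableAt_const _),
      fderiv_clm_apply (dα.clm_apply (differentiableAt_const _)) (differentiableAt_const _),
      fderiv_clm_apply dα (differentiableAt_const _)] at h1
    simpa using h1
  have h1 := hc x₀ (chartField x₀ X (chartPt x₀)) (chartField x₀ Y (chartPt x₀))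
    (chartField x₀ Z (chartPt x₀))
  rw [key Y Z X dY dZ, key X Z Y dX dZ, key X Y Z dX dY]
  beta_reduce
  rw [key2 X Y Z dX dY, key2 X Z Y dX dZ, key2 Y Z X dY dZ,
    skew' (chartField x₀ Y (chartPt x₀)) (chartField x₀ X (chartPt x₀))]
  rw [skew (chartField x₀ Y (chartPt x₀)) (fderiv ℝ (chartField x₀ Z) _ _),
    skew (chartField x₀ X (chartPt x₀)) (fderiv ℝ (chartField x₀ Z) _ _),
    skew (chartField x₀ X (chartPt x₀)) (fderiv ℝ (chartField x₀ Y) _ _)]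
  linear_combination h1

end ChartCriteria

/-! ### Basic forms and motion along the leaves. -/

section FlatTransversal

variable {F : Type*} [NormedAddCommGroup F] [NormedSpace ℝ F] [FiniteDimensional ℝ F]
  {V : Type*} [NormedAddCommGroup V] [NormedSpace ℝ V]

/-- The bilinear form `h(·, I ·)`. -/
def fundForm (h : F → F →L[ℝ] F →L[ℝ] ℝ) (I : F → F →L[ℝ] F) (y : F) : F →L[ℝ] F →L[ℝ] ℝ :=
  ContinuousLinearMap.precomp ℝ (I y) ∘L h y

theorem fundForm_apply (h : F → F →L[ℝ] F →L[ℝ] ℝ) (I : F → F →L[ℝ] F) (y u v : F) :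
    fundForm h I y u v = h y u (I y v) := rfl

theorem fderiv_form_apply {α : F → F →L[ℝ] F →L[ℝ] ℝ} {y : F} (hα : DifferentiableAt ℝ α y)
    (u v w : F) : fderiv ℝ (fun z => α z v w) y u = fderiv ℝ α y u v w := by
  rw [fderiv_clm_apply (hα.clm_apply (differentiableAt_const _)) (differentiableAt_const _),
    fderiv_clm_apply hα (differentiableAt_const _)]
  simp

theorem contDiffAt_fundForm {h : F → F →L[ℝ] F →L[ℝ] ℝ} {I : F → F →L[ℝ] F} {y : F}
    (hh : ContDiffAt ℝ ∞ h y) (hI : ContDiffAt ℝ ∞ I y) : ContDiffAt ℝ ∞ (fundForm h I) y :=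
  contDiffAt_clm_of_apply fun _ => contDiffAt_clm_of_apply fun _ =>
    (hh.clm_apply contDiffAt_const).clm_apply (hI.clm_apply contDiffAt_const)

theorem fderiv_fundForm {h : F → F →L[ℝ] F →L[ℝ] ℝ} {I : F → F →L[ℝ] F} {y : F}
    (hh : ContDiffAt ℝ ∞ h y) (hI : ContDiffAt ℝ ∞ I y) (u v w : F) :
    fderiv ℝ (fundForm h I) y u v w = fderiv ℝ h y u v (I y w) + h y v (fderiv ℝ I y u w) := by
  have dI := hI.differentiableAt (by simp)
  have dh := hh.differentiableAt (by simp)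
  rw [← fderiv_form_apply ((contDiffAt_fundForm hh hI).differentiableAt (by simp))]
  simp only [fundForm_apply]
  rw [fderiv_clm_apply (dh.clm_apply (differentiableAt_const _))
    (dI.clm_apply (differentiableAt_const _)), fderiv_clm_apply dh (differentiableAt_const _),
    fderiv_clm_apply dI (differentiableAt_const _)]
  simp [add_comm]

/-- A bilinear form which is basic for the foliation spanned by `X₁`, `X₂`. -/
structure BasicForm (Ω : Set F) (X₁ X₂ : F → F) (α : F → F →L[ℝ] F →L[ℝ] ℝ) : Prop where
  smooth : ∀ y ∈ Ω, ContDiffAt ℝ ∞ α y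
  left₁ : ∀ y ∈ Ω, ∀ v, α y (X₁ y) v = 0
  left₂ : ∀ y ∈ Ω, ∀ v, α y (X₂ y) v = 0
  right₁ : ∀ y ∈ Ω, ∀ v, α y v (X₁ y) = 0
  right₂ : ∀ y ∈ Ω, ∀ v, α y v (X₂ y) = 0
  lie₁ : ∀ y ∈ Ω, ∀ u v, fderiv ℝ α y (X₁ y) u v =
    -(α y (fderiv ℝ X₁ y u) v + α y u (fderiv ℝ X₁ y v))
  lie₂ : ∀ y ∈ Ω, ∀ u v, fderiv ℝ α y (X₂ y) u v =
    -(α y (fderiv ℝ X₂ y u) v + α y u (fderiv ℝ X₂ y v))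

namespace TransFlat

variable {Ω : Set F} {X₁ X₂ : F → F} {θ₁ θ₂ : F → F →L[ℝ] ℝ} {I : F → F →L[ℝ] F}
    {h : F → F →L[ℝ] F →L[ℝ] ℝ} (hT : TransFlat Ω X₁ X₂ θ₁ θ₂ I h) {y : F} (hy : y ∈ Ω)
include hT hy

theorem apply₂ : I y (X₂ y) = -X₁ y := by rw [← hT.apply₁ y hy, hT.sq y hy]

theorem fundForm_closed (u v w : F) : fderiv ℝ (fundForm h I) y u v w +
    fderiv ℝ (fundForm h I) y v w u + fderiv ℝ (fundForm h I) y w u v = 0 := by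
  have hh := hT.smooth_metric y hy
  have hI := hT.smooth_complex y hy
  rw [fderiv_fundForm hh hI, fderiv_fundForm hh hI, fderiv_fundForm hh hI, hT.closed y hy]

omit hy in
theorem basicForm_metric : BasicForm Ω X₁ X₂ h where
  smooth := hT.smooth_metric
  left₁ := hT.vanish₁
  left₂ := hT.vanish₂
  right₁ y hy v := by rw [hT.symm y hy, hT.vanish₁ y hy]
  right₂ y hy v := by rw [hT.symm y hy, hT.vanish₂ y hy]
  lie₁ := hT.lie_metric₁
  lie₂ := hT.lie_metric₂

omit hy in
theorem basicForm_fundForm : BasicForm Ω X₁ X₂ (fundForm h I) where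
  smooth y hy := contDiffAt_fundForm (hT.smooth_metric y hy) (hT.smooth_complex y hy)
  left₁ y hy v := hT.vanish₁ y hy _
  left₂ y hy v := hT.vanish₂ y hy _
  right₁ y hy v := by rw [fundForm_apply, hT.apply₁ y hy, hT.symm y hy, hT.vanish₂ y hy]
  right₂ y hy v := by
    rw [fundForm_apply, hT.apply₂ hy, hT.symm y hy, map_neg, neg_apply, hT.vanish₁ y hy, neg_zero]
  lie₁ y hy u v := by
    rw [fderiv_fundForm (hT.smooth_metric y hy) (hT.smooth_complex y hy), hT.lie_metric₁ y hy,
      hT.lie_complex₁ y hy, fundForm_apply, fundForm_apply, map_sub]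
    ring
  lie₂ y hy u v := by
    rw [fderiv_fundForm (hT.smooth_metric y hy) (hT.smooth_complex y hy), hT.lie_metric₂ y hy,
      hT.lie_complex₂ y hy, fundForm_apply, fundForm_apply, map_sub]
    ring

theorem eq_of_mem_span {u : F} (hu : u ∈ Submodule.span ℝ {X₁ y, X₂ y}) :
    u = θ₁ y u • X₁ y + θ₂ y u • X₂ y := by
  obtain ⟨a, b, rfl⟩ := Submodule.mem_span_pair.1 hu
  simp [hT.dual₁₁ y hy, hT.dual₁₂ y hy, hT.dual₂₁ y hy, hT.dual₂₂ y hy]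

/-- The distribution spanned by the two fields is involutive. -/
theorem bracket_mem {X Y : F → F} (hX : DifferentiableAt ℝ X y) (hY : DifferentiableAt ℝ Y y)
    (hXm : ∀ᶠ z in 𝓝 y, X z ∈ Submodule.span ℝ {X₁ z, X₂ z})
    (hYm : ∀ᶠ z in 𝓝 y, Y z ∈ Submodule.span ℝ {X₁ z, X₂ z}) :
    fderiv ℝ Y y (X y) - fderiv ℝ X y (Y y) ∈ Submodule.span ℝ {X₁ y, X₂ y} := by
  have d1 := (hT.smooth₁ y hy).differentiableAt (by simp)
  have d2 := (hT.smooth₂ y hy).differentiableAt (by simp)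
  have t1 := (hT.smooth_dual₁ y hy).differentiableAt (by simp)
  have t2 := (hT.smooth_dual₂ y hy).differentiableAt (by simp)
  -- The coefficients of a field in the distribution are its values under `θ₁`, `θ₂`, hence
  -- differentiable.
  have key : ∀ {X : F → F}, DifferentiableAt ℝ X y →
      (∀ᶠ z in 𝓝 y, X z ∈ Submodule.span ℝ {X₁ z, X₂ z}) → ∀ u, fderiv ℝ X y u =
      fderiv ℝ (fun z => θ₁ z (X z)) y u • X₁ y + θ₁ y (X y) • fderiv ℝ X₁ y u +
      (fderiv ℝ (fun z => θ₂ z (X z)) y u • X₂ y + θ₂ y (X y) • fderiv ℝ X₂ y u) := by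
    intro X hX hXm u
    have e : X =ᶠ[𝓝 y] fun z => θ₁ z (X z) • X₁ z + θ₂ z (X z) • X₂ z := by
      filter_upwards [hXm, hT.isOpen.mem_nhds hy] with z hz hzΩ using hT.eq_of_mem_span hzΩ hz
    have a1 := t1.clm_apply hX
    have a2 := t2.clm_apply hX
    have h1 := congrArg (fun L : F →L[ℝ] F => L u) e.fderiv_eq
    rw [fderiv_fun_add (a1.fun_smul d1) (a2.fun_smul d2), fderiv_fun_smul a1 d1,
      fderiv_fun_smul a2 d2] at h1
    rw [h1]
    simp only [add_apply, smul_apply, ContinuousLinearMap.smulRight_apply]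
    abel
  have eX := hT.eq_of_mem_span hy hXm.self_of_nhds
  have eY := hT.eq_of_mem_span hy hYm.self_of_nhds
  rw [key hY hYm, key hX hXm, Submodule.mem_span_pair]
  refine ⟨fderiv ℝ (fun z => θ₁ z (Y z)) y (X y) - fderiv ℝ (fun z => θ₁ z (X z)) y (Y y),
    fderiv ℝ (fun z => θ₂ z (Y z)) y (X y) - fderiv ℝ (fun z => θ₂ z (X z)) y (Y y), ?_⟩
  have e1 : ∀ L : F →L[ℝ] F, L (X y) = θ₁ y (X y) • L (X₁ y) + θ₂ y (X y) • L (X₂ y) :=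
    fun L => by conv_lhs => rw [eX, map_add, map_smul, map_smul]
  have e2 : ∀ L : F →L[ℝ] F, L (Y y) = θ₁ y (Y y) • L (X₁ y) + θ₂ y (Y y) • L (X₂ y) :=
    fun L => by conv_lhs => rw [eY, map_add, map_smul, map_smul]
  rw [e1 (fderiv ℝ X₁ y), e1 (fderiv ℝ X₂ y), e2 (fderiv ℝ X₁ y), e2 (fderiv ℝ X₂ y),
    hT.bracket y hy]
  module

end TransFlat

/-- A basic form is invariant under moving along the leaves. -/
theorem BasicForm.hasDerivAt {Ω : Set F} {X₁ X₂ : F → F} {θ₁ θ₂ : F → F →L[ℝ] ℝ}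
    {I : F → F →L[ℝ] F} {h : F → F →L[ℝ] F →L[ℝ] ℝ} (hT : TransFlat Ω X₁ X₂ θ₁ θ₂ I h)
    {α : F → F →L[ℝ] F →L[ℝ] ℝ} (hα : BasicForm Ω X₁ X₂ α) {q : ℝ × V → F} {t : ℝ} {w : V}
    (hq : ContDiffAt ℝ ∞ q (t, w)) (hΩ : q (t, w) ∈ Ω)
    (hD : ∀ᶠ x in 𝓝 w, fderiv ℝ q (t, x) (1, 0) ∈
      Submodule.span ℝ {X₁ (q (t, x)), X₂ (q (t, x))}) (u v : V) :
    HasDerivAt (fun τ => α (q (τ, w)) (fderiv ℝ q (τ, w) (0, u)) (fderiv ℝ q (τ, w) (0, v))) 0 t := by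
  have dq : DifferentiableAt ℝ q (t, w) := hq.differentiableAt (by simp)
  have dq' : DifferentiableAt ℝ (fderiv ℝ q) (t, w) :=
    (hq.fderiv_right (m := 1) two_le_infty).differentiableAt (by simp)
  have dα : DifferentiableAt ℝ α (q (t, w)) := (hα.smooth _ hΩ).differentiableAt (by simp)
  have d1 := (hT.smooth₁ _ hΩ).differentiableAt (by simp)
  have d2 := (hT.smooth₂ _ hΩ).differentiableAt (by simp)
  have t1 := (hT.smooth_dual₁ _ hΩ).differentiableAt (by simp)
  have t2 := (hT.smooth_dual₂ _ hΩ).differentiableAt (by simp)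
  have hx : HasFDerivAt (fun x : V => (t, x)) (ContinuousLinearMap.inr ℝ ℝ V) w :=
    hasFDerivAt_prodMk_right t w
  set y := q (t, w) with hy
  obtain ⟨a, b, hab⟩ : ∃ a b : ℝ, a • X₁ y + b • X₂ y = fderiv ℝ q (t, w) (1, 0) :=
    Submodule.mem_span_pair.1 hD.self_of_nhds
  -- the second derivatives
  have key : ∀ u : V, ∃ a' b' : ℝ, fderiv ℝ (fderiv ℝ q) (t, w) (1, 0) (0, u) =
      a' • X₁ y + b' • X₂ y + a • fderiv ℝ X₁ y (fderiv ℝ q (t, w) (0, u)) +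
        b • fderiv ℝ X₂ y (fderiv ℝ q (t, w) (0, u)) := by
    intro u
    have c1 : DifferentiableAt ℝ (fun x => q (t, x)) w := dq.comp w hx.differentiableAt
    have c0 : HasFDerivAt (fun x => fderiv ℝ q (t, x))
        (fderiv ℝ (fderiv ℝ q) (t, w) ∘L ContinuousLinearMap.inr ℝ ℝ V) w :=
      dq'.hasFDerivAt.comp (g := fderiv ℝ q) w hx
    have c2 : DifferentiableAt ℝ (fun x => fderiv ℝ q (t, x) (1, 0)) w :=
      c0.differentiableAt.clm_apply (differentiableAt_const _)
    have f1 : DifferentiableAt ℝ (fun x => θ₁ (q (t, x)) (fderiv ℝ q (t, x) (1, 0))) w :=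
      (t1.comp w c1).clm_apply c2
    have f2 : DifferentiableAt ℝ (fun x => θ₂ (q (t, x)) (fderiv ℝ q (t, x) (1, 0))) w :=
      (t2.comp w c1).clm_apply c2
    have g1 : HasFDerivAt (fun x => X₁ (q (t, x)))
        (fderiv ℝ X₁ y ∘L fderiv ℝ q (t, w) ∘L ContinuousLinearMap.inr ℝ ℝ V) w :=
      d1.hasFDerivAt.comp w (dq.hasFDerivAt.comp w hx)
    have g2 : HasFDerivAt (fun x => X₂ (q (t, x)))
        (fderiv ℝ X₂ y ∘L fderiv ℝ q (t, w) ∘L ContinuousLinearMap.inr ℝ ℝ V) w :=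
      d2.hasFDerivAt.comp w (dq.hasFDerivAt.comp w hx)
    have e : (fun x => fderiv ℝ q (t, x) (1, 0)) =ᶠ[𝓝 w] fun x =>
        θ₁ (q (t, x)) (fderiv ℝ q (t, x) (1, 0)) • X₁ (q (t, x)) +
        θ₂ (q (t, x)) (fderiv ℝ q (t, x) (1, 0)) • X₂ (q (t, x)) := by
      filter_upwards [hD, c1.continuousAt.preimage_mem_nhds (hT.isOpen.mem_nhds hΩ)] with x h1 h2
        using hT.eq_of_mem_span h2 h1
    have h1 := congrArg (fun L : V →L[ℝ] F => L u) e.fderiv_eq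
    -- Mixed derivatives of `q` commute: the variation of the velocity in direction `u` is the time
    -- derivative of the variation.
    have h2 : fderiv ℝ (fun x => fderiv ℝ q (t, x) (1, 0)) w u =
        fderiv ℝ (fderiv ℝ q) (t, w) (1, 0) (0, u) := by
      have sy := fderiv_fderiv_symm (hq.of_le two_le_infty) (0, u) (1, 0)
      rw [fderiv_clm_apply dq' (differentiableAt_const _),
        fderiv_clm_apply dq' (differentiableAt_const _)] at sy
      rw [fderiv_clm_apply c0.differentiableAt (differentiableAt_const _), c0.fderiv]
      simpa using sy
    rw [h2, fderiv_fun_add (f1.fun_smul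
      g1.differentiableAt) (f2.fun_smul g2.differentiableAt), fderiv_fun_smul f1 g1.differentiableAt,
      fderiv_fun_smul f2 g2.differentiableAt, g1.fderiv, g2.fderiv, ← hy, ← hab] at h1
    refine ⟨fderiv ℝ (fun x => θ₁ (q (t, x)) (fderiv ℝ q (t, x) (1, 0))) w u,
      fderiv ℝ (fun x => θ₂ (q (t, x)) (fderiv ℝ q (t, x) (1, 0))) w u, h1.trans ?_⟩
    simp only [add_apply, smul_apply, ContinuousLinearMap.smulRight_apply, map_add, map_smul,
      hT.dual₁₁ y hΩ, hT.dual₁₂ y hΩ, hT.dual₂₁ y hΩ, hT.dual₂₂ y hΩ,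
      ContinuousLinearMap.comp_apply, ContinuousLinearMap.inr_apply, smul_eq_mul, mul_zero, mul_one,
      add_zero, zero_add]
    abel
  have ht : HasFDerivAt (fun τ : ℝ => (τ, w)) (ContinuousLinearMap.inl ℝ ℝ V) t :=
    hasFDerivAt_prodMk_left t w
  have hqt : HasDerivAt (fun τ => q (τ, w)) (fderiv ℝ q (t, w) (1, 0)) t :=
    (dq.hasFDerivAt.comp t ht).hasDerivAt
  have hαt : HasDerivAt (fun τ => α (q (τ, w))) (fderiv ℝ α y (fderiv ℝ q (t, w) (1, 0))) t :=
    ((dα.hasFDerivAt.comp (g := α) (f := fun τ => q (τ, w)) t hqt.hasFDerivAt).hasDerivAt).congr_deriv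
      (by simp)
  have hut : ∀ u, HasDerivAt (fun τ => fderiv ℝ q (τ, w) (0, u))
      (fderiv ℝ (fderiv ℝ q) (t, w) (1, 0) (0, u)) t := fun u =>
    (((dq'.hasFDerivAt.comp (g := fderiv ℝ q) t ht).hasDerivAt).clm_apply
      (hasDerivAt_const t ((0, u) : ℝ × V))).congr_deriv (by simp)
  -- In the product rule the components along the fields are annihilated by `α`; the rest is `a`,
  -- `b` times the Lie derivatives of `α` along `X₁`, `X₂`, which vanish.
  refine ((hαt.clm_apply (hut u)).clm_apply (hut v)).congr_deriv ?_
  obtain ⟨a', b', hu⟩ := key u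
  obtain ⟨a'', b'', hv⟩ := key v
  rw [hu, hv, ← hab]
  simp only [map_add, map_smul, add_apply, smul_apply, smul_eq_mul, ← hy, hα.left₁ y hΩ,
    hα.left₂ y hΩ, hα.right₁ y hΩ, hα.right₂ y hΩ, hα.lie₁ y hΩ, hα.lie₂ y hΩ]
  ring

end FlatTransversal

/-! ### Structures induced on transversals. -/

section FlatInduced

variable {F : Type*} [NormedAddCommGroup F] [NormedSpace ℝ F] [FiniteDimensional ℝ F]
  {V : Type*} [NormedAddCommGroup V] [NormedSpace ℝ V] [FiniteDimensional ℝ V]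

/-- The pull-back of a bilinear form by a map. -/
def pullBilin (p : V → F) (α : F → F →L[ℝ] F →L[ℝ] ℝ) (w : V) : V →L[ℝ] V →L[ℝ] ℝ :=
  ContinuousLinearMap.precomp ℝ (fderiv ℝ p w) ∘L α (p w) ∘L fderiv ℝ p w

theorem pullBilin_apply (p : V → F) (α : F → F →L[ℝ] F →L[ℝ] ℝ) (w u v : V) :
    pullBilin p α w u v = α (p w) (fderiv ℝ p w u) (fderiv ℝ p w v) := rfl

theorem contDiffAt_pullBilin {p : V → F} {α : F → F →L[ℝ] F →L[ℝ] ℝ} {w : V}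
    (hp : ContDiffAt ℝ ∞ p w) (hα : ContDiffAt ℝ ∞ α (p w)) :
    ContDiffAt ℝ ∞ (pullBilin p α) w := by
  have hp' : ContDiffAt ℝ ∞ (fderiv ℝ p) w := hp.fderiv_right (by simp)
  refine contDiffAt_clm_of_apply fun u => contDiffAt_clm_of_apply fun v => ?_
  exact ((hα.comp w hp).clm_apply (hp'.clm_apply contDiffAt_const)).clm_apply
    (hp'.clm_apply contDiffAt_const)

/-- Pull-back commutes with the exterior derivative: the terms containing second derivatives of `p`
cancel by symmetry. -/
theorem fderiv_pullBilin_cyclic {p : V → F} {α : F → F →L[ℝ] F →L[ℝ] ℝ} {w : V}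
    (hp : ContDiffAt ℝ ∞ p w) (hα : ContDiffAt ℝ ∞ α (p w))
    (hs : ∀ u v, α (p w) u v = -α (p w) v u)
    (hc : ∀ u v x, fderiv ℝ α (p w) u v x + fderiv ℝ α (p w) v x u + fderiv ℝ α (p w) x u v = 0)
    (u v x : V) :
    fderiv ℝ (pullBilin p α) w u v x + fderiv ℝ (pullBilin p α) w v x u +
      fderiv ℝ (pullBilin p α) w x u v = 0 := by
  have dp : DifferentiableAt ℝ p w := hp.differentiableAt (by simp)
  have dp' : DifferentiableAt ℝ (fderiv ℝ p) w :=
    (hp.fderiv_right (m := 1) two_le_infty).differentiableAt (by simp)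
  have dα : DifferentiableAt ℝ α (p w) := hα.differentiableAt (by simp)
  have dc : HasFDerivAt (fun z => α (p z)) (fderiv ℝ α (p w) ∘L fderiv ℝ p w) w :=
    dα.hasFDerivAt.comp (g := α) w dp.hasFDerivAt
  have da : ∀ u, DifferentiableAt ℝ (fun z => fderiv ℝ p z u) w := fun u =>
    dp'.clm_apply (differentiableAt_const u)
  have key : ∀ u v x, fderiv ℝ (pullBilin p α) w u v x =
      fderiv ℝ α (p w) (fderiv ℝ p w u) (fderiv ℝ p w v) (fderiv ℝ p w x) +
      α (p w) (fderiv ℝ (fun z => fderiv ℝ p z v) w u) (fderiv ℝ p w x) +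
      α (p w) (fderiv ℝ p w v) (fderiv ℝ (fun z => fderiv ℝ p z x) w u) := by
    intro u v x
    rw [← fderiv_form_apply ((contDiffAt_pullBilin hp hα).differentiableAt (by simp))]
    simp only [pullBilin_apply]
    rw [fderiv_clm_apply (dc.differentiableAt.clm_apply (da v)) (da x),
      fderiv_clm_apply dc.differentiableAt (da v), dc.fderiv]
    simp only [add_apply, ContinuousLinearMap.comp_apply, ContinuousLinearMap.flip_apply]
    ring
  have sy := fun a b => fderiv_fderiv_symm (hp.of_le two_le_infty) a b
  rw [key, key, key, sy v u, sy x u, sy x v,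
    hs (fderiv ℝ p w v), hs (fderiv ℝ p w u), hs (fderiv ℝ p w x)]
  linear_combination hc (fderiv ℝ p w u) (fderiv ℝ p w v) (fderiv ℝ p w x)

namespace TransFlat

variable {Ω : Set F} {X₁ X₂ : F → F} {θ₁ θ₂ : F → F →L[ℝ] ℝ} {I : F → F →L[ℝ] F}
    {h : F → F →L[ℝ] F →L[ℝ] ℝ} (hT : TransFlat Ω X₁ X₂ θ₁ θ₂ I h)

/-- The projection with kernel spanned by the two fields. -/
def proj (X₁ X₂ : F → F) (θ₁ θ₂ : F → F →L[ℝ] ℝ) (y : F) : F →L[ℝ] F :=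
  1 - (θ₁ y).smulRight (X₁ y) - (θ₂ y).smulRight (X₂ y)

theorem proj_apply (y u : F) :
    proj X₁ X₂ θ₁ θ₂ y u = u - θ₁ y u • X₁ y - θ₂ y u • X₂ y := rfl

include hT

theorem contDiffAt_proj {y : F} (hy : y ∈ Ω) : ContDiffAt ℝ ∞ (proj X₁ X₂ θ₁ θ₂) y :=
  (contDiffAt_const.sub ((hT.smooth_dual₁ y hy).smulRight (hT.smooth₁ y hy))).sub
    ((hT.smooth_dual₂ y hy).smulRight (hT.smooth₂ y hy))

theorem proj_eq_zero {y : F} (hy : y ∈ Ω) {u : F} :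
    proj X₁ X₂ θ₁ θ₂ y u = 0 ↔ u ∈ Submodule.span ℝ {X₁ y, X₂ y} := by
  constructor
  · intro hu
    rw [proj_apply, sub_sub, sub_eq_zero] at hu
    rw [hu]
    exact Submodule.mem_span_pair.2 ⟨_, _, rfl⟩
  · intro hu
    rw [proj_apply, sub_sub, sub_eq_zero]
    exact hT.eq_of_mem_span hy hu

variable {p : V → F} {J : V → V →L[ℝ] V} {w : V}

/-- The composite of `Dp` with the projection along the fields is injective by transversality, and
`proj ∘ Dp ∘ J = proj ∘ I ∘ Dp` then determines `J` smoothly. -/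
theorem contDiffAt_induced (hp : ContDiffAt ℝ ∞ p w) (hw : p w ∈ Ω)
    (hJ : ∀ᶠ z in 𝓝 w, ∀ v, fderiv ℝ p z (J z v) - I (p z) (fderiv ℝ p z v) ∈
      Submodule.span ℝ {X₁ (p z), X₂ (p z)})
    (ht : ∀ x, fderiv ℝ p w x ∈ Submodule.span ℝ {X₁ (p w), X₂ (p w)} → x = 0) :
    ContDiffAt ℝ ∞ J w := by
  have hp' : ContDiffAt ℝ ∞ (fderiv ℝ p) w := hp.fderiv_right (by simp)
  have hπ : ContDiffAt ℝ ∞ (fun z => proj X₁ X₂ θ₁ θ₂ (p z)) w :=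
    (hT.contDiffAt_proj hw).comp w hp
  refine contDiffAt_clm_of_injective (Φ := fun z => proj X₁ X₂ θ₁ θ₂ (p z) ∘L fderiv ℝ p z)
    (d := fun z => proj X₁ X₂ θ₁ θ₂ (p z) ∘L I (p z) ∘L fderiv ℝ p z)
    (hπ.clm_comp hp') ?_ (hπ.clm_comp (((hT.smooth_complex _ hw).comp w hp).clm_comp hp')) ?_
  · refine (injective_iff_map_eq_zero _).2 fun x hx => ht x ((hT.proj_eq_zero hw).1 hx)
  · filter_upwards [hJ, hp.continuousAt.preimage_mem_nhds (hT.isOpen.mem_nhds hw)] with z hz hzΩ u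
    have := (hT.proj_eq_zero hzΩ).2 (hz u)
    rwa [map_sub, sub_eq_zero] at this

/-- `Dp ∘ J = I ∘ Dp` holds up to multiples of the fields. Since the fields commute and preserve
`I`, these errors alter `Dp` of the Nijenhuis tensor of `J` by multiples of the fields only, and its
remaining part is the Nijenhuis tensor of `I`. Transversality concludes. -/
theorem nij_induced (hp : ContDiffAt ℝ ∞ p w) (hw : p w ∈ Ω)
    (hJ : ∀ᶠ z in 𝓝 w, ∀ v, fderiv ℝ p z (J z v) - I (p z) (fderiv ℝ p z v) ∈
      Submodule.span ℝ {X₁ (p z), X₂ (p z)})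
    (ht : ∀ x, fderiv ℝ p w x ∈ Submodule.span ℝ {X₁ (p w), X₂ (p w)} → x = 0)
    (u v : V) : nij J w u v = 0 := by
  have dJ : DifferentiableAt ℝ J w := (hT.contDiffAt_induced hp hw hJ ht).differentiableAt (by simp)
  have dp : DifferentiableAt ℝ p w := hp.differentiableAt (by simp)
  have dp' : DifferentiableAt ℝ (fderiv ℝ p) w :=
    (hp.fderiv_right (m := 1) two_le_infty).differentiableAt (by simp)
  have comp : ∀ {W : Type _} [NormedAddCommGroup W] [NormedSpace ℝ W] {g : F → W},
      ContDiffAt ℝ ∞ g (p w) →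
      HasFDerivAt (fun z => g (p z)) (fderiv ℝ g (p w) ∘L fderiv ℝ p w) w := fun {W} _ _ {g} hg =>
    (hg.differentiableAt (by simp)).hasFDerivAt.comp (g := g) w dp.hasFDerivAt
  have dX₁ := comp (hT.smooth₁ _ hw)
  have dX₂ := comp (hT.smooth₂ _ hw)
  have dt₁ := comp (hT.smooth_dual₁ _ hw)
  have dt₂ := comp (hT.smooth_dual₂ _ hw)
  have dI := comp (hT.smooth_complex _ hw)
  set y := p w with hy
  -- `Dp (J v) = I (Dp v) + a v • X₁ + b v • X₂`
  obtain ⟨a, ha⟩ : ∃ a : V → V → ℝ, ∀ z v, a z v =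
    θ₁ (p z) (fderiv ℝ p z (J z v) - I (p z) (fderiv ℝ p z v)) := ⟨_, fun _ _ => rfl⟩
  obtain ⟨b, hb⟩ : ∃ b : V → V → ℝ, ∀ z v, b z v =
    θ₂ (p z) (fderiv ℝ p z (J z v) - I (p z) (fderiv ℝ p z v)) := ⟨_, fun _ _ => rfl⟩
  have hev : ∀ᶠ z in 𝓝 w, ∀ v, fderiv ℝ p z (J z v) =
      I (p z) (fderiv ℝ p z v) + a z v • X₁ (p z) + b z v • X₂ (p z) := by
    filter_upwards [hJ, hp.continuousAt.preimage_mem_nhds (hT.isOpen.mem_nhds hw)] with z hz hzΩ v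
    rw [ha, hb, add_assoc, ← hT.eq_of_mem_span hzΩ (hz v)]
    abel
  have h0 := hev.self_of_nhds
  have dv : ∀ v, DifferentiableAt ℝ (fun z => fderiv ℝ p z v) w := fun v =>
    dp'.clm_apply (differentiableAt_const v)
  have dJv : ∀ v, DifferentiableAt ℝ (fun z => J z v) w := fun v =>
    dJ.clm_apply (differentiableAt_const v)
  have dpJ : ∀ v, DifferentiableAt ℝ (fun z => fderiv ℝ p z (J z v)) w := fun v =>
    dp'.clm_apply (dJv v)
  have dIp : ∀ v, DifferentiableAt ℝ (fun z => I (p z) (fderiv ℝ p z v)) w := fun v =>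
    dI.differentiableAt.clm_apply (dv v)
  have da : ∀ v, DifferentiableAt ℝ (fun z => a z v) w := fun v => by
    simp only [ha]
    exact dt₁.differentiableAt.clm_apply ((dpJ v).fun_sub (dIp v))
  have db : ∀ v, DifferentiableAt ℝ (fun z => b z v) w := fun v => by
    simp only [hb]
    exact dt₂.differentiableAt.clm_apply ((dpJ v).fun_sub (dIp v))
  obtain ⟨D, hD⟩ : ∃ D : V → V → F, ∀ u v, D u v = fderiv ℝ (fun z => fderiv ℝ p z v) w u :=
    ⟨_, fun _ _ => rfl⟩
  have sy : ∀ u v, D u v = D v u := fun u v => by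
    rw [hD, hD, fderiv_fderiv_symm (hp.of_le two_le_infty)]
  have key : ∀ u v, fderiv ℝ p w (fderiv ℝ J w u v) =
      fderiv ℝ I y (fderiv ℝ p w u) (fderiv ℝ p w v) + I y (D u v) - D u (J w v) +
      a w v • fderiv ℝ X₁ y (fderiv ℝ p w u) + b w v • fderiv ℝ X₂ y (fderiv ℝ p w u) +
      fderiv ℝ (fun z => a z v) w u • X₁ y + fderiv ℝ (fun z => b z v) w u • X₂ y := by
    intro u v
    have e : (fun z => fderiv ℝ p z (J z v)) =ᶠ[𝓝 w] fun z =>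
        I (p z) (fderiv ℝ p z v) + a z v • X₁ (p z) + b z v • X₂ (p z) :=
      hev.mono fun z hz => hz v
    have h1 := congrArg (fun L : V →L[ℝ] F => L u) e.fderiv_eq
    rw [fderiv_clm_apply dp' (dJv v), fderiv_clm_apply dJ (differentiableAt_const v),
      fderiv_fun_add ((dIp v).fun_add ((da v).fun_smul dX₁.differentiableAt))
        ((db v).fun_smul dX₂.differentiableAt),
      fderiv_fun_add (dIp v) ((da v).fun_smul dX₁.differentiableAt),
      fderiv_fun_smul (da v) dX₁.differentiableAt, fderiv_fun_smul (db v) dX₂.differentiableAt,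
      fderiv_clm_apply dI.differentiableAt (dv v), dX₁.fderiv, dX₂.fderiv, dI.fderiv] at h1
    have h2 : D u (J w v) = fderiv ℝ (fderiv ℝ p) w u (J w v) := by
      rw [hD, fderiv_clm_apply dp' (differentiableAt_const _)]
      simp
    rw [h2, hD]
    simp only [add_apply, smul_apply, ContinuousLinearMap.comp_apply,
      ContinuousLinearMap.flip_apply, ContinuousLinearMap.smulRight_apply, fderiv_fun_const,
      Pi.zero_apply, ContinuousLinearMap.comp_zero, zero_add,
      ← hy] at h1
    rw [eq_sub_of_add_eq h1]
    abel
  apply ht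
  have n0 := hT.nijenhuis y hw (fderiv ℝ p w u) (fderiv ℝ p w v)
  have l1 := hT.lie_complex₁ y hw
  have l2 := hT.lie_complex₂ y hw
  rw [Submodule.mem_span_pair]
  -- The coefficients of `X₁` and `X₂` collected from the instances of `key`; derivatives of `a` and
  -- `b` mix because `I X₁ = X₂` and `I X₂ = -X₁`.
  refine ⟨fderiv ℝ (fun z => a z v) w (J w u) + fderiv ℝ (fun z => b z v) w u
      - a w (fderiv ℝ J w u v) - (fderiv ℝ (fun z => a z u) w (J w v) +
        fderiv ℝ (fun z => b z u) w v - a w (fderiv ℝ J w v u)),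
    fderiv ℝ (fun z => b z v) w (J w u) - fderiv ℝ (fun z => a z v) w u
      - b w (fderiv ℝ J w u v) - (fderiv ℝ (fun z => b z u) w (J w v) -
        fderiv ℝ (fun z => a z u) w v - b w (fderiv ℝ J w v u)), ?_⟩
  have b0 := hT.bracket y hw
  rw [nij]
  simp only [map_add, map_sub, h0, key, ← hy, map_smul, add_apply, smul_apply, l1, l2,
    hT.sq y hw, hT.apply₁ y hw, hT.apply₂ hw, sy u (J w v), sy v (J w u), sy v u, sy (J w v) (J w u), b0]
  rw [← sub_eq_zero]
  refine Eq.trans ?_ (congrArg Neg.neg n0 |>.trans neg_zero)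
  module

end TransFlat

end FlatInduced

/-- A positive form has a positive minimum on the compact unit sphere, and by homogeneity this
bounds its unit ball. Riemannian metrics on bundles carry this condition as a field. -/
theorem isVonNBounded_of_pos {V : Type*} [NormedAddCommGroup V] [NormedSpace ℝ V]
    [FiniteDimensional ℝ V] (B : V →L[ℝ] V →L[ℝ] ℝ) (hB : ∀ v, v ≠ 0 → 0 < B v v) :
    Bornology.IsVonNBounded ℝ {v | B v v < 1} := by
  rw [NormedSpace.isVonNBounded_iff, isBounded_iff_forall_norm_le]
  rcases (Metric.sphere (0 : V) 1).eq_empty_or_nonempty with he | hne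
  · refine ⟨0, fun v _ => ?_⟩
    by_contra hv
    have hv' : ‖v‖ ≠ 0 := fun h => hv h.le
    have : ‖v‖⁻¹ • v ∈ Metric.sphere (0 : V) 1 := by
      rw [mem_sphere_zero_iff_norm, norm_smul, norm_inv, norm_norm, inv_mul_cancel₀ hv']
    rw [he] at this
    exact this
  · obtain ⟨e, he, hmin⟩ := (isCompact_sphere (0 : V) 1).exists_isMinOn hne
      (f := fun v => B v v) (by fun_prop)
    have he0 : e ≠ 0 := by
      rintro rfl
      simp at he
    have hc := hB e he0
    refine ⟨√(1 / B e e), fun v hv => ?_⟩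
    refine Real.le_sqrt_of_sq_le ?_
    rw [le_div_iff₀ hc]
    by_cases hv0 : v = 0
    · simp [hv0]
    have hn : ‖v‖ ≠ 0 := norm_ne_zero_iff.2 hv0
    have hs : ‖v‖⁻¹ • v ∈ Metric.sphere (0 : V) 1 := by
      rw [mem_sphere_zero_iff_norm, norm_smul, norm_inv, norm_norm, inv_mul_cancel₀ hn]
    have h1 : B e e ≤ B (‖v‖⁻¹ • v) (‖v‖⁻¹ • v) := hmin hs
    rw [map_smul, map_smul, smul_apply, smul_eq_mul, smul_eq_mul] at h1
    have h2 : ‖v‖ ^ 2 * (‖v‖⁻¹ * (‖v‖⁻¹ * B v v)) = B v v := by field_simp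
    calc ‖v‖ ^ 2 * B e e ≤ ‖v‖ ^ 2 * (‖v‖⁻¹ * (‖v‖⁻¹ * B v v)) := by gcongr
      _ = B v v := h2
      _ ≤ 1 := le_of_lt hv

/-! ### Local transversal structures on a manifold. -/

section LocalStructure

variable {F : Type*} [NormedAddCommGroup F] [NormedSpace ℝ F] [FiniteDimensional ℝ F]
  {N : Type*} [TopologicalSpace N] [ChartedSpace F N] [IsManifold 𝓘(ℝ, F) ∞ N]

/-- In a chart around each point, the fields `X₁`, `X₂`, `I` and the form `h` are a transversal
Kähler structure. -/
def LocallyTrans (X₁ X₂ : Π y : N, TangentSpace 𝓘(ℝ, F) y)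
    (I : Π y : N, TangentSpace 𝓘(ℝ, F) y →L[ℝ] TangentSpace 𝓘(ℝ, F) y)
    (h : Π y : N, TangentSpace 𝓘(ℝ, F) y →L[ℝ] TangentSpace 𝓘(ℝ, F) y →L[ℝ] ℝ) : Prop :=
  ∀ y₀ : N, ∃ (Ω : Set F) (θ₁ θ₂ : F → F →L[ℝ] ℝ), chartPt y₀ ∈ Ω ∧ Ω ⊆ chartDom y₀ ∧
    TransFlat Ω (chartField y₀ X₁) (chartField y₀ X₂) θ₁ θ₂ (chartEnd y₀ I) (chartForm y₀ h)

variable {X₁ X₂ : Π y : N, TangentSpace 𝓘(ℝ, F) y}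
    {I : Π y : N, TangentSpace 𝓘(ℝ, F) y →L[ℝ] TangentSpace 𝓘(ℝ, F) y}
    {h : Π y : N, TangentSpace 𝓘(ℝ, F) y →L[ℝ] TangentSpace 𝓘(ℝ, F) y →L[ℝ] ℝ}
    {D : Π y : N, Submodule ℝ (TangentSpace 𝓘(ℝ, F) y)}

/-- The base point is a variable with an equation, since in the applications it equals `chartInv y₀
z` only propositionally. -/
theorem fromChart_mem_iff (hD : ∀ y, D y = Submodule.span ℝ {X₁ y, X₂ y}) {y₀ y : N} {z : F}
    (hz : z ∈ chartDom y₀) (hy : chartInv y₀ z = y) (u : F) :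
    fromChart y₀ y u ∈ D y ↔
      u ∈ Submodule.span ℝ {chartField y₀ X₁ z, chartField y₀ X₂ z} := by
  subst hy
  rw [hD, Submodule.mem_span_pair, Submodule.mem_span_pair, ← fromChart_chartField X₁ hz,
    ← fromChart_chartField X₂ hz]
  refine exists_congr fun a => exists_congr fun b => ?_
  rw [← map_smul, ← map_smul, ← map_add]
  have hx := chartInv_mem_source hz
  constructor
  · intro h
    have := congrArg (toChart y₀ (chartInv y₀ z)) h
    rwa [toChart_fromChart hx, toChart_fromChart hx] at this
  · intro h
    rw [h]

theorem form_fromChart {α : Π y : N, TangentSpace 𝓘(ℝ, F) y →L[ℝ] TangentSpace 𝓘(ℝ, F) y →L[ℝ] ℝ}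
    {y₀ y : N} {z : F} (hy : chartInv y₀ z = y) (u v : F) :
    α y (fromChart y₀ y u) (fromChart y₀ y v) = chartForm y₀ α z u v := by
  subst hy
  rfl

theorem end_fromChart {I : Π y : N, TangentSpace 𝓘(ℝ, F) y →L[ℝ] TangentSpace 𝓘(ℝ, F) y}
    {y₀ y : N} {z : F} (hz : z ∈ chartDom y₀) (hy : chartInv y₀ z = y) (u : F) :
    I y (fromChart y₀ y u) = fromChart y₀ y (chartEnd y₀ I z u) := by
  subst hy
  simp only [chartEnd, ContinuousLinearMap.comp_apply, fromChart_toChart (chartInv_mem_source hz)]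

/-- The form `h(·, I ·)`. -/
def fundamentalForm (h : Π y : N, TangentSpace 𝓘(ℝ, F) y →L[ℝ] TangentSpace 𝓘(ℝ, F) y →L[ℝ] ℝ)
    (I : Π y : N, TangentSpace 𝓘(ℝ, F) y →L[ℝ] TangentSpace 𝓘(ℝ, F) y) (y : N) :
    TangentSpace 𝓘(ℝ, F) y →L[ℝ] TangentSpace 𝓘(ℝ, F) y →L[ℝ] ℝ :=
  ContinuousLinearMap.precomp ℝ (I y) ∘L h y

theorem fundamentalForm_apply
    (h : Π y : N, TangentSpace 𝓘(ℝ, F) y →L[ℝ] TangentSpace 𝓘(ℝ, F) y →L[ℝ] ℝ)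
    (I : Π y : N, TangentSpace 𝓘(ℝ, F) y →L[ℝ] TangentSpace 𝓘(ℝ, F) y) (y : N)
    (u v : TangentSpace 𝓘(ℝ, F) y) : fundamentalForm h I y u v = h y u (I y v) := rfl

theorem chartForm_fundamentalForm {y₀ : N} {z : F} (hz : z ∈ chartDom y₀) :
    chartForm y₀ (fundamentalForm h I) z = fundForm (chartForm y₀ h) (chartEnd y₀ I) z := by
  ext u v
  rw [fundForm_apply, chartForm_apply, chartForm_apply, fundamentalForm_apply,
    end_fromChart hz rfl]

namespace LocallyTrans

variable (hl : LocallyTrans X₁ X₂ I h) (hD : ∀ y, D y = Submodule.span ℝ {X₁ y, X₂ y})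
include hl

theorem isInvolutive (hD : ∀ y, D y = Submodule.span ℝ {X₁ y, X₂ y}) : IsInvolutive D := by
  refine fun X Y U hU hX hY => forall_of_chart (E := F) fun y₀ hy₀ => ?_
  obtain ⟨Ω, θ₁, θ₂, hΩ, hΩc, hT⟩ := hl y₀
  have hz := chartPt_mem (E := F) y₀
  have hev : ∀ᶠ w in 𝓝 (chartPt (E := F) y₀), w ∈ chartDom y₀ ∧ chartInv y₀ w ∈ U := by
    refine ((isOpen_chartDom y₀).eventually_mem hz).and ?_
    exact (contMDiffAt_chartInv hz).continuousAt.eventually (hU.mem_nhds hy₀)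
  have mem : ∀ {X : Π y : N, TangentSpace 𝓘(ℝ, F) y}, (∀ y ∈ U, SmoothFieldAt X y ∧ X y ∈ D y) →
      ∀ᶠ w in 𝓝 (chartPt y₀), chartField y₀ X w ∈
        Submodule.span ℝ {chartField y₀ X₁ w, chartField y₀ X₂ w} := fun {X} hX => by
    filter_upwards [hev] with w hw
    rw [← fromChart_mem_iff hD hw.1 rfl, fromChart_chartField X hw.1]
    exact (hX _ hw.2).2
  have dX := ((smoothFieldAt_iff_chart hz).1 (hX _ hy₀).1).differentiableAt (by simp)
  have dY := ((smoothFieldAt_iff_chart hz).1 (hY _ hy₀).1).differentiableAt (by simp)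
  rw [mlieBracket_chart hz dX dY, fromChart_mem_iff hD hz rfl]
  exact hT.bracket_mem hΩ dX dY (mem hX) (mem hY)

theorem sq (y : N) (v : TangentSpace 𝓘(ℝ, F) y) : I y (I y v) = -v := by
  revert y
  refine forall_of_chart (E := F) fun y₀ v => ?_
  obtain ⟨Ω, θ₁, θ₂, hΩ, hΩc, hT⟩ := hl y₀
  have hz := chartPt_mem (E := F) y₀
  obtain ⟨u, rfl⟩ : ∃ u, v = fromChart y₀ _ u :=
    ⟨_, (fromChart_toChart (chartInv_mem_source hz) v).symm⟩
  rw [end_fromChart hz rfl, end_fromChart hz rfl, hT.sq _ hΩ, map_neg]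

theorem isIntegrable : IsIntegrableComplexStructure I := by
  refine isIntegrableComplexStructure_of_chart (fun y₀ => ?_) hl.sq fun y₀ u v => ?_
  · obtain ⟨Ω, θ₁, θ₂, hΩ, hΩc, hT⟩ := hl y₀
    exact hT.smooth_complex _ hΩ
  · obtain ⟨Ω, θ₁, θ₂, hΩ, hΩc, hT⟩ := hl y₀
    exact hT.nijenhuis _ hΩ u v

theorem smoothForm : SmoothForm h := smoothForm_of_chart fun y₀ => by
  obtain ⟨Ω, θ₁, θ₂, hΩ, hΩc, hT⟩ := hl y₀
  exact hT.smooth_metric _ hΩ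

/-- Properties of `h` and `I` at a point. -/
theorem pointwise (hD : ∀ y, D y = Submodule.span ℝ {X₁ y, X₂ y}) (y : N) :
    (∀ u v, h y u v = h y v u) ∧ (∀ u ∈ D y, ∀ v, h y u v = 0) ∧
    (∀ u ∈ D y, I y u ∈ D y) ∧ (∀ u v, h y (I y u) (I y v) = h y u v) ∧ (∀ u, 0 ≤ h y u u) ∧
    ∀ u, h y u u = 0 → u ∈ D y := by
  revert y
  refine forall_of_chart (E := F) fun y₀ => ?_
  obtain ⟨Ω, θ₁, θ₂, hΩ, hΩc, hT⟩ := hl y₀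
  have hz := chartPt_mem (E := F) y₀
  have hs : ∀ v : TangentSpace 𝓘(ℝ, F) (chartInv y₀ (chartPt (E := F) y₀)), ∃ u, v = fromChart y₀ _ u :=
    fun v => ⟨_, (fromChart_toChart (chartInv_mem_source hz) v).symm⟩
  refine ⟨fun u v => ?_, fun u hu v => ?_, fun u hu => ?_, fun u v => ?_, fun u => ?_,
    fun u hu => ?_⟩
  · obtain ⟨u, rfl⟩ := hs u
    obtain ⟨v, rfl⟩ := hs v
    exact hT.symm _ hΩ u v
  · obtain ⟨u, rfl⟩ := hs u
    obtain ⟨v, rfl⟩ := hs v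
    rw [fromChart_mem_iff hD hz rfl] at hu
    rw [form_fromChart rfl, hT.eq_of_mem_span hΩ hu]
    simp [hT.vanish₁ _ hΩ, hT.vanish₂ _ hΩ]
  · obtain ⟨u, rfl⟩ := hs u
    rw [end_fromChart hz rfl]
    rw [fromChart_mem_iff hD hz rfl] at hu ⊢
    obtain ⟨a, b, rfl⟩ := Submodule.mem_span_pair.1 hu
    rw [map_add, map_smul, map_smul, hT.apply₁ _ hΩ, hT.apply₂ hΩ, Submodule.mem_span_pair]
    exact ⟨-b, a, by module⟩
  · obtain ⟨u, rfl⟩ := hs u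
    obtain ⟨v, rfl⟩ := hs v
    rw [end_fromChart hz rfl, end_fromChart hz rfl]
    exact hT.hermitian _ hΩ u v
  · obtain ⟨u, rfl⟩ := hs u
    exact hT.nonneg _ hΩ u
  · obtain ⟨u, rfl⟩ := hs u
    rw [fromChart_mem_iff hD hz rfl, hT.definite _ hΩ u hu]
    exact Submodule.mem_span_pair.2 ⟨_, _, rfl⟩

end LocallyTrans

end LocalStructure

/-! ### The Kähler structure on a transversal. -/

section Induced

variable {F : Type*} [NormedAddCommGroup F] [NormedSpace ℝ F] [FiniteDimensional ℝ F]
  {N : Type*} [TopologicalSpace N] [ChartedSpace F N] [IsManifold 𝓘(ℝ, F) ∞ N]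
  {X₁ X₂ : Π y : N, TangentSpace 𝓘(ℝ, F) y}
  {I : Π y : N, TangentSpace 𝓘(ℝ, F) y →L[ℝ] TangentSpace 𝓘(ℝ, F) y}
  {h : Π y : N, TangentSpace 𝓘(ℝ, F) y →L[ℝ] TangentSpace 𝓘(ℝ, F) y →L[ℝ] ℝ}
  {D : Π y : N, Submodule ℝ (TangentSpace 𝓘(ℝ, F) y)}
  {V : Type*} [NormedAddCommGroup V] [NormedSpace ℝ V] [FiniteDimensional ℝ V]
  {S : Type*} [TopologicalSpace S] [ChartedSpace V S] [IsManifold 𝓘(ℝ, V) ∞ S]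

/-- The pull-back of a field of bilinear forms by a map. -/
def pullField (j : S → N)
    (α : Π y : N, TangentSpace 𝓘(ℝ, F) y →L[ℝ] TangentSpace 𝓘(ℝ, F) y →L[ℝ] ℝ) (s : S) :
    TangentSpace 𝓘(ℝ, V) s →L[ℝ] TangentSpace 𝓘(ℝ, V) s →L[ℝ] ℝ :=
  ContinuousLinearMap.precomp ℝ (mfderiv 𝓘(ℝ, V) 𝓘(ℝ, F) j s) ∘L
    α (j s) ∘L mfderiv 𝓘(ℝ, V) 𝓘(ℝ, F) j s

theorem pullField_apply (j : S → N)
    (α : Π y : N, TangentSpace 𝓘(ℝ, F) y →L[ℝ] TangentSpace 𝓘(ℝ, F) y →L[ℝ] ℝ) (s : S)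
    (u v : TangentSpace 𝓘(ℝ, V) s) : pullField j α s u v =
      α (j s) (mfderiv 𝓘(ℝ, V) 𝓘(ℝ, F) j s u) (mfderiv 𝓘(ℝ, V) 𝓘(ℝ, F) j s v) := rfl

variable {j : S → N} {s₀ : S} {y₀ : N} {w : V}

theorem chartForm_pullField
    {α : Π y : N, TangentSpace 𝓘(ℝ, F) y →L[ℝ] TangentSpace 𝓘(ℝ, F) y →L[ℝ] ℝ}
    (hw : w ∈ chartDom s₀) (hj : j (chartInv s₀ w) ∈ (chartAt F y₀).source)
    (hjs : MDifferentiableAt 𝓘(ℝ, V) 𝓘(ℝ, F) j (chartInv s₀ w)) :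
    chartForm s₀ (pullField j α) w = pullBilin (chartMap s₀ y₀ j) (chartForm y₀ α) w := by
  ext u v
  rw [chartForm_apply, pullField_apply, mfderiv_chartMap hw hj hjs, mfderiv_chartMap hw hj hjs,
    form_fromChart (chartInv_chartMap hj), pullBilin_apply]

theorem chartMap_chartPt (s₀ : S) : chartMap s₀ (j s₀) j (chartPt (E := V) s₀) =
    chartPt (E := F) (j s₀) := by
  rw [chartMap, chartInv_chartPt]

theorem eventually_chart (hj : ContMDiff 𝓘(ℝ, V) 𝓘(ℝ, F) ∞ j) (s₀ : S) :
    ∀ᶠ w in 𝓝 (chartPt (E := V) s₀), w ∈ chartDom s₀ ∧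
      j (chartInv s₀ w) ∈ (chartAt F (j s₀)).source := by
  have hz := chartPt_mem (E := V) s₀
  refine ((isOpen_chartDom s₀).eventually_mem hz).and ?_
  have h1 : ContinuousAt (fun w => j (chartInv s₀ w)) (chartPt (E := V) s₀) :=
    hj.continuous.continuousAt.comp (contMDiffAt_chartInv hz).continuousAt
  refine h1.eventually ((chartAt F (j s₀)).open_source.mem_nhds ?_)
  beta_reduce
  rw [chartInv_chartPt]
  exact mem_chart_source F (j s₀)

theorem induced_chart {JS : Π s : S, TangentSpace 𝓘(ℝ, V) s →L[ℝ] TangentSpace 𝓘(ℝ, V) s}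
    (hD : ∀ y, D y = Submodule.span ℝ {X₁ y, X₂ y})
    (hJ : ∀ s u, mfderiv 𝓘(ℝ, V) 𝓘(ℝ, F) j s (JS s u) - I (j s) (mfderiv 𝓘(ℝ, V) 𝓘(ℝ, F) j s u)
      ∈ D (j s))
    (hw : w ∈ chartDom s₀) (hj : j (chartInv s₀ w) ∈ (chartAt F y₀).source)
    (hjs : MDifferentiableAt 𝓘(ℝ, V) 𝓘(ℝ, F) j (chartInv s₀ w)) (u : V) :
    fderiv ℝ (chartMap s₀ y₀ j) w (chartEnd s₀ JS w u) -
      chartEnd y₀ I (chartMap s₀ y₀ j w) (fderiv ℝ (chartMap s₀ y₀ j) w u) ∈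
    Submodule.span ℝ {chartField y₀ X₁ (chartMap s₀ y₀ j w),
      chartField y₀ X₂ (chartMap s₀ y₀ j w)} := by
  have h1 := hJ (chartInv s₀ w) (fromChart s₀ _ u)
  rw [end_fromChart hw rfl, mfderiv_chartMap hw hj hjs, mfderiv_chartMap hw hj hjs,
    end_fromChart (chartMap_mem_chartDom hj) (chartInv_chartMap hj), ← map_sub,
    fromChart_mem_iff hD (chartMap_mem_chartDom hj) (chartInv_chartMap hj)] at h1
  exact h1

/-- A transversal complex structure induces an endomorphism field on a transversal. -/
theorem exists_induced
    (hc : ∀ s, IsCompl (mfderiv 𝓘(ℝ, V) 𝓘(ℝ, F) j s).range (D (j s)))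
    (hi : ∀ s, Function.Injective (mfderiv 𝓘(ℝ, V) 𝓘(ℝ, F) j s)) :
    ∃ JS : Π s : S, TangentSpace 𝓘(ℝ, V) s →L[ℝ] TangentSpace 𝓘(ℝ, V) s,
      ∀ s u, mfderiv 𝓘(ℝ, V) 𝓘(ℝ, F) j s (JS s u) -
        I (j s) (mfderiv 𝓘(ℝ, V) 𝓘(ℝ, F) j s u) ∈ D (j s) := by
  have key : ∀ s, ∃ JS : TangentSpace 𝓘(ℝ, V) s →L[ℝ] TangentSpace 𝓘(ℝ, V) s,
      ∀ u, mfderiv 𝓘(ℝ, V) 𝓘(ℝ, F) j s (JS u) -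
        I (j s) (mfderiv 𝓘(ℝ, V) 𝓘(ℝ, F) j s u) ∈ D (j s) := by
    intro s
    let A : V →L[ℝ] F := mfderiv 𝓘(ℝ, V) 𝓘(ℝ, F) j s
    let D' : Submodule ℝ F := D (j s)
    let I' : F →L[ℝ] F := I (j s)
    have hcs : IsCompl A.range D' := hc s
    -- `JS` is `I` read through `T_sS ≅ TN / D`: apply `I`, project to the image of `T_sS` along
    -- `D`, and invert the differential of `j`.
    let e := LinearEquiv.ofInjective A.toLinearMap (hi s)
    let L : F →ₗ[ℝ] V := e.symm.toLinearMap ∘ₗ Submodule.projectionOnto A.range D' hcs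
    have hL : ∀ x, A (L x) - x ∈ D' := fun x => by
      have h1 : A (L x) = Submodule.projectionOnto A.range D' hcs x :=
        congrArg Subtype.val (e.apply_symm_apply _)
      rw [h1]
      have h2 := Submodule.projection_add_projection_eq_self hcs x
      have h3 : A.range.projection D' hcs x - x = -D'.projection A.range hcs.symm x := by
        rw [sub_eq_iff_eq_add, neg_add_eq_sub, eq_sub_iff_add_eq, h2]
      rw [Submodule.coe_projectionOnto_apply, h3]
      exact neg_mem (Submodule.projection_apply_mem hcs.symm x)
    let JS : V →L[ℝ] V := LinearMap.toContinuousLinearMap (L ∘ₗ I'.toLinearMap ∘ₗ A.toLinearMap)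
    exact ⟨JS, fun u => hL (I' (A u))⟩
  choose JS hJS using key
  exact ⟨JS, hJS⟩

namespace LocallyTrans

variable (hl : LocallyTrans X₁ X₂ I h) (hD : ∀ y, D y = Submodule.span ℝ {X₁ y, X₂ y})
include hl hD

/-- The structure induced on a transversal is Kähler. -/
theorem exists_kahler (hjs : ContMDiff 𝓘(ℝ, V) 𝓘(ℝ, F) ∞ j)
    (hi : ∀ s, Function.Injective (mfderiv 𝓘(ℝ, V) 𝓘(ℝ, F) j s))
    (hc : ∀ s, IsCompl (mfderiv 𝓘(ℝ, V) 𝓘(ℝ, F) j s).range (D (j s))) :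
    ∃ (g : ContMDiffRiemannianMetric 𝓘(ℝ, V) ∞ V (TangentSpace 𝓘(ℝ, V) : S → Type _))
      (JS : Π s : S, TangentSpace 𝓘(ℝ, V) s →L[ℝ] TangentSpace 𝓘(ℝ, V) s),
      (∀ s u v, g.inner s u v = h (j s) (mfderiv 𝓘(ℝ, V) 𝓘(ℝ, F) j s u)
        (mfderiv 𝓘(ℝ, V) 𝓘(ℝ, F) j s v)) ∧
      (∀ s u, mfderiv 𝓘(ℝ, V) 𝓘(ℝ, F) j s (JS s u) -
        I (j s) (mfderiv 𝓘(ℝ, V) 𝓘(ℝ, F) j s u) ∈ D (j s)) ∧ IsKahler g JS := by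
  have hmd : ∀ s, MDifferentiableAt 𝓘(ℝ, V) 𝓘(ℝ, F) j s := fun s =>
    (hjs s).mdifferentiableAt (by simp)
  -- Transversality: identities between vectors of `S` need to be checked only modulo `D` after
  -- applying `dj`.
  have zero : ∀ s u, mfderiv 𝓘(ℝ, V) 𝓘(ℝ, F) j s u ∈ D (j s) → u = 0 := fun s u hu => by
    have h1 : mfderiv 𝓘(ℝ, V) 𝓘(ℝ, F) j s u ∈ (⊥ : Submodule ℝ _) := by
      rw [← (hc s).inf_eq_bot]
      exact ⟨⟨u, rfl⟩, hu⟩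
    exact hi s ((Submodule.mem_bot ℝ).1 h1 |>.trans (map_zero _).symm)
  have hpt := fun y => hl.pointwise hD y
  obtain ⟨JS, hJS⟩ := exists_induced (I := I) hc hi
  have hsm : ∀ s, ContDiffAt ℝ ∞ (chartMap s (j s) j : V → F) (chartPt s) := fun s => by
    refine contDiffAt_chartMap (chartPt_mem s) ?_ (hjs _)
    rw [chartInv_chartPt]
    exact mem_chart_source F (j s)
  have hform : ∀ (α : Π y : N, TangentSpace 𝓘(ℝ, F) y →L[ℝ] TangentSpace 𝓘(ℝ, F) y →L[ℝ] ℝ) s,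
      chartForm s (pullField j α) =ᶠ[𝓝 (chartPt (E := V) s)]
        pullBilin (chartMap s (j s) j) (chartForm (j s) α) := fun α s => by
    filter_upwards [eventually_chart hjs s] with w hw
    exact chartForm_pullField hw.1 hw.2 (hmd _)
  have hev : ∀ s, ∀ᶠ w in 𝓝 (chartPt (E := V) s), ∀ v,
      fderiv ℝ (chartMap s (j s) j) w (chartEnd s JS w v) -
      chartEnd (j s) I (chartMap s (j s) j w) (fderiv ℝ (chartMap s (j s) j) w v) ∈
      Submodule.span ℝ {chartField (j s) X₁ (chartMap s (j s) j w),
      chartField (j s) X₂ (chartMap s (j s) j w)} := fun s => by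
    filter_upwards [eventually_chart hjs s] with w hw v
    exact induced_chart hD hJS hw.1 hw.2 (hmd _) v
  have ht : ∀ s x, fderiv ℝ (chartMap s (j s) j) (chartPt (E := V) s) x ∈
      Submodule.span ℝ {chartField (j s) X₁ (chartMap s (j s) j (chartPt s)),
        chartField (j s) X₂ (chartMap s (j s) j (chartPt s))} → x = 0 := fun s x hx => by
    have hw := (eventually_chart hjs s).self_of_nhds
    rw [← fromChart_mem_iff hD (chartMap_mem_chartDom hw.2) (chartInv_chartMap hw.2),
      ← mfderiv_chartMap hw.1 hw.2 (hmd _)] at hx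
    have h1 := congrArg (toChart (E := V) s _) (zero _ _ hx)
    rwa [toChart_fromChart (chartInv_mem_source hw.1), map_zero] at h1
  have hsq : ∀ s v, JS s (JS s v) = -v := fun s v => by
    rw [← add_eq_zero_iff_eq_neg]
    refine zero s _ ?_
    have h1 := hJS s (JS s v)
    have h2 := (hpt (j s)).2.2.1 _ (hJS s v)
    rw [map_sub, hl.sq, sub_neg_eq_add] at h2
    have h3 := add_mem h1 h2
    rw [map_add]
    convert h3 using 1
    abel
  -- `dj ∘ JS` and `I ∘ dj` differ by elements of `D`, which `h` annihilates.
  have hdiff : ∀ s u v, h (j s) u (mfderiv 𝓘(ℝ, V) 𝓘(ℝ, F) j s (JS s v)) =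
      h (j s) u (I (j s) (mfderiv 𝓘(ℝ, V) 𝓘(ℝ, F) j s v)) := fun s u v => by
    rw [← sub_eq_zero, ← map_sub, (hpt (j s)).1, (hpt (j s)).2.1 _ (hJS s v)]
  have hdiff' : ∀ s u v, h (j s) (mfderiv 𝓘(ℝ, V) 𝓘(ℝ, F) j s (JS s v)) u =
      h (j s) (I (j s) (mfderiv 𝓘(ℝ, V) 𝓘(ℝ, F) j s v)) u := fun s u v => by
    rw [(hpt (j s)).1, hdiff, (hpt (j s)).1]
  have gpos : ∀ s v, v ≠ 0 → 0 < pullField j h s v v := fun s v hv => by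
    refine lt_of_le_of_ne ((hpt (j s)).2.2.2.2.1 _) fun h0 => hv (zero s v ?_)
    exact (hpt (j s)).2.2.2.2.2 _ h0.symm
  let g : ContMDiffRiemannianMetric 𝓘(ℝ, V) ∞ V (TangentSpace 𝓘(ℝ, V) : S → Type _) :=
    { inner := pullField j h
      symm := fun s u v => (hpt (j s)).1 _ _
      pos := gpos
      isVonNBounded := fun s => isVonNBounded_of_pos (V := V) (pullField j h s) (gpos s)
      contMDiff := smoothForm_of_chart fun s => by
        obtain ⟨Ω, θ₁, θ₂, hΩ, hΩc, hT⟩ := hl (j s)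
        rw [contDiffAt_congr (hform h s)]
        refine contDiffAt_pullBilin (hsm s) ?_
        rw [chartMap_chartPt]
        exact hT.smooth_metric _ hΩ }
  refine ⟨g, JS, fun _ _ _ => rfl, hJS, ?_, fun s u v => ?_, ?_⟩
  · refine isIntegrableComplexStructure_of_chart (fun s => ?_) hsq fun s u v => ?_
    · obtain ⟨Ω, θ₁, θ₂, hΩ, hΩc, hT⟩ := hl (j s)
      exact hT.contDiffAt_induced (hsm s) (by rwa [chartMap_chartPt]) (hev s) (ht s)
    · obtain ⟨Ω, θ₁, θ₂, hΩ, hΩc, hT⟩ := hl (j s)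
      exact hT.nij_induced (hsm s) (by rwa [chartMap_chartPt]) (hev s) (ht s) u v
  · exact (hdiff' s _ u).trans ((hdiff s _ v).trans ((hpt (j s)).2.2.2.1 _ _))
  · have hω : (fun (s : S) u v => g.inner s u (JS s v)) =
        fun s u v => pullField j (fundamentalForm h I) s u v := by
      ext s u v
      exact hdiff s _ v
    rw [hω]
    have hskew : ∀ y u v, fundamentalForm h I y u v = -fundamentalForm h I y v u := fun y u v => by
      rw [fundamentalForm_apply, fundamentalForm_apply, ← (hpt y).2.2.2.1 u, hl.sq, map_neg,
        (hpt y).1 v]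
    have hωc : ∀ s : S, chartForm (j s) (fundamentalForm h I) =ᶠ[𝓝 (chartPt (E := F) (j s))]
        fundForm (chartForm (j s) h) (chartEnd (j s) I) := fun s => by
      filter_upwards [(isOpen_chartDom (j s)).mem_nhds (chartPt_mem (j s))] with z hz
        using chartForm_fundamentalForm hz
    have hωs : ∀ s : S, ContDiffAt ℝ ∞ (chartForm (j s) (fundamentalForm h I))
        (chartMap s (j s) j (chartPt (E := V) s)) := fun s => by
      obtain ⟨Ω, θ₁, θ₂, hΩ, hΩc, hT⟩ := hl (j s)
      rw [chartMap_chartPt, contDiffAt_congr (hωc s)]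
      exact contDiffAt_fundForm (hT.smooth_metric _ hΩ) (hT.smooth_complex _ hΩ)
    refine isClosedTwoForm_of_chart (fun s => ?_) (fun s u v => hskew _ _ _) fun s u v w => ?_
    · rw [contDiffAt_congr (hform _ s)]
      exact contDiffAt_pullBilin (hsm s) (hωs s)
    · obtain ⟨Ω, θ₁, θ₂, hΩ, hΩc, hT⟩ := hl (j s)
      rw [(hform _ s).fderiv_eq]
      refine fderiv_pullBilin_cyclic (hsm s) (hωs s) (fun u v => ?_) (fun u v x => ?_) u v w
      · rw [chartForm_apply, chartForm_apply, hskew]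
      · rw [chartMap_chartPt, (hωc s).fderiv_eq]
        exact hT.fundForm_closed hΩ u v x

end LocallyTrans

end Induced

/-! ### Basic forms under motion along the leaves of a manifold. -/

section Holonomy

variable {F : Type*} [NormedAddCommGroup F] [NormedSpace ℝ F] [FiniteDimensional ℝ F]
  {N : Type*} [TopologicalSpace N] [ChartedSpace F N] [IsManifold 𝓘(ℝ, F) ∞ N]
  {X₁ X₂ : Π y : N, TangentSpace 𝓘(ℝ, F) y}
  {I : Π y : N, TangentSpace 𝓘(ℝ, F) y →L[ℝ] TangentSpace 𝓘(ℝ, F) y}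
  {h : Π y : N, TangentSpace 𝓘(ℝ, F) y →L[ℝ] TangentSpace 𝓘(ℝ, F) y →L[ℝ] ℝ}
  {D : Π y : N, Submodule ℝ (TangentSpace 𝓘(ℝ, F) y)}
  {V : Type*} [NormedAddCommGroup V] [NormedSpace ℝ V] [FiniteDimensional ℝ V]
  {S : Type*} [TopologicalSpace S] [ChartedSpace V S] [IsManifold 𝓘(ℝ, V) ∞ S]
  {S' : Type*} [TopologicalSpace S'] [ChartedSpace V S'] [IsManifold 𝓘(ℝ, V) ∞ S']

/-- The form `α` is basic in the charts adapted to the transversal Kähler structure. -/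
def LocallyBasic (X₁ X₂ : Π y : N, TangentSpace 𝓘(ℝ, F) y)
    (I : Π y : N, TangentSpace 𝓘(ℝ, F) y →L[ℝ] TangentSpace 𝓘(ℝ, F) y)
    (h α : Π y : N, TangentSpace 𝓘(ℝ, F) y →L[ℝ] TangentSpace 𝓘(ℝ, F) y →L[ℝ] ℝ) : Prop :=
  ∀ y₀ : N, ∃ (Ω : Set F) (θ₁ θ₂ : F → F →L[ℝ] ℝ), chartPt y₀ ∈ Ω ∧
    TransFlat Ω (chartField y₀ X₁) (chartField y₀ X₂) θ₁ θ₂ (chartEnd y₀ I) (chartForm y₀ h) ∧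
    ∃ β, BasicForm Ω (chartField y₀ X₁) (chartField y₀ X₂) β ∧ 
      ∀ z ∈ Ω, chartForm y₀ α z = β z

theorem LocallyTrans.locallyBasic_metric (hl : LocallyTrans X₁ X₂ I h) :
    LocallyBasic X₁ X₂ I h h := fun y₀ => by
  obtain ⟨Ω, θ₁, θ₂, hΩ, hΩc, hT⟩ := hl y₀
  exact ⟨Ω, θ₁, θ₂, hΩ, hT, _, hT.basicForm_metric, fun _ _ => rfl⟩

theorem LocallyTrans.locallyBasic_fundamentalForm (hl : LocallyTrans X₁ X₂ I h) :
    LocallyBasic X₁ X₂ I h (fundamentalForm h I) := fun y₀ => by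
  obtain ⟨Ω, θ₁, θ₂, hΩ, hΩc, hT⟩ := hl y₀
  exact ⟨Ω, θ₁, θ₂, hΩ, hT, _, hT.basicForm_fundForm,
    fun z hz => chartForm_fundamentalForm (hΩc hz)⟩

/-- The germ determines base point and differential. As the base points are only propositionally
equal, vectors are compared in the model space. -/
theorem pullField_congr
    {α : Π y : N, TangentSpace 𝓘(ℝ, F) y →L[ℝ] TangentSpace 𝓘(ℝ, F) y →L[ℝ] ℝ} {f g : S → N} {s : S}
    (e : f =ᶠ[𝓝 s] g) (u v : TangentSpace 𝓘(ℝ, V) s) :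
    pullField f α s u v = pullField g α s u v := by
  have key : ∀ (y y' : N) (_ : y = y') (a b : F), α y a b = α y' a b := fun y y' e a b => by
    subst e
    rfl
  have hd : mfderiv 𝓘(ℝ, V) 𝓘(ℝ, F) f s = mfderiv 𝓘(ℝ, V) 𝓘(ℝ, F) g s := e.mfderiv_eq
  have hu : (mfderiv 𝓘(ℝ, V) 𝓘(ℝ, F) f s u : F) = mfderiv 𝓘(ℝ, V) 𝓘(ℝ, F) g s u :=
    congrArg (fun L : V →L[ℝ] F => L u) hd
  have hv : (mfderiv 𝓘(ℝ, V) 𝓘(ℝ, F) f s v : F) = mfderiv 𝓘(ℝ, V) 𝓘(ℝ, F) g s v :=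
    congrArg (fun L : V →L[ℝ] F => L v) hd
  exact (key _ _ e.self_of_nhds _ _).trans
    ((congrArg (fun a : F => α (g s) a (mfderiv 𝓘(ℝ, V) 𝓘(ℝ, F) f s v : F)) hu).trans
      (congrArg (fun a : F => α (g s) (mfderiv 𝓘(ℝ, V) 𝓘(ℝ, F) g s u : F) a) hv))

/-- The map `(t, s) ↦ H t s`, in charts. -/
def chartFlow (s₀ : S) (y₀ : N) (H : ℝ → S → N) (p : ℝ × V) : F :=
  extChartAt 𝓘(ℝ, F) y₀ (H p.1 (chartInv s₀ p.2))

variable {H : ℝ → S → N} {U : Set S} {s₀ : S} {y₀ : N} {w : V} {t : ℝ}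

theorem contMDiffAt_flow (hU : IsOpen U)
    (hH : ContMDiffOn (𝓘(ℝ, ℝ).prod 𝓘(ℝ, V)) 𝓘(ℝ, F) ∞ (fun p : ℝ × S => H p.1 p.2)
      (Set.univ ×ˢ U)) (t : ℝ) {s : S} (hs : s ∈ U) :
    ContMDiffAt (𝓘(ℝ, ℝ).prod 𝓘(ℝ, V)) 𝓘(ℝ, F) ∞ (fun p : ℝ × S => H p.1 p.2) (t, s) :=
  hH.contMDiffAt ((isOpen_univ.prod hU).mem_nhds ⟨trivial, hs⟩)

theorem contDiffAt_chartFlow (hU : IsOpen U)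
    (hH : ContMDiffOn (𝓘(ℝ, ℝ).prod 𝓘(ℝ, V)) 𝓘(ℝ, F) ∞ (fun p : ℝ × S => H p.1 p.2)
      (Set.univ ×ˢ U)) (hw : w ∈ chartDom s₀) (hwU : chartInv s₀ w ∈ U)
    (hy : H t (chartInv s₀ w) ∈ (chartAt F y₀).source) :
    ContDiffAt ℝ ∞ (chartFlow (F := F) s₀ y₀ H) (t, w) := by
  have h1 : ContMDiffAt (𝓘(ℝ, ℝ).prod 𝓘(ℝ, V)) (𝓘(ℝ, ℝ).prod 𝓘(ℝ, V)) ∞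
      (fun p : ℝ × V => (p.1, chartInv s₀ p.2)) (t, w) :=
    contMDiffAt_fst.prodMk ((contMDiffAt_chartInv hw).comp (t, w) contMDiffAt_snd)
  have h2 : ContMDiffAt (𝓘(ℝ, ℝ).prod 𝓘(ℝ, V)) 𝓘(ℝ, F) ∞ (chartFlow s₀ y₀ H) (t, w) :=
    ContMDiffAt.comp (t, w) (g := extChartAt 𝓘(ℝ, F) y₀) (contMDiffAt_chart hy)
      (ContMDiffAt.comp (t, w) (g := fun p : ℝ × S => H p.1 p.2)
        (contMDiffAt_flow hU hH t hwU) h1)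
  rw [← modelWithCornersSelf_prod, chartedSpaceSelf_prod] at h2
  exact h2.contDiffAt

/-- The time derivative in the chart is the coordinate image of the velocity of the moving point. -/
theorem fderiv_chartFlow_mem (hD : ∀ y, D y = Submodule.span ℝ {X₁ y, X₂ y}) (hU : IsOpen U)
    (hH : ContMDiffOn (𝓘(ℝ, ℝ).prod 𝓘(ℝ, V)) 𝓘(ℝ, F) ∞ (fun p : ℝ × S => H p.1 p.2)
      (Set.univ ×ˢ U)) (hw : w ∈ chartDom s₀) (hwU : chartInv s₀ w ∈ U)
    (hy : H t (chartInv s₀ w) ∈ (chartAt F y₀).source)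
    (hHD : mfderiv 𝓘(ℝ, ℝ) 𝓘(ℝ, F) (fun τ => H τ (chartInv s₀ w)) t (1 : ℝ) ∈
      D (H t (chartInv s₀ w))) :
    fderiv ℝ (chartFlow (F := F) s₀ y₀ H) (t, w) (1, 0) ∈
      Submodule.span ℝ {chartField y₀ X₁ (chartFlow s₀ y₀ H (t, w)),
        chartField y₀ X₂ (chartFlow s₀ y₀ H (t, w))} := by
  have hd : DifferentiableAt ℝ (chartFlow (F := F) s₀ y₀ H) (t, w) :=
    (contDiffAt_chartFlow hU hH hw hwU hy).differentiableAt (by simp)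
  have h1 : MDifferentiableAt 𝓘(ℝ, ℝ) 𝓘(ℝ, F) (fun τ => H τ (chartInv s₀ w)) t :=
    (ContMDiffAt.comp t (g := fun p : ℝ × S => H p.1 p.2) (f := fun τ => (τ, chartInv s₀ w))
      (contMDiffAt_flow hU hH t hwU)
      (contMDiffAt_id.prodMk contMDiffAt_const)).mdifferentiableAt (by simp)
  have h2 : mfderiv 𝓘(ℝ, ℝ) 𝓘(ℝ, F) (fun τ => chartFlow (F := F) s₀ y₀ H (τ, w)) t =
      (toChart (E := F) y₀ (H t (chartInv s₀ w))) ∘L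
        mfderiv 𝓘(ℝ, ℝ) 𝓘(ℝ, F) (fun τ => H τ (chartInv s₀ w)) t := by
    rw [← mfderiv_chart hy]
    exact mfderiv_comp t (g := extChartAt 𝓘(ℝ, F) y₀)
      ((contMDiffAt_chart hy).mdifferentiableAt (by simp)) h1
  rw [mfderiv_eq_fderiv] at h2
  have h3 : fderiv ℝ (fun τ => chartFlow (F := F) s₀ y₀ H (τ, w)) t 1 =
      fderiv ℝ (chartFlow (F := F) s₀ y₀ H) (t, w) (1, 0) := by
    have h5 : HasFDerivAt (fun τ => chartFlow (F := F) s₀ y₀ H (τ, w))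
        (fderiv ℝ (chartFlow s₀ y₀ H) (t, w) ∘L ContinuousLinearMap.inl ℝ ℝ V) t :=
      HasFDerivAt.comp (g := chartFlow s₀ y₀ H) (f := fun τ : ℝ => (τ, w)) t hd.hasFDerivAt
        (hasFDerivAt_prodMk_left t w)
    rw [h5.fderiv]
    simp
  have h4 := congrArg (fun L : ℝ →L[ℝ] F => L 1) h2
  rw [h3] at h4
  refine (fromChart_mem_iff hD (chart_mem_chartDom hy) (chartInv_chart hy) _).1 ?_
  have h5 := fromChart_toChart (E := F) hy
    (mfderiv 𝓘(ℝ, ℝ) 𝓘(ℝ, F) (fun τ => H τ (chartInv s₀ w)) t (1 : ℝ))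
  exact (congrArg (fun x => x ∈ D (H t (chartInv s₀ w)))
    ((congrArg (fromChart y₀ (H t (chartInv s₀ w))) h4).trans h5)).mpr hHD

/-- The invariance of basic forms, read in a chart around the point reached at time `t`. Tangency to
the leaves is needed at that time only, but for all nearby starting points. -/
theorem LocallyBasic.hasDerivAt_chart
    {α : Π y : N, TangentSpace 𝓘(ℝ, F) y →L[ℝ] TangentSpace 𝓘(ℝ, F) y →L[ℝ] ℝ}
    (hα : LocallyBasic X₁ X₂ I h α) (hD : ∀ y, D y = Submodule.span ℝ {X₁ y, X₂ y})
    (hU : IsOpen U)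
    (hH : ContMDiffOn (𝓘(ℝ, ℝ).prod 𝓘(ℝ, V)) 𝓘(ℝ, F) ∞ (fun p : ℝ × S => H p.1 p.2)
      (Set.univ ×ˢ U))
    (hHD : ∀ s ∈ U, mfderiv 𝓘(ℝ, ℝ) 𝓘(ℝ, F) (fun τ => H τ s) t (1 : ℝ) ∈ D (H t s))
    (hw : w ∈ chartDom s₀) (hwU : chartInv s₀ w ∈ U) (u v : V) :
    HasDerivAt (fun τ => pullField (H τ) α (chartInv s₀ w) (fromChart s₀ _ u) (fromChart s₀ _ v))
      0 t := by
  obtain ⟨y₀, hy₀⟩ : ∃ y₀, y₀ = H t (chartInv s₀ w) := ⟨_, rfl⟩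
  have hy : H t (chartInv s₀ w) ∈ (chartAt F y₀).source := by
    rw [← hy₀]
    exact mem_chart_source F y₀
  obtain ⟨Ω, θ₁, θ₂, hΩ, hT, β, hβ, hαβ⟩ := hα y₀
  have hq := contDiffAt_chartFlow hU hH hw hwU hy
  have hqΩ : chartFlow s₀ y₀ H (t, w) ∈ Ω := by
    rw [chartFlow, ← hy₀]
    exact hΩ
  have hdom : ∀ᶠ x in 𝓝 w, x ∈ chartDom s₀ ∧ chartInv s₀ x ∈ U :=
    ((isOpen_chartDom s₀).eventually_mem hw).and
      ((contMDiffAt_chartInv hw).continuousAt.eventually (hU.mem_nhds hwU))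
  have hcs : ∀ᶠ s in 𝓝 (chartInv s₀ w), H t s ∈ (chartAt F y₀).source := by
    have : ContinuousAt (fun s => H t s) (chartInv s₀ w) :=
      ContinuousAt.comp (g := fun p : ℝ × S => H p.1 p.2) (f := fun s => (t, s))
        (contMDiffAt_flow hU hH t hwU).continuousAt (by fun_prop)
    exact this.eventually ((chartAt F y₀).open_source.mem_nhds hy)
  have hct : ∀ᶠ τ in 𝓝 t, H τ (chartInv s₀ w) ∈ (chartAt F y₀).source := by
    have : ContinuousAt (fun τ => H τ (chartInv s₀ w)) t :=
      ContinuousAt.comp (g := fun p : ℝ × S => H p.1 p.2) (f := fun τ => (τ, chartInv s₀ w))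
        (contMDiffAt_flow hU hH t hwU).continuousAt (by fun_prop)
    exact this.eventually ((chartAt F y₀).open_source.mem_nhds hy)
  have key := BasicForm.hasDerivAt hT hβ hq hqΩ (by
    filter_upwards [hdom, (contMDiffAt_chartInv hw).continuousAt.eventually hcs] with x hx hxs
    exact fderiv_chartFlow_mem hD hU hH hx.1 hx.2 hxs (hHD _ hx.2)) u v
  refine key.congr_of_eventuallyEq ?_
  have hΩt : ∀ᶠ τ in 𝓝 t, chartFlow s₀ y₀ H (τ, w) ∈ Ω := by
    have : ContinuousAt (fun τ => chartFlow (F := F) s₀ y₀ H (τ, w)) t :=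
      ContinuousAt.comp (f := fun τ => (τ, w)) hq.continuousAt (by fun_prop)
    exact this.eventually (hT.isOpen.mem_nhds hqΩ)
  filter_upwards [hct, hΩt] with τ hτ hτΩ
  have hd : DifferentiableAt ℝ (chartFlow (F := F) s₀ y₀ H) (τ, w) :=
    (contDiffAt_chartFlow hU hH hw hwU hτ).differentiableAt (by simp)
  have hmd : MDifferentiableAt 𝓘(ℝ, V) 𝓘(ℝ, F) (H τ) (chartInv s₀ w) :=
    (ContMDiffAt.comp (chartInv s₀ w) (g := fun p : ℝ × S => H p.1 p.2) (f := fun s => (τ, s))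
      (contMDiffAt_flow hU hH τ hwU)
      (contMDiffAt_const.prodMk contMDiffAt_id)).mdifferentiableAt (by simp)
  have h3 : ∀ u, fderiv ℝ (chartMap s₀ y₀ (H τ)) w u =
      fderiv ℝ (chartFlow (F := F) s₀ y₀ H) (τ, w) (0, u) := fun u => by
    have h5 : HasFDerivAt (chartMap s₀ y₀ (H τ))
        (fderiv ℝ (chartFlow s₀ y₀ H) (τ, w) ∘L ContinuousLinearMap.inr ℝ ℝ V) w :=
      HasFDerivAt.comp (g := chartFlow s₀ y₀ H) (f := fun x : V => (τ, x)) w hd.hasFDerivAt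
        (hasFDerivAt_prodMk_right τ w)
    rw [h5.fderiv]
    simp
  have h4 := congrArg (fun B : V →L[ℝ] V →L[ℝ] ℝ => B u v)
    (chartForm_pullField (α := α) (j := H τ) hw hτ hmd)
  refine h4.trans ?_
  rw [pullBilin_apply, h3, h3, ← hαβ _ hτΩ]
  rfl

/-- Basic forms are invariant under moving along the leaves. -/
theorem LocallyBasic.pullField_eq
    {α : Π y : N, TangentSpace 𝓘(ℝ, F) y →L[ℝ] TangentSpace 𝓘(ℝ, F) y →L[ℝ] ℝ}
    (hα : LocallyBasic X₁ X₂ I h α) (hD : ∀ y, D y = Submodule.span ℝ {X₁ y, X₂ y})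
    (hU : IsOpen U)
    (hH : ContMDiffOn (𝓘(ℝ, ℝ).prod 𝓘(ℝ, V)) 𝓘(ℝ, F) ∞ (fun p : ℝ × S => H p.1 p.2)
      (Set.univ ×ˢ U))
    (hHD : ∀ t ∈ Set.Icc (0 : ℝ) 1, ∀ s ∈ U,
      mfderiv 𝓘(ℝ, ℝ) 𝓘(ℝ, F) (fun τ => H τ s) t (1 : ℝ) ∈ D (H t s))
    (s : S) (hs : s ∈ U) (u v : TangentSpace 𝓘(ℝ, V) s) :
    pullField (H 1) α s u v = pullField (H 0) α s u v := by
  revert s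
  refine forall_of_chart (E := V) fun s₀ hs u v => ?_
  have hz := chartPt_mem (E := V) s₀
  rw [← fromChart_toChart (chartInv_mem_source hz) u, ← fromChart_toChart (chartInv_mem_source hz) v]
  -- The derivative vanishes at all times in `[0, 1]`, the only ones at which the motion is assumed
  -- leafwise.
  have key : ∀ t ∈ Set.Icc (0 : ℝ) 1, _ := fun t ht =>
    hα.hasDerivAt_chart hD hU hH (hHD t ht) hz hs (toChart s₀ _ u) (toChart s₀ _ v)
  exact constant_of_has_deriv_right_zero (a := (0 : ℝ)) (b := 1)
    (fun t ht => (key t ht).continuousAt.continuousWithinAt)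
    (fun t ht => (key t ⟨ht.1, ht.2.le⟩).hasDerivWithinAt) 1 ⟨zero_le_one, le_rfl⟩

end Holonomy

/-! ### Holonomy transformations. -/

section Holonomy

universe u

variable {F : Type*} [NormedAddCommGroup F] [NormedSpace ℝ F] [FiniteDimensional ℝ F]
  {N : Type u} [TopologicalSpace N] [ChartedSpace F N] [IsManifold 𝓘(ℝ, F) ∞ N]
  {X₁ X₂ : Π y : N, TangentSpace 𝓘(ℝ, F) y}
  {I : Π y : N, TangentSpace 𝓘(ℝ, F) y →L[ℝ] TangentSpace 𝓘(ℝ, F) y}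
  {h : Π y : N, TangentSpace 𝓘(ℝ, F) y →L[ℝ] TangentSpace 𝓘(ℝ, F) y →L[ℝ] ℝ}
  {D : Π y : N, Submodule ℝ (TangentSpace 𝓘(ℝ, F) y)} {k : ℕ}
  {S : Type*} [TopologicalSpace S] [ChartedSpace (EuclideanSpace ℝ (Fin k)) S]
  [IsManifold 𝓘(ℝ, EuclideanSpace ℝ (Fin k)) ∞ S]
  {S' : Type*} [TopologicalSpace S'] [ChartedSpace (EuclideanSpace ℝ (Fin k)) S']
  [IsManifold 𝓘(ℝ, EuclideanSpace ℝ (Fin k)) ∞ S']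

local notation "V" => EuclideanSpace ℝ (Fin k)

namespace LocallyTrans

variable (hl : LocallyTrans X₁ X₂ I h) (hD : ∀ y, D y = Submodule.span ℝ {X₁ y, X₂ y})
include hl hD

theorem induced_right {j : S → N}
    {g : ContMDiffRiemannianMetric 𝓘(ℝ, V) ∞ V (TangentSpace 𝓘(ℝ, V) : S → Type _)}
    {JS : Π s : S, TangentSpace 𝓘(ℝ, V) s →L[ℝ] TangentSpace 𝓘(ℝ, V) s}
    (hg : IsInducedOn (k := k) D h I j g JS) (s : S) (u v : TangentSpace 𝓘(ℝ, V) s) :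
    g.inner s u (JS s v) = pullField j (fundamentalForm h I) s u v := by
  have hp := hl.pointwise hD (j s)
  rw [hg.metric, pullField_apply, fundamentalForm_apply, ← sub_eq_zero, ← map_sub, hp.1,
    hp.2.1 _ (hg.complex s v)]

/-- Holonomy transformations preserve the induced Kähler structures. -/
theorem holonomy {j : S → N} {j' : S' → N}
    (hj' : ContMDiff 𝓘(ℝ, V) 𝓘(ℝ, F) ∞ j')
    {g : ContMDiffRiemannianMetric 𝓘(ℝ, V) ∞ V (TangentSpace 𝓘(ℝ, V) : S → Type _)}
    {JS : Π s : S, TangentSpace 𝓘(ℝ, V) s →L[ℝ] TangentSpace 𝓘(ℝ, V) s}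
    {g' : ContMDiffRiemannianMetric 𝓘(ℝ, V) ∞ V (TangentSpace 𝓘(ℝ, V) : S' → Type _)}
    {JS' : Π s : S', TangentSpace 𝓘(ℝ, V) s →L[ℝ] TangentSpace 𝓘(ℝ, V) s}
    (hg : IsInducedOn (k := k) D h I j g JS) (hg' : IsInducedOn (k := k) D h I j' g' JS')
    {U : Set S} {φ : S → S'} (hφ : IsHolonomy (k := k) D j j' U φ) {s : S} (hs : s ∈ U) :
    (∀ u v, g'.inner (φ s) (mfderiv 𝓘(ℝ, V) 𝓘(ℝ, V) φ s u) (mfderiv 𝓘(ℝ, V) 𝓘(ℝ, V) φ s v)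
      = g.inner s u v) ∧
    ∀ u, mfderiv 𝓘(ℝ, V) 𝓘(ℝ, V) φ s (JS s u) = JS' (φ s) (mfderiv 𝓘(ℝ, V) 𝓘(ℝ, V) φ s u) := by
  obtain ⟨hU, hφs, H, hH, h01, hHD⟩ := hφ
  have hφd : MDifferentiableAt 𝓘(ℝ, V) 𝓘(ℝ, V) φ s :=
    (hφs.contMDiffAt (hU.mem_nhds hs)).mdifferentiableAt (by simp)
  have e0 : H 0 =ᶠ[𝓝 s] j := by
    filter_upwards [hU.mem_nhds hs] with x hx using (h01 x hx).1
  have e1 : H 1 =ᶠ[𝓝 s] j' ∘ φ := by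
    filter_upwards [hU.mem_nhds hs] with x hx using (h01 x hx).2
  have hcomp : mfderiv 𝓘(ℝ, V) 𝓘(ℝ, F) (j' ∘ φ) s =
      mfderiv 𝓘(ℝ, V) 𝓘(ℝ, F) j' (φ s) ∘L mfderiv 𝓘(ℝ, V) 𝓘(ℝ, V) φ s :=
    mfderiv_comp s ((hj' _).mdifferentiableAt (by simp)) hφd
  -- A basic form has the same pull-back at times `0` and `1`, where the motion is `j` and `j' ∘ φ`.
  have main : ∀ {α : Π y : N, TangentSpace 𝓘(ℝ, F) y →L[ℝ] TangentSpace 𝓘(ℝ, F) y →L[ℝ] ℝ},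
      LocallyBasic X₁ X₂ I h α → ∀ u v, pullField j' α (φ s) (mfderiv 𝓘(ℝ, V) 𝓘(ℝ, V) φ s u)
        (mfderiv 𝓘(ℝ, V) 𝓘(ℝ, V) φ s v) = pullField j α s u v := fun {α} hα u v => by
    have h1 := hα.pullField_eq hD hU hH hHD s hs u v
    rw [pullField_congr e0, pullField_congr e1] at h1
    rw [← h1, pullField_apply, pullField_apply, hcomp]
    rfl
  have hmet : ∀ u v, g'.inner (φ s) (mfderiv 𝓘(ℝ, V) 𝓘(ℝ, V) φ s u)
      (mfderiv 𝓘(ℝ, V) 𝓘(ℝ, V) φ s v) = g.inner s u v := fun u v => by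
    rw [hg'.metric, hg.metric]
    exact main hl.locallyBasic_metric u v
  refine ⟨hmet, fun u => ?_⟩
  -- The differential of `φ` preserves a positive definite metric, so it is injective; both
  -- transversals have dimension `k`, so it is bijective.
  have hinj : Function.Injective (mfderiv 𝓘(ℝ, V) 𝓘(ℝ, V) φ s) := by
    refine (injective_iff_map_eq_zero _).2 fun x hx => ?_
    by_contra hx0
    have h1 := g.pos s x hx0
    rw [← hmet, hx, map_zero] at h1
    exact lt_irrefl _ h1
  have hsurj : Function.Surjective (mfderiv 𝓘(ℝ, V) 𝓘(ℝ, V) φ s) :=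
    (LinearMap.injective_iff_surjective
      (f := (mfderiv 𝓘(ℝ, V) 𝓘(ℝ, V) φ s : V →L[ℝ] V).toLinearMap)).1 hinj
  rw [← sub_eq_zero]
  -- As `φ` preserves the metrics and the fundamental forms, the difference of the two sides is
  -- orthogonal to the image of the differential, and in particular to itself.
  by_contra hne
  have h1 := g'.pos (φ s) _ hne
  obtain ⟨x, hx⟩ := hsurj (mfderiv 𝓘(ℝ, V) 𝓘(ℝ, V) φ s (JS s u) -
    JS' (φ s) (mfderiv 𝓘(ℝ, V) 𝓘(ℝ, V) φ s u))
  nth_rewrite 1 [← hx] at h1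
  rw [map_sub, hmet, hl.induced_right hD hg, hl.induced_right hD hg',
    main hl.locallyBasic_fundamentalForm, sub_self] at h1
  exact lt_irrefl _ h1

omit [IsManifold 𝓘(ℝ, EuclideanSpace ℝ (Fin k)) ∞ S]
  [IsManifold 𝓘(ℝ, EuclideanSpace ℝ (Fin k)) ∞ S'] in
theorem isTransversalKahler : IsTransversalKahler D h I where
  smooth_metric := hl.smoothForm
  smooth_complex := hl.isIntegrable.smooth
  symm y := (hl.pointwise hD y).1
  vanish y := (hl.pointwise hD y).2.1
  preserve y := (hl.pointwise hD y).2.2.1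
  kahler k S _ _ _ _ _ j hj := by
    obtain ⟨g, JS, h1, h2, h3⟩ := hl.exists_kahler hD hj.submanifold.smooth
      hj.submanifold.immersion hj.complementary
    exact ⟨g, JS, ⟨h1, h2⟩, h3⟩
  holonomy k S S' _ _ _ _ _ _ _ _ _ _ j j' _ hj' g JS g' JS' hg hg' U φ hφ s hs :=
    hl.holonomy hD hj'.submanifold.smooth hg hg' hφ hs

end LocallyTrans

end Holonomy

/-! ### Injectivity and openness in charts. -/

section Charts

variable {E : Type*} [NormedAddCommGroup E] [NormedSpace ℝ E]
  {M : Type*} [TopologicalSpace M] [ChartedSpace E M] [IsManifold 𝓘(ℝ, E) ∞ M] {x₀ : M} {z : E}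

theorem isOpen_chartDom_inter {U : Set M} (hU : IsOpen U) (x₀ : M) :
    IsOpen (chartDom (E := E) x₀ ∩ chartInv x₀ ⁻¹' U) :=
  (contMDiffOn_chartInv x₀).continuousOn.isOpen_inter_preimage (isOpen_chartDom x₀) hU

theorem fromChart_injective (hz : z ∈ chartDom x₀) :
    Function.Injective (fromChart (E := E) x₀ (chartInv x₀ z)) :=
  Function.LeftInverse.injective (toChart_fromChart (chartInv_mem_source hz))

theorem chartEnd_fromChart {A : Π x : M, TangentSpace 𝓘(ℝ, E) x →L[ℝ] TangentSpace 𝓘(ℝ, E) x}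
    (hz : z ∈ chartDom x₀) (u : E) : fromChart x₀ (chartInv x₀ z) (chartEnd x₀ A z u) =
      A (chartInv x₀ z) (fromChart x₀ (chartInv x₀ z) u) :=
  fromChart_toChart (chartInv_mem_source hz) _

end Charts

/-! ### Metrics, endomorphisms and traces in charts. -/

section RiemannianCharts

variable {E : Type*} [NormedAddCommGroup E] [NormedSpace ℝ E] [FiniteDimensional ℝ E]
  {M : Type*} [TopologicalSpace M] [ChartedSpace E M] [IsManifold 𝓘(ℝ, E) ∞ M]
  [RiemannianBundle (fun x : M => TangentSpace 𝓘(ℝ, E) x)]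

/-- The Riemannian metric, as a field of bilinear forms. -/
def metricForm (x : M) : TangentSpace 𝓘(ℝ, E) x →L[ℝ] TangentSpace 𝓘(ℝ, E) x →L[ℝ] ℝ := innerSL ℝ

theorem smoothForm_metricForm
    [IsContMDiffRiemannianBundle 𝓘(ℝ, E) ∞ E (fun x : M => TangentSpace 𝓘(ℝ, E) x)] :
    SmoothForm (metricForm (E := E) (M := M)) := by
  obtain ⟨g, hg, h⟩ := IsContMDiffRiemannianBundle.exists_contMDiff (IB := 𝓘(ℝ, E)) (n := ∞) (F := E)
    (E := fun x : M => TangentSpace 𝓘(ℝ, E) x)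
  have e : metricForm (E := E) (M := M) = g := by
    funext x
    exact ContinuousLinearMap.ext fun u => ContinuousLinearMap.ext fun v => h x u v
  rw [e]
  exact hg

variable {x₀ : M} {z : E}
  {cov : CovariantDerivative 𝓘(ℝ, E) E (TangentSpace 𝓘(ℝ, E) : M → Type _)}

/-- The metric, in the chart at `x₀`. -/
def chartMetric (x₀ : M) : E → E →L[ℝ] E →L[ℝ] ℝ := chartForm x₀ (metricForm (E := E))

theorem chartMetric_apply (z u v : E) : chartMetric x₀ z u v =
    inner ℝ (fromChart x₀ (chartInv x₀ z) u) (fromChart x₀ (chartInv x₀ z) v) := rfl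

theorem chartMetric_toChart (hz : z ∈ chartDom x₀)
    (u v : TangentSpace 𝓘(ℝ, E) (chartInv x₀ z)) :
    chartMetric x₀ z (toChart x₀ _ u) (toChart x₀ _ v) = inner ℝ u v := by
  rw [chartMetric_apply, fromChart_toChart (chartInv_mem_source hz),
    fromChart_toChart (chartInv_mem_source hz)]

theorem contDiffAt_chartMetric
    [IsContMDiffRiemannianBundle 𝓘(ℝ, E) ∞ E (fun x : M => TangentSpace 𝓘(ℝ, E) x)]
    (hz : z ∈ chartDom x₀) : ContDiffAt ℝ ∞ (chartMetric x₀) z :=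
  (contMDiffAt_form_iff_chart hz).1 (smoothForm_metricForm.contMDiffAt)

theorem chartMetric_symm (u v : E) : chartMetric x₀ z u v = chartMetric x₀ z v u := by
  rw [chartMetric_apply, chartMetric_apply, real_inner_comm]

theorem chartMetric_nonneg (u : E) : 0 ≤ chartMetric x₀ z u u := by
  rw [chartMetric_apply]
  exact real_inner_self_nonneg

theorem chartMetric_definite (hz : z ∈ chartDom x₀) (u : E) (h : chartMetric x₀ z u u = 0) :
    u = 0 := by
  rw [chartMetric_apply, inner_self_eq_zero] at h
  exact fromChart_injective hz (h.trans (map_zero _).symm)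

/-- The covariant derivative of a vector field, in the chart at `x₀`. -/
theorem chartEnd_cov {ξ : Π x : M, TangentSpace 𝓘(ℝ, E) x} (hz : z ∈ chartDom x₀)
    (hξ : DifferentiableAt ℝ (chartField x₀ ξ) z) :
    chartEnd x₀ (cov ξ) z = covOp (christoffel cov x₀) (chartField x₀ ξ) z := by
  ext u
  exact cov_chart cov hz hξ u

theorem chartEnd_toChart {A : Π x : M, TangentSpace 𝓘(ℝ, E) x →L[ℝ] TangentSpace 𝓘(ℝ, E) x}
    (hz : z ∈ chartDom x₀) (u : TangentSpace 𝓘(ℝ, E) (chartInv x₀ z)) :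
    chartEnd x₀ A z (toChart x₀ _ u) = toChart x₀ _ (A (chartInv x₀ z) u) := by
  change toChart x₀ _ (A (chartInv x₀ z) (fromChart x₀ _ (toChart x₀ _ u))) = _
  rw [fromChart_toChart (chartInv_mem_source hz)]

theorem chartEnd_mul {A C : Π x : M, TangentSpace 𝓘(ℝ, E) x →L[ℝ] TangentSpace 𝓘(ℝ, E) x}
    (hz : z ∈ chartDom x₀) : chartEnd x₀ A z * chartEnd x₀ C z =
      chartEnd x₀ (fun x => A x ∘L C x) z := by
  ext u
  exact congrArg (fun w => toChart x₀ _ (A (chartInv x₀ z) w)) (chartEnd_fromChart hz u)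

/-- The conjugation of endomorphisms by the chart at `x₀`. -/
def conjChart (x₀ x : M) :
    (TangentSpace 𝓘(ℝ, E) x →L[ℝ] TangentSpace 𝓘(ℝ, E) x) →ₗ[ℝ] (E →L[ℝ] E) where
  toFun A := toChart x₀ x ∘L A ∘L fromChart x₀ x
  map_add' A C := by ext; simp
  map_smul' c A := by ext; simp

theorem conjChart_mem_span {x : M} {A J₁ J₂ J₃ : TangentSpace 𝓘(ℝ, E) x →L[ℝ] TangentSpace 𝓘(ℝ, E) x}
    (h : A ∈ Submodule.span ℝ {J₁, J₂, J₃}) : conjChart x₀ x A ∈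
      Submodule.span ℝ {conjChart x₀ x J₁, conjChart x₀ x J₂, conjChart x₀ x J₃} := by
  obtain ⟨a, b, c, rfl⟩ := Submodule.mem_span_triple.1 h
  exact Submodule.mem_span_triple.2 ⟨a, b, c, by simp only [map_add, map_smul]⟩

theorem endTrace_conjChart {x : M} (hx : x ∈ (chartAt E x₀).source)
    (A : TangentSpace 𝓘(ℝ, E) x →L[ℝ] TangentSpace 𝓘(ℝ, E) x) :
    endTrace (conjChart x₀ x A) = LinearMap.trace ℝ (TangentSpace 𝓘(ℝ, E) x) A.toLinearMap := by
  let e : TangentSpace 𝓘(ℝ, E) x ≃ₗ[ℝ] E := LinearEquiv.ofLinearMap (toChart x₀ x).toLinearMap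
    (fromChart x₀ x).toLinearMap (LinearMap.ext fun v => toChart_fromChart hx v)
    (LinearMap.ext fun v => fromChart_toChart hx v)
  exact LinearMap.trace_conj' A.toLinearMap e

end RiemannianCharts

/-! ### The Levi-Civita connection and the scalar curvature in charts. -/

section QuaternionicCharts

variable {E : Type*} [NormedAddCommGroup E] [NormedSpace ℝ E] [FiniteDimensional ℝ E]
  {M : Type*} [TopologicalSpace M] [T2Space M] [ChartedSpace E M] [IsManifold 𝓘(ℝ, E) ∞ M]
  [RiemannianBundle (fun x : M => TangentSpace 𝓘(ℝ, E) x)]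
  {cov : CovariantDerivative 𝓘(ℝ, E) E (TangentSpace 𝓘(ℝ, E) : M → Type _)}
  {Q : Π x : M, Submodule ℝ (TangentSpace 𝓘(ℝ, E) x →L[ℝ] TangentSpace 𝓘(ℝ, E) x)}
  {x₀ : M} {z : E}

theorem differentiableAt_ofChart_const (u : E) (hz : z ∈ chartDom x₀) :
    DifferentiableAt ℝ (chartField x₀ (ofChart x₀ fun _ => u)) z :=
  (chartField_ofChart_eventuallyEq _ hz).differentiableAt_iff.2 (differentiableAt_const u)

theorem ofChart_const (u : E) :
    ofChart x₀ (fun _ => u) (chartInv x₀ z) = fromChart x₀ (chartInv x₀ z) u := rfl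

theorem cov_ofChart_const (u v : E) (hz : z ∈ chartDom x₀) :
    cov (ofChart x₀ fun _ => v) (chartInv x₀ z) (fromChart x₀ (chartInv x₀ z) u) =
      fromChart x₀ (chartInv x₀ z) (christoffel cov x₀ z u v) := by
  have h := cov_chart cov hz (differentiableAt_ofChart_const v hz) u
  rw [(chartField_ofChart_eventuallyEq _ hz).fderiv_eq, chartField_ofChart _ hz] at h
  rw [fderiv_fun_const, Pi.zero_apply, zero_apply, zero_add] at h
  rw [← h, fromChart_toChart (chartInv_mem_source hz)]

namespace IsLeviCivita

variable (hcov : IsLeviCivita cov) (hz : z ∈ chartDom x₀)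
include hcov hz

/-- The torsion vanishes on fields with constant coordinates, whose bracket is zero. -/
theorem christoffel_symm (u v : E) : christoffel cov x₀ z u v = christoffel cov x₀ z v u := by
  have hu := (mdifferentiableAt_section_iff_chart hz).2 (differentiableAt_ofChart_const u hz)
  have hv := (mdifferentiableAt_section_iff_chart hz).2 (differentiableAt_ofChart_const v hz)
  have h := CovariantDerivative.torsion_apply cov hu hv
  rw [hcov.torsion, mlieBracket_chart hz (differentiableAt_ofChart_const u hz)
    (differentiableAt_ofChart_const v hz), (chartField_ofChart_eventuallyEq _ hz).fderiv_eq,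
    (chartField_ofChart_eventuallyEq _ hz).fderiv_eq, ofChart_const u, ofChart_const v,
    cov_ofChart_const u v hz, cov_ofChart_const v u hz] at h
  simp only [fderiv_fun_const, Pi.zero_apply, zero_apply, sub_zero, map_zero] at h
  exact fromChart_injective hz (sub_eq_zero.1 h.symm)

theorem metricAt [IsContMDiffRiemannianBundle 𝓘(ℝ, E) ∞ E (fun x : M => TangentSpace 𝓘(ℝ, E) x)] :
    MetricAt (chartMetric x₀) (christoffel cov x₀) z := by
  intro u v w
  have hB : DifferentiableAt ℝ (chartMetric x₀) z :=
    (contDiffAt_chartMetric hz).differentiableAt (by simp)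
  have h := hcov.metric (chartInv x₀ z) _ _ (smoothFieldAt_ofChart hz (contDiffAt_const (c := v)))
    (smoothFieldAt_ofChart hz (contDiffAt_const (c := w))) (fromChart x₀ _ u)
  have e : (fun y => inner ℝ (ofChart x₀ (fun _ => v) (chartInv x₀ y))
      (ofChart x₀ (fun _ => w) (chartInv x₀ y))) = fun y => chartMetric x₀ y v w := rfl
  have hd : DifferentiableAt ℝ (fun y => chartMetric x₀ y v w) z :=
    (hB.clm_apply (differentiableAt_const v)).clm_apply (differentiableAt_const w)
  have h1 := tangentDeriv_chart (f := fun x : M => inner ℝ (ofChart x₀ (fun _ => v) x)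
    (ofChart x₀ (fun _ => w) x)) hz hd u
  rw [h1, cov_ofChart_const u v hz, cov_ofChart_const u w hz] at h
  refine Eq.trans ?_ h
  have h2 : fderiv ℝ (fun y => chartMetric x₀ y v w) z u = fderiv ℝ (chartMetric x₀) z u v w := by
    rw [fderiv_clm_apply (hB.clm_apply (differentiableAt_const v)) (differentiableAt_const w),
      fderiv_clm_apply hB (differentiableAt_const v)]
    simp
  exact h2.symm

end IsLeviCivita

/-- The covariant derivative of a field of endomorphisms, in the chart at `x₀`. -/
theorem IsCovDerivEnd.covEnd_chart
    {A : Π x : M, TangentSpace 𝓘(ℝ, E) x →L[ℝ] TangentSpace 𝓘(ℝ, E) x} (hz : z ∈ chartDom x₀)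
    (hA : DifferentiableAt ℝ (chartEnd x₀ A) z) {u : E}
    {C : TangentSpace 𝓘(ℝ, E) (chartInv x₀ z) →L[ℝ] TangentSpace 𝓘(ℝ, E) (chartInv x₀ z)}
    (h : IsCovDerivEnd cov A (chartInv x₀ z) (fromChart x₀ _ u) C) :
    covEnd (christoffel cov x₀) (chartEnd x₀ A) z u = conjChart x₀ (chartInv x₀ z) C := by
  ext v
  have h1 := h _ (smoothFieldAt_ofChart hz (contDiffAt_const (c := v)))
  have e : chartField x₀ (fun y => A y (ofChart x₀ (fun _ => v) y)) =ᶠ[𝓝 z]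
      fun y => chartEnd x₀ A y v := by
    filter_upwards [(isOpen_chartDom x₀).mem_nhds hz] with y hy
    rw [chartEnd_apply_chartField _ _ hy, chartField_ofChart _ hy]
  have hd : DifferentiableAt ℝ (fun y => chartEnd x₀ A y v) z :=
    hA.clm_apply (differentiableAt_const v)
  have h2 := cov_chart cov hz (e.differentiableAt_iff.2 hd) u
  rw [e.fderiv_eq, e.eq_of_nhds, fderiv_clm_apply hA (differentiableAt_const v)] at h2
  have h3 : toChart x₀ (chartInv x₀ z) (A (chartInv x₀ z)
      (cov (ofChart x₀ fun _ => v) (chartInv x₀ z) (fromChart x₀ (chartInv x₀ z) u))) =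
      chartEnd x₀ A z (christoffel cov x₀ z u v) := by
    rw [cov_ofChart_const u v hz]
    rfl
  have h4 := congrArg (toChart x₀ (chartInv x₀ z)) h1
  rw [map_sub, h2, h3] at h4
  refine Eq.trans ?_ h4
  simp [covEnd, mul_apply_eq_comp]

/-- The chart image of the standard orthonormal basis, reindexed along the equality of the
dimensions of the tangent space and of `E`. Reindexing leaves double sums unchanged whatever `T` is.
-/
theorem exists_orthonormal (hz : z ∈ chartDom x₀) :
    ∃ e : Module.Basis (Fin (Module.finrank ℝ E)) ℝ E,
    (∀ i j, chartMetric x₀ z (e i) (e j) = if i = j then 1 else 0) ∧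
    ∀ T : E → E → E → E → ℝ, (∑ i, ∑ j, T (e i) (e j) (e j) (e i)) =
      ∑ i, ∑ j, T
        (toChart x₀ _ (stdOrthonormalBasis ℝ (TangentSpace 𝓘(ℝ, E) (chartInv x₀ z)) i))
        (toChart x₀ _ (stdOrthonormalBasis ℝ (TangentSpace 𝓘(ℝ, E) (chartInv x₀ z)) j))
        (toChart x₀ _ (stdOrthonormalBasis ℝ (TangentSpace 𝓘(ℝ, E) (chartInv x₀ z)) j))
        (toChart x₀ _ (stdOrthonormalBasis ℝ (TangentSpace 𝓘(ℝ, E) (chartInv x₀ z)) i)) := by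
  have hx := chartInv_mem_source hz
  let L : TangentSpace 𝓘(ℝ, E) (chartInv x₀ z) ≃ₗ[ℝ] E := LinearEquiv.ofLinearMap
    (toChart x₀ (chartInv x₀ z)).toLinearMap (fromChart x₀ (chartInv x₀ z)).toLinearMap
    (LinearMap.ext fun v => toChart_fromChart hx v) (LinearMap.ext fun v => fromChart_toChart hx v)
  let s := stdOrthonormalBasis ℝ (TangentSpace 𝓘(ℝ, E) (chartInv x₀ z))
  let σ := finCongr L.finrank_eq
  refine ⟨(s.toBasis.map L).reindex σ, fun i j => ?_, fun T => ?_⟩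
  · have h1 : ∀ i, ((s.toBasis.map L).reindex σ) i = toChart x₀ _ (s (σ.symm i)) := fun i => by
      rw [Module.Basis.reindex_apply, Module.Basis.map_apply, OrthonormalBasis.coe_toBasis]
      rfl
    rw [h1, h1, chartMetric_toChart hz]
    refine (orthonormal_iff_ite.1 s.orthonormal _ _).trans ?_
    simp
  · have h1 : ∀ i, ((s.toBasis.map L).reindex σ) (σ i) = toChart x₀ _ (s i) := fun i => by
      rw [Module.Basis.reindex_apply, Equiv.symm_apply_apply, Module.Basis.map_apply,
        OrthonormalBasis.coe_toBasis]
      rfl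
    rw [← Equiv.sum_comp σ]
    refine Finset.sum_congr rfl fun i _ => ?_
    rw [← Equiv.sum_comp σ]
    refine Finset.sum_congr rfl fun j _ => ?_
    rw [h1, h1]

theorem scalarCurvature_chart (hcov : IsLeviCivita cov) (hz : z ∈ chartDom x₀) :
    ∃ e : Module.Basis (Fin (Module.finrank ℝ E)) ℝ E,
    (∀ i j, chartMetric x₀ z (e i) (e j) = if i = j then 1 else 0) ∧
    ∑ i, ∑ j, chartMetric x₀ z (flatCurvature (christoffel cov x₀) z (e i) (e j) (e j)) (e i) =
      scalarCurvature cov (chartInv x₀ z) := by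
  have hx := chartInv_mem_source hz
  obtain ⟨e, he, hT⟩ := exists_orthonormal hz
  refine ⟨e, he, (hT fun a b c d =>
    chartMetric x₀ z (flatCurvature (christoffel cov x₀) z a b c) d).trans ?_⟩
  refine Finset.sum_congr rfl fun i _ => Finset.sum_congr rfl fun j _ => ?_
  rw [← curvature_chart cov hcov.smooth hz, fromChart_toChart hx, fromChart_toChart hx,
    chartMetric_toChart hz]

end QuaternionicCharts

/-! ### Quaternionic Kähler manifolds in charts. -/

section QuaternionicKahlerCharts

variable {E : Type*} [NormedAddCommGroup E] [NormedSpace ℝ E] [FiniteDimensional ℝ E]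
  {M : Type*} [TopologicalSpace M] [T2Space M] [ChartedSpace E M] [IsManifold 𝓘(ℝ, E) ∞ M]
  [RiemannianBundle (fun x : M => TangentSpace 𝓘(ℝ, E) x)]
  {cov : CovariantDerivative 𝓘(ℝ, E) E (TangentSpace 𝓘(ℝ, E) : M → Type _)}
  {Q : Π x : M, Submodule ℝ (TangentSpace 𝓘(ℝ, E) x →L[ℝ] TangentSpace 𝓘(ℝ, E) x)}
  {x₀ : M} {z : E}

theorem chartMetric_conjChart_skew {A : TangentSpace 𝓘(ℝ, E) (chartInv x₀ z) →L[ℝ]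
      TangentSpace 𝓘(ℝ, E) (chartInv x₀ z)} (hz : z ∈ chartDom x₀)
    (hA : ∀ v w, inner ℝ (A v) w = -inner ℝ v (A w)) (v w : E) :
    chartMetric x₀ z (conjChart x₀ _ A v) w = -chartMetric x₀ z v (conjChart x₀ _ A w) := by
  have hx := chartInv_mem_source hz
  have h := hA (fromChart x₀ _ v) (fromChart x₀ _ w)
  rw [← chartMetric_toChart hz, ← chartMetric_toChart hz, toChart_fromChart hx,
    toChart_fromChart hx] at h
  exact h

theorem flatCurvature_conjChart (hcov : IsLeviCivita cov) (hz : z ∈ chartDom x₀)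
    {A : TangentSpace 𝓘(ℝ, E) (chartInv x₀ z) →L[ℝ] TangentSpace 𝓘(ℝ, E) (chartInv x₀ z)}
    (h : ∀ u v w : TangentSpace 𝓘(ℝ, E) (chartInv x₀ z),
      A (curvature cov _ u v w) - curvature cov _ (A u) v w - curvature cov _ u (A v) w
        - curvature cov _ u v (A w) = 0) (u v w : E) :
    conjChart x₀ _ A (flatCurvature (christoffel cov x₀) z u v w)
      - flatCurvature (christoffel cov x₀) z (conjChart x₀ _ A u) v w
      - flatCurvature (christoffel cov x₀) z u (conjChart x₀ _ A v) w
      - flatCurvature (christoffel cov x₀) z u v (conjChart x₀ _ A w) = 0 := by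
  have hx := chartInv_mem_source hz
  have e : ∀ u, fromChart x₀ _ (conjChart x₀ _ A u) = A (fromChart x₀ _ u) := fun u =>
    fromChart_toChart hx _
  have h1 := congrArg (toChart x₀ _) (h (fromChart x₀ _ u) (fromChart x₀ _ v) (fromChart x₀ _ w))
  rw [map_sub, map_sub, map_sub, map_zero, ← e, ← e, ← e, curvature_chart cov hcov.smooth hz,
    curvature_chart cov hcov.smooth hz, curvature_chart cov hcov.smooth hz] at h1
  have e' : ∀ c, conjChart x₀ _ A (toChart x₀ _ c) = toChart x₀ _ (A c) := fun c =>
    congrArg (fun c => toChart x₀ _ (A c)) (fromChart_toChart hx c)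
  rw [← curvature_chart cov hcov.smooth hz u v w, e']
  exact h1

variable [IsContMDiffRiemannianBundle 𝓘(ℝ, E) ∞ E (fun x : M => TangentSpace 𝓘(ℝ, E) x)]

/-- A quaternionic Kähler manifold, in a chart. -/
theorem IsQuaternionicKahler.exists_flatQK (hcov : IsLeviCivita cov)
    (hQ : IsQuaternionicKahler cov Q) (hscal : ∀ x, scalarCurvature cov x ≠ 0) (x₀ : M) :
    ∃ (Ω : Set E) (J₁ J₂ J₃ : E → E →L[ℝ] E), Ω ⊆ chartDom x₀ ∧ chartPt x₀ ∈ Ω ∧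
      FlatQK Ω (chartMetric x₀) (christoffel cov x₀) J₁ J₂ J₃ ∧
      (∀ z ∈ Ω, ∀ A ∈ Q (chartInv x₀ z),
        conjChart x₀ _ A ∈ Submodule.span ℝ {J₁ z, J₂ z, J₃ z}) ∧
      ∀ ξ P, IsKilling cov ξ → IsMomentMap cov Q ξ P →
        FlatMoment Ω (chartMetric x₀) (christoffel cov x₀) J₁ J₂ J₃ (chartField x₀ ξ)
          (chartEnd x₀ P) := by
  obtain ⟨U, hU, hxU, J₁, J₂, J₃, s₁, s₂, s₃, hJ⟩ := hQ.quaternionic x₀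
  -- The chart domain is cut down to the part lying over `U`, where the local quaternionic frame is
  -- defined.
  have hspan : ∀ z ∈ chartDom (E := E) x₀ ∩ chartInv x₀ ⁻¹' U, ∀ A ∈ Q (chartInv x₀ z),
      conjChart x₀ _ A ∈ Submodule.span ℝ {chartEnd x₀ J₁ z, chartEnd x₀ J₂ z, chartEnd x₀ J₃ z} := by
    intro z hz A hA
    rw [(hJ _ hz.2).2.2.2.2.2] at hA
    exact conjChart_mem_span hA
  have hmem : ∀ J ∈ ({J₁, J₂, J₃} : Set _), SmoothEndOn J U ∧ ∀ x ∈ U, J x ∈ Q x := by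
    rintro J (rfl | rfl | rfl)
    · exact ⟨s₁, fun x hx => by rw [(hJ x hx).2.2.2.2.2]; exact Submodule.subset_span (by simp)⟩
    · exact ⟨s₂, fun x hx => by rw [(hJ x hx).2.2.2.2.2]; exact Submodule.subset_span (by simp)⟩
    · exact ⟨s₃, fun x hx => by rw [(hJ x hx).2.2.2.2.2]; exact Submodule.subset_span (by simp)⟩
  refine ⟨_, chartEnd x₀ J₁, chartEnd x₀ J₂, chartEnd x₀ J₃, Set.inter_subset_left,
    ⟨chartPt_mem x₀, by rwa [Set.mem_preimage, chartInv_chartPt]⟩, ?_, hspan, ?_⟩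
  · refine ⟨isOpen_chartDom_inter hU x₀, fun z hz => contDiffAt_chartMetric hz.1,
      fun z hz => contDiffAt_christoffel cov hcov.smooth hz.1,
      fun z hz => smoothEndOn_iff_chart hU hz.1 hz.2 s₁,
      fun z hz => smoothEndOn_iff_chart hU hz.1 hz.2 s₂,
      fun z hz => smoothEndOn_iff_chart hU hz.1 hz.2 s₃,
      fun z hz => hcov.christoffel_symm hz.1, fun z hz => hcov.metricAt hz.1, ?_, ?_, ?_, ?_, ?_⟩
    · intro z hz
      obtain ⟨h1, h2, h3, h4, -, -⟩ := hJ _ hz.2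
      have hx := chartInv_mem_source hz.1
      constructor
      · rw [chartEnd_mul hz.1]
        ext u
        have := congrArg (toChart x₀ _) (h1 (fromChart x₀ _ u))
        rw [map_neg, toChart_fromChart hx] at this
        exact this
      · rw [chartEnd_mul hz.1]
        ext u
        have := congrArg (toChart x₀ _) (h2 (fromChart x₀ _ u))
        rw [map_neg, toChart_fromChart hx] at this
        exact this
      · rw [chartEnd_mul hz.1]
        ext u
        exact congrArg (toChart x₀ _) (h3 (fromChart x₀ _ u))
      · rw [chartEnd_mul hz.1]
        ext u
        have := congrArg (toChart x₀ _) (h4 (fromChart x₀ _ u))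
        rw [map_neg] at this
        exact this
    · intro z hz J hJz
      have hs := (hJ _ hz.2).2.2.2.2.1
      obtain rfl | rfl | rfl := hJz
      · exact chartMetric_conjChart_skew hz.1 (hs _ (by simp))
      · exact chartMetric_conjChart_skew hz.1 (hs _ (by simp))
      · exact chartMetric_conjChart_skew hz.1 (hs _ (by simp))
    · have key : ∀ z ∈ chartDom (E := E) x₀ ∩ chartInv x₀ ⁻¹' U, ∀ J ∈ ({J₁, J₂, J₃} : Set _), ∀ v,
          covEnd (christoffel cov x₀) (chartEnd x₀ J) z v ∈
            Submodule.span ℝ {chartEnd x₀ J₁ z, chartEnd x₀ J₂ z, chartEnd x₀ J₃ z} := by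
        intro z hz J hJ' v
        obtain ⟨hs, hm⟩ := hmem J hJ'
        obtain ⟨C, hC, hC'⟩ := hQ.parallel U J hU hs hm _ hz.2 (fromChart x₀ _ v)
        rw [hC'.covEnd_chart hz.1
          ((smoothEndOn_iff_chart hU hz.1 hz.2 hs).differentiableAt (by simp))]
        exact hspan z hz C hC
      rintro z hz J (rfl | rfl | rfl) v
      · exact key z hz _ (by simp) v
      · exact key z hz _ (by simp) v
      · exact key z hz _ (by simp) v
    · intro z hz
      obtain ⟨e, he, hs⟩ := scalarCurvature_chart hcov hz.1
      exact ⟨e, he, by rw [hs]; exact hscal _⟩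
    · intro h4 z hz J hJz
      obtain rfl | rfl | rfl := hJz
      · exact flatCurvature_conjChart hcov hz.1
          (hQ.dim_four h4 _ _ ((hmem J₁ (by simp)).2 _ hz.2))
      · exact flatCurvature_conjChart hcov hz.1
          (hQ.dim_four h4 _ _ ((hmem J₂ (by simp)).2 _ hz.2))
      · exact flatCurvature_conjChart hcov hz.1
          (hQ.dim_four h4 _ _ ((hmem J₃ (by simp)).2 _ hz.2))
  · intro ξ P hξ hP
    have hsm : ∀ z ∈ chartDom (E := E) x₀ ∩ chartInv x₀ ⁻¹' U, ContDiffAt ℝ ∞ (chartField x₀ ξ) z :=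
      fun z hz => (smoothFieldAt_iff_chart hz.1).1 (hξ.smooth _)
    have hcv : ∀ z ∈ chartDom (E := E) x₀ ∩ chartInv x₀ ⁻¹' U, chartEnd x₀ (cov ξ) z =
        covOp (christoffel cov x₀) (chartField x₀ ξ) z := fun z hz =>
      chartEnd_cov hz.1 ((hsm z hz).differentiableAt (by simp))
    refine ⟨hsm, fun z hz => ?_, fun z hz => hspan z hz _ (hP.mem _), fun z hz => ?_⟩
    · rw [← hcv z hz]
      exact chartMetric_conjChart_skew hz.1 fun v w => by
        have := hξ.skew _ v w
        linarith
    · have key : ∀ J ∈ ({J₁, J₂, J₃} : Set _), endTrace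
          ((covOp (christoffel cov x₀) (chartField x₀ ξ) z - chartEnd x₀ P z) * chartEnd x₀ J z)
            = 0 := by
        intro J hJ'
        have h1 := hP.orthogonal _ _ ((hmem J hJ').2 _ hz.2)
        rw [← endTrace_conjChart (chartInv_mem_source hz.1)] at h1
        refine Eq.trans (congrArg endTrace ?_) h1
        rw [← hcv z hz]
        ext u
        have e := chartEnd_fromChart (A := J) hz.1 u
        change toChart x₀ _ (cov ξ (chartInv x₀ z) (fromChart x₀ _ (chartEnd x₀ J z u))) -
          toChart x₀ _ (P (chartInv x₀ z) (fromChart x₀ _ (chartEnd x₀ J z u))) = _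
        rw [e, ← map_sub]
        rfl
      intro J hJz
      obtain rfl | rfl | rfl := hJz
      · exact key _ (by simp)
      · exact key _ (by simp)
      · exact key _ (by simp)

end QuaternionicKahlerCharts

/-! ### From quaternionic Kähler structures to data along a submanifold. -/

section FlatSubmanifoldsOfQuaternionic

variable {E : Type*} [NormedAddCommGroup E] [NormedSpace ℝ E] [FiniteDimensional ℝ E]
  {F : Type*} [NormedAddCommGroup F] [NormedSpace ℝ F] [FiniteDimensional ℝ F]
  {Ω : Set E} {B : E → E →L[ℝ] E →L[ℝ] ℝ} {Γ : E → E →L[ℝ] E →L[ℝ] E}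
  {J₁ J₂ J₃ : E → E →L[ℝ] E} {ξ₁ ξ₂ : E → E} {P₁ P₂ : E → E →L[ℝ] E}
  {Ω' : Set F} {i : F → E} {f : F → ℝ} {X₁ X₂ : F → F} {I : F → F →L[ℝ] F}

theorem QuatTriple.endTrace_eq_zero_of_mem {V : Type*} [NormedAddCommGroup V] [NormedSpace ℝ V]
    {J₁ J₂ J₃ p : V →L[ℝ] V} (hJ : QuatTriple J₁ J₂ J₃)
    (hp : p ∈ Submodule.span ℝ {J₁, J₂, J₃}) : endTrace p = 0 := by
  obtain ⟨a, b, c, rfl⟩ := Submodule.mem_span_triple.1 hp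
  rw [map_add, map_add, map_smul, map_smul, map_smul, hJ.endTrace_eq_zero,
    hJ.rotate.endTrace_eq_zero, hJ.rotate.rotate.endTrace_eq_zero]
  simp

/-- Imaginary quaternions with imaginary product anticommute. -/
theorem QuatTriple.anticommute_of_mul_mem [Nontrivial E] {J₁ J₂ J₃ p q : E →L[ℝ] E}
    (hJ : QuatTriple J₁ J₂ J₃) (hp : p ∈ Submodule.span ℝ {J₁, J₂, J₃})
    (hq : q ∈ Submodule.span ℝ {J₁, J₂, J₃}) (hpq : p * q ∈ Submodule.span ℝ {J₁, J₂, J₃}) :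
    q * p = -(p * q) := by
  -- The anticommutator is a scalar `a` whose trace is `2 tr(p q)`, which is zero because elements
  -- of the span are traceless.
  obtain ⟨a, ha⟩ := hJ.anticommutator_mem hp hq
  have h := congrArg endTrace ha
  have h0 := hJ.endTrace_eq_zero_of_mem hpq
  rw [map_add, endTrace_mul_comm q p, h0, map_smul, endTrace_one, add_zero, smul_eq_mul] at h
  have hn : (Module.finrank ℝ E : ℝ) ≠ 0 := by exact_mod_cast Module.finrank_pos.ne'
  obtain rfl | h := mul_eq_zero.1 h.symm
  · rw [zero_smul] at ha
    exact eq_neg_of_add_eq_zero_right ha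
  · exact absurd h hn

/-- All data are pulled back along the inclusion. The fields `X₁`, `X₂` and `I` are not assumed
smooth; they inherit smoothness through the injective differential of `i`. -/
theorem FlatQK.flatSub (hQ : FlatQK Ω B Γ J₁ J₂ J₃) (h₁ : FlatMoment Ω B Γ J₁ J₂ J₃ ξ₁ P₁)
    (h₂ : FlatMoment Ω B Γ J₁ J₂ J₃ ξ₂ P₂) (hΩ' : IsOpen Ω') (hi : ∀ y ∈ Ω', i y ∈ Ω)
    (hsymm : ∀ z ∈ Ω, ∀ u v, B z u v = B z v u) (hnonneg : ∀ z ∈ Ω, ∀ u, 0 ≤ B z u u)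
    (hdef : ∀ z ∈ Ω, ∀ u, B z u u = 0 → u = 0)
    (hs : ∀ y ∈ Ω', ContDiffAt ℝ ∞ i y) (himm : ∀ y ∈ Ω', Function.Injective (fderiv ℝ i y))
    (hf : ∀ y ∈ Ω', ContDiffAt ℝ ∞ f y) (hf0 : ∀ y ∈ Ω', f y ≠ 0)
    (hX₁ : ∀ y ∈ Ω', fderiv ℝ i y (X₁ y) = ξ₁ (i y))
    (hX₂ : ∀ y ∈ Ω', fderiv ℝ i y (X₂ y) = ξ₂ (i y))
    (hI : ∀ y ∈ Ω', ∀ v, fderiv ℝ i y (I y v) =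
      unitEnd f (fun y => P₁ (i y)) (fun y => P₂ (i y)) y (fderiv ℝ i y v))
    (hbr : ∀ y ∈ Ω', fderiv ℝ ξ₂ (i y) (ξ₁ (i y)) = fderiv ℝ ξ₁ (i y) (ξ₂ (i y)))
    (hn : ∀ y ∈ Ω', B (i y) (ξ₁ (i y)) (ξ₁ (i y)) = B (i y) (ξ₂ (i y)) (ξ₂ (i y)))
    (hn0 : ∀ y ∈ Ω', B (i y) (ξ₁ (i y)) (ξ₁ (i y)) ≠ 0)
    (hPQ : ∀ y ∈ Ω', P₁ (i y) * P₂ (i y) ∈ Submodule.span ℝ {J₁ (i y), J₂ (i y), J₃ (i y)})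
    (hfξ : ∀ y ∈ Ω', P₁ (i y) (P₂ (i y) (ξ₁ (i y))) = f y • ξ₂ (i y)) :
    FlatSub Ω' i (fun y => B (i y)) (pullForm i Γ) (fun y => ξ₁ (i y)) (fun y => ξ₂ (i y))
      (fun y => covOp Γ ξ₁ (i y)) (fun y => covOp Γ ξ₂ (i y)) (fun y => P₁ (i y))
      (fun y => P₂ (i y)) f X₁ X₂ I := by
  have nt : ∀ y ∈ Ω', Nontrivial E := fun y hy => hQ.nontrivial (hi y hy)
  have di : ∀ y ∈ Ω', DifferentiableAt ℝ i y := fun y hy => (hs y hy).differentiableAt (by simp)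
  have sξ₁ : ∀ y ∈ Ω', ContDiffAt ℝ ∞ (fun y => ξ₁ (i y)) y := fun y hy =>
    (h₁.smooth _ (hi y hy)).comp y (hs y hy)
  have sξ₂ : ∀ y ∈ Ω', ContDiffAt ℝ ∞ (fun y => ξ₂ (i y)) y := fun y hy =>
    (h₂.smooth _ (hi y hy)).comp y (hs y hy)
  have sP₁ : ∀ y ∈ Ω', ContDiffAt ℝ ∞ (fun y => P₁ (i y)) y := fun y hy =>
    have := nt y hy
    (h₁.contDiffAt hQ (hi y hy)).comp y (hs y hy)
  have sP₂ : ∀ y ∈ Ω', ContDiffAt ℝ ∞ (fun y => P₂ (i y)) y := fun y hy =>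
    have := nt y hy
    (h₂.contDiffAt hQ (hi y hy)).comp y (hs y hy)
  have sd : ∀ y ∈ Ω', ContDiffAt ℝ ∞ (fderiv ℝ i) y := fun y hy =>
    (hs y hy).fderiv_right (m := ∞) (by simp)
  have ev : ∀ y ∈ Ω', ∀ᶠ z in 𝓝 y, z ∈ Ω' := fun y hy => hΩ'.mem_nhds hy
  have sq : ∀ z ∈ Ω, ∀ p ∈ Submodule.span ℝ {J₁ z, J₂ z, J₃ z}, ∃ a : ℝ, p * p = a • 1 := by
    intro z hz p hp
    obtain ⟨a, ha⟩ := (hQ.quat z hz).anticommutator_mem hp hp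
    refine ⟨a / 2, ?_⟩
    have : p * p = (1 / 2 : ℝ) • (p * p + p * p) := by module
    rw [this, ha]
    module
  exact
  { isOpen := hΩ'
    smooth_map := hs
    immersion := himm
    smooth_metric := fun y hy => (hQ.smooth_metric _ (hi y hy)).comp y (hs y hy)
    smooth_field₁ := sξ₁
    smooth_field₂ := sξ₂
    smooth_moment₁ := sP₁
    smooth_moment₂ := sP₂
    smooth_fun := hf
    smooth_tangent₁ := fun y hy =>
      contDiffAt_of_injective (sd y hy) (himm y hy) (sξ₁ y hy) ((ev y hy).mono hX₁)
    smooth_tangent₂ := fun y hy =>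
      contDiffAt_of_injective (sd y hy) (himm y hy) (sξ₂ y hy) ((ev y hy).mono hX₂)
    smooth_complex := fun y hy => by
      have su : ContDiffAt ℝ ∞ (unitEnd f (fun y => P₁ (i y)) (fun y => P₂ (i y))) y :=
        ((hf y hy).inv (hf0 y hy)).smul ((sP₁ y hy).mul (sP₂ y hy))
      exact contDiffAt_clm_of_injective (sd y hy) (himm y hy) (su.clm_comp (sd y hy))
        ((ev y hy).mono hI)
    symm := fun y hy => hsymm _ (hi y hy)
    nonneg := fun y hy => hnonneg _ (hi y hy)
    definite := fun y hy => hdef _ (hi y hy)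
    metric := fun y hy => (hQ.metric _ (hi y hy)).pull (di y hy)
      ((hQ.smooth_metric _ (hi y hy)).differentiableAt (by simp))
    torsion := fun y hy u v => hQ.torsion _ (hi y hy) _ _
    cov₁ := fun y hy v => covVec_pull (di y hy)
      ((h₁.smooth _ (hi y hy)).differentiableAt (by simp)) v
    cov₂ := fun y hy v => covVec_pull (di y hy)
      ((h₂.smooth _ (hi y hy)).differentiableAt (by simp)) v
    skew₁ := fun y hy => h₁.skew _ (hi y hy)
    skew₂ := fun y hy => h₂.skew _ (hi y hy)
    comm := fun y hy => by
      rw [covOp_apply, covOp_apply, covVec, covVec, hbr y hy, hQ.torsion _ (hi y hy)]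
    skew_moment₁ := fun y hy => FlatMoment.skew_of_mem_span hQ (hi y hy) (h₁.mem _ (hi y hy))
    skew_moment₂ := fun y hy => FlatMoment.skew_of_mem_span hQ (hi y hy) (h₂.mem _ (hi y hy))
    sq₁ := fun y hy => sq _ (hi y hy) _ (h₁.mem _ (hi y hy))
    sq₂ := fun y hy => sq _ (hi y hy) _ (h₂.mem _ (hi y hy))
    anti := fun y hy =>
      have := nt y hy
      (hQ.quat _ (hi y hy)).anticommute_of_mul_mem (h₁.mem _ (hi y hy)) (h₂.mem _ (hi y hy))
        (hPQ y hy)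
    commute₁₁ := fun y hy =>
      have := nt y hy
      h₁.sub_commute_span hQ (hi y hy) (h₁.mem _ (hi y hy))
    commute₁₂ := fun y hy =>
      have := nt y hy
      h₁.sub_commute_span hQ (hi y hy) (h₂.mem _ (hi y hy))
    commute₂₁ := fun y hy =>
      have := nt y hy
      h₂.sub_commute_span hQ (hi y hy) (h₁.mem _ (hi y hy))
    commute₂₂ := fun y hy =>
      have := nt y hy
      h₂.sub_commute_span hQ (hi y hy) (h₂.mem _ (hi y hy))
    skew_cov₁ := fun y hy v u w => by
      have := nt y hy
      have hP := (h₁.contDiffAt hQ (hi y hy)).differentiableAt (by simp)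
      rw [covEnd_pull (di y hy) hP]
      exact FlatMoment.skew_of_mem_span hQ (hi y hy) (hQ.covEnd_mem (hi y hy) hP h₁.mem _) u w
    anticommutator := fun y hy => by
      have := nt y hy
      have hP₁ := (h₁.contDiffAt hQ (hi y hy)).differentiableAt (by simp)
      have hP₂ := (h₂.contDiffAt hQ (hi y hy)).differentiableAt (by simp)
      obtain ⟨c, -, hc⟩ := FlatMoment.anticommutator hQ (hi y hy)
      refine ⟨c, fun v => ?_⟩
      rw [covEnd_pull (di y hy) hP₁, covEnd_pull (di y hy) hP₂]
      exact ⟨hc ξ₁ P₁ h₁ _ _ (hPQ y hy), hc ξ₂ P₂ h₂ _ _ (hPQ y hy)⟩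
    ne_zero := hf0
    norm_eq := hn
    norm_ne := hn0
    apply_field := hfξ
    tangent₁ := hX₁
    tangent₂ := hX₂
    complex := hI }

end FlatSubmanifoldsOfQuaternionic

/-! ### Submanifolds in charts. -/

section SubmanifoldCharts

variable {E : Type*} [NormedAddCommGroup E] [NormedSpace ℝ E] [FiniteDimensional ℝ E]
  {M : Type*} [TopologicalSpace M] [T2Space M] [ChartedSpace E M] [IsManifold 𝓘(ℝ, E) ∞ M]
  [RiemannianBundle (fun x : M => TangentSpace 𝓘(ℝ, E) x)]

/-- The projection to the orthogonal complement of two orthogonal vectors of equal length. -/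
theorem inner_starProjection_orthogonal {V : Type*} [NormedAddCommGroup V] [InnerProductSpace ℝ V]
    {e₁ e₂ : V} [(Submodule.span ℝ {e₁, e₂}).HasOrthogonalProjection] (h : inner ℝ e₁ e₂ = 0)
    (hn : inner ℝ e₁ e₁ = inner ℝ e₂ e₂) (h0 : inner ℝ e₁ e₁ ≠ 0) (u v : V) :
    inner ℝ ((Submodule.span ℝ {e₁, e₂})ᗮ.starProjection u)
      ((Submodule.span ℝ {e₁, e₂})ᗮ.starProjection v) =
    inner ℝ u v - (inner ℝ e₁ u * inner ℝ e₁ v + inner ℝ e₂ u * inner ℝ e₂ v) / inner ℝ e₁ e₁ := by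
  have h' : inner ℝ e₂ e₁ = 0 := by rw [real_inner_comm, h]
  have key : ∀ u, (Submodule.span ℝ {e₁, e₂})ᗮ.starProjection u =
      u - ((inner ℝ e₁ u / inner ℝ e₁ e₁) • e₁ + (inner ℝ e₂ u / inner ℝ e₁ e₁) • e₂) := by
    intro u
    rw [Submodule.starProjection_orthogonal_val]
    congr 1
    refine Submodule.eq_starProjection_of_mem_of_inner_eq_zero
      (Submodule.mem_span_pair.2 ⟨_, _, rfl⟩) fun w hw => ?_
    obtain ⟨a, b, rfl⟩ := Submodule.mem_span_pair.1 hw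
    simp only [inner_sub_left, inner_add_left, inner_add_right, inner_smul_left, inner_smul_right,
      h, h', ← hn, real_inner_comm u, RCLike.conj_to_real]
    field_simp
    ring
  rw [key, key]
  simp only [inner_sub_left, inner_sub_right, inner_add_left, inner_add_right, inner_smul_left,
    inner_smul_right, h, h', ← hn, real_inner_comm u, RCLike.conj_to_real]
  field_simp
  ring

variable {x₀ x : M} {z : E}

/-- The equality of base points is a hypothesis, so that the lemma applies at the points `ι y`. -/
theorem chartField_eq_toChart {ξ : Π x : M, TangentSpace 𝓘(ℝ, E) x} (hx : chartInv x₀ z = x) :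
    chartField x₀ ξ z = toChart x₀ x (ξ x) := by
  subst hx
  rfl

theorem chartMetric_toChart' (hz : z ∈ chartDom x₀) (hx : chartInv x₀ z = x)
    (u v : TangentSpace 𝓘(ℝ, E) x) :
    chartMetric x₀ z (toChart x₀ x u) (toChart x₀ x v) = inner ℝ u v := by
  subst hx
  exact chartMetric_toChart hz u v

theorem chartEnd_toChart' {A : Π x : M, TangentSpace 𝓘(ℝ, E) x →L[ℝ] TangentSpace 𝓘(ℝ, E) x}
    (hz : z ∈ chartDom x₀) (hx : chartInv x₀ z = x) (u : TangentSpace 𝓘(ℝ, E) x) :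
    chartEnd x₀ A z (toChart x₀ x u) = toChart x₀ x (A x u) := by
  subst hx
  exact chartEnd_toChart hz u

theorem bracket_eq_of_mlieBracket_eq_zero {ξ₁ ξ₂ : Π x : M, TangentSpace 𝓘(ℝ, E) x}
    (hz : z ∈ chartDom x₀) (hx : chartInv x₀ z = x)
    (h₁ : DifferentiableAt ℝ (chartField x₀ ξ₁) z) (h₂ : DifferentiableAt ℝ (chartField x₀ ξ₂) z)
    (h : mlieBracket 𝓘(ℝ, E) ξ₁ ξ₂ x = 0) :
    fderiv ℝ (chartField x₀ ξ₂) z (chartField x₀ ξ₁ z) =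
      fderiv ℝ (chartField x₀ ξ₁) z (chartField x₀ ξ₂ z) := by
  subst hx
  rw [mlieBracket_chart hz h₁ h₂] at h
  exact sub_eq_zero.1 (fromChart_injective hz (h.trans (map_zero _).symm))

variable {F : Type*} [NormedAddCommGroup F] [NormedSpace ℝ F] [FiniteDimensional ℝ F]
  {N : Type*} [TopologicalSpace N] [ChartedSpace F N] [IsManifold 𝓘(ℝ, F) ∞ N]

theorem fderiv_chartMap {ι : N → M} {y₀ : N} {w : F} (hw : w ∈ chartDom y₀)
    (hg : ι (chartInv y₀ w) ∈ (chartAt E x₀).source)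
    (hι : MDifferentiableAt 𝓘(ℝ, F) 𝓘(ℝ, E) ι (chartInv y₀ w)) (v : F) :
    fderiv ℝ (chartMap (E := E) y₀ x₀ ι) w v = toChart x₀ (ι (chartInv y₀ w))
      (mfderiv 𝓘(ℝ, F) 𝓘(ℝ, E) ι (chartInv y₀ w) (fromChart y₀ (chartInv y₀ w) v)) := by
  rw [mfderiv_chartMap hw hg hι, toChart_fromChart hg]

variable [IsContMDiffRiemannianBundle 𝓘(ℝ, E) ∞ E (fun x : M => TangentSpace 𝓘(ℝ, E) x)]
    {cov : CovariantDerivative 𝓘(ℝ, E) E (TangentSpace 𝓘(ℝ, E) : M → Type _)}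
    (hcov : IsLeviCivita cov)
    {Q : Π x : M, Submodule ℝ (TangentSpace 𝓘(ℝ, E) x →L[ℝ] TangentSpace 𝓘(ℝ, E) x)}
    (hQ : IsQuaternionicKahler cov Q)
    (hscal : ∀ x, scalarCurvature cov x ≠ 0)
    {ξ₁ ξ₂ : Π x : M, TangentSpace 𝓘(ℝ, E) x}
    (hξ₁ : IsKilling cov ξ₁) (hξ₂ : IsKilling cov ξ₂)
    {P₁ P₂ : Π x : M, TangentSpace 𝓘(ℝ, E) x →L[ℝ] TangentSpace 𝓘(ℝ, E) x}
    (hP₁ : IsMomentMap cov Q ξ₁ P₁) (hP₂ : IsMomentMap cov Q ξ₂ P₂)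
    {ι : N → M} (hι : IsSubmanifold (E := E) (F := F) ι)
    {X₁ X₂ : Π y : N, TangentSpace 𝓘(ℝ, F) y}
    {I : Π y : N, TangentSpace 𝓘(ℝ, F) y →L[ℝ] TangentSpace 𝓘(ℝ, F) y}
    {f : N → ℝ}
    (hX₁ : ∀ y, mfderiv 𝓘(ℝ, F) 𝓘(ℝ, E) ι y (X₁ y) = ξ₁ (ι y))
    (hX₂ : ∀ y, mfderiv 𝓘(ℝ, F) 𝓘(ℝ, E) ι y (X₂ y) = ξ₂ (ι y))
    (hcomm : ∀ y, mlieBracket 𝓘(ℝ, E) ξ₁ ξ₂ (ι y) = 0)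
    (hnorm : ∀ y, ‖ξ₁ (ι y)‖ = ‖ξ₂ (ι y)‖ ∧ ‖ξ₁ (ι y)‖ ≠ 0)
    (hPQ : ∀ y, P₁ (ι y) ∘L P₂ (ι y) ∈ Q (ι y))
    (hf : ContMDiff 𝓘(ℝ, F) 𝓘(ℝ, ℝ) ∞ f) (hf0 : ∀ y, f y ≠ 0)
    (hfξ : ∀ y, P₁ (ι y) (P₂ (ι y) (ξ₁ (ι y))) = f y • ξ₂ (ι y))
    (hI : ∀ y v, mfderiv 𝓘(ℝ, F) 𝓘(ℝ, E) ι y (I y v) =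
        (f y)⁻¹ • P₁ (ι y) (P₂ (ι y) (mfderiv 𝓘(ℝ, F) 𝓘(ℝ, E) ι y v)))
include hcov hQ hscal hξ₁ hξ₂ hP₁ hP₂ hι hX₁ hX₂ hcomm hnorm hPQ hf hf0 hfξ hI

/-- A submanifold tangent to two commuting Killing fields, in charts. -/
theorem exists_flatSub (y₀ : N) : ∃ (Ω : Set F) (G : F → F →L[ℝ] E →L[ℝ] E)
    (A₁ A₂ : F → E →L[ℝ] E), chartPt y₀ ∈ Ω ∧ Ω ⊆ chartDom y₀ ∧
      (∀ w ∈ Ω, ι (chartInv y₀ w) ∈ (chartAt E (ι y₀)).source) ∧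
      FlatSub Ω (chartMap y₀ (ι y₀) ι) (fun w => chartMetric (ι y₀) (chartMap y₀ (ι y₀) ι w)) G
        (fun w => chartField (ι y₀) ξ₁ (chartMap y₀ (ι y₀) ι w))
        (fun w => chartField (ι y₀) ξ₂ (chartMap y₀ (ι y₀) ι w)) A₁ A₂
        (fun w => chartEnd (ι y₀) P₁ (chartMap y₀ (ι y₀) ι w))
        (fun w => chartEnd (ι y₀) P₂ (chartMap y₀ (ι y₀) ι w))
        (fun w => f (chartInv y₀ w)) (chartField y₀ X₁) (chartField y₀ X₂) (chartEnd y₀ I) := by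
  obtain ⟨Ω, J₁, J₂, J₃, hΩ, hpt, hfl, hspan, hmom⟩ := hQ.exists_flatQK hcov hscal (ι y₀)
  -- The chart of `N` is restricted to the points that `ι` maps into the chart of `M` and, in
  -- coordinates, into `Ω`.
  let U : Set M := (chartAt E (ι y₀)).source ∩ extChartAt 𝓘(ℝ, E) (ι y₀) ⁻¹' Ω
  have hU : IsOpen (ι ⁻¹' U) :=
    (isOpen_extChartAt_preimage (ι y₀) hfl.isOpen).preimage hι.smooth.continuous
  have hmd : ∀ y, MDifferentiableAt 𝓘(ℝ, F) 𝓘(ℝ, E) ι y := fun y =>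
    (hι.smooth y).mdifferentiableAt (by simp)
  have hs : ∀ w ∈ chartDom (E := F) y₀ ∩ chartInv y₀ ⁻¹' (ι ⁻¹' U),
      ι (chartInv y₀ w) ∈ (chartAt E (ι y₀)).source := fun w hw => hw.2.1
  have hx : ∀ w ∈ chartDom (E := F) y₀ ∩ chartInv y₀ ⁻¹' (ι ⁻¹' U),
      chartInv (ι y₀) (chartMap (E := E) y₀ (ι y₀) ι w) = ι (chartInv y₀ w) := fun w hw =>
    chartInv_chartMap (hs w hw)
  have hz : ∀ w ∈ chartDom (E := F) y₀ ∩ chartInv y₀ ⁻¹' (ι ⁻¹' U),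
      chartMap (E := E) y₀ (ι y₀) ι w ∈ chartDom (ι y₀) := fun w hw =>
    chartMap_mem_chartDom (hs w hw)
  have hd : ∀ w ∈ chartDom (E := F) y₀ ∩ chartInv y₀ ⁻¹' (ι ⁻¹' U), ∀ v,
      fderiv ℝ (chartMap (E := E) y₀ (ι y₀) ι) w v = toChart (ι y₀) (ι (chartInv y₀ w))
        (mfderiv 𝓘(ℝ, F) 𝓘(ℝ, E) ι (chartInv y₀ w) (fromChart y₀ (chartInv y₀ w) v)) :=
    fun w hw v => fderiv_chartMap hw.1 (hs w hw) (hmd _) v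
  have h₁ := hmom ξ₁ P₁ hξ₁ hP₁
  have h₂ := hmom ξ₂ P₂ hξ₂ hP₂
  have hp : chartPt y₀ ∈ chartDom (E := F) y₀ ∩ chartInv y₀ ⁻¹' (ι ⁻¹' U) := by
    refine ⟨chartPt_mem y₀, ?_⟩
    rw [Set.mem_preimage, chartInv_chartPt]
    exact ⟨mem_chart_source E _, hpt⟩
  refine ⟨_, _, _, _, hp, Set.inter_subset_left, hs,
    hfl.flatSub h₁ h₂ (isOpen_chartDom_inter hU y₀) (fun w hw => hw.2.2)
    (fun z _ => chartMetric_symm) (fun z _ => chartMetric_nonneg)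
    (fun z hz => chartMetric_definite (hΩ hz)) ?_ ?_ ?_ ?_ ?_ ?_ ?_ ?_ ?_ ?_ ?_ ?_⟩
  · exact fun w hw => contDiffAt_chartMap hw.1 (hs w hw) (hι.smooth _)
  · intro w hw
    have : ∀ u v, fderiv ℝ (chartMap (E := E) y₀ (ι y₀) ι) w u =
        fderiv ℝ (chartMap (E := E) y₀ (ι y₀) ι) w v → u = v := by
      intro u v huv
      rw [hd w hw, hd w hw] at huv
      have h3 := congrArg (fromChart (ι y₀) (ι (chartInv y₀ w))) huv
      rw [fromChart_toChart (hs w hw), fromChart_toChart (hs w hw)] at h3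
      exact fromChart_injective hw.1 (hι.immersion _ h3)
    exact this
  · exact fun w hw => (contMDiffAt_iff_chart (n := ⊤) hw.1).1 (hf _)
  · exact fun w _ => hf0 _
  · intro w hw
    rw [hd w hw, fromChart_chartField X₁ hw.1, hX₁, chartField_eq_toChart (hx w hw)]
  · intro w hw
    rw [hd w hw, fromChart_chartField X₂ hw.1, hX₂, chartField_eq_toChart (hx w hw)]
  · intro w hw v
    rw [hd w hw, hd w hw, chartEnd_fromChart hw.1, hI, map_smul, unitEnd, smul_apply,
      mul_apply_eq_comp, chartEnd_toChart' (hz w hw) (hx w hw),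
      chartEnd_toChart' (hz w hw) (hx w hw)]
  · exact fun w hw => bracket_eq_of_mlieBracket_eq_zero (hz w hw) (hx w hw)
      ((h₁.smooth _ hw.2.2).differentiableAt (by simp))
      ((h₂.smooth _ hw.2.2).differentiableAt (by simp)) (hcomm _)
  · intro w hw
    rw [chartField_eq_toChart (hx w hw), chartField_eq_toChart (hx w hw),
      chartMetric_toChart' (hz w hw) (hx w hw), chartMetric_toChart' (hz w hw) (hx w hw),
      real_inner_self_eq_norm_sq, real_inner_self_eq_norm_sq, (hnorm _).1]
  · intro w hw
    rw [chartField_eq_toChart (hx w hw), chartMetric_toChart' (hz w hw) (hx w hw),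
      real_inner_self_eq_norm_sq]
    exact pow_ne_zero 2 (hnorm _).2
  · intro w hw
    rw [chartEnd_mul (hz w hw)]
    -- Both the endomorphisms and `Q` depend on the base point, so the membership is moved along the
    -- equality as a whole.
    have hx' : ∀ x, x = ι (chartInv y₀ w) → P₁ x ∘L P₂ x ∈ Q x := by
      rintro _ rfl
      exact hPQ _
    exact hspan _ hw.2.2 (P₁ _ ∘L P₂ _) (hx' _ (hx w hw))
  · intro w hw
    rw [chartField_eq_toChart (hx w hw), chartField_eq_toChart (hx w hw),
      chartEnd_toChart' (hz w hw) (hx w hw), chartEnd_toChart' (hz w hw) (hx w hw), hfξ, map_smul]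

end SubmanifoldCharts

/-! ### The transversal structure of the submanifold. -/

section SubmanifoldTransversal

variable {E : Type*} [NormedAddCommGroup E] [NormedSpace ℝ E] [FiniteDimensional ℝ E]
  {M : Type*} [TopologicalSpace M] [T2Space M] [ChartedSpace E M] [IsManifold 𝓘(ℝ, E) ∞ M]
  [RiemannianBundle (fun x : M => TangentSpace 𝓘(ℝ, E) x)]
  {F : Type*} [NormedAddCommGroup F] [NormedSpace ℝ F] [FiniteDimensional ℝ F]
  {N : Type*} [TopologicalSpace N] [ChartedSpace F N] [IsManifold 𝓘(ℝ, F) ∞ N]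
  [IsContMDiffRiemannianBundle 𝓘(ℝ, E) ∞ E (fun x : M => TangentSpace 𝓘(ℝ, E) x)]
    {cov : CovariantDerivative 𝓘(ℝ, E) E (TangentSpace 𝓘(ℝ, E) : M → Type _)}
    (hcov : IsLeviCivita cov)
    {Q : Π x : M, Submodule ℝ (TangentSpace 𝓘(ℝ, E) x →L[ℝ] TangentSpace 𝓘(ℝ, E) x)}
    (hQ : IsQuaternionicKahler cov Q)
    (hscal : ∀ x, scalarCurvature cov x ≠ 0)
    {ξ₁ ξ₂ : Π x : M, TangentSpace 𝓘(ℝ, E) x}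
    (hξ₁ : IsKilling cov ξ₁) (hξ₂ : IsKilling cov ξ₂)
    {P₁ P₂ : Π x : M, TangentSpace 𝓘(ℝ, E) x →L[ℝ] TangentSpace 𝓘(ℝ, E) x}
    (hP₁ : IsMomentMap cov Q ξ₁ P₁) (hP₂ : IsMomentMap cov Q ξ₂ P₂)
    {ι : N → M} (hι : IsSubmanifold (E := E) (F := F) ι)
    {X₁ X₂ : Π y : N, TangentSpace 𝓘(ℝ, F) y}
    {I : Π y : N, TangentSpace 𝓘(ℝ, F) y →L[ℝ] TangentSpace 𝓘(ℝ, F) y}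
    {f : N → ℝ}
    (hX₁ : ∀ y, mfderiv 𝓘(ℝ, F) 𝓘(ℝ, E) ι y (X₁ y) = ξ₁ (ι y))
    (hX₂ : ∀ y, mfderiv 𝓘(ℝ, F) 𝓘(ℝ, E) ι y (X₂ y) = ξ₂ (ι y))
    (hcomm : ∀ y, mlieBracket 𝓘(ℝ, E) ξ₁ ξ₂ (ι y) = 0)
    (hnorm : ∀ y, ‖ξ₁ (ι y)‖ = ‖ξ₂ (ι y)‖ ∧ ‖ξ₁ (ι y)‖ ≠ 0)
    (hPQ : ∀ y, P₁ (ι y) ∘L P₂ (ι y) ∈ Q (ι y))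
    (hf : ContMDiff 𝓘(ℝ, F) 𝓘(ℝ, ℝ) ∞ f) (hf0 : ∀ y, f y ≠ 0)
    (hfξ : ∀ y, P₁ (ι y) (P₂ (ι y) (ξ₁ (ι y))) = f y • ξ₂ (ι y))
    (hI : ∀ y v, mfderiv 𝓘(ℝ, F) 𝓘(ℝ, E) ι y (I y v) =
        (f y)⁻¹ • P₁ (ι y) (P₂ (ι y) (mfderiv 𝓘(ℝ, F) 𝓘(ℝ, E) ι y v)))
include hcov hQ hscal hξ₁ hξ₂ hP₁ hP₂ hι hX₁ hX₂ hcomm hnorm hPQ hf hf0 hfξ hI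


/-- Along the submanifold the two fields are orthogonal, and `P₁ P₂ / f` is a skew-symmetric
complex structure which exchanges them. -/
theorem submanifold_pointwise (y : N) : inner ℝ (ξ₁ (ι y)) (ξ₂ (ι y)) = 0 ∧
    ∀ v : TangentSpace 𝓘(ℝ, E) (ι y),
      (f y)⁻¹ • P₁ (ι y) (P₂ (ι y) ((f y)⁻¹ • P₁ (ι y) (P₂ (ι y) v))) = -v ∧
      inner ℝ ((f y)⁻¹ • P₁ (ι y) (P₂ (ι y) v)) (ξ₁ (ι y)) = -inner ℝ v (ξ₂ (ι y)) ∧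
      inner ℝ ((f y)⁻¹ • P₁ (ι y) (P₂ (ι y) v)) (ξ₂ (ι y)) = inner ℝ v (ξ₁ (ι y)) := by
  revert y
  refine forall_of_chart (E := F) fun y₀ => ?_
  obtain ⟨Ω, G, A₁, A₂, hΩ, hΩc, hs, h⟩ := exists_flatSub hcov hQ hscal hξ₁ hξ₂ hP₁ hP₂ hι hX₁ hX₂
    hcomm hnorm hPQ hf hf0 hfξ hI y₀
  have hx := chartInv_chartMap (E := E) (hs _ hΩ)
  have hz := chartMap_mem_chartDom (E := E) (hs _ hΩ)
  have hu : ∀ v, unitEnd (fun w => f (chartInv y₀ w))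
      (fun w => chartEnd (ι y₀) P₁ (chartMap (E := E) y₀ (ι y₀) ι w))
      (fun w => chartEnd (ι y₀) P₂ (chartMap (E := E) y₀ (ι y₀) ι w)) (chartPt y₀)
        (toChart (ι y₀) _ v) = toChart (ι y₀) _ ((f (chartInv y₀ (chartPt y₀)))⁻¹ •
          P₁ (ι (chartInv y₀ (chartPt y₀))) (P₂ (ι (chartInv y₀ (chartPt y₀))) v)) := fun v => by
    rw [unitEnd, smul_apply, mul_apply_eq_comp, chartEnd_toChart' hz hx, chartEnd_toChart' hz hx,
      map_smul]
  refine ⟨?_, fun v => ⟨?_, ?_, ?_⟩⟩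
  · have := h.orthogonal hΩ
    rwa [chartField_eq_toChart hx, chartField_eq_toChart hx, chartMetric_toChart' hz hx] at this
  · have := h.unit_unit hΩ (toChart (ι y₀) _ v)
    rw [hu, hu, ← map_neg] at this
    have h2 := congrArg (fromChart (ι y₀) (ι (chartInv y₀ (chartPt (E := F) y₀)))) this
    rwa [fromChart_toChart (hs _ hΩ), fromChart_toChart (hs _ hΩ)] at h2
  · have := h.unit_left₁ hΩ (toChart (ι y₀) _ v)
    rwa [hu, chartField_eq_toChart hx, chartField_eq_toChart hx, chartMetric_toChart' hz hx,
      chartMetric_toChart' hz hx] at this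
  · have := h.unit_left₂ hΩ (toChart (ι y₀) _ v)
    rwa [hu, chartField_eq_toChart hx, chartField_eq_toChart hx, chartMetric_toChart' hz hx,
      chartMetric_toChart' hz hx] at this

/-- By `inner_starProjection_orthogonal` the projected metric is `g` minus the normalized products
with the two fields, which is the form that `FlatSub.transFlat` asks for. -/
theorem locallyTrans : LocallyTrans X₁ X₂ I (transversalMetric (F := F) ι ξ₁ ξ₂) := by
  intro y₀
  obtain ⟨Ω, G, A₁, A₂, hΩ, hΩc, hs, h⟩ := exists_flatSub hcov hQ hscal hξ₁ hξ₂ hP₁ hP₂ hι hX₁ hX₂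
    hcomm hnorm hPQ hf hf0 hfξ hI y₀
  refine ⟨Ω, _, _, hΩ, hΩc, h.transFlat fun w hw u v => ?_⟩
  have hx := chartInv_chartMap (E := E) (hs w hw)
  have hz := chartMap_mem_chartDom (E := E) (hs w hw)
  have hmd : MDifferentiableAt 𝓘(ℝ, F) 𝓘(ℝ, E) ι (chartInv y₀ w) :=
    (hι.smooth _).mdifferentiableAt (by simp)
  have ho := (submanifold_pointwise hcov hQ hscal hξ₁ hξ₂ hP₁ hP₂ hι hX₁ hX₂
    hcomm hnorm hPQ hf hf0 hfξ hI (chartInv y₀ w)).1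
  rw [chartForm_apply, transversalMetric_apply, fderiv_chartMap (hΩc hw) (hs w hw) hmd,
    fderiv_chartMap (hΩc hw) (hs w hw) hmd]
  simp only [chartField_eq_toChart hx, chartMetric_toChart' hz hx]
  refine inner_starProjection_orthogonal ho ?_ ?_ _ _
  · rw [real_inner_self_eq_norm_sq, real_inner_self_eq_norm_sq, (hnorm _).1]
  · rw [real_inner_self_eq_norm_sq]
    exact pow_ne_zero 2 (hnorm _).2

end SubmanifoldTransversal

/-! ### Linear algebra of the distribution, and the theorem. -/

theorem exists_lift_of_injective {V W : Type*} [NormedAddCommGroup V] [NormedSpace ℝ V]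
    [FiniteDimensional ℝ V] [NormedAddCommGroup W] [NormedSpace ℝ W] {A : V →L[ℝ] W}
    (hA : Function.Injective A) {K : V →L[ℝ] W} (h : ∀ v, K v ∈ A.range) :
    ∃ I : V →L[ℝ] V, ∀ v, A (I v) = K v := by
  let e := LinearEquiv.ofInjective A.toLinearMap hA
  refine ⟨LinearMap.toContinuousLinearMap
    (e.symm.toLinearMap ∘ₗ K.toLinearMap.codRestrict A.range h), fun v => ?_⟩
  have := congrArg Subtype.val (e.apply_symm_apply (K.toLinearMap.codRestrict A.range h v))
  exact this

theorem finrank_span_pair_of_orthogonal {V W : Type*} [AddCommGroup V] [Module ℝ V]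
    [NormedAddCommGroup W] [InnerProductSpace ℝ W] (A : V →ₗ[ℝ] W) {x y : V}
    (h : inner ℝ (A x) (A y) = 0) (hx : A x ≠ 0) (hy : A y ≠ 0) :
    Module.finrank ℝ (Submodule.span ℝ {x, y}) = 2 := by
  have hli : LinearIndependent ℝ ![x, y] := by
    rw [LinearIndependent.pair_iff]
    intro s t hst
    have h1 := congrArg A hst
    rw [map_add, map_smul, map_smul, map_zero] at h1
    have h2 := congrArg (inner ℝ (A x)) h1
    have h3 := congrArg (inner ℝ (A y)) h1
    rw [inner_add_right, real_inner_smul_right, real_inner_smul_right, h, inner_zero_right] at h2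
    rw [inner_add_right, real_inner_smul_right, real_inner_smul_right, real_inner_comm, h,
      inner_zero_right] at h3
    simpa [hx, hy] using And.intro h2 h3
  have := finrank_span_eq_card hli
  rwa [Matrix.range_cons_cons_empty, Fintype.card_fin] at this

theorem spanDistribution_eq_span
    {E : Type*} [NormedAddCommGroup E] [NormedSpace ℝ E] [FiniteDimensional ℝ E]
    {M : Type*} [TopologicalSpace M] [ChartedSpace E M]
    {F : Type*} [NormedAddCommGroup F] [NormedSpace ℝ F]
    {N : Type*} [TopologicalSpace N] [ChartedSpace F N]
    {ι : N → M} (hι : IsSubmanifold (E := E) (F := F) ι) {ξ₁ ξ₂ : Π x : M, TangentSpace 𝓘(ℝ, E) x}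
    {X₁ X₂ : Π y : N, TangentSpace 𝓘(ℝ, F) y}
    (hX₁ : ∀ y, mfderiv 𝓘(ℝ, F) 𝓘(ℝ, E) ι y (X₁ y) = ξ₁ (ι y))
    (hX₂ : ∀ y, mfderiv 𝓘(ℝ, F) 𝓘(ℝ, E) ι y (X₂ y) = ξ₂ (ι y)) (y : N) :
    spanDistribution (F := F) ι ξ₁ ξ₂ y = Submodule.span ℝ {X₁ y, X₂ y} := by
  ext v
  rw [spanDistribution, Submodule.mem_comap, Submodule.mem_span_pair, Submodule.mem_span_pair]
  refine exists_congr fun a => exists_congr fun b => ?_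
  rw [← hX₁, ← hX₂]
  have e : mfderiv 𝓘(ℝ, F) 𝓘(ℝ, E) ι y (a • X₁ y + b • X₂ y) =
      a • mfderiv 𝓘(ℝ, F) 𝓘(ℝ, E) ι y (X₁ y) + b • mfderiv 𝓘(ℝ, F) 𝓘(ℝ, E) ι y (X₂ y) := by
    rw [map_add, map_smul, map_smul]
  rw [← e]
  exact (hι.immersion y).eq_iff

theorem theorem2p1
    {E : Type*} [NormedAddCommGroup E] [NormedSpace ℝ E] [FiniteDimensional ℝ E]
    {M : Type*} [TopologicalSpace M] [T2Space M] [SecondCountableTopology M]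
    [ChartedSpace E M] [IsManifold 𝓘(ℝ, E) ∞ M]
    [RiemannianBundle (fun x : M => TangentSpace 𝓘(ℝ, E) x)]
    [IsContMDiffRiemannianBundle 𝓘(ℝ, E) ∞ E (fun x : M => TangentSpace 𝓘(ℝ, E) x)]
    (cov : CovariantDerivative 𝓘(ℝ, E) E (TangentSpace 𝓘(ℝ, E) : M → Type _))
    (hcov : IsLeviCivita cov)
    (Q : Π x : M, Submodule ℝ (TangentSpace 𝓘(ℝ, E) x →L[ℝ] TangentSpace 𝓘(ℝ, E) x))
    (hQ : IsQuaternionicKahler cov Q)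
    (hscal : ∀ x, scalarCurvature cov x ≠ 0)
    (ξ₁ ξ₂ : Π x : M, TangentSpace 𝓘(ℝ, E) x)
    (hξ₁ : IsKilling cov ξ₁) (hξ₂ : IsKilling cov ξ₂)
    (P₁ P₂ : Π x : M, TangentSpace 𝓘(ℝ, E) x →L[ℝ] TangentSpace 𝓘(ℝ, E) x)
    (hP₁ : IsMomentMap cov Q ξ₁ P₁) (hP₂ : IsMomentMap cov Q ξ₂ P₂)
    {F : Type*} [NormedAddCommGroup F] [NormedSpace ℝ F] [FiniteDimensional ℝ F]
    {N : Type*} [TopologicalSpace N] [T2Space N] [SecondCountableTopology N]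
    [ChartedSpace F N] [IsManifold 𝓘(ℝ, F) ∞ N]
    (ι : N → M) (hι : IsSubmanifold (E := E) (F := F) ι)
    (htan₁ : ∀ y, ξ₁ (ι y) ∈ (mfderiv 𝓘(ℝ, F) 𝓘(ℝ, E) ι y).range)
    (htan₂ : ∀ y, ξ₂ (ι y) ∈ (mfderiv 𝓘(ℝ, F) 𝓘(ℝ, E) ι y).range)
    (hcomm : ∀ y, mlieBracket 𝓘(ℝ, E) ξ₁ ξ₂ (ι y) = 0)
    (hnorm : ∀ y, ‖ξ₁ (ι y)‖ = ‖ξ₂ (ι y)‖ ∧ ‖ξ₁ (ι y)‖ ≠ 0)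
    (hPQ : ∀ y, P₁ (ι y) ∘L P₂ (ι y) ∈ Q (ι y))
    (hPN : ∀ y, ∀ v ∈ (mfderiv 𝓘(ℝ, F) 𝓘(ℝ, E) ι y).range,
      P₁ (ι y) (P₂ (ι y) v) ∈ (mfderiv 𝓘(ℝ, F) 𝓘(ℝ, E) ι y).range)
    (f : N → ℝ) (hf : ContMDiff 𝓘(ℝ, F) 𝓘(ℝ, ℝ) ∞ f) (hf0 : ∀ y, f y ≠ 0)
    (hfξ : ∀ y, P₁ (ι y) (P₂ (ι y) (ξ₁ (ι y))) = f y • ξ₂ (ι y)) :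
    -- the distribution spanned by the two fields has rank two and is integrable
    (∀ y, Module.finrank ℝ (spanDistribution (F := F) ι ξ₁ ξ₂ y) = 2) ∧
    IsInvolutive (spanDistribution (F := F) ι ξ₁ ξ₂) ∧
    -- `(1 / f) P₁ P₂` squares to `-1` along `N`
    (∀ y (v : TangentSpace 𝓘(ℝ, E) (ι y)),
      (f y)⁻¹ • P₁ (ι y) (P₂ (ι y) ((f y)⁻¹ • P₁ (ι y) (P₂ (ι y) v))) = -v) ∧
    ∃ I : Π y : N, TangentSpace 𝓘(ℝ, F) y →L[ℝ] TangentSpace 𝓘(ℝ, F) y,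
      -- `I` is the restriction of `(1 / f) P₁ P₂` to `TN`
      (∀ y v, mfderiv 𝓘(ℝ, F) 𝓘(ℝ, E) ι y (I y v) =
        (f y)⁻¹ • P₁ (ι y) (P₂ (ι y) (mfderiv 𝓘(ℝ, F) 𝓘(ℝ, E) ι y v))) ∧
      IsIntegrableComplexStructure I ∧
      -- `I` preserves the orthogonal complement of the distribution in `TN`
      (∀ y (v : TangentSpace 𝓘(ℝ, F) y),
        mfderiv 𝓘(ℝ, F) 𝓘(ℝ, E) ι y v ∈ (Submodule.span ℝ {ξ₁ (ι y), ξ₂ (ι y)})ᗮ →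
        mfderiv 𝓘(ℝ, F) 𝓘(ℝ, E) ι y (I y v) ∈ (Submodule.span ℝ {ξ₁ (ι y), ξ₂ (ι y)})ᗮ) ∧
      IsTransversalKahler (spanDistribution (F := F) ι ξ₁ ξ₂)
        (transversalMetric (F := F) ι ξ₁ ξ₂) I := by
  -- The tangent fields, and below the restriction of `P₁ P₂ / f` to `TN`, are chosen point by
  -- point. Injectivity of the differential of `ι` makes the choices unique, and their smoothness is
  -- recovered in charts.
  choose X₁ hX₁ using htan₁
  choose X₂ hX₂ using htan₂
  have hex : ∀ y, ∃ I : TangentSpace 𝓘(ℝ, F) y →L[ℝ] TangentSpace 𝓘(ℝ, F) y, ∀ v,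
      mfderiv 𝓘(ℝ, F) 𝓘(ℝ, E) ι y (I v) =
        (f y)⁻¹ • P₁ (ι y) (P₂ (ι y) (mfderiv 𝓘(ℝ, F) 𝓘(ℝ, E) ι y v)) := fun y =>
    exists_lift_of_injective (V := F) (W := E) (A := mfderiv 𝓘(ℝ, F) 𝓘(ℝ, E) ι y)
      (hι.immersion y) (K := (f y)⁻¹ • (P₁ (ι y) ∘L P₂ (ι y) ∘L mfderiv 𝓘(ℝ, F) 𝓘(ℝ, E) ι y))
      fun v => Submodule.smul_mem _ _ (hPN y _ ⟨v, rfl⟩)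
  choose I hI using hex
  have hD := spanDistribution_eq_span hι hX₁ hX₂
  have hpt := submanifold_pointwise hcov hQ hscal hξ₁ hξ₂ hP₁ hP₂ hι hX₁ hX₂
    hcomm hnorm hPQ hf hf0 hfξ hI
  have hl := locallyTrans hcov hQ hscal hξ₁ hξ₂ hP₁ hP₂ hι hX₁ hX₂ hcomm hnorm hPQ hf hf0 hfξ hI
  refine ⟨fun y => ?_, hl.isInvolutive hD, fun y v => ((hpt y).2 v).1, I, hI, hl.isIntegrable,
    fun y v hv => ?_, hl.isTransversalKahler hD⟩
  · rw [hD y]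
    refine finrank_span_pair_of_orthogonal (V := F) (mfderiv 𝓘(ℝ, F) 𝓘(ℝ, E) ι y).toLinearMap
      (x := X₁ y) (y := X₂ y) ?_ ?_ ?_
    · exact (congrArg₂ (inner ℝ) (hX₁ y) (hX₂ y)).trans (hpt y).1
    · intro h0
      exact (hnorm y).2 (norm_eq_zero.2 ((hX₁ y).symm.trans h0))
    · intro h0
      exact (hnorm y).2 ((hnorm y).1.trans (norm_eq_zero.2 ((hX₂ y).symm.trans h0)))
  -- `P₁ P₂ / f` exchanges the products with `ξ₁` and `ξ₂` up to sign, so it preserves their common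
  -- kernel.
  · rw [Submodule.mem_orthogonal'] at hv ⊢
    intro w hw
    obtain ⟨a, b, rfl⟩ := Submodule.mem_span_pair.1 hw
    have h1 := hv _ (Submodule.subset_span (show ξ₁ (ι y) ∈ {ξ₁ (ι y), ξ₂ (ι y)} by simp))
    have h2 := hv _ (Submodule.subset_span (show ξ₂ (ι y) ∈ {ξ₁ (ι y), ξ₂ (ι y)} by simp))
    rw [hI y v, inner_add_right, real_inner_smul_right, real_inner_smul_right,
      ((hpt y).2 _).2.1, ((hpt y).2 _).2.2, h1, h2]
    simp

end
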